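/- **Corollary 3.11.** Let $\mathcal U=\bigoplus_{1\le i,j\le r}\mathcal U_{ij}$ be a $T$-algebra of rank $r$ in the sense of Vinberg, with involution $x\mapsto x^\star$, $\mathcal U_{ii}=\mathbb R c_i$, $n_{ij}=\dim\mathcal U_{ij}$ and trace $\mathrm{tr}\,x=\sum_i\rho(x_{ii})$, where $\rho(c_i)=1$. Let $H$ be the group of its upper triangular elements with positive diagonal, $V=\{x\in\mathcal U:x^\star=x\}$, and let $\Omega=\{ss^\star:s\in H\}\subset V$ be the associated homogeneous cone, on which $H$ acts simply transitively by $\pi(t)[ss^\star]=(ts)(s^\star t^\star)$, $\pi(t)$ extending linearly to $V$. Put $$n_j=\sum_{i<j}n_{ij},\qquad m_j=\sum_{i>j}n_{ji},\qquad \tau_j=1+\tfrac12(m_j+n_j),$$ $Q_j(tt^\star)=\rho(t_{jj})^2$ for $t\in H$, and $Q^\alpha=\prod_jQ_j^{\alpha_j}$ for $\alpha\in\mathbb R^r$. Let $F:\mathbb C^k\times\mathbb C^k\to V^{\mathbb C}$ ($k\ge0$) be an $\Omega$-Hermitian homogeneous form: $F$ is linear in the first and conjugate linear in the second variable, $F(v,u)=\overline{F(u,v)}$,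 $F(u,u)\in\overline\Omega$, $F(u,u)=0$ only if $u=0$, and for every $t\in H$ there is $\tilde t\in GL(k,\mathbb C)$ with $\pi(t)[F(u,u)]=F(\tilde tu,\tilde tu)$ for all $u$. Let $b_j$ be the rank of the Hermitian form $F_{jj}$ (the $(j,j)$-component of $F$), i.e. the dimension of the subspace of $\mathbb C^k$ on which $F_{jj}$ is concentrated, and write $b=(b_1,\dots,b_r)$. Let $$D=\{(z,u)\in V^{\mathbb C}\times\mathbb C^k:\ \mathrm{Im}\,z-F(u,u)\in\Omega\}$$ be the associated homogeneous Siegel domain of type II. For $\nu\in\mathbb R^r$ put $dV_\nu(x+iy,u)=Q^{\nu-\frac b2-\tau}(y-F(u,u))\,dx\,dy\,dv(u)$ on $D$ and, for $1\le p\le\infty$, $1\le q<\infty$, let $L^{p,q}_\nu(D)$ be the space of (classes of) measurable functions on $D$ with $$\|f\|_{L^{p,q}_\nu(D)}=\Big(\int_{\mathbb C^k}\int_{\Omega+F(u,u)}\|f(\cdot+iy,u)\|_{L^p(V)}^{q}\,Q^{\nu-\tau-\frac b2}(y-F(u,u))\,dy\,dv(u)\Big)^{1/q}<\infty ,$$ and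 $A^{p,q}_\nu(D)$ its subspace of holomorphic functions; $L^2_\nu(D)=L^2(D,dV_\nu)$, and $A^2_\nu(D)$ is its subspace of holomorphic functions. Let $\mu,\nu\in\mathbb R^r$ satisfy $\mu_j>\frac{m_j+n_j+b_j}{2}$ and $\nu_j>\frac{m_j+b_j}{2}$ for all $j$, and let $1\le p\le\infty$, $1\le q<\infty$ be such that for all $j=1,\dots,r$ $$\frac{\nu_j-\frac{m_j+b_j}{2}+\frac{n_j}{2}}{\mu_j-\frac{m_j+b_j}{2}}<q<1+\frac{\nu_j-\frac{m_j+b_j}{2}}{n_j/2}$$ (the upper bound being $+\infty$ when $n_j=0$). Then $A^2_\mu(D)$ has a reproducing kernel $B_\mu$ (the weighted Bergman kernel), and the following hold. 1. The operator $P^+_\mu f(\zeta)=\int_D|B_\mu(\zeta,w)|f(w)\,dV_\mu(w)$ is bounded on $L^{p,q}_\nu(D)$; that is, for each $f\in L^{p,q}_\nu(D)$ the integral converges absolutely for almost every $\zeta\in D$, and $\|P^+_\mu f\|_{L^{p,q}_\nu(D)}\le C\|f\|_{L^{p,q}_\nu(D)}$ with $C$ independent of $f$. 2. Hence $P_\mu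 f(\zeta)=\int_DB_\mu(\zeta,w)f(w)\,dV_\mu(w)$ is, in the same sense, a bounded operator on $L^{p,q}_\nu(D)$. It extends the Bergman projector: on $L^2_\mu(D)\cap L^{p,q}_\nu(D)$ it coincides with the orthogonal projector of $L^2_\mu(D)$ onto $A^2_\mu(D)$. 3. $P_\mu$ maps $L^{p,q}_\nu(D)$ onto $A^{p,q}_\nu(D)$. -/

import Mathlib

open MeasureTheory
open scoped ENNReal NNReal

noncomputable section

/-- A `T`-algebra of rank `r` in the sense of Vinberg, on a (not necessarily associative) real
algebra `𝒰` with involution `star` (real-linear, `star (star a) = a`,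
`star (a * b) = star b * star a`). -/
structure TAlgebra (r : ℕ) (𝒰 : Type*) [NonUnitalNonAssocRing 𝒰] [Module ℝ 𝒰]
    [IsScalarTower ℝ 𝒰 𝒰] [SMulCommClass ℝ 𝒰 𝒰] [StarRing 𝒰] [StarModule ℝ 𝒰] where
  /-- the subspaces `𝒰_{ij}` of the canonical decomposition -/
  comp : Fin r → Fin r → Submodule ℝ 𝒰
  isInternal : DirectSum.IsInternal fun ij : Fin r × Fin r => comp ij.1 ij.2
  mul_mem : ∀ {i j k a b}, a ∈ comp i j → b ∈ comp j k → a * b ∈ comp i k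
  mul_eq_zero : ∀ {i j l k a b}, j ≠ l → a ∈ comp i j → b ∈ comp l k → a * b = 0
  star_mem : ∀ {i j a}, a ∈ comp i j → star a ∈ comp j i
  /-- the unit `c_i` of the algebra `𝒰_{ii} = ℝ c_i` -/
  c : Fin r → 𝒰
  comp_diag : ∀ i, comp i i = Submodule.span ℝ {c i}
  c_mul_c : ∀ i, c i * c i = c i
  c_mul : ∀ {i j a}, a ∈ comp i j → c i * a = a
  mul_c : ∀ {i j a}, a ∈ comp i j → a * c j = a
  /-- `ρ i a` is the real number `ρ(a_{ii})`, where `a_{ii} = ρ(a_{ii}) c_i` is the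
  `(i,i)`-component of `a` -/
  ρ : Fin r → 𝒰 →ₗ[ℝ] ℝ
  ρ_c : ∀ i, ρ i (c i) = 1
  ρ_comp : ∀ {i j k a}, (j, k) ≠ (i, i) → a ∈ comp j k → ρ i a = 0
  /-- `tr (ab) = tr (ba)`, where `tr a = ∑ ρ(a_{ii})` -/
  tr_mul_comm : ∀ a b, ∑ i, ρ i (a * b) = ∑ i, ρ i (b * a)
  /-- `tr (a(bc)) = tr ((ab)c)` -/
  tr_mul_assoc : ∀ a b d, ∑ i, ρ i (a * (b * d)) = ∑ i, ρ i (a * b * d)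
  /-- `tr (a a^⋆) > 0` for `a ≠ 0` -/
  tr_mul_star_pos : ∀ a, a ≠ 0 → 0 < ∑ i, ρ i (a * star a)
  /-- the upper triangular elements multiply associatively -/
  upper_assoc : ∀ {a b d}, a ∈ (⨆ i, ⨆ j, ⨆ _ : i ≤ j, comp i j) →
    b ∈ (⨆ i, ⨆ j, ⨆ _ : i ≤ j, comp i j) → d ∈ (⨆ i, ⨆ j, ⨆ _ : i ≤ j, comp i j) →
    a * (b * d) = a * b * d
  /-- `a (b b^⋆) = (a b) b^⋆` for upper triangular `a`, `b` -/
  upper_mul_star : ∀ {a b}, a ∈ (⨆ i, ⨆ j, ⨆ _ : i ≤ j, comp i j) →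
    b ∈ (⨆ i, ⨆ j, ⨆ _ : i ≤ j, comp i j) → a * (b * star b) = a * b * star b

namespace TAlgebra

variable {r : ℕ} {𝒰 : Type*} [NonUnitalNonAssocRing 𝒰] [Module ℝ 𝒰]
  [IsScalarTower ℝ 𝒰 𝒰] [SMulCommClass ℝ 𝒰 𝒰] [StarRing 𝒰] [StarModule ℝ 𝒰]
  (T : TAlgebra r 𝒰)

/-- The upper triangular elements `𝒯 = ⨁_{i ≤ j} 𝒰_{ij}`. -/
def upper : Submodule ℝ 𝒰 := ⨆ i, ⨆ j, ⨆ _ : i ≤ j, T.comp i j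

/-- The group `H` of upper triangular elements with positive diagonal. -/
def H : Set 𝒰 := {t | t ∈ T.upper ∧ ∀ i, 0 < T.ρ i t}

/-- `n_i = ∑_{j < i} dim 𝒰_{ji}`. -/
def n (i : Fin r) : ℕ := ∑ j ∈ Finset.Iio i, Module.finrank ℝ (T.comp j i)

/-- `m_i = ∑_{j > i} dim 𝒰_{ij}`. -/
def m (i : Fin r) : ℕ := ∑ j ∈ Finset.Ioi i, Module.finrank ℝ (T.comp i j)

/-- `τ_i = 1 + (m_i + n_i) / 2`. -/
def τ (i : Fin r) : ℝ := 1 + ((T.m i : ℝ) + T.n i) / 2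

variable {ι : Type*} [Fintype ι] (e : Module.Basis ι ℝ (selfAdjoint.submodule ℝ 𝒰))

/-- The Hermitian element of `𝒰` with coordinates `y` in the basis `e` of the real vector space
`V = {x ∈ 𝒰 : x^⋆ = x}`. Throughout, `V` is identified with `ι → ℝ` and its complexification with
`ι → ℂ` by means of the basis `e`. -/
def ofCoords (y : ι → ℝ) : 𝒰 := (e.equivFun.symm y : selfAdjoint.submodule ℝ 𝒰)

/-- The homogeneous cone `Ω = {s s^⋆ : s ∈ H}`, in coordinates. -/
def cone : Set (ι → ℝ) := {y | ∃ t ∈ T.H, ofCoords e y = t * star t}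

open Classical in
/-- The fundamental functions `Q_j(y) = ρ(t_{jj})²` for `y = t t^⋆ ∈ Ω`, where `t ∈ H` is
determined by `y` (`H` acts simply transitively on `Ω`); outside `Ω` the value is irrelevant. -/
def Q (j : Fin r) (y : ι → ℝ) : ℝ :=
  if h : ∃ t ∈ T.H, ofCoords e y = t * star t then (T.ρ j h.choose) ^ 2 else 0

/-- `Q^α(y) = ∏_j Q_j(y)^{α_j}`, `y ∈ Ω`. -/
def Qpow (α : Fin r → ℝ) (y : ι → ℝ) : ℝ := ∏ j, T.Q e j y ^ α j

/-- `g` is the linear transformation `π(t)` of `V` (in coordinates), determined on `Ω` (which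
spans `V`) by `π(t)[s s^⋆] = (t s)(s^⋆ t^⋆)` for `s ∈ H`. -/
def IsAction (t : 𝒰) (g : (ι → ℝ) →ₗ[ℝ] (ι → ℝ)) : Prop :=
  ∀ s ∈ T.H, ∀ y, ofCoords e y = s * star s → ofCoords e (g y) = (t * s) * (star s * star t)

/-- An `Ω`-Hermitian, homogeneous form `F : ℂ^k × ℂ^k → V^ℂ`. -/
structure HermForm (k : ℕ) where
  /-- the form: linear in the first and conjugate linear in the second variable -/
  F : (Fin k → ℂ) →ₗ[ℂ] (Fin k → ℂ) →ₗ⋆[ℂ] (ι → ℂ)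
  hermitian : ∀ u v, F v u = star (F u v)
  mem_closure : ∀ u, (fun i => (F u u i).re) ∈ closure (T.cone e)
  eq_zero : ∀ u, F u u = 0 → u = 0
  /-- for `t ∈ H` there is `t' ∈ GL(k, ℂ)` with `t · F(u,u) = F(t'u, t'u)` for all `u` -/
  homogeneous : ∀ t ∈ T.H, ∃ g : (ι → ℝ) →ₗ[ℝ] (ι → ℝ), T.IsAction e t g ∧
    ∃ t' : (Fin k → ℂ) ≃ₗ[ℂ] (Fin k → ℂ),
      ∀ u, g (fun i => (F u u i).re) = fun i => (F (t' u) (t' u) i).re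

namespace HermForm

variable {T e}
variable {k : ℕ} (Φ : HermForm T e k)

/-- `Re F(u,u)`, which is `F(u,u)` itself regarded as an element of `V`. -/
def diag (u : Fin k → ℂ) : ι → ℝ := fun i => (Φ.F u u i).re

/-- The matrix of the Hermitian form `F_{jj}`, the `(j,j)`-component of `F`
(`ρ(·_{jj})` extended complex linearly to `V^ℂ`). -/
def matrix (j : Fin r) : Matrix (Fin k) (Fin k) ℂ :=
  Matrix.of fun a b => ∑ i, Φ.F (Pi.single a 1) (Pi.single b 1) i * (T.ρ j (e i : 𝒰) : ℂ)

/-- `b_j`: the dimension of the subspace of `ℂ^k` on which `F_{jj}` is concentrated, i.e. the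
rank of `F_{jj}`. -/
def b (j : Fin r) : ℕ := (Φ.matrix j).rank

/-- The homogeneous Siegel domain of type II,
`D = {(z,u) : Im z - F(u,u) ∈ Ω} ⊆ ℂ^ι × ℂ^k`. -/
def domain : Set ((ι → ℂ) × (Fin k → ℂ)) :=
  {w | (fun i => (w.1 i).im) - Φ.diag w.2 ∈ T.cone e}

/-- The weight `Q^{ν - b/2 - τ}` on `Ω`. -/
def weight (ν : Fin r → ℝ) (y : ι → ℝ) : ℝ :=
  T.Qpow e (fun j => ν j - (Φ.b j : ℝ) / 2 - T.τ j) y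

/-- The measure `dV_ν(x+iy,u) = Q^{ν - b/2 - τ}(y - F(u,u)) dx dy dv(u)` on `D`. -/
def measure (ν : Fin r → ℝ) : Measure ((ι → ℂ) × (Fin k → ℂ)) :=
  (volume.restrict Φ.domain).withDensity fun w =>
    ENNReal.ofReal (Φ.weight ν ((fun i => (w.1 i).im) - Φ.diag w.2))

/-- The mixed norm of `L^{p,q}_ν(D)` for `q < ∞`:
`(∫_{ℂ^k} ∫_{Ω + F(u,u)} ‖f(· + iy, u)‖_{L^p(V)}^q Q^{ν-τ-b/2}(y - F(u,u)) dy dv(u))^{1/q}`. -/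
def mixedNorm (ν : Fin r → ℝ) (p : ℝ≥0∞) (q : ℝ) (f : (ι → ℂ) × (Fin k → ℂ) → ℂ) : ℝ≥0∞ :=
  (∫⁻ u : Fin k → ℂ, ∫⁻ y : ι → ℝ in {y | y - Φ.diag u ∈ T.cone e},
    (eLpNorm (fun x : ι → ℝ => f (fun i => (x i : ℂ) + (y i : ℂ) * Complex.I, u)) p volume) ^ q
      * ENNReal.ofReal (Φ.weight ν (y - Φ.diag u))) ^ (1 / q)

/-- Membership in `L^{p,q}_ν(D)`. -/
def MemL (ν : Fin r → ℝ) (p : ℝ≥0∞) (q : ℝ) (f : (ι → ℂ) × (Fin k → ℂ) → ℂ) : Prop :=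
  AEStronglyMeasurable f (volume.restrict Φ.domain) ∧ Φ.mixedNorm ν p q f < ∞

/-- Membership in the mixed norm Bergman space `A^{p,q}_ν(D)`. -/
def MemA (ν : Fin r → ℝ) (p : ℝ≥0∞) (q : ℝ) (f : (ι → ℂ) × (Fin k → ℂ) → ℂ) : Prop :=
  DifferentiableOn ℂ f Φ.domain ∧ Φ.MemL ν p q f

/-- `B` is the weighted Bergman kernel, i.e. the reproducing kernel of the Hilbert space
`A²_μ(D)`: for `ζ ∈ D` the function `B(·,ζ)` belongs to `A²_μ(D)` and
`f(ζ) = ⟨f, B(·,ζ)⟩_μ` for all `f ∈ A²_μ(D)`. -/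
def IsBergmanKernel (μ : Fin r → ℝ)
    (B : (ι → ℂ) × (Fin k → ℂ) → (ι → ℂ) × (Fin k → ℂ) → ℂ) : Prop :=
  ∀ ζ ∈ Φ.domain,
    (DifferentiableOn ℂ (fun w => B w ζ) Φ.domain ∧ MemLp (fun w => B w ζ) 2 (Φ.measure μ)) ∧
    ∀ f : (ι → ℂ) × (Fin k → ℂ) → ℂ,
      DifferentiableOn ℂ f Φ.domain → MemLp f 2 (Φ.measure μ) →
        f ζ = ∫ w, f w * star (B w ζ) ∂(Φ.measure μ)

/-- The weighted Bergman kernel `B_μ` of `D` (unique on `D × D`; only its values there matter). -/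
def bergmanKernel (μ : Fin r → ℝ) : (ι → ℂ) × (Fin k → ℂ) → (ι → ℂ) × (Fin k → ℂ) → ℂ :=
  Classical.epsilon (Φ.IsBergmanKernel μ)

/-- `A²_μ(D)`, as a subspace of `L²_μ(D)`: the classes that contain a function which is
holomorphic on `D`. -/
def bergmanSpace (μ : Fin r → ℝ) : Submodule ℂ (Lp ℂ 2 (Φ.measure μ)) where
  carrier := {f | ∃ g : (ι → ℂ) × (Fin k → ℂ) → ℂ,
    DifferentiableOn ℂ g Φ.domain ∧ f =ᵐ[Φ.measure μ] g}
  add_mem' := by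
    rintro f₁ f₂ ⟨g₁, h₁, e₁⟩ ⟨g₂, h₂, e₂⟩
    exact ⟨g₁ + g₂, h₁.add h₂, (Lp.coeFn_add f₁ f₂).trans (e₁.add e₂)⟩
  zero_mem' := ⟨0, differentiableOn_const 0, Lp.coeFn_zero ℂ 2 (Φ.measure μ)⟩
  smul_mem' := by
    rintro a f ⟨g, h, he⟩
    exact ⟨a • g, h.const_smul a, (Lp.coeFn_smul a f).trans (he.const_smul a)⟩

/-- The weighted Bergman projector on `L²_μ(D)`: the orthogonal projector of `L²_μ(D)` onto its
subspace `A²_μ(D)`. (This subspace is closed, so taking the closure changes nothing; it lets the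
projector be written down without first proving so.) -/
def bergmanProjector (μ : Fin r → ℝ) : Lp ℂ 2 (Φ.measure μ) →L[ℂ] Lp ℂ 2 (Φ.measure μ) :=
  (Φ.bergmanSpace μ).topologicalClosure.starProjection

/-- The integral operator `f ↦ ∫_D K(·, w) f(w) dV_μ(w)`. -/
def integralOp (μ : Fin r → ℝ) (K : (ι → ℂ) × (Fin k → ℂ) → (ι → ℂ) × (Fin k → ℂ) → ℂ)
    (f : (ι → ℂ) × (Fin k → ℂ) → ℂ) : (ι → ℂ) × (Fin k → ℂ) → ℂ :=
  fun ζ => ∫ w, K ζ w * f w ∂(Φ.measure μ)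

/-- `P_μ f(ζ) = ∫_D B_μ(ζ,w) f(w) dV_μ(w)`. -/
def P (μ : Fin r → ℝ) (f : (ι → ℂ) × (Fin k → ℂ) → ℂ) : (ι → ℂ) × (Fin k → ℂ) → ℂ :=
  Φ.integralOp μ (Φ.bergmanKernel μ) f

/-- The integral operator with kernel `K` (with respect to `V_μ`) is a bounded operator on
`L^{p,q}_ν(D)`: for each `f` in that space the integral converges absolutely at almost every point
of `D` and defines an element of the space of norm at most `C ‖f‖`. -/
def IsBoundedOn (μ : Fin r → ℝ) (K : (ι → ℂ) × (Fin k → ℂ) → (ι → ℂ) × (Fin k → ℂ) → ℂ)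
    (ν : Fin r → ℝ) (p : ℝ≥0∞) (q : ℝ) : Prop :=
  ∃ C : ℝ≥0, ∀ f, Φ.MemL ν p q f →
    (∀ᵐ ζ ∂(volume.restrict Φ.domain), Integrable (fun w => K ζ w * f w) (Φ.measure μ)) ∧
    Φ.MemL ν p q (Φ.integralOp μ K f) ∧
    Φ.mixedNorm ν p q (Φ.integralOp μ K f) ≤ C * Φ.mixedNorm ν p q f

end HermForm

end TAlgebra

end

/-!
The group `H` of a `T`-algebra acts simply transitively on the cone `Ω` and, contragrediently, on
the dual cone `Ωd`. What follows uses only this action and the diagonal entries as characters of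
`H`, so the `T`-algebra and the Hermitian form are reduced to the structures `ConeData` and
`FormData`, where the triangular elements form an associative algebra with unit. Both orbits are
characterized by quadratic forms on `H` (`mem_Ω_iff`, `mem_Ωd_iff`): the maximum over `t` of
`∏ ρ_i(t)² e^{-tr (π(t) y)}` is attained at the `t` that moves `y` to the base point. Hence both are
open convex cones, and the parametrization by `H` reduces their gamma integrals
`∫ e^{-⟨y, ξ⟩} Q^{α-τ}(y) dy = Γ (Q⋆)^{-α}(ξ)` to the diagonal (`lintegral_gamma`,
`lintegral_gammad`). The Gaussian integral of the form, `∫ e^{-⟨F(u,u), ξ⟩} du`, is a relative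
invariant of `H` whose exponents are found by letting the diagonal entries tend to infinity: it is
a multiple of `(Q⋆)^{-b}(ξ)` (`exists_J_eq`). Together these give the beta integral `lintegral_beta`.

The Bergman kernel is a multiple of `L_β(z - w̄ - 2iF(u,v))`, where `β = μ + b/2` and `L_β` is the
Laplace transform of `(Q⋆)^β`, a holomorphic extension of a multiple of `Q^{-(β+τ)}`. Up to a
constant, `L_β` is the square of another such transform (`exists_L_eq_sq`), so that Plancherel's
theorem turns the `L¹`-norm of `L_β` over a horizontal slice of the tube into a gamma integral
(`lintegral_L`). By Minkowski's inequality the mixed norm of `P⁺ f` is then controlled by a positive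
operator in the variables `(u, t)`, with kernel `Q^{-β}(t + t' + F(u-u', u-u'))` (`exists_N_le`).
This is bounded by Schur's test with a test function `Q^{-σ}`, by the beta integral; the conditions
on `q` say exactly that an admissible `σ` exists (`Admissible.exists_exponent`, `exists_schur`).

Boundedness of the positive operator and the sub-mean value property show that `P f` is given by
absolutely convergent integrals at every point of the domain and is holomorphic
(`differentiableOn_integral_of_locally`). For surjectivity it suffices that `P` fixes the holomorphic
functions `f` of the mixed norm space. If all slices of `f` are integrable, `f` is the Laplace
transform of a partial Fourier transform that depends holomorphically on `u` and is supported in the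
dual cone (`ft_eq_zero`, `inversion`); integrating the kernel against it leaves a Gaussian mean value
in `u` (`integral_psi`) and a gamma integral in `t`, and their product cancels the density
`(Q⋆)^β`. The general case follows by multiplying `f` with bounded holomorphic functions of `z`
that tend to `1` and have integrable slices (`exists_regularizers`, `Admissible.reproducing`).

For `p = q = 2` and `ν = μ` the same facts identify the kernel with the Bergman kernel, which is
unique, and by self-adjointness the operator with the orthogonal projector
(`isBergmanKernel_bk`, `bergmanProjector_eq`).
-/

noncomputable section

/-! ### Mean value properties of holomorphic functions -/

section Holomorphic

open Metric

/-- Cauchy estimate for the derivative in several variables. -/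
theorem norm_fderiv_le_of_ball {E : Type*} [NormedAddCommGroup E] [NormedSpace ℂ E]
    {f : E → ℂ} {c : E} {r M : ℝ} (hr : 0 < r) (hM : 0 ≤ M)
    (hf : DifferentiableOn ℂ f (ball c r)) (hb : ∀ z ∈ ball c r, ‖f z‖ ≤ M) :
    ‖fderiv ℂ f c‖ ≤ 2 * M / r := by
  refine ContinuousLinearMap.opNorm_le_bound _ (by positivity) fun v => ?_
  by_cases hv : v = 0
  · simp [hv]
  have hv' : 0 < ‖v‖ := norm_pos_iff.2 hv
  have hmem : ∀ a : ℂ, ‖a‖ ≤ r / (2 * ‖v‖) → c + a • v ∈ ball c r := fun a ha => by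
    rw [mem_ball, dist_eq_norm, add_sub_cancel_left, norm_smul]
    calc ‖a‖ * ‖v‖ ≤ r / (2 * ‖v‖) * ‖v‖ := by gcongr
      _ = r / 2 := by field_simp
      _ < r := by linarith
  have hρ : 0 < r / (2 * ‖v‖) := by positivity
  have hdat : ∀ a : ℂ, ‖a‖ ≤ r / (2 * ‖v‖) →
      DifferentiableAt ℂ (fun a : ℂ => f (c + a • v)) a := fun a ha => by
    have h1 := hf.differentiableAt (isOpen_ball.mem_nhds (hmem a ha))
    have h2 : DifferentiableAt ℂ (fun a : ℂ => c + a • v) a := by fun_prop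
    exact DifferentiableAt.comp a h1 h2
  have hd : DiffContOnCl ℂ (fun a : ℂ => f (c + a • v)) (ball 0 (r / (2 * ‖v‖))) := by
    apply DifferentiableOn.diffContOnCl
    intro a ha
    rw [closure_ball _ hρ.ne', mem_closedBall_zero_iff] at ha
    exact (hdat a ha).differentiableWithinAt
  have h1 := Complex.norm_deriv_le_of_forall_mem_sphere_norm_le hρ hd (C := M) fun a ha =>
    hb _ (hmem a (by rw [mem_sphere_zero_iff_norm] at ha; exact ha.le))
  have h2 : deriv (fun a : ℂ => f (c + a • v)) 0 = fderiv ℂ f c v := by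
    have h3 : HasDerivAt (fun a : ℂ => c + a • v) v 0 := by
      simpa using ((hasDerivAt_id (0 : ℂ)).smul_const v).const_add c
    have h4 : HasFDerivAt f (fderiv ℂ f c) (c + (0 : ℂ) • v) := by
      rw [zero_smul, add_zero]
      exact (hf.differentiableAt (isOpen_ball.mem_nhds (mem_ball_self hr))).hasFDerivAt
    exact (h4.comp_hasDerivAt (0 : ℂ) h3).deriv
  rw [h2] at h1
  refine h1.trans (le_of_eq ?_)
  field_simp

variable {E : Type*} [NormedAddCommGroup E] [NormedSpace ℂ E] [FiniteDimensional ℂ E]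
  [MeasurableSpace E] [BorelSpace E] (μ : Measure E) [μ.IsAddHaarMeasure]

theorem measurePreserving_unit_smul {a : ℂ} (ha : ‖a‖ = 1) :
    MeasurePreserving (fun x : E => a • x) μ μ := by
  have hmeas : Measurable (fun x : E => a • x) := (continuous_const_smul a).measurable
  refine ⟨hmeas, ?_⟩
  set L : E →ₗ[ℝ] E := (a • (LinearMap.id : E →ₗ[ℂ] E)).restrictScalars ℝ with hL
  have hdet : |LinearMap.det L| = 1 := by
    rw [hL, LinearMap.det_restrictScalars, Algebra.norm_complex_eq]
    simp [Complex.normSq_eq_norm_sq, ha]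
  have hdet0 : LinearMap.det L ≠ 0 := by
    intro h
    rw [h] at hdet
    simp at hdet
  have := Measure.map_linearMap_addHaar_eq_smul_addHaar μ hdet0
  rw [abs_inv, hdet, inv_one, ENNReal.ofReal_one, one_smul] at this
  exact this

/-- **Mean value property** against a circular weight: averaging over the rotations
`x ↦ e^{iθ} x` replaces `f (c + x)` by `f c`. -/
theorem integral_mul_circular {f w : E → ℂ} {c : E}
    (hw : ∀ (a : ℂ) (x : E), ‖a‖ = 1 → w (a • x) = w x)
    (hf : ∀ x, w x ≠ 0 → ∀ a : ℂ, ‖a‖ ≤ 1 → DifferentiableAt ℂ f (c + a • x))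
    (hint : Integrable (fun x => f (c + x) * w x) μ) :
    ∫ x, f (c + x) * w x ∂μ = f c * ∫ x, w x ∂μ := by
  set ν : Measure ℝ := volume.restrict (Set.Ioc 0 (2 * Real.pi)) with hν
  set F : E → ℂ := fun x => f (c + x) * w x with hF
  have hnorm : ∀ θ : ℝ, ‖Complex.exp (θ * Complex.I)‖ = 1 := Complex.norm_exp_ofReal_mul_I
  have hmp : MeasurePreserving
      (fun p : ℝ × E => (p.1, Complex.exp (p.1 * Complex.I) • p.2)) (ν.prod μ) (ν.prod μ) := by
    refine MeasurePreserving.skew_product (MeasurePreserving.id ν)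
      (g := fun θ x => Complex.exp (θ * Complex.I) • x) ?_ ?_
    · apply Continuous.measurable
      simp only [Function.uncurry_def]
      fun_prop
    · filter_upwards with θ
      exact (measurePreserving_unit_smul μ (hnorm θ)).map_eq
  have hint2 : Integrable (fun p : ℝ × E => F (Complex.exp (p.1 * Complex.I) • p.2))
      (ν.prod μ) := by
    have h1 : Integrable (fun p : ℝ × E => F p.2) (ν.prod μ) := hint.comp_snd ν
    exact hmp.integrable_comp_of_integrable h1
  -- For each `θ` the integral over `x` is unchanged by the rotation, whereas for each `x` the
  -- integral over `θ` is a circle average of a holomorphic function; equate the two iterated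
  -- integrals.
  have hswap := integral_integral_swap (μ := ν) (ν := μ)
    (f := fun (θ : ℝ) (x : E) => F (Complex.exp (θ * Complex.I) • x)) hint2
  have hl : ∀ θ : ℝ, ∫ x, F (Complex.exp (θ * Complex.I) • x) ∂μ = ∫ x, F x ∂μ := fun θ => by
    have hmp := measurePreserving_unit_smul μ (hnorm θ)
    have hme : MeasurableEmbedding (fun x : E => Complex.exp (θ * Complex.I) • x) :=
      (Homeomorph.smulOfNeZero (Complex.exp (θ * Complex.I))
        (Complex.exp_ne_zero _)).measurableEmbedding
    exact hmp.integral_comp hme F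
  have hr : ∀ x : E, ∫ θ, F (Complex.exp (θ * Complex.I) • x) ∂ν
      = 2 * Real.pi * (f c * w x) := fun x => by
    have h0 : ∀ θ : ℝ, F (Complex.exp (θ * Complex.I) • x)
        = f (c + Complex.exp (θ * Complex.I) • x) * w x := fun θ => by
      simp only [hF]
      rw [hw _ _ (hnorm θ)]
    simp_rw [h0]
    rw [integral_mul_const]
    by_cases hx : w x = 0
    · simp [hx]
    · have hd : DiffContOnCl ℂ (fun a : ℂ => f (c + a • x)) (ball 0 |1|) := by
        apply DifferentiableOn.diffContOnCl
        intro a ha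
        rw [abs_one, closure_ball _ one_ne_zero, mem_closedBall_zero_iff] at ha
        have h1 := hf x hx a ha
        have h2 : DifferentiableAt ℂ (fun a : ℂ => c + a • x) a := by fun_prop
        exact (DifferentiableAt.comp a h1 h2).differentiableWithinAt
      have h3 := hd.circleAverage
      rw [Real.circleAverage_def, intervalIntegral.integral_of_le Real.two_pi_pos.le] at h3
      simp only [circleMap, zero_smul, add_zero, Complex.ofReal_one, one_mul, zero_add] at h3
      rw [hν, ← mul_assoc, ← h3]
      rw [Complex.real_smul]
      generalize (∫ θ : ℝ in Set.Ioc 0 (2 * Real.pi),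
        f (c + Complex.exp (θ * Complex.I) • x)) = J
      have hpi : (Real.pi : ℂ) ≠ 0 := by exact_mod_cast Real.pi_ne_zero
      push_cast
      field_simp
  simp_rw [hl, hr] at hswap
  rw [integral_const, integral_const_mul, integral_const_mul] at hswap
  have hvol : ν.real Set.univ = 2 * Real.pi := by
    simp [hν, Measure.real, Real.pi_pos.le]
  rw [hvol, Complex.real_smul] at hswap
  push_cast at hswap
  exact mul_left_cancel₀ (by simp [Real.pi_ne_zero]) hswap

/-- Sub-mean value property on balls of an arbitrary norm. -/
theorem enorm_mul_measure_ball_le {f : E → ℂ} {c : E} {R : ℝ}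
    (hf : DifferentiableOn ℂ f (ball c R)) :
    ‖f c‖ₑ * μ (ball c R) ≤ ∫⁻ z in ball c R, ‖f z‖ₑ ∂μ := by
  by_cases hfin : ∫⁻ z in ball c R, ‖f z‖ₑ ∂μ = ∞
  · rw [hfin]; exact le_top
  have hi : IntegrableOn f (ball c R) μ :=
    ⟨hf.continuousOn.aestronglyMeasurable measurableSet_ball, lt_top_iff_ne_top.2 hfin⟩
  set w : E → ℂ := (ball (0 : E) R).indicator 1 with hw
  have hFw : (fun x => f (c + x) * w x) = (ball (0 : E) R).indicator (fun x => f (c + x)) := by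
    ext x
    by_cases hx : x ∈ ball (0 : E) R <;> simp [hw, hx]
  have hpre : (fun x => c + x) ⁻¹' ball c R = ball (0 : E) R := by
    ext x
    simp [mem_ball, dist_eq_norm]
  have hmp := measurePreserving_add_left μ c
  have hme : MeasurableEmbedding (fun x : E => c + x) := measurableEmbedding_addLeft c
  have hint : IntegrableOn (fun x => f (c + x)) (ball (0 : E) R) μ := by
    rw [← hpre]
    exact (hmp.integrableOn_comp_preimage hme).2 hi
  have key := integral_mul_circular μ (f := f) (w := w) (c := c) ?_ ?_ ?_
  · rw [hFw, integral_indicator measurableSet_ball, hw, integral_indicator measurableSet_ball] at key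
    simp only [Pi.one_apply, integral_const, MeasurableSet.univ, measureReal_restrict_apply,
      Set.univ_inter, mul_one, Complex.real_smul] at key
    have h2 : ∫ x in ball (0 : E) R, f (c + x) ∂μ = ∫ x in ball c R, f x ∂μ := by
      rw [← hpre]
      exact hmp.setIntegral_preimage_emb hme f (ball c R)
    have h3 : μ (ball c R) = ‖((μ.real (ball (0 : E) R) : ℝ) : ℂ)‖ₑ := by
      rw [Measure.addHaar_ball_center μ c R, ← ofReal_norm, Complex.norm_real, Real.norm_eq_abs,
        abs_of_nonneg measureReal_nonneg, ofReal_measureReal measure_ball_lt_top.ne]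
    rw [h3, ← enorm_mul, ← key, h2]
    exact enorm_integral_le_lintegral_enorm _
  · intro a x ha
    have : a • x ∈ ball (0 : E) R ↔ x ∈ ball (0 : E) R := by simp [norm_smul, ha]
    by_cases hx : x ∈ ball (0 : E) R
    · simp only [hw, Set.indicator_of_mem (this.2 hx), Set.indicator_of_mem hx, Pi.one_apply]
    · simp only [hw, Set.indicator_of_notMem (mt this.1 hx), Set.indicator_of_notMem hx]
  · intro x hx a ha
    have hx' : x ∈ ball (0 : E) R := by
      by_contra h
      exact hx (by simp only [hw, Set.indicator_of_notMem h])
    refine hf.differentiableAt (isOpen_ball.mem_nhds ?_)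
    rw [mem_ball, dist_eq_norm, add_sub_cancel_left, norm_smul]
    rw [mem_ball_zero_iff] at hx'
    nlinarith [norm_nonneg x]
  · rw [hFw]
    exact (integrable_indicator_iff measurableSet_ball).2 hint

end Holomorphic

/-! ### Integrals of holomorphic families -/

section HolomorphicIntegral

open Metric Filter Topology

variable {E : Type*} [NormedAddCommGroup E] [NormedSpace ℂ E] [FiniteDimensional ℂ E]
  [MeasurableSpace E] [BorelSpace E] (μ : Measure E) [μ.IsAddHaarMeasure]
  {X : Type*} [MeasurableSpace X] (m : Measure X) [SFinite m]

/-- Sub-mean value bound that is uniform over a smaller concentric ball. -/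
theorem enorm_le_lintegral_ball_div {f : E → ℂ} {c z : E} {R : ℝ} (hR : 0 < R)
    (hf : DifferentiableOn ℂ f (ball c R)) (hz : z ∈ ball c (R / 2)) :
    ‖f z‖ₑ ≤ (∫⁻ w in ball c R, ‖f w‖ₑ ∂μ) / μ (ball c (R / 2)) := by
  have hsub : ball z (R / 2) ⊆ ball c R := by
    apply ball_subset_ball'
    rw [mem_ball] at hz
    linarith
  rw [ENNReal.le_div_iff_mul_le (Or.inl (measure_ball_pos μ c (by positivity)).ne')
    (Or.inl measure_ball_lt_top.ne)]
  calc ‖f z‖ₑ * μ (ball c (R / 2)) = ‖f z‖ₑ * μ (ball z (R / 2)) := by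
        rw [Measure.addHaar_ball_center μ c, Measure.addHaar_ball_center μ z]
    _ ≤ ∫⁻ w in ball z (R / 2), ‖f w‖ₑ ∂μ := enorm_mul_measure_ball_le μ (hf.mono hsub)
    _ ≤ _ := lintegral_mono_set hsub

/-- The derivative is measurable in the parameter, being determined by finitely many limits of
difference quotients. -/
theorem aestronglyMeasurable_fderiv_param {f : E → X → ℂ} {U : Set E} (hU : IsOpen U)
    (hmeas : ∀ ζ ∈ U, AEStronglyMeasurable (f ζ) m)
    (hf : ∀ᵐ x ∂m, DifferentiableOn ℂ (fun ζ => f ζ x) U) {ζ : E} (hζ : ζ ∈ U) :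
    AEStronglyMeasurable (fun x => fderiv ℂ (fun ζ => f ζ x) ζ) m := by
  set b := Module.finBasis ℂ E
  have hdir : ∀ v : E, AEStronglyMeasurable (fun x => fderiv ℂ (fun ζ => f ζ x) ζ v) m := by
    intro v
    have ht : Tendsto (fun n : ℕ => ζ + ((n : ℂ) + 1)⁻¹ • v) atTop (𝓝 ζ) := by
      have h1 : Tendsto (fun n : ℕ => ((n : ℂ) + 1)⁻¹) atTop (𝓝 0) := by
        have := tendsto_one_div_add_atTop_nhds_zero_nat (𝕜 := ℂ)
        simpa [one_div] using this
      simpa using (h1.smul_const v).const_add ζ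
    obtain ⟨N, hN⟩ := eventually_atTop.1 (ht.eventually (hU.mem_nhds hζ))
    refine aestronglyMeasurable_of_tendsto_ae atTop
      (f := fun (n : ℕ) x => (((n + N : ℕ) : ℂ) + 1) *
        (f (ζ + (((n + N : ℕ) : ℂ) + 1)⁻¹ • v) x - f ζ x)) ?_ ?_
    · intro n
      exact ((hmeas _ (hN _ (Nat.le_add_left _ _))).sub (hmeas ζ hζ)).const_mul _
    · filter_upwards [hf] with x hx
      have hd := (hx.differentiableAt (hU.mem_nhds hζ)).hasFDerivAt
      have h2 : HasDerivAt (fun a : ℂ => ζ + a • v) v 0 := by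
        simpa using ((hasDerivAt_id (0 : ℂ)).smul_const v).const_add ζ
      have h3 : HasDerivAt (fun a : ℂ => f (ζ + a • v) x) (fderiv ℂ (fun ζ => f ζ x) ζ v) 0 := by
        refine HasFDerivAt.comp_hasDerivAt (0 : ℂ) (l := fun ζ => f ζ x) ?_ h2
        rw [zero_smul, add_zero]
        exact hd
      have h4 := h3.tendsto_slope_zero
      have h5 : Tendsto (fun n : ℕ => (((n + N : ℕ) : ℂ) + 1)⁻¹) atTop (𝓝[≠] 0) := by
        refine tendsto_nhdsWithin_iff.2 ⟨?_, ?_⟩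
        · have := tendsto_one_div_add_atTop_nhds_zero_nat (𝕜 := ℂ)
          have := this.comp (tendsto_add_atTop_nat N)
          refine this.congr fun n => ?_
          simp [one_div]
        · filter_upwards with n
          exact inv_ne_zero (Nat.cast_add_one_ne_zero _)
      have h6 := h4.comp h5
      refine h6.congr fun n => ?_
      simp [Function.comp]
  have hrep : ∀ A : E →L[ℂ] ℂ, A = ∑ i, A (b i) • (LinearMap.toContinuousLinearMap (b.coord i)) := by
    intro A
    ext v
    have h1 := congrArg A (b.sum_repr v).symm
    rw [map_sum] at h1
    rw [h1]
    simp [mul_comm]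
  have : (fun x => fderiv ℂ (fun ζ => f ζ x) ζ) = fun x => ∑ i,
      fderiv ℂ (fun ζ => f ζ x) ζ (b i) • (LinearMap.toContinuousLinearMap (b.coord i)) := by
    ext1 x
    exact hrep _
  rw [this]
  exact Finset.aestronglyMeasurable_fun_sum _ fun i _ => (hdir (b i)).smul_const _

/-- Integrals of holomorphic families: local integrability in both variables jointly already
dominates the family locally uniformly, by the sub-mean value property, so that the integral
exists at every point and is holomorphic. -/
theorem differentiableOn_integral_of_locally {f : E → X → ℂ} {U : Set E} (hU : IsOpen U)
    (hmeas : ∀ ζ ∈ U, AEStronglyMeasurable (f ζ) m)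
    (hjoint : AEMeasurable (fun p : E × X => ‖f p.1 p.2‖ₑ) ((μ.restrict U).prod m))
    (hf : ∀ᵐ x ∂m, DifferentiableOn ℂ (fun ζ => f ζ x) U)
    (hbound : ∀ ζ₀ ∈ U, ∃ R > 0, ball ζ₀ R ⊆ U ∧ ∫⁻ ζ in ball ζ₀ R, ∫⁻ x, ‖f ζ x‖ₑ ∂m ∂μ < ∞) :
    (∀ ζ ∈ U, Integrable (f ζ) m) ∧ DifferentiableOn ℂ (fun ζ => ∫ x, f ζ x ∂m) U := by
  have key : ∀ ζ₀ ∈ U, Integrable (f ζ₀) m ∧ DifferentiableAt ℂ (fun ζ => ∫ x, f ζ x ∂m) ζ₀ := by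
    intro ζ₀ hζ₀
    obtain ⟨R, hR, hsub, hfin⟩ := hbound ζ₀ hζ₀
    have hjoint' : AEMeasurable (fun p : E × X => ‖f p.1 p.2‖ₑ)
        ((μ.restrict (ball ζ₀ R)).prod m) :=
      hjoint.mono_ac ((Measure.absolutelyContinuous_of_le
        (Measure.restrict_mono hsub le_rfl)).prod Measure.AbsolutelyContinuous.rfl)
    rw [lintegral_lintegral_swap hjoint'] at hfin
    set g : X → ℝ≥0∞ := fun x => (∫⁻ w in ball ζ₀ R, ‖f w x‖ₑ ∂μ) / μ (ball ζ₀ (R / 2)) with hg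
    have hv0 : μ (ball ζ₀ (R / 2)) ≠ 0 := (measure_ball_pos μ _ (by positivity)).ne'
    have hgm : AEMeasurable g m := (hjoint'.lintegral_prod_left).div_const _
    have hgfin : ∫⁻ x, g x ∂m < ∞ := by
      have h1 : ∀ x, g x = (∫⁻ w in ball ζ₀ R, ‖f w x‖ₑ ∂μ) * (μ (ball ζ₀ (R / 2)))⁻¹ :=
        fun x => div_eq_mul_inv _ _
      simp_rw [h1]
      rw [lintegral_mul_const' _ _ (ENNReal.inv_ne_top.2 hv0)]
      exact ENNReal.mul_lt_top hfin (ENNReal.inv_lt_top.2 (pos_iff_ne_zero.2 hv0))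
    have hgae : ∀ᵐ x ∂m, g x < ∞ := ae_lt_top' hgm hgfin.ne
    have hb : ∀ᵐ x ∂m, ∀ z ∈ ball ζ₀ (R / 2), ‖f z x‖ ≤ (g x).toReal := by
      filter_upwards [hf, hgae] with x hx hxg z hz
      have := enorm_le_lintegral_ball_div μ hR (hx.mono hsub) hz
      rw [← toReal_enorm]
      exact ENNReal.toReal_mono hxg.ne this
    have hgi : Integrable (fun x => (g x).toReal) m := integrable_toReal_of_lintegral_ne_top hgm hgfin.ne
    have hint : Integrable (f ζ₀) m := hgi.mono' (hmeas ζ₀ hζ₀) (by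
      filter_upwards [hb] with x hx
      exact hx ζ₀ (mem_ball_self (by positivity)))
    refine ⟨hint, ?_⟩
    have hnb : ball ζ₀ (R / 4) ∈ 𝓝 ζ₀ := ball_mem_nhds _ (by positivity)
    refine (hasFDerivAt_integral_of_dominated_of_fderiv_le
      (F' := fun ζ x => fderiv ℂ (fun ζ => f ζ x) ζ) (bound := fun x => 2 * (g x).toReal / (R / 4))
      hnb ?_ hint ?_ ?_ ?_ ?_).differentiableAt
    · filter_upwards [hU.mem_nhds hζ₀] with ζ hζ using hmeas ζ hζ
    · exact aestronglyMeasurable_fderiv_param m hU hmeas hf hζ₀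
    · filter_upwards [hf, hb] with x hx hxb ζ hζ
      have hs : ball ζ (R / 4) ⊆ ball ζ₀ (R / 2) := by
        apply ball_subset_ball'
        rw [mem_ball] at hζ
        linarith
      refine norm_fderiv_le_of_ball (by positivity) ENNReal.toReal_nonneg
        (hx.mono (hs.trans ((ball_subset_ball (by linarith)).trans hsub))) fun z hz => hxb z (hs hz)
    · exact (hgi.const_mul 2).div_const _
    · filter_upwards [hf] with x hx ζ hζ
      exact (hx.differentiableAt (hU.mem_nhds
        (hsub (ball_subset_ball (by linarith) hζ)))).hasFDerivAt
  exact ⟨fun ζ hζ => (key ζ hζ).1, fun ζ hζ => (key ζ hζ).2.differentiableWithinAt⟩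

end HolomorphicIntegral

/-! ### Minkowski's inequality and Schur's test -/

section Inequalities

variable {X Y : Type*} [MeasurableSpace X] [MeasurableSpace Y] (μ : Measure X) (m : Measure Y)
  [SFinite μ] [SFinite m]

theorem measurable_eLpNorm_param {Z : Type*} [MeasurableSpace Z] {f : Z → X → ℂ}
    (hf : Measurable (Function.uncurry f)) (p : ℝ≥0∞) :
    Measurable fun z => eLpNorm (f z) p μ := by
  rcases eq_or_ne p 0 with rfl | hp0
  · simp
  rcases eq_or_ne p ∞ with rfl | hp
  · simp only [eLpNorm_exponent_top, eLpNormEssSup]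
    refine measurable_of_Iic fun a => ?_
    have hset : (fun z => essSup (fun x => ‖f z x‖ₑ) μ) ⁻¹' Set.Iic a
        = {z | μ (Prod.mk z ⁻¹' {q : Z × X | a < ‖f q.1 q.2‖ₑ}) = 0} := by
      ext z
      simp only [Set.mem_preimage, Set.mem_Iic, Set.mem_ofPred_eq]
      constructor
      · intro h
        have h1 : ∀ᵐ x ∂μ, ‖f z x‖ₑ ≤ a := by
          filter_upwards [ENNReal.ae_le_essSup (fun x => ‖f z x‖ₑ)] with x hx using hx.trans h
        rw [ae_iff] at h1
        simpa using h1
      · intro h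
        refine essSup_le_of_ae_le a ?_
        change ∀ᵐ x ∂μ, ‖f z x‖ₑ ≤ a
        rw [ae_iff]
        simpa using h
    rw [hset]
    have hms : MeasurableSet {q : Z × X | a < ‖f q.1 q.2‖ₑ} :=
      measurableSet_lt measurable_const hf.enorm
    exact (measurable_measure_prodMk_left hms) (measurableSet_singleton 0)
  · simp_rw [eLpNorm_eq_lintegral_rpow_enorm_toReal hp0 hp]
    exact (Measurable.lintegral_prod_right' (hf.enorm.pow_const _)).pow_const _

/-- Jensen's inequality for `x ↦ x ^ p`, in weighted form. -/
theorem lintegral_mul_rpow_le {p : ℝ} (hp : 1 ≤ p) {k h : Y → ℝ≥0∞} (hk : AEMeasurable k m)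
    (hh : AEMeasurable h m) :
    (∫⁻ y, k y * h y ∂m) ^ p ≤ (∫⁻ y, k y ∂m) ^ (p - 1) * ∫⁻ y, k y * h y ^ p ∂m := by
  rcases eq_or_lt_of_le hp with rfl | hp1
  · simp
  have hp0 : 0 < p := by linarith
  have hc : (Real.conjExponent p).HolderConjugate p :=
    (Real.HolderConjugate.conjExponent hp1).symm
  have hq0 : 0 < Real.conjExponent p := hc.pos
  have hsum : 1 / Real.conjExponent p + 1 / p = 1 := by
    have := hc.inv_add_inv_eq_one
    simpa [one_div] using this
  have h1 := ENNReal.lintegral_mul_le_Lp_mul_Lq m hc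
    (f := fun y => k y ^ (1 / Real.conjExponent p)) (g := fun y => k y ^ (1 / p) * h y)
    (hk.pow_const _) ((hk.pow_const _).mul hh)
  have h2 : ∀ y, k y ^ (1 / Real.conjExponent p) * (k y ^ (1 / p) * h y) = k y * h y := fun y => by
    rw [← mul_assoc, ← ENNReal.rpow_add_of_nonneg _ _ (by positivity) (by positivity), hsum,
      ENNReal.rpow_one]
  have h3 : ∀ y, (k y ^ (1 / Real.conjExponent p)) ^ (Real.conjExponent p) = k y := fun y => by
    rw [← ENNReal.rpow_mul, one_div_mul_cancel hq0.ne', ENNReal.rpow_one]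
  have h4 : ∀ y, (k y ^ (1 / p) * h y) ^ p = k y * h y ^ p := fun y => by
    rw [ENNReal.mul_rpow_of_nonneg _ _ hp0.le, ← ENNReal.rpow_mul, one_div_mul_cancel hp0.ne',
      ENNReal.rpow_one]
  simp only [Pi.mul_apply, h2, h3, h4] at h1
  calc (∫⁻ y, k y * h y ∂m) ^ p
      ≤ ((∫⁻ y, k y ∂m) ^ (1 / Real.conjExponent p) * (∫⁻ y, k y * h y ^ p ∂m) ^ (1 / p)) ^ p := by
        gcongr
    _ = _ := by
        rw [ENNReal.mul_rpow_of_nonneg _ _ hp0.le, ← ENNReal.rpow_mul, ← ENNReal.rpow_mul,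
          one_div_mul_cancel hp0.ne', ENNReal.rpow_one]
        congr 2
        have : 1 / Real.conjExponent p = 1 - 1 / p := by linarith
        rw [this]
        field_simp

/-- **Minkowski's integral inequality**, for a nonnegative kernel `k` on the parameter space. -/
theorem lintegral_rpow_lintegral_le {p : ℝ} (hp : 1 ≤ p) {k : Y → ℝ≥0∞} {h : X → Y → ℝ≥0∞}
    (hk : Measurable k) (hh : Measurable (Function.uncurry h)) :
    (∫⁻ x, (∫⁻ y, k y * h x y ∂m) ^ p ∂μ) ^ (1 / p)
      ≤ ∫⁻ y, k y * (∫⁻ x, h x y ^ p ∂μ) ^ (1 / p) ∂m := by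
  have hp0 : 0 < p := by linarith
  set N : Y → ℝ≥0∞ := fun y => (∫⁻ x, h x y ^ p ∂μ) ^ (1 / p) with hN
  have hNm : Measurable N :=
    (Measurable.lintegral_prod_left' (f := fun q : X × Y => h q.1 q.2 ^ p)
      (hh.pow_const p)).pow_const _
  have hNp : ∀ y, N y ^ p = ∫⁻ x, h x y ^ p ∂μ := fun y => by
    simp only [hN]
    rw [← ENNReal.rpow_mul, one_div_mul_cancel hp0.ne', ENNReal.rpow_one]
  set W := ∫⁻ y, k y * N y ∂m with hW
  rcases eq_or_ne W ∞ with hWt | hWt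
  · rw [hWt]; exact le_top
  have hxm : ∀ x, Measurable (h x) := fun x => hh.comp measurable_prodMk_left
  have hkN : Measurable fun y => k y * N y := hk.mul hNm
  -- almost everywhere with respect to `k dm` the norm `N` is finite
  have hfin : ∀ᵐ y ∂m, k y * N y < ∞ := ae_lt_top hkN hWt
  -- where `k N = 0` the product `k h` vanishes almost everywhere
  have hzero : ∀ᵐ x ∂μ, ∀ᵐ y ∂m, k y * N y = 0 → k y * h x y = 0 := by
    have hms : MeasurableSet {q : X × Y | k q.2 * N q.2 = 0 → k q.2 * h q.1 q.2 = 0} := by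
      have e1 : MeasurableSet {q : X × Y | k q.2 * N q.2 = 0} :=
        (hkN.comp measurable_snd) (measurableSet_singleton 0)
      have e2 : MeasurableSet {q : X × Y | k q.2 * h q.1 q.2 = 0} :=
        ((hk.comp measurable_snd).mul hh) (measurableSet_singleton 0)
      have : {q : X × Y | k q.2 * N q.2 = 0 → k q.2 * h q.1 q.2 = 0}
          = {q : X × Y | k q.2 * N q.2 = 0}ᶜ ∪ {q : X × Y | k q.2 * h q.1 q.2 = 0} := by
        ext q; simp [imp_iff_not_or]
      rw [this]
      exact e1.compl.union e2
    refine (Measure.ae_ae_comm (p := fun x y => k y * N y = 0 → k y * h x y = 0) hms).2 ?_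
    refine Filter.Eventually.of_forall fun y => ?_
    rcases eq_or_ne (k y) 0 with h0 | h0
    · simp [h0]
    rcases eq_or_ne (N y) 0 with h1 | h1
    · have h2 : ∫⁻ x, h x y ^ p ∂μ = 0 := by rw [← hNp, h1, ENNReal.zero_rpow_of_pos hp0]
      have h3 : Measurable fun x => h x y ^ p := (hh.comp measurable_prodMk_right).pow_const p
      rw [lintegral_eq_zero_iff h3] at h2
      filter_upwards [h2] with x hx _
      have : h x y = 0 := by
        rcases ENNReal.rpow_eq_zero_iff.1 hx with h | h
        · exact h.1
        · exact absurd h.2 (by linarith)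
      simp [this]
    · exact Filter.Eventually.of_forall fun x h => absurd h (mul_ne_zero h0 h1)
  have hpt : ∀ᵐ x ∂μ, (∫⁻ y, k y * h x y ∂m) ^ p
      ≤ W ^ (p - 1) * ∫⁻ y, (k y * N y) * (h x y / N y) ^ p ∂m := by
    filter_upwards [hzero] with x hx
    refine le_trans ?_ (lintegral_mul_rpow_le m hp hkN.aemeasurable
      ((hxm x).div hNm).aemeasurable)
    gcongr ?_ ^ p
    refine lintegral_mono_ae ?_
    filter_upwards [hx, hfin] with y hy hyf
    rcases eq_or_ne (k y * N y) 0 with h0 | h0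
    · rw [hy h0]; exact zero_le
    · have hN0 : N y ≠ 0 := fun h => h0 (by rw [h, mul_zero])
      have hk0 : k y ≠ 0 := fun h => h0 (by rw [h, zero_mul])
      have hNt : N y ≠ ∞ := fun h => by rw [h, ENNReal.mul_top hk0] at hyf; exact hyf.ne rfl
      rw [mul_assoc, ENNReal.mul_div_cancel hN0 hNt]
  have hfinal : ∫⁻ x, (∫⁻ y, k y * h x y ∂m) ^ p ∂μ ≤ W ^ p := by
    calc ∫⁻ x, (∫⁻ y, k y * h x y ∂m) ^ p ∂μ
        ≤ ∫⁻ x, W ^ (p - 1) * ∫⁻ y, (k y * N y) * (h x y / N y) ^ p ∂m ∂μ :=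
          lintegral_mono_ae hpt
      _ = W ^ (p - 1) * ∫⁻ x, ∫⁻ y, (k y * N y) * (h x y / N y) ^ p ∂m ∂μ :=
          lintegral_const_mul' _ _ (ENNReal.rpow_ne_top_of_nonneg (by linarith) hWt)
      _ = W ^ (p - 1) * ∫⁻ y, ∫⁻ x, (k y * N y) * (h x y / N y) ^ p ∂μ ∂m := by
          rw [lintegral_lintegral_swap]
          apply Measurable.aemeasurable
          exact (hkN.comp measurable_snd).mul ((hh.div (hNm.comp measurable_snd)).pow_const p)
      _ ≤ W ^ (p - 1) * ∫⁻ y, k y * N y ∂m := by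
          gcongr with y
          have hm : Measurable fun x => (h x y / N y) ^ p :=
            ((hh.comp measurable_prodMk_right).div_const _).pow_const p
          rw [lintegral_const_mul _ hm]
          refine mul_le_of_le_one_right' ?_
          simp_rw [ENNReal.div_rpow_of_nonneg _ _ hp0.le, div_eq_mul_inv]
          have hm' : Measurable fun x => h x y ^ p := (hh.comp measurable_prodMk_right).pow_const p
          rw [lintegral_mul_const _ hm', ← hNp]
          exact ENNReal.mul_inv_le_one _
      _ = W ^ p := by
          rw [← hW]
          rcases eq_or_ne W 0 with h0 | h0
          · rw [h0, mul_zero, ENNReal.zero_rpow_of_pos hp0]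
          · have := ENNReal.rpow_add (p - 1) 1 h0 hWt
            rw [ENNReal.rpow_one, sub_add_cancel] at this
            exact this.symm
  calc (∫⁻ x, (∫⁻ y, k y * h x y ∂m) ^ p ∂μ) ^ (1 / p) ≤ (W ^ p) ^ (1 / p) := by gcongr
    _ = W := by rw [← ENNReal.rpow_mul, mul_one_div_cancel hp0.ne', ENNReal.rpow_one]

/-- Minkowski's integral inequality for all `1 ≤ p ≤ ∞`, for the norm of a (not necessarily
measurable) function dominated by a positive integral. -/
theorem eLpNorm_le_lintegral_of_le {p : ℝ≥0∞} (hp : 1 ≤ p) {k : Y → ℝ≥0∞} {h : X → Y → ℂ}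
    (hk : Measurable k) (hh : Measurable (Function.uncurry h)) {g : X → ℂ}
    (hg : ∀ᵐ x ∂μ, ‖g x‖ₑ ≤ ∫⁻ y, k y * ‖h x y‖ₑ ∂m) :
    eLpNorm g p μ ≤ ∫⁻ y, k y * eLpNorm (fun x => h x y) p μ ∂m := by
  have hp0 : p ≠ 0 := (zero_lt_one.trans_le hp).ne'
  rcases eq_or_ne p ∞ with rfl | hpt
  · simp only [eLpNorm_exponent_top, eLpNormEssSup]
    refine essSup_le_of_ae_le _ ?_
    have hNm : Measurable fun y => essSup (fun x => ‖h x y‖ₑ) μ := by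
      have := measurable_eLpNorm_param μ (f := fun y x => h x y) (hh.comp measurable_swap) ∞
      simpa [eLpNorm_exponent_top, eLpNormEssSup] using this
    have hae : ∀ᵐ x ∂μ, ∀ᵐ y ∂m, ‖h x y‖ₑ ≤ essSup (fun x => ‖h x y‖ₑ) μ := by
      refine (Measure.ae_ae_comm (p := fun x y => ‖h x y‖ₑ ≤ essSup (fun x => ‖h x y‖ₑ) μ)
        (measurableSet_le hh.enorm (hNm.comp measurable_snd))).2 ?_
      exact Filter.Eventually.of_forall fun y => ENNReal.ae_le_essSup _
    filter_upwards [hg, hae] with x hx hxy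
    refine hx.trans (lintegral_mono_ae ?_)
    filter_upwards [hxy] with y hy
    gcongr
  · have h1 : 1 ≤ p.toReal := by
      rw [← ENNReal.toReal_one]
      exact ENNReal.toReal_mono hpt hp
    simp_rw [eLpNorm_eq_lintegral_rpow_enorm_toReal hp0 hpt]
    refine le_trans ?_ (lintegral_rpow_lintegral_le μ m h1 hk hh.enorm)
    gcongr ?_ ^ _
    refine lintegral_mono_ae ?_
    filter_upwards [hg] with x hx
    gcongr

/-- **Schur test** on `L^q`, `1 < q < ∞`, with test function `φ`. -/
theorem schur_test {q q' : ℝ} (hqq : q.HolderConjugate q') {K : X → Y → ℝ≥0∞}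
    (hK : Measurable (Function.uncurry K)) {φ : X → ℝ≥0∞} {ψ : Y → ℝ≥0∞} (hφ : Measurable φ)
    (hψ : Measurable ψ) (hψ0 : ∀ᵐ y ∂m, ψ y ≠ 0) (hψt : ∀ᵐ y ∂m, ψ y ≠ ∞) {A B : ℝ≥0∞}
    (h1 : ∀ᵐ x ∂μ, ∫⁻ y, K x y * ψ y ^ q' ∂m ≤ A * φ x ^ q')
    (h2 : ∀ᵐ y ∂m, ∫⁻ x, K x y * φ x ^ q ∂μ ≤ B * ψ y ^ q)
    {f : Y → ℝ≥0∞} (hf : AEMeasurable f m) :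
    ∫⁻ x, (∫⁻ y, K x y * f y ∂m) ^ q ∂μ ≤ A ^ (q / q') * B * ∫⁻ y, f y ^ q ∂m := by
  have hq0 : 0 < q := hqq.pos
  have hq0' : 0 < q' := hqq.symm.pos
  have hKx : ∀ x, Measurable (K x) := fun x => hK.comp measurable_prodMk_left
  have hpt : ∀ᵐ x ∂μ, (∫⁻ y, K x y * f y ∂m) ^ q
      ≤ A ^ (q / q') * ∫⁻ y, K x y * φ x ^ q * (f y / ψ y) ^ q ∂m := by
    filter_upwards [h1] with x hx
    -- Hölder's inequality for `K f = (K^{1/q'} ψ) (K^{1/q} f / ψ)`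
    have hH := ENNReal.lintegral_mul_le_Lp_mul_Lq m hqq.symm
      (f := fun y => K x y ^ (1 / q') * ψ y) (g := fun y => K x y ^ (1 / q) * (f y / ψ y))
      (((hKx x).pow_const _).mul hψ).aemeasurable
      (((hKx x).pow_const _).aemeasurable.mul (hf.div hψ.aemeasurable))
    have hsum : 1 / q' + 1 / q = 1 := by
      have := hqq.symm.inv_add_inv_eq_one
      simpa [one_div] using this
    have e1 : ∫⁻ y, K x y * f y ∂m = ∫⁻ y, ((fun y => K x y ^ (1 / q') * ψ y) *
        fun y => K x y ^ (1 / q) * (f y / ψ y)) y ∂m := by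
      refine lintegral_congr_ae ?_
      filter_upwards [hψ0, hψt] with y hy0 hyt
      simp only [Pi.mul_apply]
      calc K x y * f y = K x y ^ (1 / q' + 1 / q) * (ψ y * (f y / ψ y)) := by
            rw [hsum, ENNReal.rpow_one, ENNReal.mul_div_cancel hy0 hyt]
        _ = _ := by
            rw [ENNReal.rpow_add_of_nonneg _ _ (by positivity) (by positivity)]
            ring
    have e2 : ∀ y, (K x y ^ (1 / q') * ψ y) ^ q' = K x y * ψ y ^ q' := fun y => by
      rw [ENNReal.mul_rpow_of_nonneg _ _ hq0'.le, ← ENNReal.rpow_mul, one_div_mul_cancel hq0'.ne',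
        ENNReal.rpow_one]
    have e3 : ∀ y, (K x y ^ (1 / q) * (f y / ψ y)) ^ q = K x y * (f y / ψ y) ^ q := fun y => by
      rw [ENNReal.mul_rpow_of_nonneg _ _ hq0.le, ← ENNReal.rpow_mul, one_div_mul_cancel hq0.ne',
        ENNReal.rpow_one]
    simp only [e2, e3] at hH
    rw [← e1] at hH
    calc (∫⁻ y, K x y * f y ∂m) ^ q
        ≤ ((A * φ x ^ q') ^ (1 / q') * (∫⁻ y, K x y * (f y / ψ y) ^ q ∂m) ^ (1 / q)) ^ q := by
          gcongr
          refine hH.trans ?_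
          gcongr
      _ = A ^ (q / q') * (φ x ^ q * ∫⁻ y, K x y * (f y / ψ y) ^ q ∂m) := by
          rw [ENNReal.mul_rpow_of_nonneg _ _ hq0.le, ← ENNReal.rpow_mul, ← ENNReal.rpow_mul,
            one_div_mul_cancel hq0.ne', ENNReal.rpow_one,
            ENNReal.mul_rpow_of_nonneg _ _ (by positivity), ← ENNReal.rpow_mul]
          have e4 : q' * (1 / q' * q) = q := by field_simp
          have e5 : 1 / q' * q = q / q' := by ring
          rw [e4, e5, mul_assoc]
      _ = _ := by
          have hm : AEMeasurable (fun y => K x y * (f y / ψ y) ^ q) m :=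
            (hKx x).aemeasurable.mul ((hf.div hψ.aemeasurable).pow_const q)
          rw [← lintegral_const_mul'' _ hm]
          congr 2
          ext y
          ring
  have hm2 : AEMeasurable (fun p : X × Y => K p.1 p.2 * φ p.1 ^ q * (f p.2 / ψ p.2) ^ q)
      (μ.prod m) :=
    ((hK.mul ((hφ.comp measurable_fst).pow_const q)).aemeasurable).mul
      (((hf.comp_snd).div (hψ.comp measurable_snd).aemeasurable).pow_const q)
  calc ∫⁻ x, (∫⁻ y, K x y * f y ∂m) ^ q ∂μ
      ≤ ∫⁻ x, A ^ (q / q') * ∫⁻ y, K x y * φ x ^ q * (f y / ψ y) ^ q ∂m ∂μ := lintegral_mono_ae hpt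
    _ = A ^ (q / q') * ∫⁻ x, ∫⁻ y, K x y * φ x ^ q * (f y / ψ y) ^ q ∂m ∂μ :=
        lintegral_const_mul'' _ hm2.lintegral_prod_right'
    _ = A ^ (q / q') * ∫⁻ y, ∫⁻ x, K x y * φ x ^ q * (f y / ψ y) ^ q ∂μ ∂m := by
        rw [lintegral_lintegral_swap hm2]
    _ ≤ A ^ (q / q') * ∫⁻ y, B * f y ^ q ∂m := by
        refine mul_le_mul_right (lintegral_mono_ae ?_) _
        filter_upwards [h2, hψ0, hψt] with y hy hy0 hyt
        have hKy : Measurable fun x => K x y * φ x ^ q :=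
          (hK.comp measurable_prodMk_right).mul (hφ.pow_const q)
        rw [lintegral_mul_const _ hKy]
        calc (∫⁻ x, K x y * φ x ^ q ∂μ) * (f y / ψ y) ^ q
            ≤ B * ψ y ^ q * (f y / ψ y) ^ q := by gcongr
          _ = B * f y ^ q := by
              rw [mul_assoc, ← ENNReal.mul_rpow_of_nonneg _ _ hq0.le, ENNReal.mul_div_cancel hy0 hyt]
    _ = _ := by
        rw [lintegral_const_mul'' _ (hf.pow_const q), mul_assoc]

end Inequalities

/-! ### Fourier transform on `ℝ^ι` -/

section Fourier

open FourierTransform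

/-- The Fourier integral of a function in `L¹ ∩ L²` represents its `L²` Fourier transform. -/
theorem lintegral_enorm_fourier_sq {V : Type*} [NormedAddCommGroup V] [InnerProductSpace ℝ V]
    [FiniteDimensional ℝ V] [MeasurableSpace V] [BorelSpace V] {g : V → ℂ}
    (h1 : Integrable g) (h2 : MemLp g 2) :
    ∫⁻ x, ‖𝓕 g x‖ₑ ^ 2 = ∫⁻ x, ‖g x‖ₑ ^ 2 := by
  set G : Lp ℂ 2 (volume : Measure V) := h2.toLp g with hG
  have hcont : Continuous (𝓕 g) :=
    VectorFourier.fourierIntegral_continuous Real.continuous_fourierChar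
      (innerSL ℝ).continuous₂ h1
  have hae : ∀ᵐ x, (𝓕 G : Lp ℂ 2 (volume : Measure V)) x = 𝓕 g x := by
    -- both transforms have the same integrals against test functions
    refine ae_eq_of_integral_contDiff_smul_eq ?_ hcont.locallyIntegrable ?_
    · exact (Lp.memLp (𝓕 G)).locallyIntegrable (by norm_num)
    · intro φ hφ hφc
      have hg₁ : HasCompactSupport (Complex.ofRealCLM ∘ φ) := hφc.comp_left rfl
      have hg₂ : ContDiff ℝ (⊤ : ℕ∞) (Complex.ofRealCLM ∘ φ) := by fun_prop
      set Φ := hg₁.toSchwartzMap hg₂ with hΦ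
      have hΦx : ∀ x, Φ x = (φ x : ℂ) := fun x => rfl
      have e1 := congrArg (fun T => T Φ) (Lp.fourier_toTemperedDistribution_eq G)
      simp only [TemperedDistribution.fourier_apply, Lp.toTemperedDistribution_apply, hΦx] at e1
      have e2 := VectorFourier.integral_fourierIntegral_smul_eq_flip (L := innerₗ V)
        (μ := volume) (ν := volume) Real.continuous_fourierChar
        (by simpa using continuous_inner) Φ.integrable h1
      simp only [Complex.real_smul]
      simp only [smul_eq_mul] at e1
      rw [← e1]
      have e3 : ∫ x, (𝓕 Φ) x * G x = ∫ x, (𝓕 Φ) x * g x := by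
        refine integral_congr_ae ?_
        filter_upwards [h2.coeFn_toLp] with x hx
        rw [hx]
      rw [e3]
      simp only [smul_eq_mul, flip_innerₗ] at e2
      exact e2
  have e4 : eLpNorm (𝓕 G : Lp ℂ 2 (volume : Measure V)) 2 volume = eLpNorm G 2 volume := by
    have := Lp.norm_fourier_eq G
    rw [Lp.norm_def, Lp.norm_def] at this
    exact (ENNReal.toReal_eq_toReal_iff' (Lp.eLpNorm_ne_top _) (Lp.eLpNorm_ne_top _)).1 this
  have e5 : eLpNorm (𝓕 g) 2 volume = eLpNorm g 2 volume := by
    rw [← eLpNorm_congr_ae hae, e4]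
    exact eLpNorm_congr_ae h2.coeFn_toLp
  have e6 : ∀ f : V → ℂ, eLpNorm f 2 volume ^ 2 = ∫⁻ x, ‖f x‖ₑ ^ 2 := fun f => by
    have := eLpNorm_nnreal_pow_eq_lintegral (f := f) (μ := (volume : Measure V)) (p := 2)
      (by norm_num)
    simpa using this
  rw [← e6, ← e6, e5]

variable {ι : Type*} [Fintype ι]

/-- The character `x ↦ exp (2πi x·ξ)`, complexified in `x`. -/
def cexpPairing (z : ι → ℂ) (ξ : ι → ℝ) : ℂ := Complex.exp (2 * Real.pi * Complex.I * ∑ i, z i * ξ i)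

/-- Plancherel's theorem on `ℝ^ι`. The type `ι → ℝ` carries the sup norm, so the statement is
transported from the Euclidean space. -/
theorem lintegral_fourier_pi_sq {g : (ι → ℝ) → ℂ} (h1 : Integrable g) (h2 : MemLp g 2) :
    ∫⁻ x : ι → ℝ, ‖∫ ξ, cexpPairing (fun i => (x i : ℂ)) ξ * g ξ‖ₑ ^ 2 = ∫⁻ ξ, ‖g ξ‖ₑ ^ 2 := by
  have hmp := EuclideanSpace.volume_preserving_symm_measurableEquiv_toLp ι
  set e := (MeasurableEquiv.toLp 2 (ι → ℝ)).symm with he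
  have hmp' : MeasurePreserving e := hmp
  have h1' : Integrable (g ∘ e) := hmp'.integrable_comp_of_integrable h1
  have h2' : MemLp (g ∘ e) 2 := h2.comp_measurePreserving hmp'
  have key := lintegral_enorm_fourier_sq h1' h2'
  have e1 : ∫⁻ x, ‖(g ∘ e) x‖ₑ ^ 2 = ∫⁻ ξ, ‖g ξ‖ₑ ^ 2 :=
    hmp'.lintegral_comp_emb e.measurableEmbedding (fun ξ => ‖g ξ‖ₑ ^ 2)
  rw [e1] at key
  rw [← key, ← hmp'.lintegral_comp_emb e.measurableEmbedding, ← lintegral_neg_eq_self]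
  refine lintegral_congr fun x => ?_
  congr 2
  rw [Real.fourier_eq', ← hmp'.integral_comp e.measurableEmbedding]
  refine integral_congr_ae (Filter.Eventually.of_forall fun v => ?_)
  simp only [smul_eq_mul, Function.comp_apply, cexpPairing]
  congr 2
  simp [PiLp.inner_apply, he, Finset.mul_sum, mul_comm]
  exact Finset.sum_congr rfl fun i _ => by ring

/-- Fourier inversion on `ℝ^ι`, transported from the Euclidean space. -/
theorem fourier_inversion_pi {f : (ι → ℝ) → ℂ} (hc : Continuous f) (hf : Integrable f)
    (hf' : Integrable fun ξ : ι → ℝ => ∫ x, cexpPairing (fun i => -(x i : ℂ)) ξ * f x)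
    (x : ι → ℝ) :
    ∫ ξ : ι → ℝ, cexpPairing (fun i => (x i : ℂ)) ξ *
      ∫ x, cexpPairing (fun i => -(x i : ℂ)) ξ * f x = f x := by
  have hmp := EuclideanSpace.volume_preserving_symm_measurableEquiv_toLp ι
  set e := (MeasurableEquiv.toLp 2 (ι → ℝ)).symm with he
  have hmp' : MeasurePreserving e := hmp
  have hf1 : Integrable (f ∘ e) := hmp'.integrable_comp_of_integrable hf
  have hce : Continuous (f ∘ e) := hc.comp (PiLp.continuous_ofLp 2 _)
  have hF : 𝓕 (f ∘ e) = (fun ξ : ι → ℝ => ∫ x, cexpPairing (fun i => -(x i : ℂ)) ξ * f x) ∘ e := by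
    ext w
    rw [Real.fourier_eq', Function.comp_apply, ← hmp'.integral_comp e.measurableEmbedding]
    refine integral_congr_ae (Filter.Eventually.of_forall fun v => ?_)
    simp only [smul_eq_mul, Function.comp_apply, cexpPairing]
    congr 2
    simp [PiLp.inner_apply, he, Finset.mul_sum, mul_comm]
    exact Finset.sum_congr rfl fun i _ => by ring
  have hf2 : Integrable (𝓕 (f ∘ e)) := by
    rw [hF]
    exact hmp'.integrable_comp_of_integrable hf'
  have key := congrFun (hce.fourierInv_fourier_eq hf1 hf2) (e.symm x)
  rw [hF, Real.fourierInv_eq'] at key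
  simp only [Function.comp_apply, MeasurableEquiv.apply_symm_apply] at key
  rw [← key, ← hmp'.integral_comp e.measurableEmbedding]
  refine integral_congr_ae (Filter.Eventually.of_forall fun v => ?_)
  simp only [smul_eq_mul]
  congr 1
  simp only [cexpPairing]
  congr 1
  simp [PiLp.inner_apply, he, Finset.mul_sum, mul_comm]
  exact Finset.sum_congr rfl fun i _ => by ring

end Fourier

/-! ### Triangular elements and their determinants -/

section LinearAlgebra

theorem det_eq_prod_of_isInternal {κ W : Type*} [Fintype κ] [DecidableEq κ] [AddCommGroup W]
    [Module ℝ W] [FiniteDimensional ℝ W] {N : κ → Submodule ℝ W} (h : DirectSum.IsInternal N)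
    {f : W →ₗ[ℝ] W} {s : κ → ℝ} (hf : ∀ k, ∀ a ∈ N k, f a = s k • a) :
    LinearMap.det f = ∏ k, s k ^ Module.finrank ℝ (N k) := by
  classical
  set b := h.collectedBasis (fun k => Module.finBasis ℝ (N k)) with hb
  have hM : LinearMap.toMatrix b b f = Matrix.diagonal fun x => s x.1 := by
    ext x y
    rw [LinearMap.toMatrix_apply, hf y.1 (b y) (by
      rw [hb]; exact h.collectedBasis_mem _ y)]
    rw [map_smul, Finsupp.smul_apply, Module.Basis.repr_self, Matrix.diagonal_apply,
      Finsupp.single_apply]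
    by_cases hxy : x = y
    · subst hxy; simp
    · rw [if_neg hxy, if_neg (Ne.symm hxy), smul_zero]
  rw [← LinearMap.det_toMatrix b, hM, Matrix.det_diagonal, Fintype.prod_sigma]
  simp

theorem continuous_bilin_pi {ι F : Type*} [Fintype ι] [AddCommGroup F] [Module ℝ F]
    [TopologicalSpace F] [IsTopologicalAddGroup F] [ContinuousSMul ℝ F]
    (b : (ι → ℝ) →ₗ[ℝ] (ι → ℝ) →ₗ[ℝ] F) : Continuous fun p : (ι → ℝ) × (ι → ℝ) => b p.1 p.2 := by
  classical
  have h : ∀ p : (ι → ℝ) × (ι → ℝ), b p.1 p.2 = ∑ i, p.1 i • b (Pi.single i 1) p.2 := by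
    intro p
    conv_lhs => rw [← Finset.univ_sum_single p.1]
    rw [map_sum, LinearMap.sum_apply]
    refine Finset.sum_congr rfl fun i _ => ?_
    have : (Pi.single i (p.1 i) : ι → ℝ) = p.1 i • Pi.single i 1 := by
      rw [← Pi.single_smul, smul_eq_mul, mul_one]
    rw [this, map_smul, LinearMap.smul_apply]
  simp_rw [h]
  refine continuous_finsetSum _ fun i _ => ?_
  exact ((continuous_apply i).comp continuous_fst).smul
    ((LinearMap.continuous_on_pi (b (Pi.single i 1))).comp continuous_snd)

theorem continuous_det_comp {ι W : Type*} [Fintype ι] [AddCommGroup W] [Module ℝ W]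
    [FiniteDimensional ℝ W] (f : (ι → ℝ) →ₗ[ℝ] (ι → ℝ) →ₗ[ℝ] W →ₗ[ℝ] W) :
    Continuous fun x => LinearMap.det (f x x) := by
  classical
  set b := Module.finBasis ℝ W
  have h : ∀ x, LinearMap.det (f x x) = (LinearMap.toMatrix b b (f x x)).det := fun x =>
    (LinearMap.det_toMatrix b _).symm
  simp_rw [h]
  refine Continuous.matrix_det ?_
  exact (continuous_bilin_pi (f.compr₂ (LinearMap.toMatrix b b).toLinearMap)).comp
    (continuous_id.prodMk continuous_id)

theorem continuous_det_linear {ι W : Type*} [Fintype ι] [AddCommGroup W] [Module ℝ W]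
    [FiniteDimensional ℝ W] (f : (ι → ℝ) →ₗ[ℝ] W →ₗ[ℝ] W) :
    Continuous fun x => LinearMap.det (f x) := by
  classical
  set b := Module.finBasis ℝ W
  have h : ∀ x, LinearMap.det (f x) = (LinearMap.toMatrix b b (f x)).det := fun x =>
    (LinearMap.det_toMatrix b _).symm
  simp_rw [h]
  exact (LinearMap.continuous_on_pi
    ((LinearMap.toMatrix b b).toLinearMap.comp f)).matrix_det

end LinearAlgebra

/-- The data by which a homogeneous cone is parametrized: `W` is the associative algebra of
triangular elements, graded by the subspaces `N i j` (`i ≤ j`), and the ambient space `ℝ^ι` of the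
cone is identified with `W` by means of `sym : s ↦ s + s⋆`. The bilinear map `B` stands for
`(s, t) ↦ s t⋆ + t s⋆` and `tr` for the trace form. -/
structure ConeData (r : ℕ) (ι W : Type*) [Fintype ι] [Ring W] [Algebra ℝ W] where
  N : Fin r → Fin r → Submodule ℝ W
  isInternal : DirectSum.IsInternal fun p : {p : Fin r × Fin r // p.1 ≤ p.2} => N p.1.1 p.1.2
  c : Fin r → W
  sum_c : ∑ i, c i = 1
  c_mem : ∀ i, c i ∈ N i i
  c_mul : ∀ {i j a}, i ≤ j → a ∈ N i j → ∀ k, c k * a = if k = i then a else 0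
  mul_c : ∀ {i j a}, i ≤ j → a ∈ N i j → ∀ k, a * c k = if k = j then a else 0
  ρ : Fin r → W →ₐ[ℝ] ℝ
  ρ_c : ∀ i j, ρ i (c j) = if i = j then 1 else 0
  ρ_N : ∀ {i j a}, i < j → a ∈ N i j → ∀ k, ρ k a = 0
  eq_smul_c : ∀ {i a}, a ∈ N i i → a = ρ i a • c i
  sym : W ≃ₗ[ℝ] (ι → ℝ)
  B : W →ₗ[ℝ] W →ₗ[ℝ] (ι → ℝ)
  B_symm : ∀ s t, B s t = B t s
  B_c : ∀ a i, B a (c i) = sym (a * c i)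
  act : ∀ t, (∀ i, 0 < ρ i t) → ∃ g : (ι → ℝ) →ₗ[ℝ] (ι → ℝ), ∀ s s', B (t * s) (t * s') = g (B s s')
  tr : (ι → ℝ) →ₗ[ℝ] ℝ
  tr_sym : ∀ s, tr (sym s) = 2 * ∑ i, ρ i s
  tr_pos : ∀ s, s ≠ 0 → 0 < tr (B s s)

namespace ConeData

variable {r : ℕ} {ι W : Type*} [Fintype ι] [Ring W] [Algebra ℝ W] (C : ConeData r ι W)

theorem finiteDimensional {r : ℕ} {ι W : Type*} [Fintype ι] [Ring W] [Algebra ℝ W]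
    (C : ConeData r ι W) : FiniteDimensional ℝ W :=
  LinearEquiv.finiteDimensional C.sym.symm

/-- The triangular elements with positive diagonal. -/
def H : Set W := {t | ∀ i, 0 < C.ρ i t}

/-- The diagonal element with entries `v`. -/
def diag (v : Fin r → ℝ) : W := ∑ i, v i • C.c i

/-- `n_j = ∑_{i < j} dim N i j`. -/
def n (j : Fin r) : ℕ := ∑ i ∈ Finset.Iio j, Module.finrank ℝ (C.N i j)

/-- `m_i = ∑_{j > i} dim N i j`. -/
def m (i : Fin r) : ℕ := ∑ j ∈ Finset.Ioi i, Module.finrank ℝ (C.N i j)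

/-- `τ_i = 1 + (m_i + n_i) / 2`. -/
def τ (i : Fin r) : ℝ := 1 + ((C.m i : ℝ) + C.n i) / 2

theorem n_lt_τ (i : Fin r) : (C.n i : ℝ) / 2 < C.τ i := by
  have : (0 : ℝ) ≤ C.m i := Nat.cast_nonneg _
  rw [τ]
  linarith

theorem induction_on {P : W → Prop} (hN : ∀ i j a, i ≤ j → a ∈ C.N i j → P a)
    (hadd : ∀ a b, P a → P b → P (a + b)) (h0 : P 0) (a : W) : P a := by
  have hmem : a ∈ ⨆ p : {p : Fin r × Fin r // p.1 ≤ p.2}, C.N p.1.1 p.1.2 := by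
    rw [C.isInternal.submodule_iSup_eq_top]; exact Submodule.mem_top
  exact Submodule.iSup_induction (motive := P) _ hmem (fun p a ha => hN _ _ a p.2 ha) h0 hadd

theorem diag_mul {i j : Fin r} {a : W} (hij : i ≤ j) (ha : a ∈ C.N i j) (v : Fin r → ℝ) :
    C.diag v * a = v i • a := by
  simp [diag, Finset.sum_mul, C.c_mul hij ha]

theorem mul_diag {i j : Fin r} {a : W} (hij : i ≤ j) (ha : a ∈ C.N i j) (v : Fin r → ℝ) :
    a * C.diag v = v j • a := by
  simp [diag, Finset.mul_sum, C.mul_c hij ha]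

theorem diag_mul_diag (v w : Fin r → ℝ) : C.diag v * C.diag w = C.diag (v * w) := by
  conv_lhs => rw [show C.diag w = ∑ i, w i • C.c i from rfl]
  rw [Finset.mul_sum]
  simp_rw [mul_smul_comm, C.diag_mul le_rfl (C.c_mem _), smul_smul]
  simp [diag, mul_comm]

theorem diag_one : C.diag 1 = 1 := by simp [diag, C.sum_c]

theorem ρ_diag (v : Fin r → ℝ) (i : Fin r) : C.ρ i (C.diag v) = v i := by
  simp [diag, C.ρ_c]

theorem diag_mem_H {v : Fin r → ℝ} (hv : ∀ i, 0 < v i) : C.diag v ∈ C.H := fun i => by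
  rw [C.ρ_diag]; exact hv i

theorem one_mem_H : (1 : W) ∈ C.H := fun i => by simp

theorem mul_mem_H {s t : W} (hs : s ∈ C.H) (ht : t ∈ C.H) : s * t ∈ C.H := fun i => by
  rw [map_mul]; exact mul_pos (hs i) (ht i)

/-- The diagonal part of `t`. -/
def dpart (t : W) : W := C.diag fun i => C.ρ i t

theorem B_diag (a : W) (v : Fin r → ℝ) : C.B a (C.diag v) = C.sym (a * C.diag v) := by
  simp [diag, Finset.mul_sum, C.B_c]

theorem B_one (a : W) : C.B a 1 = C.sym a := by
  rw [← C.diag_one, C.B_diag, C.diag_one, mul_one]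

/-- Conjugation by the one-parameter group of diagonal elements contracts `t` to its diagonal
part. -/
theorem tendsto_conj (t : W) : Filter.Tendsto
    (fun s : ℝ => C.sym (C.diag (fun i => (s ^ (i : ℕ))⁻¹) * t * C.diag (fun i => s ^ (i : ℕ))))
    (nhdsWithin 0 (Set.Ioi 0)) (nhds (C.sym (C.dpart t))) := by
  refine C.induction_on (P := fun t => Filter.Tendsto
    (fun s : ℝ => C.sym (C.diag (fun i => (s ^ (i : ℕ))⁻¹) * t * C.diag (fun i => s ^ (i : ℕ))))
    (nhdsWithin 0 (Set.Ioi 0)) (nhds (C.sym (C.dpart t)))) ?_ ?_ ?_ t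
  · intro i j a hij ha
    have h1 : ∀ s : ℝ, s ∈ Set.Ioi (0 : ℝ) →
        s ^ ((j : ℕ) - (i : ℕ)) • C.sym a =
        C.sym (C.diag (fun i => (s ^ (i : ℕ))⁻¹) * a * C.diag (fun i => s ^ (i : ℕ))) := by
      intro s hs
      have hs0 : s ≠ 0 := (Set.mem_Ioi.1 hs).ne'
      rw [C.diag_mul hij ha, smul_mul_assoc, C.mul_diag hij ha, map_smul, map_smul, smul_smul]
      congr 1
      rw [pow_sub₀ _ hs0 (by exact_mod_cast hij), mul_comm]
    refine Filter.Tendsto.congr' (Filter.eventually_of_mem self_mem_nhdsWithin h1) ?_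
    rcases hij.eq_or_lt with rfl | hlt
    · have h2 : C.dpart a = a := by
        have h3 := C.eq_smul_c ha
        unfold dpart diag
        rw [Finset.sum_eq_single i]
        · exact h3.symm
        · intro k _ hk
          rw [h3]
          simp [C.ρ_c, hk]
        · simp
      simp [h2]
    · have h2 : C.dpart a = 0 := by
        unfold dpart diag
        simp [C.ρ_N hlt ha]
      rw [h2, map_zero]
      have h3 : Filter.Tendsto (fun s : ℝ => s ^ ((j : ℕ) - (i : ℕ))) (nhdsWithin 0 (Set.Ioi 0))
          (nhds 0) := by
        have h4 : Filter.Tendsto (fun s : ℝ => s ^ ((j : ℕ) - (i : ℕ))) (nhds 0) (nhds 0) := by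
          have h5 := (continuous_pow ((j : ℕ) - (i : ℕ))).tendsto (0 : ℝ)
          rwa [zero_pow (by have : (i : ℕ) < j := hlt
                            omega)] at h5
        exact h4.mono_left nhdsWithin_le_nhds
      simpa using h3.smul_const (C.sym a)
  · intro a b ha hb
    have h1 := ha.add hb
    have h2 : C.dpart (a + b) = C.dpart a + C.dpart b := by
      simp [dpart, diag, add_smul, Finset.sum_add_distrib]
    rw [h2, map_add]
    refine h1.congr fun s => ?_
    rw [mul_add, add_mul, map_add]
  · have h2 : C.dpart 0 = 0 := by simp [dpart, diag]
    simp [h2]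

/-- A function that is invariant under conjugation by positive diagonal elements depends only on
the diagonal part. -/
theorem eq_dpart_of_conj_invariant {f : W → ℝ} {t : W}
    (hc : ContinuousAt (fun x => f (C.sym.symm x)) (C.sym (C.dpart t)))
    (hf : ∀ v w : Fin r → ℝ, (∀ i, 0 < v i) → (∀ i, 0 < w i) → v * w = 1 →
      f (C.diag v * t * C.diag w) = f t) : f t = f (C.dpart t) := by
  have h1 := hc.tendsto.comp (C.tendsto_conj t)
  simp only [Function.comp_def, LinearEquiv.symm_apply_apply] at h1
  refine tendsto_nhds_unique (Filter.Tendsto.congr' ?_ tendsto_const_nhds) h1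
  refine Filter.eventually_of_mem self_mem_nhdsWithin fun s hs => ?_
  have hs0 : 0 < s := hs
  refine (hf _ _ (fun i => by positivity) (fun i => by positivity) ?_).symm
  ext i
  simp [hs0.ne']

theorem diag_conj_mul {v w : Fin r → ℝ} (h : v * w = 1) : C.diag v * C.diag w = 1 := by
  rw [C.diag_mul_diag, h, C.diag_one]

theorem ρ_dpart (t : W) (i : Fin r) : C.ρ i (C.dpart t) = C.ρ i t := by
  rw [dpart, C.ρ_diag]

theorem prod_pairs (f : Fin r → Fin r → ℝ) :
    ∏ p : {p : Fin r × Fin r // p.1 ≤ p.2}, f p.1.1 p.1.2 =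
      ∏ i, f i i * ∏ j ∈ Finset.Ioi i, f i j := by
  rw [← Finset.prod_subtype (Finset.univ.filter fun p : Fin r × Fin r => p.1 ≤ p.2)
    (by simp) (fun p => f p.1 p.2)]
  rw [Finset.prod_filter, Fintype.prod_prod_type]
  refine Finset.prod_congr rfl fun i _ => ?_
  rw [← Finset.prod_filter]
  have : Finset.univ.filter (fun j => i ≤ j) = insert i (Finset.Ioi i) := by
    ext j; simp [le_iff_eq_or_lt]
  rw [this, Finset.prod_insert (by simp)]

theorem prod_pairs_left (f : Fin r → Fin r → ℝ) :
    ∏ i, ∏ j ∈ Finset.Ioi i, f i j = ∏ j, ∏ i ∈ Finset.Iio j, f i j := by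
  refine Finset.prod_comm' fun i j => ?_
  simp

theorem finrank_N_diag (i : Fin r) : Module.finrank ℝ (C.N i i) = 1 := by
  have hc0 : C.c i ≠ 0 := fun h => by
    have := C.ρ_c i i
    rw [h] at this
    simp at this
  have h : C.N i i = Submodule.span ℝ {C.c i} := by
    apply le_antisymm
    · intro a ha
      rw [C.eq_smul_c ha]
      exact Submodule.smul_mem _ _ (Submodule.mem_span_singleton_self _)
    · rw [Submodule.span_singleton_le_iff_mem]
      exact C.c_mem i
  rw [h, finrank_span_singleton hc0]

theorem det_mulLeft_diag (v : Fin r → ℝ) :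
    LinearMap.det (LinearMap.mulLeft ℝ (C.diag v)) = ∏ i, v i ^ (1 + C.m i) := by
  have := C.finiteDimensional
  rw [det_eq_prod_of_isInternal C.isInternal (s := fun p => v p.1.1)
    (fun p a ha => by rw [LinearMap.mulLeft_apply, C.diag_mul p.2 ha])]
  rw [prod_pairs (fun i j => v i ^ Module.finrank ℝ (C.N i j))]
  refine Finset.prod_congr rfl fun i _ => ?_
  rw [C.finrank_N_diag, Finset.prod_pow_eq_pow_sum, pow_add]
  rfl

theorem det_mulRight_diag (v : Fin r → ℝ) :
    LinearMap.det (LinearMap.mulRight ℝ (C.diag v)) = ∏ i, v i ^ (1 + C.n i) := by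
  have := C.finiteDimensional
  rw [det_eq_prod_of_isInternal C.isInternal (s := fun p => v p.1.2)
    (fun p a ha => by rw [LinearMap.mulRight_apply, C.mul_diag p.2 ha])]
  rw [prod_pairs (fun i j => v j ^ Module.finrank ℝ (C.N i j)), Finset.prod_mul_distrib,
    prod_pairs_left, ← Finset.prod_mul_distrib]
  refine Finset.prod_congr rfl fun i _ => ?_
  rw [C.finrank_N_diag, Finset.prod_pow_eq_pow_sum, pow_add]
  rfl

/-- By invariance under conjugation only the diagonal part of `t` enters the determinant. -/
theorem det_mulLeft (t : W) :
    LinearMap.det (LinearMap.mulLeft ℝ t) = ∏ i, C.ρ i t ^ (1 + C.m i) := by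
  have := C.finiteDimensional
  rw [C.eq_dpart_of_conj_invariant (f := fun t => LinearMap.det (LinearMap.mulLeft ℝ t)) (t := t)]
  · rw [dpart, det_mulLeft_diag]
  · exact (continuous_det_linear
      ((LinearMap.mul ℝ W).comp C.sym.symm.toLinearMap)).continuousAt
  · intro v w _ _ h
    rw [LinearMap.mulLeft_mul, LinearMap.mulLeft_mul, LinearMap.det_comp, LinearMap.det_comp,
      mul_comm, ← mul_assoc, ← LinearMap.det_comp, ← LinearMap.mulLeft_mul,
      C.diag_conj_mul (by rw [mul_comm]; exact h)]
    simp

theorem det_mulRight (t : W) :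
    LinearMap.det (LinearMap.mulRight ℝ t) = ∏ i, C.ρ i t ^ (1 + C.n i) := by
  have := C.finiteDimensional
  rw [C.eq_dpart_of_conj_invariant (f := fun t => LinearMap.det (LinearMap.mulRight ℝ t)) (t := t)]
  · rw [dpart, det_mulRight_diag]
  · exact (continuous_det_linear
      ((LinearMap.mul ℝ W).flip.comp C.sym.symm.toLinearMap)).continuousAt
  · intro v w _ _ h
    rw [LinearMap.mulRight_mul, LinearMap.mulRight_mul, LinearMap.det_comp, LinearMap.det_comp,
      mul_comm, mul_assoc, ← LinearMap.det_comp, ← LinearMap.mulRight_mul,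
      C.diag_conj_mul (by rw [mul_comm]; exact h)]
    simp

/-- The action `π(t)` of a triangular element on the ambient space: `π(t)(s + s⋆) = (ts)t⋆ + t(ts)⋆`. -/
def π (t : W) : (ι → ℝ) →ₗ[ℝ] (ι → ℝ) := (C.B.flip t).comp ((LinearMap.mulLeft ℝ t).comp C.sym.symm.toLinearMap)

theorem π_apply (t : W) (x : ι → ℝ) : C.π t x = C.B (t * C.sym.symm x) t := rfl

theorem π_B {t : W} (ht : t ∈ C.H) (s s' : W) : C.π t (C.B s s') = C.B (t * s) (t * s') := by
  obtain ⟨g, hg⟩ := C.act t ht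
  have h : C.π t = g := by
    ext1 x
    obtain ⟨a, rfl⟩ := C.sym.surjective x
    rw [π_apply, LinearEquiv.symm_apply_apply, ← C.B_one a, ← hg, mul_one]
  rw [h, hg]

theorem π_sym (t s : W) : C.π t (C.sym s) = C.B (t * s) t := by
  rw [π_apply, LinearEquiv.symm_apply_apply]

theorem π_mul {s t : W} (hs : s ∈ C.H) : C.π (s * t) = (C.π s).comp (C.π t) := by
  ext1 x
  rw [LinearMap.comp_apply, C.π_apply t, C.π_B hs, π_apply, mul_assoc]

theorem π_one : C.π 1 = LinearMap.id := by
  ext1 x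
  rw [π_apply, one_mul, C.B_one]
  simp

theorem isUnit_of_mem_H {t : W} (ht : t ∈ C.H) : ∃ s ∈ C.H, t * s = 1 ∧ s * t = 1 := by
  have := C.finiteDimensional
  have hdet : LinearMap.det (LinearMap.mulLeft ℝ t) ≠ 0 := by
    rw [C.det_mulLeft]
    exact Finset.prod_ne_zero_iff.2 fun i _ => pow_ne_zero _ (ht i).ne'
  set L := LinearMap.equivOfDetNeZero _ hdet with hL
  have hLt : ∀ x, L x = t * x := fun x => rfl
  obtain ⟨s, hs⟩ := L.surjective 1
  rw [hLt] at hs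
  refine ⟨s, fun i => ?_, hs, ?_⟩
  · have h1 := congrArg (C.ρ i) hs
    rw [map_mul, map_one] at h1
    have h2 := ht i
    by_contra h3
    nlinarith
  · apply L.injective
    rw [hLt, hLt, ← mul_assoc, hs, one_mul, mul_one]

theorem det_π_diag (v : Fin r → ℝ) :
    LinearMap.det (C.π (C.diag v)) = ∏ i, v i ^ (2 + C.m i + C.n i) := by
  have := C.finiteDimensional
  have h1 : C.π (C.diag v) = (C.sym.toLinearMap.comp
      ((LinearMap.mulRight ℝ (C.diag v)).comp (LinearMap.mulLeft ℝ (C.diag v)))).comp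
      C.sym.symm.toLinearMap := by
    ext1 x
    rw [π_apply, C.B_diag]
    rfl
  rw [h1, LinearMap.comp_assoc]
  have h2 := LinearMap.det_conj (((LinearMap.mulRight ℝ (C.diag v)).comp
    (LinearMap.mulLeft ℝ (C.diag v)))) C.sym
  rw [h2, LinearMap.det_comp, det_mulLeft_diag, det_mulRight_diag, ← Finset.prod_mul_distrib]
  refine Finset.prod_congr rfl fun i _ => ?_
  rw [← pow_add]
  congr 1
  ring

/-- As a function of `t` the determinant is a character of `H`, so that only the diagonal part of
`t` matters. -/
theorem det_π {t : W} (ht : t ∈ C.H) :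
    LinearMap.det (C.π t) = ∏ i, C.ρ i t ^ (2 + C.m i + C.n i) := by
  have := C.finiteDimensional
  rw [C.eq_dpart_of_conj_invariant (f := fun t => LinearMap.det (C.π t)) (t := t)]
  · rw [dpart, det_π_diag]
  · have h := continuous_det_comp (W := ι → ℝ) (ι := ι) (LinearMap.mk₂ ℝ
      (fun y y' : ι → ℝ => (C.B.flip (C.sym.symm y')).comp
        ((LinearMap.mulLeft ℝ (C.sym.symm y)).comp C.sym.symm.toLinearMap))
      (fun a b c => by ext1 x; simp [add_mul]) (fun a b c => by ext1 x; simp)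
      (fun a b c => by ext1 x; simp) (fun a b c => by ext1 x; simp))
    exact h.continuousAt
  · intro v w hv hw h
    have hvH := C.diag_mem_H hv
    rw [C.π_mul (C.mul_mem_H hvH ht), C.π_mul hvH, LinearMap.det_comp, LinearMap.det_comp,
      mul_comm, ← mul_assoc, ← LinearMap.det_comp, ← C.π_mul (C.diag_mem_H hw),
      C.diag_conj_mul (by rw [mul_comm]; exact h), π_one]
    simp

end ConeData

/-! ### The cone and its dual as orbits -/

section Dvec

variable {ι : Type*} [Fintype ι]

open Classical in
/-- The vector representing a linear functional on `ℝ^ι`. -/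
def dualVec (f : (ι → ℝ) →ₗ[ℝ] ℝ) : ι → ℝ := fun i => f (Pi.single i 1)

theorem dotProduct_dualVec (f : (ι → ℝ) →ₗ[ℝ] ℝ) (y : ι → ℝ) : y ⬝ᵥ dualVec f = f y := by
  classical
  have h : ∀ i, (Pi.single i (y i) : ι → ℝ) = y i • Pi.single i 1 := fun i => by
    rw [← Pi.single_smul, smul_eq_mul, mul_one]
  conv_rhs => rw [← Finset.univ_sum_single y, map_sum]
  simp_rw [h, map_smul]
  simp only [dotProduct, dualVec, smul_eq_mul]

theorem eq_dualVec_iff {f : (ι → ℝ) →ₗ[ℝ] ℝ} {ξ : ι → ℝ} :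
    ξ = dualVec f ↔ ∀ y, y ⬝ᵥ ξ = f y := by
  constructor
  · rintro rfl y
    exact dotProduct_dualVec f y
  · intro h
    classical
    ext i
    rw [dualVec, ← h]
    simp [dotProduct, Pi.single_apply]

theorem exists_bound_bilin {F : Type*} [NormedAddCommGroup F] [NormedSpace ℝ F]
    (b : (ι → ℝ) →ₗ[ℝ] (ι → ℝ) →ₗ[ℝ] F) : ∃ K > 0, ∀ x y, ‖b x y‖ ≤ K * ‖x‖ * ‖y‖ := by
  obtain ⟨M, hM⟩ := (isCompact_closedBall (0 : (ι → ℝ) × (ι → ℝ)) 1).exists_bound_of_continuousOn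
    (continuous_bilin_pi b).continuousOn
  refine ⟨|M| + 1, by positivity, fun x y => ?_⟩
  have hM1 : ∀ p ∈ Metric.closedBall (0 : (ι → ℝ) × (ι → ℝ)) 1, ‖b p.1 p.2‖ ≤ |M| + 1 := fun p hp =>
    (hM p hp).trans ((le_abs_self M).trans (by linarith))
  rcases eq_or_ne x 0 with rfl | hx
  · simp
  rcases eq_or_ne y 0 with rfl | hy
  · simp
  have hx' : 0 < ‖x‖ := norm_pos_iff.2 hx
  have hy' : 0 < ‖y‖ := norm_pos_iff.2 hy
  have h := hM1 (‖x‖⁻¹ • x, ‖y‖⁻¹ • y) (by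
    rw [mem_closedBall_zero_iff, Prod.norm_def, norm_smul, norm_smul, norm_inv, norm_inv,
      norm_norm, norm_norm, inv_mul_cancel₀ hx'.ne', inv_mul_cancel₀ hy'.ne', max_self])
  simp only [map_smul, LinearMap.smul_apply, norm_smul, norm_inv, norm_norm] at h
  calc ‖b x y‖ = (‖y‖⁻¹ * (‖x‖⁻¹ * ‖b x y‖)) * ‖x‖ * ‖y‖ := by field_simp
    _ ≤ _ := by gcongr

end Dvec

/-- First-order condition at a maximum of `∏ (1 + ε a_i)² e^{-(bε + dε²)}`. -/
theorem eq_two_mul_sum_of_isMax {κ : Type*} [Fintype κ] {a : κ → ℝ} {b d : ℝ}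
    (h : ∀ᶠ ε in nhds (0 : ℝ), (∏ i, (1 + ε * a i) ^ 2) * Real.exp (-(b * ε + d * ε ^ 2)) ≤ 1) :
    b = 2 * ∑ i, a i := by
  have hd : HasDerivAt (fun ε : ℝ => (∑ i, 2 * Real.log (1 + ε * a i)) - (b * ε + d * ε ^ 2))
      ((∑ i, 2 * a i) - (b * 1 + d * (2 * 0))) 0 := by
    refine HasDerivAt.sub (HasDerivAt.fun_sum fun i _ => HasDerivAt.const_mul 2 ?_) ?_
    · have h1 : HasDerivAt (fun ε : ℝ => 1 + ε * a i) (a i) 0 := by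
        simpa using ((hasDerivAt_id (0 : ℝ)).mul_const (a i)).const_add 1
      simpa using h1.log (by simp)
    · refine HasDerivAt.add ((hasDerivAt_id 0).const_mul b) (HasDerivAt.const_mul d ?_)
      simpa using hasDerivAt_pow 2 (0 : ℝ)
  have hmax : IsLocalMax
      (fun ε : ℝ => (∑ i, 2 * Real.log (1 + ε * a i)) - (b * ε + d * ε ^ 2)) 0 := by
    have hpos : ∀ᶠ ε in nhds (0 : ℝ), ∀ i, 0 < 1 + ε * a i := by
      rw [Filter.eventually_all]
      intro i
      have hc : Continuous fun ε : ℝ => 1 + ε * a i := by fun_prop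
      exact hc.continuousAt.eventually (lt_mem_nhds (by simp))
    filter_upwards [h, hpos] with ε hε hp
    have hprod : 0 < ∏ i, (1 + ε * a i) ^ 2 := Finset.prod_pos fun i _ => pow_pos (hp i) 2
    have h2 := Real.log_nonpos (by positivity) hε
    rw [Real.log_mul hprod.ne' (Real.exp_ne_zero _), Real.log_exp,
      Real.log_prod (fun i _ => (pow_pos (hp i) 2).ne')] at h2
    simp only [Real.log_pow] at h2
    push_cast at h2
    simp
    linarith
  have := hmax.hasDerivAt_eq_zero hd
  rw [← Finset.mul_sum] at this
  linarith

namespace ConeData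

variable {r : ℕ} {ι W : Type*} [Fintype ι] [Ring W] [Algebra ℝ W] (C : ConeData r ι W)

/-- The square `t t⋆`. -/
def sq (t : W) : ι → ℝ := (2⁻¹ : ℝ) • C.B t t

/-- The functional `y ↦ tr (π(t) y)`, as a vector. -/
def dsq (t : W) : ι → ℝ := dualVec (C.tr.comp (C.π t))

/-- The cone `{t t⋆ : t ∈ H}`. -/
def Ω : Set (ι → ℝ) := C.sq '' C.H

/-- The dual cone, as the orbit of the trace under the contragredient action. -/
def Ωd : Set (ι → ℝ) := C.dsq '' C.H

theorem π_sq {t : W} (ht : t ∈ C.H) (s : W) : C.π t (C.sq s) = C.sq (t * s) := by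
  rw [sq, map_smul, C.π_B ht, sq]

theorem π_sq_one (t : W) : C.π t (C.sq 1) = C.sq t := by
  rw [sq, C.B_one, map_smul, π_sym, mul_one, sq]

theorem sq_one : C.sq 1 = C.sym ((2⁻¹ : ℝ) • 1) := by rw [sq, C.B_one, map_smul]

theorem dotProduct_dsq (y : ι → ℝ) (t : W) : y ⬝ᵥ C.dsq t = C.tr (C.π t y) :=
  dotProduct_dualVec _ y

theorem tr_sq_pos {t : W} (ht : t ≠ 0) : 0 < C.tr (C.sq t) := by
  rw [sq, map_smul, smul_eq_mul]
  have := C.tr_pos t ht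
  positivity

theorem tr_sq_nonneg (t : W) : 0 ≤ C.tr (C.sq t) := by
  rcases eq_or_ne t 0 with rfl | h
  · simp [sq]
  · exact (C.tr_sq_pos h).le

theorem tr_B_of_dpart (t : W) :
    C.tr (C.B t t) = 2 * ∑ i, C.ρ i t ^ 2 + C.tr (C.B (t - C.dpart t) (t - C.dpart t)) := by
  set d := C.dpart t with hd
  set w := t - d with hw
  have h1 : t = d + w := by rw [hw]; abel
  have h2 : ∀ a, C.tr (C.B a d) = 2 * ∑ i, C.ρ i a * C.ρ i t := fun a => by
    rw [hd, dpart, C.B_diag, C.tr_sym]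
    simp [C.ρ_diag]
  have h3 : ∀ i, C.ρ i w = 0 := fun i => by rw [hw, map_sub, hd, C.ρ_dpart, sub_self]
  have h4 : ∀ i, C.ρ i d = C.ρ i t := fun i => by rw [hd, C.ρ_dpart]
  conv_lhs => rw [h1]
  simp only [map_add, LinearMap.add_apply]
  rw [C.B_symm d w, h2, h2]
  simp [h3, h4, pow_two]

theorem sum_sq_le_tr (t : W) : ∑ i, C.ρ i t ^ 2 ≤ C.tr (C.sq t) := by
  have h := C.tr_B_of_dpart t
  have h2 : 0 ≤ C.tr (C.B (t - C.dpart t) (t - C.dpart t)) := by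
    rcases eq_or_ne (t - C.dpart t) 0 with h | h
    · simp [h]
    · exact (C.tr_pos _ h).le
  rw [sq, map_smul, smul_eq_mul, h]
  linarith

/-- An element of `H` is the identity as soon as it and its inverse have the norm of the
identity: by `x + x⁻¹ ≥ 2` the diagonal is trivial, which leaves no room for the rest. -/
theorem eq_one_of_tr {u u' : W} (hu : u ∈ C.H) (h1 : u * u' = 1)
    (h2 : C.tr (C.sq u) = C.tr (C.sq 1)) (h3 : C.tr (C.sq u') = C.tr (C.sq 1)) : u = 1 := by
  have e1 : C.tr (C.sq 1) = r := by
    rw [sq_one, C.tr_sym]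
    simp
    ring
  have hsu := C.sum_sq_le_tr u
  have hsu' := C.sum_sq_le_tr u'
  rw [h2, e1] at hsu
  rw [h3, e1] at hsu'
  have hinv : ∀ i, C.ρ i u * C.ρ i u' = 1 := fun i => by rw [← map_mul, h1, map_one]
  have hterm : ∀ i, 0 ≤ C.ρ i u ^ 2 + C.ρ i u' ^ 2 - 2 := fun i => by
    nlinarith [sq_nonneg (C.ρ i u - C.ρ i u'), hinv i]
  have hsum : ∑ i, (C.ρ i u ^ 2 + C.ρ i u' ^ 2 - 2) ≤ 0 := by
    rw [Finset.sum_sub_distrib, Finset.sum_add_distrib]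
    simp only [Finset.sum_const, Finset.card_univ, Fintype.card_fin, nsmul_eq_mul]
    linarith
  have hz : ∀ i, C.ρ i u = 1 := by
    have h0 := (Finset.sum_eq_zero_iff_of_nonneg (fun i _ => hterm i)).1
      (le_antisymm hsum (Finset.sum_nonneg fun i _ => hterm i))
    intro i
    have h4 := h0 i (Finset.mem_univ i)
    have h5 := hinv i
    have h6 := hu i
    have h7 : C.ρ i u = C.ρ i u' := by nlinarith [sq_nonneg (C.ρ i u - C.ρ i u')]
    rw [← h7] at h5
    nlinarith
  have h8 := C.tr_B_of_dpart u
  have h9 : C.tr (C.B u u) = 2 * r := by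
    rw [← e1, ← h2, sq, map_smul, smul_eq_mul]
    ring
  have h10 : C.tr (C.B (u - C.dpart u) (u - C.dpart u)) = 0 := by
    rw [h9] at h8
    simp only [hz, one_pow, Finset.sum_const, Finset.card_univ, Fintype.card_fin, nsmul_eq_mul,
      mul_one] at h8
    linarith
  have h11 : u - C.dpart u = 0 := by
    by_contra h
    exact absurd h10 (C.tr_pos _ h).ne'
  rw [sub_eq_zero] at h11
  rw [h11, dpart]
  simp only [hz]
  exact C.diag_one

/-- Triviality of the stabilizers: if `t t⋆ = s s⋆`, then `s⁻¹ t` and its inverse both have the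
norm of the identity. -/
theorem sq_injOn : Set.InjOn C.sq C.H := by
  intro t ht s hs h
  obtain ⟨t', ht', htt, htt'⟩ := C.isUnit_of_mem_H ht
  obtain ⟨s', hs', hss, hss'⟩ := C.isUnit_of_mem_H hs
  have h1 : s' * t = 1 := by
    refine C.eq_one_of_tr (u' := t' * s) (C.mul_mem_H hs' ht) ?_ ?_ ?_
    · rw [mul_assoc, ← mul_assoc t, htt, one_mul, hss']
    · rw [← C.π_sq hs', h, C.π_sq hs', hss']
    · rw [← C.π_sq ht', ← h, C.π_sq ht', htt']
  calc t = s * s' * t := by rw [hss, one_mul]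
    _ = s := by rw [mul_assoc, h1, mul_one]

theorem dsq_injOn : Set.InjOn C.dsq C.H := by
  intro t ht s hs h
  obtain ⟨t', ht', htt, htt'⟩ := C.isUnit_of_mem_H ht
  obtain ⟨s', hs', hss, hss'⟩ := C.isUnit_of_mem_H hs
  have hy : ∀ y, C.tr (C.π t y) = C.tr (C.π s y) := fun y => by
    rw [← C.dotProduct_dsq, ← C.dotProduct_dsq, h]
  have h1 : t * s' = 1 := by
    refine C.eq_one_of_tr (u' := s * t') (C.mul_mem_H ht hs') ?_ ?_ ?_
    · rw [mul_assoc, ← mul_assoc s', hss', one_mul, htt]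
    · rw [← C.π_sq ht, hy, C.π_sq hs, hss]
    · rw [← C.π_sq hs, ← hy, C.π_sq ht, htt]
  calc t = t * (s' * s) := by rw [hss', mul_one]
    _ = s := by rw [← mul_assoc, h1, one_mul]

theorem continuous_ρ (i : Fin r) : Continuous fun x => C.ρ i (C.sym.symm x) :=
  LinearMap.continuous_on_pi ((C.ρ i).toLinearMap.comp C.sym.symm.toLinearMap)

theorem isOpen_H : IsOpen {x | C.sym.symm x ∈ C.H} := by
  have : {x | C.sym.symm x ∈ C.H} = ⋂ i, {x | 0 < C.ρ i (C.sym.symm x)} := by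
    ext x; simp [H]
  rw [this]
  exact isOpen_iInter_of_finite fun i => isOpen_lt continuous_const (C.continuous_ρ i)

/-- The bilinear map `B` in coordinates. -/
def Bcoord : (ι → ℝ) →ₗ[ℝ] (ι → ℝ) →ₗ[ℝ] (ι → ℝ) :=
  C.B.compl₁₂ C.sym.symm.toLinearMap C.sym.symm.toLinearMap

theorem continuous_sq : Continuous fun x => C.sq (C.sym.symm x) := by
  have h := (continuous_bilin_pi C.Bcoord).comp (continuous_id.prodMk continuous_id)
  exact h.const_smul (2⁻¹ : ℝ)

theorem exists_lower_bound : ∃ c > 0, ∀ t, c * ‖C.sym t‖ ^ 2 ≤ C.tr (C.sq t) := by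
  have hc : Continuous fun x => C.tr (C.sq (C.sym.symm x)) :=
    (LinearMap.continuous_on_pi C.tr).comp C.continuous_sq
  rcases subsingleton_or_nontrivial (ι → ℝ) with hs | hn
  · refine ⟨1, one_pos, fun t => ?_⟩
    have : C.sym t = 0 := Subsingleton.elim _ _
    rw [this]
    simpa using C.tr_sq_nonneg t
  obtain ⟨x₀, hx₀, hmin⟩ := (isCompact_sphere (0 : ι → ℝ) 1).exists_isMinOn
    (NormedSpace.sphere_nonempty.2 zero_le_one) hc.continuousOn
  have hx0 : C.sym.symm x₀ ≠ 0 := by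
    intro h
    rw [LinearEquiv.map_eq_zero_iff] at h
    rw [h] at hx₀
    simp at hx₀
  refine ⟨C.tr (C.sq (C.sym.symm x₀)), C.tr_sq_pos hx0, fun t => ?_⟩
  rcases eq_or_ne (C.sym t) 0 with h | h
  · rw [h]
    simpa using C.tr_sq_nonneg t
  have hn : 0 < ‖C.sym t‖ := norm_pos_iff.2 h
  have h1 := hmin (show ‖C.sym t‖⁻¹ • C.sym t ∈ Metric.sphere (0 : ι → ℝ) 1 by
    rw [mem_sphere_zero_iff_norm, norm_smul, norm_inv, norm_norm, inv_mul_cancel₀ hn.ne'])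
  simp only [map_smul, LinearEquiv.symm_apply_apply, Set.mem_ofPred_eq] at h1
  have h2 : C.tr (C.sq (‖C.sym t‖⁻¹ • t)) = (‖C.sym t‖ ^ 2)⁻¹ * C.tr (C.sq t) := by
    simp only [sq, map_smul, LinearMap.smul_apply, smul_eq_mul]
    field_simp
  rw [h2] at h1
  calc _ ≤ ((‖C.sym t‖ ^ 2)⁻¹ * C.tr (C.sq t)) * ‖C.sym t‖ ^ 2 := by gcongr
    _ = _ := by field_simp

theorem exists_upper_bound_ρ : ∃ M > 0, ∀ i t, |C.ρ i t| ≤ M * ‖C.sym t‖ := by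
  have h : ∀ i, ∃ M > 0, ∀ t, |C.ρ i t| ≤ M * ‖C.sym t‖ := fun i => by
    set L := LinearMap.toContinuousLinearMap ((C.ρ i).toLinearMap.comp C.sym.symm.toLinearMap)
    refine ⟨‖L‖ + 1, by positivity, fun t => ?_⟩
    have := L.le_opNorm (C.sym t)
    have h2 : L (C.sym t) = C.ρ i t := by simp [L]
    rw [h2, Real.norm_eq_abs] at this
    nlinarith [norm_nonneg (C.sym t)]
  choose M hM hb using h
  refine ⟨1 + ∑ i, M i, by have := Finset.sum_nonneg (fun i (_ : i ∈ Finset.univ) => (hM i).le)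
                           linarith, fun i t => (hb i t).trans ?_⟩
  gcongr
  have := Finset.single_le_sum (fun i _ => (hM i).le) (Finset.mem_univ i)
  linarith

/-- Existence of a maximum of `∏ ρ_i(t)² e^{-Θ(t)}` over `H`, for `Θ` of quadratic growth. -/
theorem exists_max {Θ : W → ℝ} (hΘ : Continuous fun x => Θ (C.sym.symm x)) {c : ℝ} (hc : 0 < c)
    (hb : ∀ t ∈ C.H, c * ‖C.sym t‖ ^ 2 ≤ Θ t) :
    ∃ t₀ ∈ C.H, ∀ t ∈ C.H, (∏ i, C.ρ i t ^ 2) * Real.exp (-Θ t) ≤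
      (∏ i, C.ρ i t₀ ^ 2) * Real.exp (-Θ t₀) := by
  -- Maximize over the closed set `K` of elements with nonnegative diagonal: the function tends to
  -- `0` at infinity and vanishes where a diagonal entry does, hence the maximum lies in `H`.
  set f : (ι → ℝ) → ℝ := fun x =>
    (∏ i, C.ρ i (C.sym.symm x) ^ 2) * Real.exp (-Θ (C.sym.symm x)) with hf
  set K : Set (ι → ℝ) := {x | ∀ i, 0 ≤ C.ρ i (C.sym.symm x)} with hK
  have hfc : Continuous f := by
    refine Continuous.mul (continuous_finsetProd _ fun i _ => (C.continuous_ρ i).pow 2) ?_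
    exact Real.continuous_exp.comp hΘ.neg
  have hKc : IsClosed K := by
    have : K = ⋂ i, {x | 0 ≤ C.ρ i (C.sym.symm x)} := by ext x; simp [hK]
    rw [this]
    exact isClosed_iInter fun i => isClosed_le continuous_const (C.continuous_ρ i)
  have hbK : ∀ x ∈ K, c * ‖x‖ ^ 2 ≤ Θ (C.sym.symm x) := by
    intro x hx
    have ht : Filter.Tendsto (fun ε : ℝ => x + ε • C.sym 1) (nhdsWithin 0 (Set.Ioi 0)) (nhds x) := by
      have : Continuous fun ε : ℝ => x + ε • C.sym 1 := by fun_prop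
      have h := this.tendsto 0
      simp only [zero_smul, add_zero] at h
      exact h.mono_left nhdsWithin_le_nhds
    have h1 : Filter.Tendsto (fun ε : ℝ => c * ‖x + ε • C.sym 1‖ ^ 2) (nhdsWithin 0 (Set.Ioi 0))
        (nhds (c * ‖x‖ ^ 2)) := (ht.norm.pow 2).const_mul c
    have h2 := (hΘ.tendsto x).comp ht
    refine le_of_tendsto_of_tendsto h1 h2 ?_
    refine Filter.eventually_of_mem self_mem_nhdsWithin fun ε hε => ?_
    have h3 := hb (C.sym.symm (x + ε • C.sym 1)) (fun i => by
      simp only [map_add, map_smul, LinearEquiv.symm_apply_apply, map_one, smul_eq_mul, mul_one]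
      have := hx i
      have hε' : 0 < ε := hε
      linarith)
    simpa using h3
  obtain ⟨M, hM, hMb⟩ := C.exists_upper_bound_ρ
  have hle : ∀ x ∈ K, f x ≤ (M ^ 2 / c) ^ r * ((c * ‖x‖ ^ 2) ^ r * Real.exp (-(c * ‖x‖ ^ 2))) := by
    intro x hx
    have h1 : ∏ i, C.ρ i (C.sym.symm x) ^ 2 ≤ ∏ _i : Fin r, (M ^ 2 * ‖x‖ ^ 2) := by
      refine Finset.prod_le_prod (fun i _ => sq_nonneg _) fun i _ => ?_
      have := hMb i (C.sym.symm x)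
      rw [LinearEquiv.apply_symm_apply] at this
      rw [← mul_pow, ← sq_abs]
      exact pow_le_pow_left₀ (abs_nonneg _) this 2
    have h2 : Real.exp (-Θ (C.sym.symm x)) ≤ Real.exp (-(c * ‖x‖ ^ 2)) :=
      Real.exp_le_exp.2 (neg_le_neg (hbK x hx))
    calc f x ≤ (∏ _i : Fin r, (M ^ 2 * ‖x‖ ^ 2)) * Real.exp (-(c * ‖x‖ ^ 2)) := by
          refine mul_le_mul h1 h2 (Real.exp_pos _).le (Finset.prod_nonneg fun i _ => by positivity)
      _ = _ := by
          have h3 : M ^ 2 * ‖x‖ ^ 2 = M ^ 2 / c * (c * ‖x‖ ^ 2) := by field_simp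
          rw [Finset.prod_const, Finset.card_univ, Fintype.card_fin, h3, mul_pow, mul_assoc]
  have h1K : C.sym 1 ∈ K := fun i => by simp
  have hf1 : 0 < f (C.sym 1) := by
    simp only [hf, LinearEquiv.symm_apply_apply, map_one]
    positivity
  have htend : Filter.Tendsto (fun x : ι → ℝ =>
      (M ^ 2 / c) ^ r * ((c * ‖x‖ ^ 2) ^ r * Real.exp (-(c * ‖x‖ ^ 2))))
      (Filter.cocompact _) (nhds 0) := by
    have h1 : Filter.Tendsto (fun x : ι → ℝ => c * ‖x‖ ^ 2) (Filter.cocompact _) Filter.atTop :=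
      ((Filter.tendsto_pow_atTop two_ne_zero).comp tendsto_norm_cocompact_atTop).const_mul_atTop hc
    have h2 := ((Real.tendsto_pow_mul_exp_neg_atTop_nhds_zero r).comp h1).const_mul ((M ^ 2 / c) ^ r)
    rw [mul_zero] at h2
    exact h2
  obtain ⟨x₀, hx₀, hmax⟩ := hfc.continuousOn.exists_isMaxOn' (s := K) hKc h1K (by
    have h3 := htend.eventually (gt_mem_nhds hf1)
    rw [Filter.eventually_inf_principal]
    filter_upwards [h3] with x hx hxK
    exact (hle x hxK).trans hx.le)
  refine ⟨C.sym.symm x₀, fun i => ?_, fun t ht => ?_⟩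
  · have h4 : f (C.sym 1) ≤ f x₀ := hmax h1K
    refine lt_of_le_of_ne (hx₀ i) fun h0 => ?_
    have h5 : f x₀ = 0 := by
      simp only [hf]
      rw [Finset.prod_eq_zero (Finset.mem_univ i) (by rw [← h0]; simp), zero_mul]
    linarith
  · have h6 : f (C.sym t) ≤ f x₀ := hmax (show C.sym t ∈ K from fun i => by
      simpa using (ht i).le)
    simpa [hf] using h6

end ConeData

/-! ### Convexity and openness of the cones -/

namespace ConeData

variable {r : ℕ} {ι W : Type*} [Fintype ι] [Ring W] [Algebra ℝ W] (C : ConeData r ι W)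

theorem continuous_π (y : ι → ℝ) : Continuous fun x => C.π (C.sym.symm x) y := by
  have h := (continuous_bilin_pi (C.Bcoord.compl₁₂ (C.sym.toLinearMap.comp
    ((LinearMap.mulRight ℝ (C.sym.symm y)).comp C.sym.symm.toLinearMap)) LinearMap.id)).comp
    (continuous_id.prodMk continuous_id)
  refine h.congr fun x => ?_
  simp [Bcoord, π_apply]

theorem exists_bound_tr_π : ∃ K > 0, ∀ t y, |C.tr (C.π t y)| ≤ K * ‖y‖ * ‖C.sym t‖ ^ 2 := by
  have : FiniteDimensional ℝ W := C.finiteDimensional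
  obtain ⟨K₁, hK₁, h₁⟩ := exists_bound_bilin
    (((LinearMap.mul ℝ W).compl₁₂ C.sym.symm.toLinearMap C.sym.symm.toLinearMap).compr₂
      C.sym.toLinearMap)
  obtain ⟨K₂, hK₂, h₂⟩ := exists_bound_bilin (C.Bcoord.compr₂ C.tr)
  refine ⟨K₂ * K₁, by positivity, fun t y => ?_⟩
  have e1 := h₁ (C.sym t) y
  have e2 := h₂ (C.sym (t * C.sym.symm y)) (C.sym t)
  simp only [LinearMap.compr₂_apply, LinearMap.compl₁₂_apply, LinearEquiv.coe_coe,
    LinearEquiv.symm_apply_apply, LinearMap.mul_apply', Bcoord] at e1 e2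
  rw [π_apply, ← Real.norm_eq_abs]
  calc _ ≤ K₂ * ‖C.sym (t * C.sym.symm y)‖ * ‖C.sym t‖ := e2
    _ ≤ K₂ * (K₁ * ‖C.sym t‖ * ‖y‖) * ‖C.sym t‖ := by gcongr
    _ = _ := by ring

theorem exists_bound_sq : ∃ K > 0, ∀ t, ‖C.sq t‖ ≤ K * ‖C.sym t‖ ^ 2 := by
  obtain ⟨K, hK, h⟩ := exists_bound_bilin C.Bcoord
  refine ⟨K, hK, fun t => ?_⟩
  have e := h (C.sym t) (C.sym t)
  simp only [Bcoord, LinearMap.compl₁₂_apply, LinearEquiv.coe_coe,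
    LinearEquiv.symm_apply_apply] at e
  rw [sq, norm_smul]
  norm_num
  nlinarith [norm_nonneg (C.B t t)]

theorem exists_bound_mul (s : W) :
    ∃ K > 0, ∀ t, ‖C.sym (t * s)‖ ≤ K * ‖C.sym t‖ ∧ ‖C.sym (s * t)‖ ≤ K * ‖C.sym t‖ := by
  set L := LinearMap.toContinuousLinearMap (C.sym.toLinearMap.comp
    ((LinearMap.mulRight ℝ s).comp C.sym.symm.toLinearMap)) with hL
  set L' := LinearMap.toContinuousLinearMap (C.sym.toLinearMap.comp
    ((LinearMap.mulLeft ℝ s).comp C.sym.symm.toLinearMap)) with hL'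
  refine ⟨‖L‖ + ‖L'‖ + 1, by positivity, fun t => ?_⟩
  have h1 := L.le_opNorm (C.sym t)
  have h2 := L'.le_opNorm (C.sym t)
  have e1 : L (C.sym t) = C.sym (t * s) := by simp [hL]
  have e2 : L' (C.sym t) = C.sym (s * t) := by simp [hL']
  rw [e1] at h1
  rw [e2] at h2
  constructor <;> nlinarith [norm_nonneg (C.sym t), norm_nonneg L, norm_nonneg L']

theorem eventually_one_add_mem_H (x : W) : ∀ᶠ ε in nhds (0 : ℝ), 1 + ε • x ∈ C.H := by
  simp only [H, Set.mem_ofPred_eq]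
  rw [Filter.eventually_all]
  intro i
  have hc : Continuous fun ε : ℝ => C.ρ i (1 + ε • x) := by
    simp only [map_add, map_one, map_smul, smul_eq_mul]
    fun_prop
  exact hc.continuousAt.eventually (lt_mem_nhds (by simp))

/-- Characterization of the cone by the quadratic forms `t ↦ tr (π(t) y)`; the maximum of
`∏ ρ_i(t)² e^{-tr (π(t) y)}` provides the `t` that moves `y` to the base point. -/
theorem mem_Ω_iff {y : ι → ℝ} :
    y ∈ C.Ω ↔ ∃ c > 0, ∀ t ∈ C.H, c * ‖C.sym t‖ ^ 2 ≤ C.tr (C.π t y) := by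
  constructor
  · rintro ⟨s, hs, rfl⟩
    obtain ⟨s', hs', hss, hss'⟩ := C.isUnit_of_mem_H hs
    obtain ⟨c, hc, hcb⟩ := C.exists_lower_bound
    obtain ⟨K, hK, hKb⟩ := C.exists_bound_mul s'
    refine ⟨c / K ^ 2, by positivity, fun t ht => ?_⟩
    rw [C.π_sq ht]
    refine le_trans ?_ (hcb _)
    have h1 := (hKb (t * s)).1
    rw [mul_assoc, hss, mul_one] at h1
    calc c / K ^ 2 * ‖C.sym t‖ ^ 2 ≤ c / K ^ 2 * (K * ‖C.sym (t * s)‖) ^ 2 := by gcongr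
      _ = _ := by field_simp
  · rintro ⟨c, hc, hcb⟩
    obtain ⟨t₀, ht₀, hmax⟩ := C.exists_max (Θ := fun t => C.tr (C.π t y))
      ((LinearMap.continuous_on_pi C.tr).comp (C.continuous_π y)) hc hcb
    obtain ⟨s₀, hs₀, hts, hst⟩ := C.isUnit_of_mem_H ht₀
    set a : W := C.sym.symm (C.π t₀ y) with ha
    have hya : C.π t₀ y = C.sym a := by rw [ha]; simp
    -- first-order condition at the maximum `t₀` in the direction `x t₀`
    have key : ∀ x : W, C.tr (C.B a x) + 2 * ∑ i, C.ρ i x * C.ρ i a = 2 * ∑ i, C.ρ i x := by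
      intro x
      refine eq_two_mul_sum_of_isMax (d := C.tr (C.B (x * a) x)) ?_
      filter_upwards [C.eventually_one_add_mem_H x] with ε hε
      have h1 := hmax _ (C.mul_mem_H hε ht₀)
      have h2 : C.tr (C.π ((1 + ε • x) * t₀) y) = C.tr (C.π t₀ y) +
          ((C.tr (C.B a x) + 2 * ∑ i, C.ρ i x * C.ρ i a) * ε + C.tr (C.B (x * a) x) * ε ^ 2) := by
        have h3 : C.tr (C.B (x * a) 1) = 2 * ∑ i, C.ρ i x * C.ρ i a := by
          rw [C.B_one, C.tr_sym]; simp
        rw [C.π_mul hε, LinearMap.comp_apply, hya, C.π_sym]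
        simp only [add_mul, one_mul, map_add, LinearMap.add_apply, smul_mul_assoc, map_smul,
          LinearMap.smul_apply, smul_eq_mul, C.B_one a, h3]
        ring
      simp only [h2] at h1
      have hP : 0 < ∏ i, C.ρ i t₀ ^ 2 := Finset.prod_pos fun i _ => pow_pos (ht₀ i) 2
      have h4 : ∀ i, C.ρ i ((1 + ε • x) * t₀) ^ 2 = (1 + ε * C.ρ i x) ^ 2 * C.ρ i t₀ ^ 2 := fun i => by
        simp [mul_pow]
      simp_rw [h4] at h1
      rw [Finset.prod_mul_distrib, neg_add, Real.exp_add] at h1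
      have hE := Real.exp_pos (-C.tr (C.π t₀ y))
      have hPE : 0 < (∏ i, C.ρ i t₀ ^ 2) * Real.exp (-C.tr (C.π t₀ y)) := by positivity
      by_contra hcon
      push Not at hcon
      have := mul_lt_mul_of_pos_left hcon hPE
      linarith
    -- The condition in the direction `x = w = a - 1/2` reads `tr (w w⋆ + w w⋆) + 2 ∑ ρ_i(w)² =
    -- 0`.
    have ha' : a - (2⁻¹ : ℝ) • 1 = 0 := by
      set w := a - (2⁻¹ : ℝ) • (1 : W) with hw
      by_contra h0
      have h1 := key w
      have h2 := C.tr_pos w h0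
      have h3 : a = w + (2⁻¹ : ℝ) • 1 := by rw [hw]; abel
      rw [h3] at h1
      simp only [map_add, LinearMap.add_apply, map_smul, LinearMap.smul_apply, map_one,
        smul_eq_mul, mul_one] at h1
      rw [C.B_symm 1 w, C.B_one, C.tr_sym] at h1
      simp only [mul_add, Finset.sum_add_distrib] at h1
      rw [← Finset.sum_mul] at h1
      have h4 : 0 ≤ ∑ i, C.ρ i w * C.ρ i w := Finset.sum_nonneg fun i _ => mul_self_nonneg _
      linarith
    rw [sub_eq_zero] at ha'
    refine ⟨s₀, hs₀, ?_⟩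
    rw [← C.π_sq_one, C.sq_one, ← ha', ← hya, ← LinearMap.comp_apply, ← C.π_mul hs₀, hst, π_one]
    rfl

/-- Characterization of the dual orbit by the values of `ξ` on the squares, by the same maximum
principle. -/
theorem mem_Ωd_iff {ξ : ι → ℝ} :
    ξ ∈ C.Ωd ↔ ∃ c > 0, ∀ t ∈ C.H, c * ‖C.sym t‖ ^ 2 ≤ C.sq t ⬝ᵥ ξ := by
  constructor
  · rintro ⟨s, hs, rfl⟩
    obtain ⟨s', hs', hss, hss'⟩ := C.isUnit_of_mem_H hs
    obtain ⟨c, hc, hcb⟩ := C.exists_lower_bound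
    obtain ⟨K, hK, hKb⟩ := C.exists_bound_mul s'
    refine ⟨c / K ^ 2, by positivity, fun t ht => ?_⟩
    rw [C.dotProduct_dsq, C.π_sq hs]
    refine le_trans ?_ (hcb _)
    have h1 := (hKb (s * t)).2
    rw [← mul_assoc, hss', one_mul] at h1
    calc c / K ^ 2 * ‖C.sym t‖ ^ 2 ≤ c / K ^ 2 * (K * ‖C.sym (s * t)‖) ^ 2 := by gcongr
      _ = _ := by field_simp
  · rintro ⟨c, hc, hcb⟩
    have hcont : Continuous fun x => C.sq (C.sym.symm x) ⬝ᵥ ξ :=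
      C.continuous_sq.dotProduct continuous_const
    obtain ⟨t₀, ht₀, hmax⟩ := C.exists_max (Θ := fun t => C.sq t ⬝ᵥ ξ) hcont hc hcb
    obtain ⟨s₀, hs₀, hts, hst⟩ := C.isUnit_of_mem_H ht₀
    -- first-order condition at the maximum `t₀` in the direction `t₀ x`: it says that the
    -- transpose of `π(t₀)` maps `ξ` to the trace
    have key : ∀ x : W, C.π t₀ (C.sym x) ⬝ᵥ ξ = 2 * ∑ i, C.ρ i x := by
      intro x
      refine eq_two_mul_sum_of_isMax (d := C.π t₀ (C.sq x) ⬝ᵥ ξ) ?_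
      filter_upwards [C.eventually_one_add_mem_H x] with ε hε
      have h1 := hmax _ (C.mul_mem_H ht₀ hε)
      have h2 : C.sq (t₀ * (1 + ε • x)) ⬝ᵥ ξ = C.sq t₀ ⬝ᵥ ξ +
          (C.π t₀ (C.sym x) ⬝ᵥ ξ * ε + C.π t₀ (C.sq x) ⬝ᵥ ξ * ε ^ 2) := by
        have h3 : C.sq (1 + ε • x) = C.sq 1 + ε • C.sym x + ε ^ 2 • C.sq x := by
          simp only [sq, map_add, LinearMap.add_apply, map_smul, LinearMap.smul_apply]
          rw [C.B_symm 1 x, C.B_one, C.B_one]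
          module
        rw [← C.π_sq ht₀, h3]
        simp only [map_add, map_smul, add_dotProduct, smul_dotProduct, smul_eq_mul, C.π_sq_one]
        ring
      simp only [h2] at h1
      have hP : 0 < ∏ i, C.ρ i t₀ ^ 2 := Finset.prod_pos fun i _ => pow_pos (ht₀ i) 2
      have h4 : ∀ i, C.ρ i (t₀ * (1 + ε • x)) ^ 2 = (1 + ε * C.ρ i x) ^ 2 * C.ρ i t₀ ^ 2 := fun i => by
        simp [mul_pow, mul_comm]
      simp_rw [h4] at h1
      rw [Finset.prod_mul_distrib, neg_add, Real.exp_add] at h1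
      have hE := Real.exp_pos (-(C.sq t₀ ⬝ᵥ ξ))
      have hPE : 0 < (∏ i, C.ρ i t₀ ^ 2) * Real.exp (-(C.sq t₀ ⬝ᵥ ξ)) := by positivity
      by_contra hcon
      push Not at hcon
      have := mul_lt_mul_of_pos_left hcon hPE
      linarith
    refine ⟨s₀, hs₀, ?_⟩
    symm
    rw [dsq, eq_dualVec_iff]
    intro y
    obtain ⟨x, hx⟩ := C.sym.surjective (C.π s₀ y)
    have h1 := key x
    rw [hx, ← LinearMap.comp_apply, ← C.π_mul ht₀, hts, π_one, LinearMap.id_apply,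
      ← C.tr_sym, hx] at h1
    exact h1

theorem isOpen_Ω : IsOpen C.Ω := by
  rw [Metric.isOpen_iff]
  intro y hy
  obtain ⟨c, hc, hcb⟩ := C.mem_Ω_iff.1 hy
  obtain ⟨K, hK, hKb⟩ := C.exists_bound_tr_π
  refine ⟨c / (2 * K), by positivity, fun z hz => C.mem_Ω_iff.2 ⟨c / 2, by positivity,
    fun t ht => ?_⟩⟩
  have h1 := hKb t (z - y)
  rw [Metric.mem_ball, dist_eq_norm] at hz
  have h2 := hcb t ht
  rw [map_sub, map_sub] at h1
  have h3 : K * ‖z - y‖ * ‖C.sym t‖ ^ 2 ≤ c / 2 * ‖C.sym t‖ ^ 2 := by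
    gcongr
    calc K * ‖z - y‖ ≤ K * (c / (2 * K)) := by gcongr
      _ = c / 2 := by field_simp
  have h4 := (abs_le.1 h1).1
  linarith

theorem isOpen_Ωd : IsOpen C.Ωd := by
  rw [Metric.isOpen_iff]
  intro y hy
  obtain ⟨c, hc, hcb⟩ := C.mem_Ωd_iff.1 hy
  obtain ⟨K, hK, hKb⟩ := C.exists_bound_sq
  refine ⟨c / (2 * (K * (Fintype.card ι + 1))), by positivity, fun z hz => C.mem_Ωd_iff.2
    ⟨c / 2, by positivity, fun t ht => ?_⟩⟩
  rw [Metric.mem_ball, dist_eq_norm] at hz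
  have h2 := hcb t ht
  have h1 : |C.sq t ⬝ᵥ (z - y)| ≤ (Fintype.card ι + 1) * (‖C.sq t‖ * ‖z - y‖) := by
    rw [dotProduct]
    refine (Finset.abs_sum_le_sum_abs _ _).trans ?_
    have : ∀ i ∈ Finset.univ, |C.sq t i * (z - y) i| ≤ ‖C.sq t‖ * ‖z - y‖ := fun i _ => by
      rw [abs_mul]
      exact mul_le_mul (norm_le_pi_norm (C.sq t) i) (norm_le_pi_norm (z - y) i) (abs_nonneg _)
        (norm_nonneg _)
    refine (Finset.sum_le_card_nsmul _ _ _ this).trans ?_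
    rw [nsmul_eq_mul, Finset.card_univ]
    gcongr
    linarith
  rw [dotProduct_sub] at h1
  have h3 : (Fintype.card ι + 1) * (‖C.sq t‖ * ‖z - y‖) ≤ c / 2 * ‖C.sym t‖ ^ 2 := by
    calc (Fintype.card ι + 1) * (‖C.sq t‖ * ‖z - y‖)
        ≤ (Fintype.card ι + 1) * ((K * ‖C.sym t‖ ^ 2) * (c / (2 * (K * (Fintype.card ι + 1))))) := by
          gcongr
          exact hKb t
      _ = _ := by field_simp
  have h4 := (abs_le.1 h1).1
  linarith

theorem tr_π_nonneg_of_mem_closure {y : ι → ℝ} (hy : y ∈ closure C.Ω) {t : W} (ht : t ∈ C.H) :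
    0 ≤ C.tr (C.π t y) := by
  have hcl : IsClosed {y | 0 ≤ C.tr (C.π t y)} :=
    isClosed_le continuous_const (LinearMap.continuous_on_pi (C.tr.comp (C.π t)))
  refine closure_minimal (fun z hz => ?_) hcl hy
  obtain ⟨c, hc, hcb⟩ := C.mem_Ω_iff.1 hz
  exact le_trans (by positivity) (hcb t ht)

theorem add_mem_Ω {y z : ι → ℝ} (hy : y ∈ C.Ω) (hz : z ∈ closure C.Ω) : y + z ∈ C.Ω := by
  obtain ⟨c, hc, hcb⟩ := C.mem_Ω_iff.1 hy
  refine C.mem_Ω_iff.2 ⟨c, hc, fun t ht => ?_⟩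
  rw [map_add, map_add]
  have := C.tr_π_nonneg_of_mem_closure hz ht
  linarith [hcb t ht]

theorem smul_mem_Ω {y : ι → ℝ} (hy : y ∈ C.Ω) {a : ℝ} (ha : 0 < a) : a • y ∈ C.Ω := by
  obtain ⟨c, hc, hcb⟩ := C.mem_Ω_iff.1 hy
  refine C.mem_Ω_iff.2 ⟨a * c, by positivity, fun t ht => ?_⟩
  rw [map_smul, map_smul, smul_eq_mul, mul_assoc]
  exact mul_le_mul_of_nonneg_left (hcb t ht) ha.le

theorem add_mem_Ωd {y z : ι → ℝ} (hy : y ∈ C.Ωd) (hz : ∀ x ∈ C.Ω, 0 ≤ x ⬝ᵥ z) :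
    y + z ∈ C.Ωd := by
  obtain ⟨c, hc, hcb⟩ := C.mem_Ωd_iff.1 hy
  refine C.mem_Ωd_iff.2 ⟨c, hc, fun t ht => ?_⟩
  rw [dotProduct_add]
  have := hz _ ⟨t, ht, rfl⟩
  linarith [hcb t ht]

theorem smul_mem_Ωd {y : ι → ℝ} (hy : y ∈ C.Ωd) {a : ℝ} (ha : 0 < a) : a • y ∈ C.Ωd := by
  obtain ⟨c, hc, hcb⟩ := C.mem_Ωd_iff.1 hy
  refine C.mem_Ωd_iff.2 ⟨a * c, by positivity, fun t ht => ?_⟩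
  rw [dotProduct_smul, smul_eq_mul, mul_assoc]
  exact mul_le_mul_of_nonneg_left (hcb t ht) ha.le

theorem dsq_one_mem : C.dsq 1 ∈ C.Ωd := ⟨1, C.one_mem_H, rfl⟩

theorem dotProduct_nonneg {y ξ : ι → ℝ} (hy : y ∈ C.Ω) (hξ : ξ ∈ C.Ωd) : 0 ≤ y ⬝ᵥ ξ := by
  obtain ⟨t, ht, rfl⟩ := hy
  obtain ⟨c, hc, hcb⟩ := C.mem_Ωd_iff.1 hξ
  exact le_trans (by positivity) (hcb t ht)

theorem dotProduct_nonneg_closure {y ξ : ι → ℝ} (hy : y ∈ closure C.Ω) (hξ : ξ ∈ C.Ωd) :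
    0 ≤ y ⬝ᵥ ξ := by
  have hcl : IsClosed {y : ι → ℝ | 0 ≤ y ⬝ᵥ ξ} :=
    isClosed_le continuous_const (continuous_id.dotProduct continuous_const)
  exact closure_minimal (fun z hz => C.dotProduct_nonneg hz hξ) hcl hy

theorem convex_Ω : Convex ℝ C.Ω := by
  rw [convex_iff_forall_pos]
  intro x hx y hy a b ha hb _
  exact C.add_mem_Ω (C.smul_mem_Ω hx ha) (subset_closure (C.smul_mem_Ω hy hb))

theorem convex_Ωd : Convex ℝ C.Ωd := by
  rw [convex_iff_forall_pos]
  intro x hx y hy a b ha hb _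
  exact C.add_mem_Ωd (C.smul_mem_Ωd hx ha)
    fun z hz => C.dotProduct_nonneg hz (C.smul_mem_Ωd hy hb)

/-- The closed dual cone differs from the open orbit by a null set. -/
theorem ae_mem_Ωd : ∀ᵐ ξ : ι → ℝ, (∀ y ∈ C.Ω, 0 ≤ y ⬝ᵥ ξ) → ξ ∈ C.Ωd := by
  have h0 := C.convex_Ωd.addHaar_frontier (volume : Measure (ι → ℝ))
  have h1 : ∀ᵐ ξ : ι → ℝ, ξ ∉ frontier C.Ωd := measure_eq_zero_iff_ae_notMem.1 h0
  filter_upwards [h1] with ξ hξ hd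
  have hcl : ξ ∈ closure C.Ωd := by
    refine mem_closure_of_tendsto (f := fun ε : ℝ => ε • C.dsq 1 + ξ)
      (b := nhdsWithin 0 (Set.Ioi 0)) ?_ ?_
    · have : Continuous fun ε : ℝ => ε • C.dsq 1 + ξ := by fun_prop
      have h := this.tendsto 0
      simp only [zero_smul, zero_add] at h
      exact h.mono_left nhdsWithin_le_nhds
    · exact Filter.eventually_of_mem self_mem_nhdsWithin fun ε hε =>
        C.add_mem_Ωd (C.smul_mem_Ωd C.dsq_one_mem hε) hd
  rw [C.isOpen_Ωd.frontier_eq] at hξ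
  by_contra hn
  exact hξ ⟨hcl, hn⟩

end ConeData

/-! ### Generalized powers -/

theorem integrable_of_comp_linearEquiv {E F : Type*} [NormedAddCommGroup E] [NormedSpace ℝ E]
    [FiniteDimensional ℝ E] [MeasurableSpace E] [BorelSpace E] [NormedAddCommGroup F]
    [NormedSpace ℝ F] [FiniteDimensional ℝ F] [MeasurableSpace F] [BorelSpace F]
    (μ : Measure E) [μ.IsAddHaarMeasure] (ν : Measure F) [ν.IsAddHaarMeasure] (L : E ≃ₗ[ℝ] F)
    {f : F → ℝ} (hf : Integrable (fun x => f (L x)) μ) : Integrable f ν := by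
  set L' := L.toContinuousLinearEquiv with hL'
  have h1 : (Measure.map L' μ).IsAddHaarMeasure := L'.isAddHaarMeasure_map μ
  rw [Measure.isAddLeftInvariant_eq_smul ν (Measure.map L' μ)]
  refine Integrable.smul_measure_nnreal ?_
  exact (L'.toHomeomorph.measurableEmbedding.integrable_map_iff).2 hf

theorem setLIntegral_image_linearMap {ι : Type*} [Fintype ι] {s : Set (ι → ℝ)}
    (hs : MeasurableSet s) {L : (ι → ℝ) →ₗ[ℝ] (ι → ℝ)} (hL : LinearMap.det L ≠ 0)
    (f : (ι → ℝ) → ℝ≥0∞) :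
    ∫⁻ y in L '' s, f y = ENNReal.ofReal |LinearMap.det L| * ∫⁻ y in s, f (L y) := by
  set L' := LinearMap.toContinuousLinearMap L with hL'
  have hinj : Function.Injective L := (LinearMap.equivOfDetNeZero L hL).injective
  have h := lintegral_image_eq_lintegral_abs_det_fderiv_mul (volume : Measure (ι → ℝ)) hs
    (f := L) (f' := fun _ => L') (fun x _ => L'.hasFDerivAt.hasFDerivWithinAt) hinj.injOn f
  rw [h]
  have hdet : L'.det = LinearMap.det L := rfl
  rw [hdet, lintegral_const_mul' _ _ ENNReal.ofReal_ne_top]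

namespace ConeData

variable {r : ℕ} {ι W : Type*} [Fintype ι] [Ring W] [Algebra ℝ W] (C : ConeData r ι W)

/-- `Q_j(t t⋆) = ρ_j(t)²`. -/
def Q (j : Fin r) (y : ι → ℝ) : ℝ := C.ρ j (Function.invFunOn C.sq C.H y) ^ 2

/-- The dual functions `Q⋆_j(π(t)⋆ tr) = ρ_j(t)²`. -/
def Qd (j : Fin r) (ξ : ι → ℝ) : ℝ := C.ρ j (Function.invFunOn C.dsq C.H ξ) ^ 2

/-- The generalized power `Q^α`. -/
def Qp (α : Fin r → ℝ) (y : ι → ℝ) : ℝ := ∏ j, C.Q j y ^ α j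

/-- The generalized power `(Q⋆)^α` on the dual cone. -/
def Qdp (α : Fin r → ℝ) (ξ : ι → ℝ) : ℝ := ∏ j, C.Qd j ξ ^ α j

/-- The character `t ↦ ∏ ρ_j(t)^{2α_j}`. -/
def χ (α : Fin r → ℝ) (t : W) : ℝ := ∏ j, (C.ρ j t ^ 2) ^ α j

variable {C}

theorem Q_sq {t : W} (ht : t ∈ C.H) (j : Fin r) : C.Q j (C.sq t) = C.ρ j t ^ 2 := by
  rw [Q, C.sq_injOn.leftInvOn_invFunOn ht]

theorem Qd_dsq {t : W} (ht : t ∈ C.H) (j : Fin r) : C.Qd j (C.dsq t) = C.ρ j t ^ 2 := by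
  rw [Qd, C.dsq_injOn.leftInvOn_invFunOn ht]

theorem Qp_sq {t : W} (ht : t ∈ C.H) (α : Fin r → ℝ) : C.Qp α (C.sq t) = C.χ α t := by
  simp [Qp, χ, Q_sq ht]

theorem Qdp_dsq {t : W} (ht : t ∈ C.H) (α : Fin r → ℝ) : C.Qdp α (C.dsq t) = C.χ α t := by
  simp [Qdp, χ, Qd_dsq ht]

theorem χ_pos {t : W} (ht : t ∈ C.H) (α : Fin r → ℝ) : 0 < C.χ α t :=
  Finset.prod_pos fun j _ => Real.rpow_pos_of_pos (pow_pos (ht j) 2) _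

theorem χ_mul (s t : W) (α : Fin r → ℝ) : C.χ α (s * t) = C.χ α s * C.χ α t := by
  rw [χ, χ, χ, ← Finset.prod_mul_distrib]
  refine Finset.prod_congr rfl fun j _ => ?_
  rw [map_mul, mul_pow, Real.mul_rpow (sq_nonneg _) (sq_nonneg _)]

theorem χ_one (α : Fin r → ℝ) : C.χ α 1 = 1 := by simp [χ]

theorem χ_add {t : W} (ht : t ∈ C.H) (α β : Fin r → ℝ) : C.χ (α + β) t = C.χ α t * C.χ β t := by
  rw [χ, χ, χ, ← Finset.prod_mul_distrib]
  refine Finset.prod_congr rfl fun j _ => ?_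
  rw [Pi.add_apply, Real.rpow_add (pow_pos (ht j) 2)]

theorem Q_pos {y : ι → ℝ} (hy : y ∈ C.Ω) (j : Fin r) : 0 < C.Q j y := by
  obtain ⟨t, ht, rfl⟩ := hy
  rw [Q_sq ht]
  exact pow_pos (ht j) 2

theorem Qd_pos {y : ι → ℝ} (hy : y ∈ C.Ωd) (j : Fin r) : 0 < C.Qd j y := by
  obtain ⟨t, ht, rfl⟩ := hy
  rw [Qd_dsq ht]
  exact pow_pos (ht j) 2

theorem Qp_pos {y : ι → ℝ} (hy : y ∈ C.Ω) (α : Fin r → ℝ) : 0 < C.Qp α y :=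
  Finset.prod_pos fun j _ => Real.rpow_pos_of_pos (Q_pos hy j) _

theorem Qdp_pos {y : ι → ℝ} (hy : y ∈ C.Ωd) (α : Fin r → ℝ) : 0 < C.Qdp α y :=
  Finset.prod_pos fun j _ => Real.rpow_pos_of_pos (Qd_pos hy j) _

theorem Qp_add {y : ι → ℝ} (hy : y ∈ C.Ω) (α β : Fin r → ℝ) :
    C.Qp (α + β) y = C.Qp α y * C.Qp β y := by
  obtain ⟨t, ht, rfl⟩ := hy
  simp only [Qp_sq ht, χ_add ht]

theorem Qdp_add {y : ι → ℝ} (hy : y ∈ C.Ωd) (α β : Fin r → ℝ) :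
    C.Qdp (α + β) y = C.Qdp α y * C.Qdp β y := by
  obtain ⟨t, ht, rfl⟩ := hy
  simp only [Qdp_dsq ht, χ_add ht]

theorem Qp_zero (y : ι → ℝ) : C.Qp 0 y = 1 := by simp [Qp]

theorem Qdp_zero (y : ι → ℝ) : C.Qdp 0 y = 1 := by simp [Qdp]

theorem sq_smul (a : ℝ) (t : W) : C.sq (a • t) = a ^ 2 • C.sq t := by
  simp only [sq, map_smul, LinearMap.smul_apply, smul_smul]
  congr 1
  ring

theorem dsq_smul (a : ℝ) (t : W) : C.dsq (a • t) = a ^ 2 • C.dsq t := by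
  symm
  rw [show C.dsq (a • t) = dualVec (C.tr ∘ₗ C.π (a • t)) from rfl, eq_dualVec_iff]
  intro y
  rw [dotProduct_smul, C.dotProduct_dsq]
  simp only [LinearMap.comp_apply, π_apply, smul_mul_assoc, map_smul, LinearMap.smul_apply,
    smul_eq_mul]
  ring

theorem smul_mem_H {a : ℝ} (ha : 0 < a) {t : W} (ht : t ∈ C.H) : a • t ∈ C.H := fun i => by
  rw [map_smul, smul_eq_mul]
  exact mul_pos ha (ht i)

theorem χ_smul {a : ℝ} (ha : 0 < a) (t : W) (α : Fin r → ℝ) :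
    C.χ α (a • t) = (a ^ 2) ^ (∑ j, α j) * C.χ α t := by
  rw [χ, χ, Real.rpow_sum_of_pos (by positivity), ← Finset.prod_mul_distrib]
  refine Finset.prod_congr rfl fun j _ => ?_
  rw [map_smul, smul_eq_mul, mul_pow, Real.mul_rpow (sq_nonneg _) (sq_nonneg _)]

theorem Qp_smul {y : ι → ℝ} (hy : y ∈ C.Ω) {a : ℝ} (ha : 0 < a) (α : Fin r → ℝ) :
    C.Qp α (a • y) = a ^ (∑ j, α j) * C.Qp α y := by
  obtain ⟨t, ht, rfl⟩ := hy
  have h1 : a = (Real.sqrt a) ^ 2 := (Real.sq_sqrt ha.le).symm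
  have h2 := Real.sqrt_pos.2 ha
  rw [Qp_sq ht, h1, ← sq_smul, Qp_sq (smul_mem_H h2 ht), χ_smul h2]

theorem Qdp_smul {y : ι → ℝ} (hy : y ∈ C.Ωd) {a : ℝ} (ha : 0 < a) (α : Fin r → ℝ) :
    C.Qdp α (a • y) = a ^ (∑ j, α j) * C.Qdp α y := by
  obtain ⟨t, ht, rfl⟩ := hy
  have h1 : a = (Real.sqrt a) ^ 2 := (Real.sq_sqrt ha.le).symm
  have h2 := Real.sqrt_pos.2 ha
  rw [Qdp_dsq ht, h1, ← dsq_smul, Qdp_dsq (smul_mem_H h2 ht), χ_smul h2]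

variable (C)

/-- The integral splits into one-dimensional gamma integrals over the diagonal entries and a
Gaussian integral over the strictly triangular part. -/
theorem integrable_prod_rpow_mul_exp {a : Fin r → ℝ} (ha : ∀ i, -1 < a i) :
    Integrable fun x : ι → ℝ => (∏ i, C.ρ i (C.sym.symm x) ^ a i) *
      Real.exp (-C.tr (C.sq (C.sym.symm x))) := by
  have : FiniteDimensional ℝ W := C.finiteDimensional
  -- coordinates adapted to the splitting into the diagonal and the strictly triangular part
  set p : (ι → ℝ) →ₗ[ℝ] (Fin r → ℝ) :=
    LinearMap.pi fun i => (C.ρ i).toLinearMap.comp C.sym.symm.toLinearMap with hp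
  set b := Module.finBasis ℝ (LinearMap.ker p) with hb
  set d := Module.finrank ℝ (LinearMap.ker p)
  set dg : (Fin r → ℝ) →ₗ[ℝ] (ι → ℝ) := C.sym.toLinearMap.comp
    (∑ i, (LinearMap.proj i : (Fin r → ℝ) →ₗ[ℝ] ℝ).smulRight (C.c i)) with hdg
  have hdgv : ∀ v, dg v = C.sym (C.diag v) := fun v => by
    simp [hdg, diag]
  set Ψ₀ : ((Fin r → ℝ) × (Fin d → ℝ)) →ₗ[ℝ] (ι → ℝ) :=
    dg.coprod ((LinearMap.ker p).subtype.comp b.equivFun.symm.toLinearMap) with hΨ₀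
  have hΨv : ∀ q, Ψ₀ q = C.sym (C.diag q.1) + (b.equivFun.symm q.2 : ι → ℝ) := fun q => by
    simp [hΨ₀, hdgv]
  have hker : ∀ w : LinearMap.ker p, ∀ i, C.ρ i (C.sym.symm (w : ι → ℝ)) = 0 := fun w i => by
    have := congrFun (LinearMap.mem_ker.1 w.2) i
    simpa [hp] using this
  have hρΨ : ∀ q i, C.ρ i (C.sym.symm (Ψ₀ q)) = q.1 i := fun q i => by
    rw [hΨv, map_add, map_add, hker, LinearEquiv.symm_apply_apply, C.ρ_diag, add_zero]
  have hbij : Function.Bijective Ψ₀ := by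
    constructor
    · rw [injective_iff_map_eq_zero]
      intro q hq
      have h1 : q.1 = 0 := by
        ext i
        rw [← hρΨ q i, hq]; simp
      have h2 := hΨv q
      have h3 : C.diag (0 : Fin r → ℝ) = 0 := by simp [diag]
      rw [hq, h1, h3, map_zero, zero_add] at h2
      have h4 : b.equivFun.symm q.2 = 0 := Subtype.ext h2.symm
      rw [LinearEquiv.map_eq_zero_iff] at h4
      exact Prod.ext h1 h4
    · intro x
      have hx : x - C.sym (C.diag (p x)) ∈ LinearMap.ker p := by
        rw [LinearMap.mem_ker]
        ext i
        simp [hp, C.ρ_diag]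
      refine ⟨(p x, b.equivFun ⟨_, hx⟩), ?_⟩
      rw [hΨv]
      simp
  set Ψ := LinearEquiv.ofBijective Ψ₀ hbij with hΨ
  have hΨΨ : ∀ q, Ψ q = Ψ₀ q := fun q => rfl
  have hHaar : ((volume : Measure (Fin r → ℝ)).prod
      (volume : Measure (Fin d → ℝ))).IsAddHaarMeasure := Measure.prod.instIsAddHaarMeasure _ _
  refine integrable_of_comp_linearEquiv
    ((volume : Measure (Fin r → ℝ)).prod (volume : Measure (Fin d → ℝ))) volume Ψ ?_
  have htr : ∀ q, C.tr (C.sq (C.sym.symm (Ψ q))) = (∑ i, q.1 i ^ 2) +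
      C.tr (C.sq (C.sym.symm (Ψ₀ (0, q.2)))) := by
    intro q
    have h1 := C.tr_B_of_dpart (C.sym.symm (Ψ q))
    have h2 : C.dpart (C.sym.symm (Ψ q)) = C.diag q.1 := by
      rw [dpart]; congr 1; ext i; exact hρΨ q i
    have h4 : C.diag (0 : Fin r → ℝ) = 0 := by simp [diag]
    have h3 : C.sym.symm (Ψ q) - C.diag q.1 = C.sym.symm (Ψ₀ (0, q.2)) := by
      rw [hΨΨ, hΨv, hΨv, map_add, LinearEquiv.symm_apply_apply, h4, map_zero, zero_add]
      simp
    rw [h2, h3] at h1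
    have h5 : ∀ i, C.ρ i (C.sym.symm (Ψ q)) = q.1 i := hρΨ q
    simp only [h5] at h1
    rw [sq, map_smul, h1, sq, map_smul, smul_eq_mul, smul_eq_mul]
    ring
  obtain ⟨c, hc, hcb⟩ := C.exists_lower_bound
  -- the strictly triangular coordinates contribute a Gaussian integral
  have hw : ∃ c' > 0, ∀ w : Fin d → ℝ,
      c' * ∑ j, w j ^ 2 ≤ C.tr (C.sq (C.sym.symm (Ψ₀ (0, w)))) := by
    set L := LinearMap.toContinuousLinearMap Ψ.symm.toLinearMap
    refine ⟨c / ((d + 1) * (‖L‖ + 1) ^ 2), by positivity, fun w => ?_⟩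
    have h1 := hcb (C.sym.symm (Ψ₀ (0, w)))
    rw [LinearEquiv.apply_symm_apply] at h1
    refine le_trans ?_ h1
    have h2 := L.le_opNorm (Ψ₀ (0, w))
    have h3 : L (Ψ₀ (0, w)) = (0, w) := by
      change Ψ.symm (Ψ₀ (0, w)) = _
      rw [← hΨΨ, LinearEquiv.symm_apply_apply]
    rw [h3, Prod.norm_def] at h2
    have h4 : ‖w‖ ≤ (‖L‖ + 1) * ‖Ψ₀ (0, w)‖ := by
      refine (le_max_right _ _).trans (h2.trans ?_)
      gcongr
      linarith
    have h5 : ∑ j, w j ^ 2 ≤ (d + 1) * ‖w‖ ^ 2 := by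
      have : ∀ j ∈ Finset.univ, w j ^ 2 ≤ ‖w‖ ^ 2 := fun j _ => by
        rw [← sq_abs]
        exact pow_le_pow_left₀ (abs_nonneg _) (norm_le_pi_norm w j) 2
      refine (Finset.sum_le_card_nsmul _ _ _ this).trans ?_
      rw [nsmul_eq_mul, Finset.card_univ, Fintype.card_fin]
      gcongr
      linarith
    calc c / ((d + 1) * (‖L‖ + 1) ^ 2) * ∑ j, w j ^ 2
        ≤ c / ((d + 1) * (‖L‖ + 1) ^ 2) * ((d + 1) * ((‖L‖ + 1) * ‖Ψ₀ (0, w)‖) ^ 2) := by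
          gcongr
          refine h5.trans ?_
          gcongr
      _ = _ := by field_simp
  obtain ⟨c', hc', hcb'⟩ := hw
  have hI1 : Integrable fun v : Fin r → ℝ => ∏ i, (v i ^ a i * Real.exp (-1 * v i ^ 2)) :=
    Integrable.fintype_prod fun i => integrable_rpow_mul_exp_neg_mul_sq one_pos (ha i)
  have hI2 : Integrable fun w : Fin d → ℝ => Real.exp (-C.tr (C.sq (C.sym.symm (Ψ₀ (0, w))))) := by
    have h1 : Integrable fun w : Fin d → ℝ => ∏ j, Real.exp (-c' * w j ^ 2) :=
      Integrable.fintype_prod fun j => integrable_exp_neg_mul_sq hc'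
    refine h1.mono' ?_ (Filter.Eventually.of_forall fun w => ?_)
    · have hcont : Continuous fun w : Fin d → ℝ => C.tr (C.sq (C.sym.symm (Ψ₀ (0, w)))) := by
        have e1 := (LinearMap.continuous_on_pi C.tr).comp C.continuous_sq
        have e2 : Continuous fun w : Fin d → ℝ => Ψ₀ (0, w) :=
          LinearMap.continuous_on_pi (Ψ₀.comp (LinearMap.inr ℝ _ _))
        exact e1.comp e2
      exact (Real.continuous_exp.comp hcont.neg).aestronglyMeasurable
    · rw [Real.norm_eq_abs, abs_of_pos (Real.exp_pos _), ← Real.exp_sum]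
      apply Real.exp_le_exp.2
      rw [← Finset.mul_sum]
      have := hcb' w
      linarith
  refine (hI1.mul_prod hI2).congr (Filter.Eventually.of_forall fun q => ?_)
  simp only
  have h5 : ∀ i, C.ρ i (C.sym.symm (Ψ q)) = q.1 i := hρΨ q
  rw [htr, Finset.prod_mul_distrib, neg_add, Real.exp_add, ← Finset.sum_neg_distrib, Real.exp_sum]
  simp only [h5, neg_one_mul]
  ring

end ConeData

/-! ### Gamma integrals -/

theorem hasFDerivAt_bilin_diag {E F : Type*} [NormedAddCommGroup E] [NormedSpace ℝ E]
    [FiniteDimensional ℝ E] [NormedAddCommGroup F] [NormedSpace ℝ F] (b : E →ₗ[ℝ] E →ₗ[ℝ] F)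
    (x : E) : HasFDerivAt (fun x => b x x) (LinearMap.toContinuousLinearMap (b x + b.flip x)) x := by
  set bc : E →L[ℝ] E →L[ℝ] F := LinearMap.toContinuousLinearMap
    (LinearMap.toContinuousLinearMap.toLinearMap ∘ₗ b) with hbc
  have h : ∀ x y, bc x y = b x y := fun x y => rfl
  have h1 := bc.hasFDerivAt_of_bilinear (hasFDerivAt_id x) (hasFDerivAt_id x)
  refine h1.congr_fderiv ?_
  ext v
  simp [h]

namespace ConeData

variable {r : ℕ} {ι W : Type*} [Fintype ι] [Ring W] [Algebra ℝ W] (C : ConeData r ι W)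

/-- The set of triangular elements with positive diagonal, in coordinates. -/
def Hc : Set (ι → ℝ) := {x | C.sym.symm x ∈ C.H}

theorem isOpen_Hc : IsOpen C.Hc := C.isOpen_H

theorem sym_mem_Hc {t : W} : C.sym t ∈ C.Hc ↔ t ∈ C.H := by
  simp [Hc]

theorem image_Hc {α : Type*} (f : W → α) : (fun x => f (C.sym.symm x)) '' C.Hc = f '' C.H := by
  ext y
  constructor
  · rintro ⟨x, hx, rfl⟩; exact ⟨_, hx, rfl⟩
  · rintro ⟨t, ht, rfl⟩; exact ⟨C.sym t, C.sym_mem_Hc.2 ht, by simp⟩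

theorem det_conj (f : W →ₗ[ℝ] W) :
    LinearMap.det (C.sym.toLinearMap ∘ₗ f ∘ₗ C.sym.symm.toLinearMap) = LinearMap.det f :=
  LinearMap.det_conj f C.sym

/-- A cone that is parametrized by `H` through a map of multiplicative Jacobian carries finite
and positive gamma integrals. -/
theorem lintegral_param {φ : W → ι → ℝ} (hinj : Set.InjOn φ C.H)
    {D : (ι → ℝ) → (ι → ℝ) →ₗ[ℝ] (ι → ℝ)}
    (hD : ∀ x ∈ C.Hc, HasFDerivAt (fun x => φ (C.sym.symm x))
      (LinearMap.toContinuousLinearMap (D x)) x)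
    {c : ℝ} (hc : c ≠ 0) {d : Fin r → ℕ}
    (hdet : ∀ t ∈ C.H, LinearMap.det (D (C.sym t)) = c * ∏ i, C.ρ i t ^ d i)
    {β : Fin r → ℝ} (hβ : ∀ i, -1 < 2 * β i + d i) {E P : (ι → ℝ) → ℝ}
    (hE : ∀ t ∈ C.H, E (φ t) = C.tr (C.sq t)) (hP : ∀ t ∈ C.H, P (φ t) = C.χ β t) :
    ∃ Γ > 0, ∫⁻ y in φ '' C.H, ENNReal.ofReal (Real.exp (-E y) * P y) = ENNReal.ofReal Γ := by
  have hinj' : Set.InjOn (fun x => φ (C.sym.symm x)) C.Hc := fun x hx y hy h =>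
    C.sym.symm.injective (hinj hx hy h)
  have h := lintegral_image_eq_lintegral_abs_det_fderiv_mul (volume : Measure (ι → ℝ))
    C.isOpen_Hc.measurableSet (fun x hx => (hD x hx).hasFDerivWithinAt) hinj'
    (fun y => ENNReal.ofReal (Real.exp (-E y) * P y))
  rw [C.image_Hc] at h
  set F : (ι → ℝ) → ℝ := fun x => |c| * ((∏ i, C.ρ i (C.sym.symm x) ^ (2 * β i + d i)) *
      Real.exp (-C.tr (C.sq (C.sym.symm x)))) with hF
  have hint : Integrable F := (C.integrable_prod_rpow_mul_exp hβ).const_mul _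
  have h1 : ∀ x ∈ C.Hc, ENNReal.ofReal |(LinearMap.toContinuousLinearMap (D x)).det| *
      ENNReal.ofReal (Real.exp (-E (φ (C.sym.symm x))) * P (φ (C.sym.symm x))) =
      ENNReal.ofReal (F x) := by
    intro x hx
    have hx' : C.sym.symm x ∈ C.H := hx
    have e1 : (LinearMap.toContinuousLinearMap (D x)).det = LinearMap.det (D x) := rfl
    have e2 := hdet _ hx'
    rw [LinearEquiv.apply_symm_apply] at e2
    rw [e1, e2, hE _ hx', hP _ hx', ← ENNReal.ofReal_mul (abs_nonneg _)]
    congr 1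
    have e3 : ∏ i, C.ρ i (C.sym.symm x) ^ (2 * β i + d i) =
        C.χ β (C.sym.symm x) * ∏ i, C.ρ i (C.sym.symm x) ^ d i := by
      rw [χ, ← Finset.prod_mul_distrib]
      refine Finset.prod_congr rfl fun i _ => ?_
      rw [Real.rpow_add (hx' i), Real.rpow_natCast, Real.rpow_mul (hx' i).le]
      norm_num
    have e4 : |∏ i, C.ρ i (C.sym.symm x) ^ d i| = ∏ i, C.ρ i (C.sym.symm x) ^ d i :=
      abs_of_nonneg (Finset.prod_nonneg fun i _ => pow_nonneg (hx' i).le _)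
    rw [abs_mul, e4, hF]
    simp only [e3]
    ring
  rw [setLIntegral_congr_fun C.isOpen_Hc.measurableSet h1] at h
  have hFpos : ∀ x ∈ C.Hc, 0 < F x := fun x hx =>
    mul_pos (abs_pos.2 hc) (mul_pos (Finset.prod_pos fun i _ => Real.rpow_pos_of_pos (hx i) _)
      (Real.exp_pos _))
  refine ⟨∫ x in C.Hc, F x, ?_, ?_⟩
  · rw [gt_iff_lt, setIntegral_pos_iff_support_of_nonneg_ae
      (ae_restrict_of_forall_mem C.isOpen_Hc.measurableSet fun x hx => (hFpos x hx).le)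
      hint.integrableOn]
    refine lt_of_lt_of_le (C.isOpen_Hc.measure_pos volume ⟨C.sym 1, C.sym_mem_Hc.2 C.one_mem_H⟩)
      (measure_mono fun x hx => ⟨(hFpos x hx).ne', hx⟩)
  · rw [h, ofReal_integral_eq_lintegral_ofReal hint.integrableOn
      (ae_restrict_of_forall_mem C.isOpen_Hc.measurableSet fun x hx => (hFpos x hx).le)]

theorem prod_pow_split {t : W} (a b : Fin r → ℕ) :
    ∏ i, C.ρ i t ^ (2 + a i + b i) = (∏ i, C.ρ i t ^ (1 + a i)) * ∏ i, C.ρ i t ^ (1 + b i) := by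
  rw [← Finset.prod_mul_distrib]
  refine Finset.prod_congr rfl fun i _ => ?_
  rw [← pow_add]
  congr 1
  ring

theorem hasFDerivAt_sq (x : ι → ℝ) : HasFDerivAt (fun x => C.sq (C.sym.symm x))
    (LinearMap.toContinuousLinearMap (C.Bcoord x)) x := by
  refine (((hasFDerivAt_bilin_diag C.Bcoord x).const_smul (2⁻¹ : ℝ)).congr_fderiv ?_)
  ext1 v
  have h : C.Bcoord v x = C.Bcoord x v := C.B_symm _ _
  simp only [map_add, smul_apply, add_apply,
    LinearMap.coe_toContinuousLinearMap', LinearMap.flip_apply, h, ← two_smul ℝ, smul_smul]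
  norm_num

/-- The Jacobian of `t ↦ t t⋆`, from `π(t)(s + s⋆) = (ts) t⋆ + t (ts)⋆`. -/
theorem det_Bcoord {t : W} (ht : t ∈ C.H) :
    LinearMap.det (C.Bcoord (C.sym t)) = 1 * ∏ i, C.ρ i t ^ (1 + C.n i) := by
  have h : C.Bcoord (C.sym t) ∘ₗ
      (C.sym.toLinearMap ∘ₗ LinearMap.mulLeft ℝ t ∘ₗ C.sym.symm.toLinearMap) = C.π t := by
    ext1 x
    obtain ⟨s, rfl⟩ := C.sym.surjective x
    have h2 := C.π_B ht 1 s
    rw [C.B_symm 1, C.B_one, mul_one] at h2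
    simp [Bcoord, h2]
  have h1 := congrArg LinearMap.det h
  rw [LinearMap.det_comp, C.det_conj, C.det_mulLeft, C.det_π ht, C.prod_pow_split] at h1
  have h3 : ∏ i, C.ρ i t ^ (1 + C.m i) ≠ 0 :=
    Finset.prod_ne_zero_iff.2 fun i _ => pow_ne_zero _ (ht i).ne'
  apply mul_right_cancel₀ h3
  rw [h1, one_mul, mul_comm]

/-- The bilinear map whose values on the diagonal are those of `dsq`, in coordinates. -/
def dBcoord : (ι → ℝ) →ₗ[ℝ] (ι → ℝ) →ₗ[ℝ] (ι → ℝ) := by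
  classical
  exact LinearMap.mk₂ ℝ (fun x x' i =>
    C.tr (C.B (C.sym.symm x * C.sym.symm (Pi.single i 1)) (C.sym.symm x')))
    (fun x y z => by ext i; simp [add_mul]) (fun a x y => by ext i; simp)
    (fun x y z => by ext i; simp) (fun a x y => by ext i; simp)

theorem dBcoord_self (x : ι → ℝ) : C.dBcoord x x = C.dsq (C.sym.symm x) := by
  ext i
  simp [dBcoord, dsq, dualVec, π_apply]

/-- The derivative of the parametrization `dsq` of the dual cone, in coordinates. -/
def dD (x : ι → ℝ) : (ι → ℝ) →ₗ[ℝ] (ι → ℝ) := C.dBcoord x + C.dBcoord.flip x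

theorem hasFDerivAt_dsq (x : ι → ℝ) : HasFDerivAt (fun x => C.dsq (C.sym.symm x))
    (LinearMap.toContinuousLinearMap (C.dD x)) x := by
  simp_rw [← dBcoord_self]
  exact hasFDerivAt_bilin_diag C.dBcoord x

/-- The transpose of `π(t)`, which acts on the dual cone. -/
def πd (t : W) : (ι → ℝ) →ₗ[ℝ] (ι → ℝ) := by
  classical exact Matrix.mulVecLin (LinearMap.toMatrix' (C.π t)).transpose

theorem dotProduct_πd (t : W) (y ξ : ι → ℝ) : y ⬝ᵥ C.πd t ξ = C.π t y ⬝ᵥ ξ := by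
  classical
  have h : C.πd t ξ = Matrix.mulVec (LinearMap.toMatrix' (C.π t)).transpose ξ := rfl
  rw [h, Matrix.mulVec_transpose, dotProduct_comm, ← Matrix.dotProduct_mulVec,
    LinearMap.toMatrix'_mulVec, dotProduct_comm]

theorem det_πd (t : W) : LinearMap.det (C.πd t) = LinearMap.det (C.π t) := by
  classical
  have h : C.πd t = Matrix.toLin' (LinearMap.toMatrix' (C.π t)).transpose := rfl
  rw [h, LinearMap.det_toLin', Matrix.det_transpose, LinearMap.det_toMatrix']

theorem πd_dsq {s : W} (hs : s ∈ C.H) (t : W) : C.πd t (C.dsq s) = C.dsq (s * t) := by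
  rw [show C.dsq (s * t) = dualVec (C.tr ∘ₗ C.π (s * t)) from rfl, eq_dualVec_iff]
  intro y
  rw [dotProduct_πd, dotProduct_dsq, C.π_mul hs]
  rfl

theorem continuous_dsq : Continuous fun x => C.dsq (C.sym.symm x) :=
  continuous_iff_continuousAt.2 fun x => (C.hasFDerivAt_dsq x).continuousAt

/-- The Jacobian of the parametrization of the dual cone: differentiate the equivariance `πd t
(dsq s) = dsq (s t)` at `s = 1` and compare determinants. -/
theorem det_dD {t : W} (ht : t ∈ C.H) : LinearMap.det (C.dD (C.sym t)) =
    LinearMap.det (C.dD (C.sym 1)) * ∏ i, C.ρ i t ^ (1 + C.m i) := by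
  set R := C.sym.toLinearMap ∘ₗ LinearMap.mulRight ℝ t ∘ₗ C.sym.symm.toLinearMap with hR
  have hR1 : R (C.sym 1) = C.sym t := by simp [hR]
  have h1 : HasFDerivAt (fun x => C.dsq (C.sym.symm (R x)))
      ((LinearMap.toContinuousLinearMap (C.dD (C.sym t))).comp
        (LinearMap.toContinuousLinearMap R)) (C.sym 1) := by
    refine HasFDerivAt.comp (C.sym 1) (g := fun x => C.dsq (C.sym.symm x)) ?_
      (LinearMap.toContinuousLinearMap R).hasFDerivAt
    have := C.hasFDerivAt_dsq (C.sym t)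
    rwa [← hR1] at this ⊢
  have h2 : HasFDerivAt (fun x => C.πd t (C.dsq (C.sym.symm x)))
      ((LinearMap.toContinuousLinearMap (C.πd t)).comp
        (LinearMap.toContinuousLinearMap (C.dD (C.sym 1)))) (C.sym 1) :=
    (LinearMap.toContinuousLinearMap (C.πd t)).hasFDerivAt.comp (C.sym 1)
      (C.hasFDerivAt_dsq (C.sym 1))
  have h3 : (fun x => C.πd t (C.dsq (C.sym.symm x))) =ᶠ[nhds (C.sym 1)]
      (fun x => C.dsq (C.sym.symm (R x))) := by
    filter_upwards [C.isOpen_Hc.mem_nhds (C.sym_mem_Hc.2 C.one_mem_H)] with x hx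
    rw [C.πd_dsq hx]
    simp [hR]
  have h4 := h2.unique (h1.congr_of_eventuallyEq h3)
  have h5 : C.πd t ∘ₗ C.dD (C.sym 1) = C.dD (C.sym t) ∘ₗ R := by
    ext1 x
    exact congrArg (fun L => L x) h4
  have h6 := congrArg LinearMap.det h5
  rw [LinearMap.det_comp, LinearMap.det_comp, hR, C.det_conj, C.det_mulRight, C.det_πd,
    C.det_π ht, C.prod_pow_split] at h6
  have h7 : ∏ i, C.ρ i t ^ (1 + C.n i) ≠ 0 :=
    Finset.prod_ne_zero_iff.2 fun i _ => pow_ne_zero _ (ht i).ne'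
  apply mul_right_cancel₀ h7
  rw [← h6]
  ring

/-- Otherwise the image of the parametrization, an open set, would be null by Sard's theorem. -/
theorem det_dD_one_ne_zero : LinearMap.det (C.dD (C.sym 1)) ≠ 0 := by
  intro h0
  have h1 := addHaar_image_eq_zero_of_det_fderivWithin_eq_zero (volume : Measure (ι → ℝ))
    (fun x (_ : x ∈ C.Hc) => (C.hasFDerivAt_dsq x).hasFDerivWithinAt) (fun x hx => by
      have h2 := C.det_dD (t := C.sym.symm x) hx
      rw [LinearEquiv.apply_symm_apply, h0, zero_mul] at h2
      exact h2)
  rw [C.image_Hc] at h1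
  exact (C.isOpen_Ωd.measure_pos volume ⟨_, C.dsq_one_mem⟩).ne' h1

theorem π_image_Ω {t : W} (ht : t ∈ C.H) : C.π t '' C.Ω = C.Ω := by
  obtain ⟨s, hs, hts, -⟩ := C.isUnit_of_mem_H ht
  ext y
  constructor
  · rintro ⟨_, ⟨u, hu, rfl⟩, rfl⟩
    exact ⟨t * u, C.mul_mem_H ht hu, (C.π_sq ht u).symm⟩
  · rintro ⟨u, hu, rfl⟩
    refine ⟨_, ⟨s * u, C.mul_mem_H hs hu, rfl⟩, ?_⟩
    rw [C.π_sq ht, ← mul_assoc, hts, one_mul]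

theorem πd_image_Ωd {t : W} (ht : t ∈ C.H) : C.πd t '' C.Ωd = C.Ωd := by
  obtain ⟨s, hs, -, hst⟩ := C.isUnit_of_mem_H ht
  ext y
  constructor
  · rintro ⟨_, ⟨u, hu, rfl⟩, rfl⟩
    exact ⟨u * t, C.mul_mem_H hu ht, (C.πd_dsq hu t).symm⟩
  · rintro ⟨u, hu, rfl⟩
    refine ⟨_, ⟨u * s, C.mul_mem_H hu hs, rfl⟩, ?_⟩
    rw [C.πd_dsq (C.mul_mem_H hu hs), mul_assoc, hst, mul_one]

variable {C}

theorem Qp_π {t : W} (ht : t ∈ C.H) {y : ι → ℝ} (hy : y ∈ C.Ω) (α : Fin r → ℝ) :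
    C.Qp α (C.π t y) = C.χ α t * C.Qp α y := by
  obtain ⟨s, hs, rfl⟩ := hy
  rw [C.π_sq ht, Qp_sq (C.mul_mem_H ht hs), Qp_sq hs, χ_mul]

theorem Qdp_πd {t : W} (ht : t ∈ C.H) {y : ι → ℝ} (hy : y ∈ C.Ωd) (α : Fin r → ℝ) :
    C.Qdp α (C.πd t y) = C.χ α t * C.Qdp α y := by
  obtain ⟨s, hs, rfl⟩ := hy
  rw [C.πd_dsq hs, Qdp_dsq (C.mul_mem_H hs ht), Qdp_dsq hs, χ_mul, mul_comm]

theorem abs_det_π {t : W} (ht : t ∈ C.H) : |LinearMap.det (C.π t)| = C.χ C.τ t := by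
  rw [C.det_π ht, abs_of_pos (Finset.prod_pos fun i _ => pow_pos (ht i) _), χ]
  refine Finset.prod_congr rfl fun i _ => ?_
  rw [← Real.rpow_natCast (C.ρ i t) 2, ← Real.rpow_mul (ht i).le, ← Real.rpow_natCast]
  congr 1
  simp only [τ, Nat.cast_add, Nat.cast_ofNat]
  ring

theorem det_π_ne_zero {t : W} (ht : t ∈ C.H) : LinearMap.det (C.π t) ≠ 0 := by
  rw [← abs_pos, abs_det_π ht]
  exact χ_pos ht _

/-- Change of variables in `Ω`. -/
theorem lintegral_Ω_π {t : W} (ht : t ∈ C.H) (f : (ι → ℝ) → ℝ≥0∞) :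
    ∫⁻ y in C.Ω, f y = ENNReal.ofReal (C.χ C.τ t) * ∫⁻ y in C.Ω, f (C.π t y) := by
  have h := setLIntegral_image_linearMap C.isOpen_Ω.measurableSet (det_π_ne_zero ht) f
  rwa [C.π_image_Ω ht, abs_det_π ht] at h

theorem lintegral_Ωd_πd {t : W} (ht : t ∈ C.H) (f : (ι → ℝ) → ℝ≥0∞) :
    ∫⁻ y in C.Ωd, f y = ENNReal.ofReal (C.χ C.τ t) * ∫⁻ y in C.Ωd, f (C.πd t y) := by
  have h := setLIntegral_image_linearMap C.isOpen_Ωd.measurableSet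
    (L := C.πd t) (by rw [C.det_πd]; exact det_π_ne_zero ht) f
  rwa [C.πd_image_Ωd ht, C.det_πd, abs_det_π ht] at h

theorem χ_inv {s t : W} (h : s * t = 1) (α : Fin r → ℝ) : C.χ α s * C.χ α t = 1 := by
  rw [← χ_mul, h, χ_one]

theorem χ_neg {t : W} (ht : t ∈ C.H) (α : Fin r → ℝ) : C.χ (-α) t * C.χ α t = 1 := by
  rw [← χ_add ht, neg_add_cancel]
  simp [χ]

/-- The gamma integral of `Ω`. -/
theorem lintegral_gamma {α : Fin r → ℝ} (hα : ∀ i, (C.m i : ℝ) / 2 < α i) :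
    ∃ Γ > 0, ∀ ξ ∈ C.Ωd, ∫⁻ y in C.Ω, ENNReal.ofReal (Real.exp (-(y ⬝ᵥ ξ)) * C.Qp (α - C.τ) y) =
      ENNReal.ofReal (Γ * C.Qdp (-α) ξ) := by
  obtain ⟨Γ, hΓ, h⟩ := C.lintegral_param C.sq_injOn (fun x _ => C.hasFDerivAt_sq x) one_ne_zero
    (fun t ht => C.det_Bcoord ht) (β := α - C.τ) (fun i => by
      have := hα i
      simp only [Pi.sub_apply, τ, Nat.cast_add, Nat.cast_one]
      linarith) (E := fun y => C.tr y) (P := C.Qp (α - C.τ)) (fun t ht => rfl)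
    (fun t ht => Qp_sq ht _)
  refine ⟨Γ, hΓ, ?_⟩
  rintro _ ⟨t, ht, rfl⟩
  obtain ⟨s, hs, hts, hst⟩ := C.isUnit_of_mem_H ht
  rw [lintegral_Ω_π hs]
  have h1 : ∀ y ∈ C.Ω, ENNReal.ofReal (Real.exp (-(C.π s y ⬝ᵥ C.dsq t)) *
      C.Qp (α - C.τ) (C.π s y)) = ENNReal.ofReal (C.χ (α - C.τ) s) *
      ENNReal.ofReal (Real.exp (-C.tr y) * C.Qp (α - C.τ) y) := by
    intro y hy
    have h2 : C.π t (C.π s y) = y := by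
      rw [← LinearMap.comp_apply, ← C.π_mul ht, hts, C.π_one, LinearMap.id_apply]
    rw [← ENNReal.ofReal_mul (χ_pos hs _).le, Qp_π hs hy, C.dotProduct_dsq, h2]
    congr 1
    ring
  rw [setLIntegral_congr_fun C.isOpen_Ω.measurableSet h1,
    lintegral_const_mul' _ _ ENNReal.ofReal_ne_top, show C.Ω = C.sq '' C.H from rfl, h, ← mul_assoc,
    ← ENNReal.ofReal_mul (χ_pos hs _).le, ← ENNReal.ofReal_mul (by
      exact mul_nonneg (χ_pos hs _).le (χ_pos hs _).le), ← χ_add hs, Qdp_dsq ht]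
  congr 1
  have h2 := χ_inv (C := C) hst α
  have h3 := χ_neg ht α
  have h4 : C.χ (C.τ + (α - C.τ)) s = C.χ (-α) t := by
    rw [add_sub_cancel]
    exact mul_right_cancel₀ (χ_pos ht α).ne' (h2.trans h3.symm)
  rw [h4, mul_comm]

/-- The gamma integral of the dual cone. -/
theorem lintegral_gammad {α : Fin r → ℝ} (hα : ∀ i, (C.n i : ℝ) / 2 < α i) :
    ∃ Γ > 0, ∀ y ∈ C.Ω, ∫⁻ ξ in C.Ωd, ENNReal.ofReal (Real.exp (-(y ⬝ᵥ ξ)) * C.Qdp (α - C.τ) ξ) =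
      ENNReal.ofReal (Γ * C.Qp (-α) y) := by
  obtain ⟨Γ, hΓ, h⟩ := C.lintegral_param C.dsq_injOn (fun x _ => C.hasFDerivAt_dsq x)
    C.det_dD_one_ne_zero (fun t ht => C.det_dD ht) (β := α - C.τ) (fun i => by
      have := hα i
      simp only [Pi.sub_apply, τ, Nat.cast_add, Nat.cast_one]
      linarith) (E := fun ξ => C.sq 1 ⬝ᵥ ξ) (P := C.Qdp (α - C.τ)) (fun t ht => by
        rw [C.dotProduct_dsq, C.π_sq_one])
    (fun t ht => Qdp_dsq ht _)
  refine ⟨Γ, hΓ, ?_⟩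
  rintro _ ⟨t, ht, rfl⟩
  obtain ⟨s, hs, hts, hst⟩ := C.isUnit_of_mem_H ht
  rw [lintegral_Ωd_πd hs]
  have h1 : ∀ ξ ∈ C.Ωd, ENNReal.ofReal (Real.exp (-(C.sq t ⬝ᵥ C.πd s ξ)) *
      C.Qdp (α - C.τ) (C.πd s ξ)) = ENNReal.ofReal (C.χ (α - C.τ) s) *
      ENNReal.ofReal (Real.exp (-(C.sq 1 ⬝ᵥ ξ)) * C.Qdp (α - C.τ) ξ) := by
    intro ξ hξ
    rw [← ENNReal.ofReal_mul (χ_pos hs _).le, Qdp_πd hs hξ, C.dotProduct_πd, C.π_sq hs, hst]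
    congr 1
    ring
  rw [setLIntegral_congr_fun C.isOpen_Ωd.measurableSet h1,
    lintegral_const_mul' _ _ ENNReal.ofReal_ne_top, show C.Ωd = C.dsq '' C.H from rfl, h,
    ← mul_assoc,
    ← ENNReal.ofReal_mul (χ_pos hs _).le, ← ENNReal.ofReal_mul (by
      exact mul_nonneg (χ_pos hs _).le (χ_pos hs _).le), ← χ_add hs, Qp_sq ht]
  congr 1
  have h2 := χ_inv (C := C) hst α
  have h3 := χ_neg ht α
  have h4 : C.χ (C.τ + (α - C.τ)) s = C.χ (-α) t := by
    rw [add_sub_cancel]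
    exact mul_right_cancel₀ (χ_pos ht α).ne' (h2.trans h3.symm)
  rw [h4, mul_comm]

end ConeData

/-! ### Monotonicity and continuity of the generalized powers -/

/-- A homogeneous function on an open cone that is monotone for the order of the cone is
continuous. -/
theorem continuousOn_of_antitone_of_homogeneous {E : Type*} [NormedAddCommGroup E]
    [NormedSpace ℝ E] {K : Set E} (hK : IsOpen K)
    (hsmul : ∀ y ∈ K, ∀ a : ℝ, 0 < a → a • y ∈ K) {f : E → ℝ} {s : ℝ}
    (hanti : ∀ y ∈ K, ∀ z ∈ K, f (y + z) ≤ f y)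
    (hhom : ∀ y ∈ K, ∀ a : ℝ, 0 < a → f (a • y) = a ^ s * f y) : ContinuousOn f K := by
  intro y₀ hy₀
  refine ContinuousAt.continuousWithinAt ?_
  rw [ContinuousAt, tendsto_order]
  have hlim : ∀ s : ℝ, Filter.Tendsto (fun a : ℝ => a ^ s * f y₀) (nhdsWithin 1 (Set.Ioi 1))
      (nhds (f y₀)) := fun s => by
    have h1 : ContinuousAt (fun a : ℝ => a ^ s * f y₀) 1 :=
      (Real.continuousAt_rpow_const 1 s (Or.inl one_ne_zero)).mul continuousAt_const
    have h2 := h1.tendsto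
    rw [Real.one_rpow, one_mul] at h2
    exact h2.mono_left nhdsWithin_le_nhds
  have hmem : ∀ a : ℝ, 1 < a → a • y₀ - y₀ ∈ K := fun a ha => by
    have h : a • y₀ - y₀ = (a - 1) • y₀ := by rw [sub_smul, one_smul]
    rw [h]; exact hsmul _ hy₀ _ (by linarith)
  constructor
  · intro l hl
    obtain ⟨a, hal, ha⟩ := (((tendsto_order.1 (hlim s)).1 l hl).and self_mem_nhdsWithin).exists
    have ha1 : 1 < a := ha
    have hev : ∀ᶠ y in nhds y₀, y ∈ K ∧ a • y₀ - y ∈ K := by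
      refine (show ∀ᶠ y in nhds y₀, y ∈ K from hK.mem_nhds hy₀).and ?_
      exact (continuous_const.sub continuous_id).continuousAt.eventually (hK.mem_nhds (hmem a ha1))
    filter_upwards [hev] with y hy
    refine lt_of_lt_of_le hal ?_
    rw [← hhom _ hy₀ a (by linarith)]
    have := hanti y hy.1 _ hy.2
    rwa [add_sub_cancel] at this
  · intro l hl
    obtain ⟨a, hal, ha⟩ := (((tendsto_order.1 (hlim (-s))).2 l hl).and self_mem_nhdsWithin).exists
    have ha1 : 1 < a := ha
    have hev : ∀ᶠ y in nhds y₀, y ∈ K ∧ a • y - y₀ ∈ K := by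
      refine (show ∀ᶠ y in nhds y₀, y ∈ K from hK.mem_nhds hy₀).and ?_
      exact ((continuous_const_smul a).sub continuous_const).continuousAt.eventually
        (hK.mem_nhds (hmem a ha1))
    filter_upwards [hev] with y hy
    refine lt_of_le_of_lt ?_ hal
    have h1 := hanti y₀ hy₀ _ hy.2
    rw [add_sub_cancel, hhom y hy.1 a (by linarith)] at h1
    rw [Real.rpow_neg (by linarith), inv_mul_eq_div, le_div_iff₀ (Real.rpow_pos_of_pos (by linarith) _)]
    linarith

namespace ConeData

variable {r : ℕ} {ι W : Type*} [Fintype ι] [Ring W] [Algebra ℝ W] {C : ConeData r ι W}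

/-- By the gamma integral of the dual cone, `Q^{-α}` is a Laplace transform of a positive
function. -/
theorem Qp_add_le {α : Fin r → ℝ} (hα : ∀ i, (C.n i : ℝ) / 2 < α i) {y z : ι → ℝ} (hy : y ∈ C.Ω)
    (hz : z ∈ closure C.Ω) : C.Qp (-α) (y + z) ≤ C.Qp (-α) y := by
  obtain ⟨Γ, hΓ, h⟩ := lintegral_gammad hα
  have hyz := C.add_mem_Ω hy hz
  have h1 : ENNReal.ofReal (Γ * C.Qp (-α) (y + z)) ≤ ENNReal.ofReal (Γ * C.Qp (-α) y) := by
    rw [← h y hy, ← h _ hyz]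
    refine setLIntegral_mono_ae' C.isOpen_Ωd.measurableSet
      (Filter.Eventually.of_forall fun ξ hξ => ENNReal.ofReal_le_ofReal ?_)
    have h2 := C.dotProduct_nonneg_closure hz hξ
    have h3 := (Qdp_pos hξ (α - C.τ)).le
    gcongr
    rw [add_dotProduct]
    linarith
  rw [ENNReal.ofReal_le_ofReal_iff (mul_pos hΓ (Qp_pos hy _)).le] at h1
  exact le_of_mul_le_mul_left h1 hΓ

theorem Qdp_add_le {α : Fin r → ℝ} (hα : ∀ i, (C.m i : ℝ) / 2 < α i) {ξ η : ι → ℝ}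
    (hξ : ξ ∈ C.Ωd) (hη : ∀ y ∈ C.Ω, 0 ≤ y ⬝ᵥ η) : C.Qdp (-α) (ξ + η) ≤ C.Qdp (-α) ξ := by
  obtain ⟨Γ, hΓ, h⟩ := lintegral_gamma hα
  have hyz := C.add_mem_Ωd hξ hη
  have h1 : ENNReal.ofReal (Γ * C.Qdp (-α) (ξ + η)) ≤ ENNReal.ofReal (Γ * C.Qdp (-α) ξ) := by
    rw [← h ξ hξ, ← h _ hyz]
    refine setLIntegral_mono_ae' C.isOpen_Ω.measurableSet
      (Filter.Eventually.of_forall fun y hy => ENNReal.ofReal_le_ofReal ?_)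
    have h2 := hη y hy
    have h3 := (Qp_pos hy (α - C.τ)).le
    gcongr
    rw [dotProduct_add]
    linarith
  rw [ENNReal.ofReal_le_ofReal_iff (mul_pos hΓ (Qdp_pos hξ _)).le] at h1
  exact le_of_mul_le_mul_left h1 hΓ

/-- For large exponents by monotonicity and homogeneity; a general power is a quotient of two of
these. -/
theorem continuousOn_Qp (α : Fin r → ℝ) : ContinuousOn (C.Qp α) C.Ω := by
  have h0 : ∀ β : Fin r → ℝ, (∀ i, (C.n i : ℝ) / 2 < β i) → ContinuousOn (C.Qp (-β)) C.Ω :=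
    fun β hβ => continuousOn_of_antitone_of_homogeneous C.isOpen_Ω
      (fun y hy a ha => C.smul_mem_Ω hy ha)
      (fun y hy z hz => Qp_add_le hβ hy (subset_closure hz)) (fun y hy a ha => Qp_smul hy ha _)
  set β : Fin r → ℝ := fun i => (C.n i : ℝ) / 2 + 1 + |α i|
  have h1 := h0 β fun i => by
    have := abs_nonneg (α i); simp only [β]; linarith
  have h2 := h0 (β + α) fun i => by
    have := neg_abs_le (α i); simp only [β, Pi.add_apply]; linarith
  refine (h1.div h2 fun y hy => (Qp_pos hy _).ne').congr fun y hy => ?_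
  rw [Pi.div_apply, eq_div_iff (Qp_pos hy _).ne', ← Qp_add hy]
  congr 1
  abel

theorem continuousOn_Qdp (α : Fin r → ℝ) : ContinuousOn (C.Qdp α) C.Ωd := by
  have h0 : ∀ β : Fin r → ℝ, (∀ i, (C.m i : ℝ) / 2 < β i) → ContinuousOn (C.Qdp (-β)) C.Ωd :=
    fun β hβ => continuousOn_of_antitone_of_homogeneous C.isOpen_Ωd
      (fun y hy a ha => C.smul_mem_Ωd hy ha)
      (fun y hy z hz => Qdp_add_le hβ hy fun x hx => C.dotProduct_nonneg hx hz)
      (fun y hy a ha => Qdp_smul hy ha _)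
  set β : Fin r → ℝ := fun i => (C.m i : ℝ) / 2 + 1 + |α i|
  have h1 := h0 β fun i => by
    have := abs_nonneg (α i); simp only [β]; linarith
  have h2 := h0 (β + α) fun i => by
    have := neg_abs_le (α i); simp only [β, Pi.add_apply]; linarith
  refine (h1.div h2 fun y hy => (Qdp_pos hy _).ne').congr fun y hy => ?_
  rw [Pi.div_apply, eq_div_iff (Qdp_pos hy _).ne', ← Qdp_add hy]
  congr 1
  abel

variable (C) in
/-- The diagonal entries of the Hermitian elements. -/
def entry (j : Fin r) : (ι → ℝ) →ₗ[ℝ] ℝ := (2 : ℝ) • ((C.ρ j).toLinearMap ∘ₗ C.sym.symm.toLinearMap)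

theorem entry_apply (j : Fin r) (y : ι → ℝ) : C.entry j y = 2 * C.ρ j (C.sym.symm y) := rfl

theorem tr_π_diag (v : Fin r → ℝ) (y : ι → ℝ) :
    C.tr (C.π (C.diag v) y) = ∑ i, v i ^ 2 * C.entry i y := by
  obtain ⟨s, rfl⟩ := C.sym.surjective y
  rw [C.π_sym, C.B_diag, C.tr_sym, Finset.mul_sum]
  refine Finset.sum_congr rfl fun i _ => ?_
  simp only [map_mul, C.ρ_diag, entry_apply, LinearEquiv.symm_apply_apply]
  ring

theorem entry_nonneg {y : ι → ℝ} (hy : y ∈ closure C.Ω) (j : Fin r) : 0 ≤ C.entry j y := by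
  have h1 : ∀ ε : ℝ, 0 < ε → 0 ≤ C.entry j y + ε ^ 2 * ∑ i ∈ Finset.univ.erase j, C.entry i y := by
    intro ε hε
    have h := C.tr_π_nonneg_of_mem_closure hy
      (C.diag_mem_H (v := fun i => if i = j then 1 else ε) fun i => by split_ifs <;> positivity)
    rw [tr_π_diag, ← Finset.add_sum_erase _ _ (Finset.mem_univ j)] at h
    rw [Finset.mul_sum]
    refine h.trans (le_of_eq ?_)
    congr 1
    · simp
    · refine Finset.sum_congr rfl fun i hi => ?_
      rw [if_neg (Finset.ne_of_mem_erase hi)]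
  set S := ∑ i ∈ Finset.univ.erase j, C.entry i y
  have h2 : Filter.Tendsto (fun ε : ℝ => C.entry j y + ε ^ 2 * S) (nhdsWithin 0 (Set.Ioi 0))
      (nhds (C.entry j y + 0 ^ 2 * S)) := by
    have : Continuous fun ε : ℝ => C.entry j y + ε ^ 2 * S := by fun_prop
    exact (this.tendsto 0).mono_left nhdsWithin_le_nhds
  have h3 := ge_of_tendsto h2 (Filter.eventually_of_mem self_mem_nhdsWithin fun ε hε => h1 ε hε)
  simpa using h3

theorem dotProduct_pos_of_mem_closure {y ξ : ι → ℝ} (hy : y ∈ closure C.Ω) (hy0 : y ≠ 0)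
    (hξ : ξ ∈ C.Ωd) : 0 < y ⬝ᵥ ξ := by
  have h1 : ∀ᶠ ε in nhds (0 : ℝ), ξ - ε • y ∈ C.Ωd := by
    have hc : Continuous fun ε : ℝ => ξ - ε • y := by fun_prop
    exact hc.continuousAt.eventually (C.isOpen_Ωd.mem_nhds (by simpa using hξ))
  obtain ⟨ε, hε, hε0⟩ := ((h1.filter_mono nhdsWithin_le_nhds).and
    (self_mem_nhdsWithin : Set.Ioi (0 : ℝ) ∈ nhdsWithin 0 (Set.Ioi 0))).exists
  have hε0' : 0 < ε := hε0
  have h2 := C.dotProduct_nonneg_closure hy hε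
  rw [dotProduct_sub, dotProduct_smul, smul_eq_mul] at h2
  have h3 : 0 < y ⬝ᵥ y := by
    have := Matrix.dotProduct_self_star_pos_iff.2 hy0
    rwa [star_trivial] at this
  nlinarith [mul_pos hε0' h3]

end ConeData

/-! ### Hermitian forms with values in the cone -/

theorem exists_lintegral_comp_linearEquiv {k : ℕ} (L : (Fin k → ℂ) ≃ₗ[ℂ] (Fin k → ℂ)) :
    ∃ c > 0, ∀ f : (Fin k → ℂ) → ℝ≥0∞, ∫⁻ u, f (L u) = ENNReal.ofReal c * ∫⁻ u, f u := by
  set L' := (L.toContinuousLinearEquiv).restrictScalars ℝ with hL'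
  have h1 : (Measure.map L' (volume : Measure (Fin k → ℂ))).IsAddHaarMeasure :=
    L'.isAddHaarMeasure_map volume
  have h2 := Measure.isAddLeftInvariant_eq_smul (Measure.map L' (volume : Measure (Fin k → ℂ)))
    (volume : Measure (Fin k → ℂ))
  set c := Measure.addHaarScalarFactor (Measure.map L' (volume : Measure (Fin k → ℂ))) volume
  have hc : 0 < c := Measure.addHaarScalarFactor_pos_of_isAddHaarMeasure _ _
  refine ⟨c, hc, fun f => ?_⟩
  have h3 : ∫⁻ u, f (L u) = ∫⁻ u, f u ∂(Measure.map L' volume) :=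
    (lintegral_map_equiv f L'.toHomeomorph.toMeasurableEquiv).symm
  rw [h3, h2, lintegral_smul_measure]
  simp [ENNReal.smul_def]

theorem lintegral_gaussian_pi {k : ℕ} {a : Fin k → ℝ} (ha : ∀ i, 0 < a i) :
    ∫⁻ u : Fin k → ℂ, ENNReal.ofReal (Real.exp (-∑ i, a i * ‖u i‖ ^ 2)) =
      ENNReal.ofReal (∏ i, (Real.pi / a i)) := by
  have h1 : ∀ i, Integrable fun z : ℂ => Real.exp (-a i * ‖z‖ ^ 2) := fun i => by
    have := (GaussianFourier.integrable_cexp_neg_mul_sq_norm_add (V := ℂ) (b := a i)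
      (by simpa using ha i) 0 0).norm
    refine this.congr (Filter.Eventually.of_forall fun z => ?_)
    simp [Complex.norm_exp, ← Complex.ofReal_pow]
  have h2 : ∀ u : Fin k → ℂ, Real.exp (-∑ i, a i * ‖u i‖ ^ 2) =
      ∏ i, Real.exp (-a i * ‖u i‖ ^ 2) := fun u => by
    rw [← Real.exp_sum, ← Finset.sum_neg_distrib]
    simp
  simp_rw [h2]
  have h3 : Integrable (fun u : Fin k → ℂ => ∏ i, Real.exp (-a i * ‖u i‖ ^ 2)) volume :=
    Integrable.fintype_prod (f := fun i (z : ℂ) => Real.exp (-a i * ‖z‖ ^ 2)) h1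
  rw [← ofReal_integral_eq_lintegral_ofReal h3
    (Filter.Eventually.of_forall fun u => Finset.prod_nonneg fun i _ => (Real.exp_pos _).le),
    integral_fintype_prod_volume_eq_prod (fun i (z : ℂ) => Real.exp (-a i * ‖z‖ ^ 2))]
  congr 1
  refine Finset.prod_congr rfl fun i _ => ?_
  rw [GaussianFourier.integral_rexp_neg_mul_sq_norm (ha i), Complex.finrank_real_complex]
  norm_num

theorem eq_one_of_pow_bounded {x A B : ℝ} (hA : 0 < A)
    (h : ∀ n : ℕ, A ≤ x ^ n ∧ x ^ n ≤ B) : x = 1 := by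
  rcases lt_trichotomy x 1 with h1 | h1 | h1
  · obtain ⟨n, hn⟩ := exists_pow_lt_of_lt_one hA h1
    exact absurd (h n).1 (not_le.2 hn)
  · exact h1
  · obtain ⟨n, hn⟩ := pow_unbounded_of_one_lt B h1
    exact absurd (h n).2 (not_le.2 hn)

/-- A Hermitian form with values in the complexification of the space of the cone, which is
positive and homogeneous with respect to the cone. -/
structure FormData {r : ℕ} {ι W : Type*} [Fintype ι] [Ring W] [Algebra ℝ W] (C : ConeData r ι W)
    (k : ℕ) where
  F : (Fin k → ℂ) →ₗ[ℂ] (Fin k → ℂ) →ₗ⋆[ℂ] (ι → ℂ)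
  hermitian : ∀ u v, F v u = star (F u v)
  mem_closure : ∀ u, (fun i => (F u u i).re) ∈ closure C.Ω
  eq_zero : ∀ u, F u u = 0 → u = 0
  homogeneous : ∀ t ∈ C.H, ∃ t' : (Fin k → ℂ) ≃ₗ[ℂ] (Fin k → ℂ),
    ∀ u, C.π t (fun i => (F u u i).re) = fun i => (F (t' u) (t' u) i).re

namespace FormData

variable {r : ℕ} {ι W : Type*} [Fintype ι] [Ring W] [Algebra ℝ W] {C : ConeData r ι W}
  {k : ℕ} (Φ : FormData C k)

/-- The values of the form on the diagonal. -/
def fd (u : Fin k → ℂ) : ι → ℝ := fun i => (Φ.F u u i).re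

theorem F_self (u : Fin k → ℂ) : Φ.F u u = fun i => (Φ.fd u i : ℂ) := by
  ext i
  have h := congrFun (Φ.hermitian u u) i
  exact (Complex.conj_eq_iff_re.1 h.symm).symm

theorem fd_smul (a : ℂ) (u : Fin k → ℂ) : Φ.fd (a • u) = ‖a‖ ^ 2 • Φ.fd u := by
  ext i
  have h : a * (starRingEnd ℂ) a = ((‖a‖ ^ 2 : ℝ) : ℂ) := by
    rw [Complex.mul_conj, Complex.normSq_eq_norm_sq]
  have h2 : Φ.F (a • u) (a • u) i = ((‖a‖ ^ 2 : ℝ) : ℂ) * Φ.F u u i := by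
    have h3 : Φ.F (a • u) (a • u) = a • (starRingEnd ℂ) a • Φ.F u u := by
      rw [LinearMap.map_smul Φ.F a u, LinearMap.smul_apply, LinearMap.map_smulₛₗ]
    rw [← h, h3]
    simp only [Pi.smul_apply, smul_eq_mul]
    ring
  rw [Pi.smul_apply, smul_eq_mul, fd, fd, h2, Complex.re_ofReal_mul]

theorem fd_eq_zero {u : Fin k → ℂ} (h : Φ.fd u = 0) : u = 0 := by
  refine Φ.eq_zero u ?_
  rw [F_self, h]
  ext i; simp

theorem F_eq_sum (u v : Fin k → ℂ) : Φ.F u v =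
    ∑ a, ∑ b, (u a * star (v b)) • Φ.F (Pi.single a 1) (Pi.single b 1) := by
  have hs : ∀ w : Fin k → ℂ, w = ∑ a, w a • (Pi.single a 1 : Fin k → ℂ) := fun w => by
    conv_lhs => rw [← Finset.univ_sum_single w]
    refine Finset.sum_congr rfl fun a _ => ?_
    rw [← Pi.single_smul, smul_eq_mul, mul_one]
  conv_lhs => rw [hs u, hs v]
  simp only [map_sum, LinearMap.sum_apply, map_smul, LinearMap.smul_apply, LinearMap.map_smulₛₗ,
    Finset.smul_sum, smul_smul]
  rw [Finset.sum_comm]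
  refine Finset.sum_congr rfl fun a _ => Finset.sum_congr rfl fun b _ => ?_
  rw [mul_comm, starRingEnd_apply]

theorem continuous_F : Continuous fun p : (Fin k → ℂ) × (Fin k → ℂ) => Φ.F p.1 p.2 := by
  have h : (fun p : (Fin k → ℂ) × (Fin k → ℂ) => Φ.F p.1 p.2) = fun p =>
      ∑ a, ∑ b, (p.1 a * star (p.2 b)) • Φ.F (Pi.single a 1) (Pi.single b 1) :=
    funext fun p => Φ.F_eq_sum p.1 p.2
  rw [h]
  fun_prop

theorem continuous_fd : Continuous Φ.fd := by
  have h := Φ.continuous_F.comp (continuous_id.prodMk continuous_id)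
  exact continuous_pi fun i => Complex.continuous_re.comp ((continuous_apply i).comp h)

/-- The matrix of the `j`-th diagonal entry of the form. -/
def mat (j : Fin r) : Matrix (Fin k) (Fin k) ℂ := by
  classical
  exact Matrix.of fun a b => ∑ i, Φ.F (Pi.single a 1) (Pi.single b 1) i *
    (C.entry j (Pi.single i 1) : ℂ)

/-- The rank of the `j`-th diagonal entry of the form. -/
def b (j : Fin r) : ℕ := (Φ.mat j).rank

theorem isHermitian_mat (j : Fin r) : (Φ.mat j).IsHermitian := by
  ext a b
  simp only [Matrix.conjTranspose_apply, mat, Matrix.of_apply, star_sum, star_mul']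
  refine Finset.sum_congr rfl fun i _ => ?_
  rw [Φ.hermitian (Pi.single b 1) (Pi.single a 1)]
  simp

theorem entry_fd (j : Fin r) (u : Fin k → ℂ) : C.entry j (Φ.fd u) =
    (∑ a, ∑ b, u a * star (u b) * Φ.mat j a b).re := by
  classical
  have h1 : C.entry j (Φ.fd u) = (∑ i, Φ.F u u i * (C.entry j (Pi.single i 1) : ℂ)).re := by
    rw [← dotProduct_dualVec, Complex.re_sum]
    refine Finset.sum_congr rfl fun i _ => ?_
    rw [Complex.re_mul_ofReal]
    rfl
  rw [h1]
  congr 1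
  simp_rw [F_eq_sum Φ u u, mat, Matrix.of_apply, Finset.sum_apply, Finset.sum_mul, Finset.mul_sum]
  rw [Finset.sum_comm]
  refine Finset.sum_congr rfl fun a _ => ?_
  rw [Finset.sum_comm]
  refine Finset.sum_congr rfl fun b _ => Finset.sum_congr rfl fun i _ => ?_
  simp [mul_assoc]

/-- Coordinates in which a given diagonal entry of the form is diagonal; the number of nonzero
coefficients is its rank. -/
theorem exists_diagonalization (j : Fin r) : ∃ L : (Fin k → ℂ) ≃ₗ[ℂ] (Fin k → ℂ),
    ∃ l : Fin k → ℝ, (∀ i, 0 ≤ l i) ∧ (Finset.univ.filter fun i => l i ≠ 0).card = Φ.b j ∧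
    ∀ w, C.entry j (Φ.fd (L w)) = ∑ i, l i * ‖w i‖ ^ 2 := by
  classical
  have hM := Φ.isHermitian_mat j
  set U : Matrix (Fin k) (Fin k) ℂ := (hM.eigenvectorUnitary : Matrix (Fin k) (Fin k) ℂ) with hU
  have hU1 : U * star U = 1 := Unitary.coe_mul_star_self hM.eigenvectorUnitary
  have hU2 : star U * U = 1 := Unitary.coe_star_mul_self hM.eigenvectorUnitary
  have hspec : ∀ a b, Φ.mat j a b = ∑ i, U a i * (hM.eigenvalues i : ℂ) * star (U b i) := by
    intro a b
    conv_lhs => rw [hM.spectral_theorem, Unitary.conjStarAlgAut_apply]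
    rw [Matrix.mul_apply]
    refine Finset.sum_congr rfl fun i _ => ?_
    rw [Matrix.mul_diagonal]
    rfl
  have hent : ∀ u, C.entry j (Φ.fd u) = ∑ i, hM.eigenvalues i * ‖Matrix.vecMul u U i‖ ^ 2 := by
    intro u
    rw [entry_fd]
    have : ∑ a, ∑ b, u a * star (u b) * Φ.mat j a b =
        ((∑ i, hM.eigenvalues i * ‖Matrix.vecMul u U i‖ ^ 2 : ℝ) : ℂ) := by
      simp_rw [hspec, Finset.mul_sum]
      rw [Complex.ofReal_sum]
      have e1 : ∀ i, ((hM.eigenvalues i * ‖Matrix.vecMul u U i‖ ^ 2 : ℝ) : ℂ) =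
          ∑ a, ∑ b, u a * star (u b) * (U a i * (hM.eigenvalues i : ℂ) * star (U b i)) := by
        intro i
        rw [Complex.ofReal_mul, Complex.ofReal_pow, ← Complex.mul_conj', Matrix.vecMul, dotProduct,
          map_sum, Finset.sum_mul_sum, Finset.mul_sum]
        refine Finset.sum_congr rfl fun a _ => ?_
        rw [Finset.mul_sum]
        refine Finset.sum_congr rfl fun b _ => ?_
        simp only [map_mul, ← starRingEnd_apply]
        ring
      simp_rw [e1]
      rw [Finset.sum_comm]
      conv_rhs => rw [Finset.sum_comm]
      rw [Finset.sum_comm]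
      refine Finset.sum_congr rfl fun a _ => ?_
      rw [Finset.sum_comm]
    rw [this, Complex.ofReal_re]
  set L : (Fin k → ℂ) ≃ₗ[ℂ] (Fin k → ℂ) := LinearEquiv.ofLinearMap (Matrix.vecMulLinear (star U))
    (Matrix.vecMulLinear U) (LinearMap.ext fun x => by simp [Matrix.vecMul_vecMul, hU1])
    (LinearMap.ext fun x => by simp [Matrix.vecMul_vecMul, hU2])
  have hL : ∀ w, Matrix.vecMul (L w) U = w := fun w => by
    change Matrix.vecMul (Matrix.vecMul w (star U)) U = w
    rw [Matrix.vecMul_vecMul, hU2, Matrix.vecMul_one]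
  have hLw : ∀ w, C.entry j (Φ.fd (L w)) = ∑ i, hM.eigenvalues i * ‖w i‖ ^ 2 := fun w => by
    rw [hent, hL]
  refine ⟨L, hM.eigenvalues, fun i => ?_, ?_, hLw⟩
  · have h := hLw (Pi.single i 1)
    rw [Finset.sum_eq_single i (fun b _ hb => by simp [hb]) (by simp)] at h
    simp only [Pi.single_eq_same, norm_one, one_pow, mul_one] at h
    rw [← h]
    exact ConeData.entry_nonneg (Φ.mem_closure _) j
  · rw [b, hM.rank_eq_card_non_zero_eigs, Fintype.card_subtype]

theorem tr_fd_pos {u : Fin k → ℂ} (hu : u ≠ 0) : 0 < C.tr (Φ.fd u) := by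
  have h := ConeData.dotProduct_pos_of_mem_closure (Φ.mem_closure u)
    (fun h => hu (Φ.fd_eq_zero h)) C.dsq_one_mem
  rwa [C.dotProduct_dsq, C.π_one] at h

/-- By compactness of the unit sphere the definite form `tr F(u,u)` is comparable to any Hermitian
norm. -/
theorem exists_bounds (L : (Fin k → ℂ) ≃ₗ[ℂ] (Fin k → ℂ)) : ∃ c > 0, ∃ M > 0, ∀ w,
    c * ∑ i, ‖w i‖ ^ 2 ≤ C.tr (Φ.fd (L w)) ∧ C.tr (Φ.fd (L w)) ≤ M * ∑ i, ‖w i‖ ^ 2 := by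
  set g : (Fin k → ℂ) → ℝ := fun w => C.tr (Φ.fd (L w)) with hg
  have hgc : Continuous g := (LinearMap.continuous_on_pi C.tr).comp
    (Φ.continuous_fd.comp (LinearMap.continuous_on_pi L.toLinearMap))
  have hhom : ∀ (a : ℝ) w, g ((a : ℂ) • w) = a ^ 2 * g w := fun a w => by
    simp only [hg]
    rw [map_smul, fd_smul, map_smul, Complex.norm_real, Real.norm_eq_abs, sq_abs, smul_eq_mul]
  have h0 : g 0 = 0 := by
    have := hhom 0 0
    simpa using this
  rcases (Metric.sphere (0 : Fin k → ℂ) 1).eq_empty_or_nonempty with he | hne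
  · have hall : ∀ w : Fin k → ℂ, w = 0 := by
      intro w
      by_contra hw
      have h1 : ((‖w‖⁻¹ : ℝ) : ℂ) • w ∈ Metric.sphere (0 : Fin k → ℂ) 1 := by
        rw [mem_sphere_zero_iff_norm, norm_smul, Complex.norm_real, norm_inv, norm_norm,
          inv_mul_cancel₀ (norm_ne_zero_iff.2 hw)]
      rw [he] at h1
      exact h1
    refine ⟨1, one_pos, 1, one_pos, fun w => ?_⟩
    rw [hall w]
    have h0' : C.tr (Φ.fd (L 0)) = 0 := h0
    rw [h0']
    simp
  · obtain ⟨x, hx, hxm⟩ := (isCompact_sphere (0 : Fin k → ℂ) 1).exists_isMinOn hne hgc.continuousOn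
    obtain ⟨y, hy, hym⟩ := (isCompact_sphere (0 : Fin k → ℂ) 1).exists_isMaxOn hne hgc.continuousOn
    have hpos : 0 < g x := Φ.tr_fd_pos fun h => by
      have : x = 0 := by simpa using h
      rw [this] at hx
      simp at hx
    have hposy : 0 < g y := hpos.trans_le (hxm hy)
    have hk : (0 : ℝ) < k + 1 := by positivity
    have hn1 : ∀ w : Fin k → ℂ, ∑ i, ‖w i‖ ^ 2 ≤ (k + 1) * ‖w‖ ^ 2 := fun w => by
      have : ∀ j ∈ Finset.univ, ‖w j‖ ^ 2 ≤ ‖w‖ ^ 2 := fun j _ =>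
        pow_le_pow_left₀ (norm_nonneg _) (norm_le_pi_norm w j) 2
      refine (Finset.sum_le_card_nsmul _ _ _ this).trans ?_
      rw [nsmul_eq_mul, Finset.card_univ, Fintype.card_fin]
      gcongr
      linarith
    have hn2 : ∀ w : Fin k → ℂ, ‖w‖ ^ 2 ≤ ∑ i, ‖w i‖ ^ 2 := fun w => by
      have h1 : ‖w‖ ≤ Real.sqrt (∑ i, ‖w i‖ ^ 2) := by
        refine (pi_norm_le_iff_of_nonneg (Real.sqrt_nonneg _)).2 fun i => ?_
        refine Real.le_sqrt_of_sq_le ?_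
        exact Finset.single_le_sum (f := fun i => ‖w i‖ ^ 2) (fun i _ => sq_nonneg _)
          (Finset.mem_univ i)
      calc ‖w‖ ^ 2 ≤ Real.sqrt (∑ i, ‖w i‖ ^ 2) ^ 2 := pow_le_pow_left₀ (norm_nonneg _) h1 2
        _ = _ := Real.sq_sqrt (Finset.sum_nonneg fun i _ => sq_nonneg _)
    have hb : ∀ w, g x * ‖w‖ ^ 2 ≤ g w ∧ g w ≤ g y * ‖w‖ ^ 2 := by
      intro w
      rcases eq_or_ne w 0 with rfl | hw
      · rw [h0]; simp
      · have hw' : ‖w‖ ≠ 0 := norm_ne_zero_iff.2 hw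
        have h1 : ((‖w‖⁻¹ : ℝ) : ℂ) • w ∈ Metric.sphere (0 : Fin k → ℂ) 1 := by
          rw [mem_sphere_zero_iff_norm, norm_smul, Complex.norm_real, norm_inv, norm_norm,
            inv_mul_cancel₀ hw']
        have h2 : g w = ‖w‖ ^ 2 * g (((‖w‖⁻¹ : ℝ) : ℂ) • w) := by
          rw [hhom]; field_simp
        rw [h2]
        have h3 : g x ≤ g (((‖w‖⁻¹ : ℝ) : ℂ) • w) := hxm h1
        have h4 : g (((‖w‖⁻¹ : ℝ) : ℂ) • w) ≤ g y := hym h1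
        constructor <;> nlinarith [sq_nonneg ‖w‖]
    refine ⟨g x / (k + 1), div_pos hpos hk, g y, hposy, fun w => ⟨?_, ?_⟩⟩
    · refine le_trans ?_ (hb w).1
      rw [div_mul_eq_mul_div, div_le_iff₀ hk]
      nlinarith [hn1 w]
    · refine (hb w).2.trans ?_
      have := hn2 w
      gcongr

end FormData

/-! ### The Gaussian integral of a Hermitian form -/

namespace FormData

variable {r : ℕ} {ι W : Type*} [Fintype ι] [Ring W] [Algebra ℝ W] {C : ConeData r ι W}
  {k : ℕ} (Φ : FormData C k)

/-- The Gaussian integral `∫ e^{-⟨F(u,u), ξ⟩} du`. -/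
def J (ξ : ι → ℝ) : ℝ≥0∞ := ∫⁻ u, ENNReal.ofReal (Real.exp (-(Φ.fd u ⬝ᵥ ξ)))

/-- Relative invariance: `π(t) F(u,u) = F(t̃u,t̃u)` makes `t` act by a linear change of variables.
-/
theorem J_dsq_mul {t : W} (ht : t ∈ C.H) :
    ∃ κ > 0, ∀ s ∈ C.H, Φ.J (C.dsq (s * t)) = ENNReal.ofReal κ * Φ.J (C.dsq s) := by
  obtain ⟨t', ht'⟩ := Φ.homogeneous t ht
  obtain ⟨c, hc, h⟩ := exists_lintegral_comp_linearEquiv t'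
  refine ⟨c, hc, fun s hs => ?_⟩
  rw [J, J, ← h]
  refine lintegral_congr fun u => ?_
  congr 3
  have e : C.π t (Φ.fd u) = Φ.fd (t' u) := ht' u
  rw [C.dotProduct_dsq, C.dotProduct_dsq, C.π_mul hs, LinearMap.comp_apply, e]

theorem fd_dotProduct_dsq_diag (v : Fin r → ℝ) (u : Fin k → ℂ) :
    Φ.fd u ⬝ᵥ C.dsq (C.diag v) = ∑ i, v i ^ 2 * C.entry i (Φ.fd u) := by
  rw [C.dotProduct_dsq, ConeData.tr_π_diag]

theorem tr_fd (u : Fin k → ℂ) : C.tr (Φ.fd u) = ∑ i, C.entry i (Φ.fd u) := by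
  have h := ConeData.tr_π_diag (C := C) 1 (Φ.fd u)
  rw [C.diag_one, C.π_one] at h
  simpa using h

theorem J_one : 0 < Φ.J (C.dsq 1) ∧ Φ.J (C.dsq 1) < ∞ := by
  obtain ⟨c, hc, M, hM, hb⟩ := Φ.exists_bounds (LinearEquiv.refl ℂ _)
  have h1 : ∀ u, Φ.fd u ⬝ᵥ C.dsq 1 = C.tr (Φ.fd u) := fun u => by
    rw [C.dotProduct_dsq, C.π_one, LinearMap.id_apply]
  simp only [LinearEquiv.refl_apply] at hb
  constructor
  · refine lt_of_lt_of_le ?_ (lintegral_mono (f := fun u : Fin k → ℂ =>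
      ENNReal.ofReal (Real.exp (-∑ i, M * ‖u i‖ ^ 2))) fun u => ?_)
    · rw [lintegral_gaussian_pi (fun _ => hM), ENNReal.ofReal_pos]
      exact Finset.prod_pos fun i _ => by positivity
    · refine ENNReal.ofReal_le_ofReal (Real.exp_le_exp.2 ?_)
      rw [h1, ← Finset.mul_sum]
      linarith [(hb u).2]
  · refine lt_of_le_of_lt (lintegral_mono (g := fun u : Fin k → ℂ =>
      ENNReal.ofReal (Real.exp (-∑ i, c * ‖u i‖ ^ 2))) fun u => ?_) ?_
    · refine ENNReal.ofReal_le_ofReal (Real.exp_le_exp.2 ?_)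
      rw [h1, ← Finset.mul_sum]
      linarith [(hb u).1]
    · rw [lintegral_gaussian_pi (fun _ => hc)]
      exact ENNReal.ofReal_lt_top

theorem J_pos_lt_top {ξ : ι → ℝ} (hξ : ξ ∈ C.Ωd) : 0 < Φ.J ξ ∧ Φ.J ξ < ∞ := by
  obtain ⟨t, ht, rfl⟩ := hξ
  obtain ⟨κ, hκ, h⟩ := Φ.J_dsq_mul ht
  rw [← one_mul t, h 1 C.one_mem_H]
  exact ⟨ENNReal.mul_pos (ENNReal.ofReal_pos.2 hκ).ne' Φ.J_one.1.ne',
    ENNReal.mul_lt_top ENNReal.ofReal_lt_top Φ.J_one.2⟩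

theorem continuous_fd_dotProduct : Continuous fun p : (Fin k → ℂ) × (ι → ℝ) =>
    Φ.fd p.1 ⬝ᵥ p.2 := by
  have h := Φ.continuous_fd
  unfold dotProduct
  fun_prop

theorem integrable_exp_fd {ξ : ι → ℝ} (hξ : ξ ∈ C.Ωd) :
    Integrable fun u => Real.exp (-(Φ.fd u ⬝ᵥ ξ)) := by
  have hc : Continuous fun u => Real.exp (-(Φ.fd u ⬝ᵥ ξ)) :=
    Real.continuous_exp.comp (Φ.continuous_fd_dotProduct.comp
      (continuous_id.prodMk continuous_const)).neg
  refine ⟨hc.aestronglyMeasurable, ?_⟩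
  rw [hasFiniteIntegral_iff_ofReal (Filter.Eventually.of_forall fun u => (Real.exp_pos _).le)]
  exact (Φ.J_pos_lt_top hξ).2

theorem toReal_J {ξ : ι → ℝ} : (Φ.J ξ).toReal = ∫ u, Real.exp (-(Φ.fd u ⬝ᵥ ξ)) := by
  have hc : Continuous fun u => Real.exp (-(Φ.fd u ⬝ᵥ ξ)) :=
    Real.continuous_exp.comp (Φ.continuous_fd_dotProduct.comp
      (continuous_id.prodMk continuous_const)).neg
  rw [integral_eq_lintegral_of_nonneg_ae
    (Filter.Eventually.of_forall fun u => (Real.exp_pos _).le) hc.aestronglyMeasurable]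
  rfl

theorem continuousAt_J {ξ : ι → ℝ} (hξ : ξ ∈ C.Ωd) : ContinuousAt (fun ξ => (Φ.J ξ).toReal) ξ := by
  simp_rw [toReal_J]
  have h2 : (2⁻¹ : ℝ) • ξ ∈ C.Ωd := C.smul_mem_Ωd hξ (by norm_num)
  refine continuousAt_of_dominated (bound := fun u => Real.exp (-(Φ.fd u ⬝ᵥ ((2⁻¹ : ℝ) • ξ))))
    ?_ ?_ (Φ.integrable_exp_fd h2) ?_
  · refine Filter.Eventually.of_forall fun η => Continuous.aestronglyMeasurable ?_
    exact Real.continuous_exp.comp (Φ.continuous_fd_dotProduct.comp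
      (continuous_id.prodMk continuous_const)).neg
  · have hc : Continuous fun η : ι → ℝ => η - (2⁻¹ : ℝ) • ξ := by fun_prop
    have hm : ξ - (2⁻¹ : ℝ) • ξ ∈ C.Ωd := by
      have : ξ - (2⁻¹ : ℝ) • ξ = (2⁻¹ : ℝ) • ξ := by
        ext i; simp only [Pi.sub_apply, Pi.smul_apply, smul_eq_mul]; ring
      rwa [this]
    filter_upwards [hc.continuousAt.eventually (C.isOpen_Ωd.mem_nhds hm)] with η hη
    refine Filter.Eventually.of_forall fun u => ?_
    rw [Real.norm_eq_abs, abs_of_pos (Real.exp_pos _)]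
    refine Real.exp_le_exp.2 ?_
    have h3 := C.dotProduct_nonneg_closure (Φ.mem_closure u) hη
    rw [dotProduct_sub] at h3
    change 0 ≤ Φ.fd u ⬝ᵥ η - Φ.fd u ⬝ᵥ ((2⁻¹ : ℝ) • ξ) at h3
    linarith
  · refine Filter.Eventually.of_forall fun u => Continuous.continuousAt ?_
    exact Real.continuous_exp.comp (Φ.continuous_fd_dotProduct.comp
      (continuous_const.prodMk continuous_id)).neg

/-- The normalized Gaussian integral, as a function on `H`. -/
def K (t : W) : ℝ := (Φ.J (C.dsq t)).toReal / (Φ.J (C.dsq 1)).toReal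

theorem K_one : Φ.K 1 = 1 := div_self (ENNReal.toReal_pos Φ.J_one.1.ne' Φ.J_one.2.ne).ne'

theorem K_mul {s t : W} (hs : s ∈ C.H) (ht : t ∈ C.H) : Φ.K (s * t) = Φ.K s * Φ.K t := by
  obtain ⟨κ, hκ, h⟩ := Φ.J_dsq_mul ht
  have h0 := (ENNReal.toReal_pos Φ.J_one.1.ne' Φ.J_one.2.ne).ne'
  have h1 : Φ.K t = κ := by
    have := h 1 C.one_mem_H
    rw [one_mul] at this
    rw [K, this, ENNReal.toReal_mul, ENNReal.toReal_ofReal hκ.le, mul_div_assoc, div_self h0, mul_one]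
  rw [h1, K, h s hs, ENNReal.toReal_mul, ENNReal.toReal_ofReal hκ.le, K]
  ring

/-- `K` is a character of `H`, so it only depends on the diagonal part. -/
theorem K_eq_dpart {t : W} (ht : t ∈ C.H) : Φ.K t = Φ.K (C.dpart t) := by
  have hd : C.dpart t ∈ C.H := C.diag_mem_H ht
  refine C.eq_dpart_of_conj_invariant ?_ fun v w hv hw hvw => ?_
  · have h1 : ContinuousAt (fun x => (Φ.J (C.dsq (C.sym.symm x))).toReal) (C.sym (C.dpart t)) := by
      refine ContinuousAt.comp (g := fun ξ => (Φ.J ξ).toReal) (f := fun x => C.dsq (C.sym.symm x)) ?_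
        C.continuous_dsq.continuousAt
      refine Φ.continuousAt_J ⟨C.dpart t, hd, ?_⟩
      simp
    exact h1.div_const _
  · have h1 := C.diag_mem_H hv
    have h2 := C.diag_mem_H hw
    rw [Φ.K_mul (C.mul_mem_H h1 ht) h2, Φ.K_mul h1 ht]
    have h3 : Φ.K (C.diag v) * Φ.K (C.diag w) = 1 := by
      rw [← Φ.K_mul h1 h2, C.diag_conj_mul hvw, K_one]
    calc _ = Φ.K (C.diag v) * Φ.K (C.diag w) * Φ.K t := by ring
      _ = _ := by rw [h3, one_mul]

theorem mulSingle_pos {j : Fin r} {T : ℝ} (hT : 0 < T) (i : Fin r) :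
    0 < (Pi.mulSingle j T : Fin r → ℝ) i := by
  by_cases h : i = j
  · subst h; simpa using hT
  · rw [Pi.mulSingle_eq_of_ne h]; exact one_pos

theorem K_diag_eq_prod {v : Fin r → ℝ} (hv : ∀ i, 0 < v i) :
    Φ.K (C.diag v) = ∏ j, Φ.K (C.diag (Pi.mulSingle j (v j))) := by
  have h : ∀ s : Finset (Fin r), (∀ i, 0 < (∏ j ∈ s, (Pi.mulSingle j (v j) : Fin r → ℝ)) i) ∧
      Φ.K (C.diag (∏ j ∈ s, Pi.mulSingle j (v j))) =
      ∏ j ∈ s, Φ.K (C.diag (Pi.mulSingle j (v j))) := by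
    intro s
    induction s using Finset.induction_on with
    | empty => simp [C.diag_one, K_one]
    | insert a s ha ih =>
      have h1 : ∀ i, 0 < (Pi.mulSingle a (v a) : Fin r → ℝ) i := mulSingle_pos (hv a)
      rw [Finset.prod_insert ha, Finset.prod_insert ha, ← C.diag_mul_diag,
        Φ.K_mul (C.diag_mem_H h1) (C.diag_mem_H ih.1), ih.2]
      exact ⟨fun i => mul_pos (h1 i) (ih.1 i), rfl⟩
  have h2 := (h Finset.univ).2
  rwa [Finset.univ_prod_mulSingle] at h2

/-- For a diagonal element with entry `T` in the place `j` and `1` elsewhere, the Gaussian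
integral decays exactly like `T^{-2b_j}`: only the directions on which the form `F_jj` is
concentrated are affected. -/
theorem K_bounds (j : Fin r) : ∃ A > 0, ∃ B : ℝ, ∀ T : ℝ, 1 ≤ T →
    A ≤ Φ.K (C.diag (Pi.mulSingle j T)) * (T ^ 2) ^ Φ.b j ∧
    Φ.K (C.diag (Pi.mulSingle j T)) * (T ^ 2) ^ Φ.b j ≤ B := by
  obtain ⟨L, l, hl, hcard, hL⟩ := Φ.exists_diagonalization j
  obtain ⟨c, hc, M, hM, hb⟩ := Φ.exists_bounds L
  obtain ⟨d, hd, hdL⟩ := exists_lintegral_comp_linearEquiv L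
  have hJ1 := ENNReal.toReal_pos Φ.J_one.1.ne' Φ.J_one.2.ne
  set J1 := (Φ.J (C.dsq 1)).toReal
  -- the quadratic form is comparable to a diagonal one
  have hq : ∀ T : ℝ, 1 ≤ T → ∀ w, Φ.fd (L w) ⬝ᵥ C.dsq (C.diag (Pi.mulSingle j T)) =
      C.tr (Φ.fd (L w)) + (T ^ 2 - 1) * ∑ i, l i * ‖w i‖ ^ 2 := by
    intro T hT w
    rw [fd_dotProduct_dsq_diag, tr_fd, ← hL, ← Finset.add_sum_erase _ _ (Finset.mem_univ j),
      ← Finset.add_sum_erase _ _ (Finset.mem_univ j), Pi.mulSingle_eq_same]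
    have : ∑ x ∈ Finset.univ.erase j, (Pi.mulSingle j T : Fin r → ℝ) x ^ 2 * C.entry x (Φ.fd (L w))
        = ∑ x ∈ Finset.univ.erase j, C.entry x (Φ.fd (L w)) := by
      refine Finset.sum_congr rfl fun i hi => ?_
      rw [Pi.mulSingle_eq_of_ne (Finset.ne_of_mem_erase hi)]
      ring
    rw [this]
    ring
  have hval : ∀ T : ℝ, 1 ≤ T → ∀ m > 0,
      ∫⁻ w : Fin k → ℂ, ENNReal.ofReal (Real.exp (-∑ i, (m + (T ^ 2 - 1) * l i) * ‖w i‖ ^ 2)) =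
      ENNReal.ofReal (∏ i, (Real.pi / (m + (T ^ 2 - 1) * l i))) := by
    intro T hT m hm
    refine lintegral_gaussian_pi fun i => ?_
    have : 0 ≤ (T ^ 2 - 1) * l i := mul_nonneg (by nlinarith) (hl i)
    linarith
  have hpos : ∀ T : ℝ, 1 ≤ T → ∀ m > 0, 0 < ∏ i, (Real.pi / (m + (T ^ 2 - 1) * l i)) := by
    intro T hT m hm
    refine Finset.prod_pos fun i _ => div_pos Real.pi_pos ?_
    have : 0 ≤ (T ^ 2 - 1) * l i := mul_nonneg (by nlinarith) (hl i)
    linarith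
  have hK : ∀ T : ℝ, 1 ≤ T →
      (∏ i, (Real.pi / (M + (T ^ 2 - 1) * l i))) / d / J1 ≤ Φ.K (C.diag (Pi.mulSingle j T)) ∧
      Φ.K (C.diag (Pi.mulSingle j T)) ≤ (∏ i, (Real.pi / (c + (T ^ 2 - 1) * l i))) / d / J1 := by
    intro T hT
    have hmem : C.dsq (C.diag (Pi.mulSingle j T)) ∈ C.Ωd :=
      ⟨_, C.diag_mem_H (mulSingle_pos (by linarith)), rfl⟩
    have h1 := hdL fun u => ENNReal.ofReal
      (Real.exp (-(Φ.fd u ⬝ᵥ C.dsq (C.diag (Pi.mulSingle j T)))))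
    change _ = ENNReal.ofReal d * Φ.J (C.dsq (C.diag (Pi.mulSingle j T))) at h1
    have h2 : d * (Φ.J (C.dsq (C.diag (Pi.mulSingle j T)))).toReal = (∫⁻ w, ENNReal.ofReal
      (Real.exp (-(Φ.fd (L w) ⬝ᵥ C.dsq (C.diag (Pi.mulSingle j T)))))).toReal := by
      rw [h1, ENNReal.toReal_mul, ENNReal.toReal_ofReal hd.le]
    have hfin : ∫⁻ w, ENNReal.ofReal
      (Real.exp (-(Φ.fd (L w) ⬝ᵥ C.dsq (C.diag (Pi.mulSingle j T))))) ≠ ∞ := by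
      rw [h1]
      exact ENNReal.mul_ne_top ENNReal.ofReal_ne_top (Φ.J_pos_lt_top hmem).2.ne
    have hsum : ∀ (m : ℝ) (w : Fin k → ℂ), ∑ i, (m + (T ^ 2 - 1) * l i) * ‖w i‖ ^ 2 =
        m * ∑ i, ‖w i‖ ^ 2 + (T ^ 2 - 1) * ∑ i, l i * ‖w i‖ ^ 2 := by
      intro m w
      rw [Finset.mul_sum, Finset.mul_sum, ← Finset.sum_add_distrib]
      exact Finset.sum_congr rfl fun i _ => by ring
    rw [K]
    change _ ≤ _ / J1 ∧ _ / J1 ≤ _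
    constructor
    · rw [div_le_div_iff_of_pos_right hJ1, div_le_iff₀ hd, mul_comm, h2,
        ← ENNReal.toReal_ofReal (hpos T hT M hM).le, ← hval T hT M hM]
      refine ENNReal.toReal_mono hfin (lintegral_mono fun w => ENNReal.ofReal_le_ofReal
        (Real.exp_le_exp.2 ?_))
      rw [hq T hT, hsum]
      linarith [(hb w).2]
    · rw [div_le_div_iff_of_pos_right hJ1, le_div_iff₀ hd, mul_comm, h2,
        ← ENNReal.toReal_ofReal (hpos T hT c hc).le, ← hval T hT c hc]
      refine ENNReal.toReal_mono (by rw [hval T hT c hc]; exact ENNReal.ofReal_ne_top)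
        (lintegral_mono fun w => ENNReal.ofReal_le_ofReal (Real.exp_le_exp.2 ?_))
      rw [hq T hT, hsum]
      linarith [(hb w).1]
  have hT2 : ∀ T : ℝ, (T ^ 2) ^ Φ.b j = ∏ i, if l i ≠ 0 then T ^ 2 else 1 := by
    intro T
    rw [← hcard, Finset.prod_ite]
    simp
  set a : Fin k → ℝ := fun i => Real.pi / (M + l i) with ha
  set e : Fin k → ℝ := fun i => Real.pi / c + if l i ≠ 0 then Real.pi / c + Real.pi / l i else 0 with he
  refine ⟨(∏ i, a i) / d / J1, div_pos (div_pos (Finset.prod_pos fun i _ => div_pos Real.pi_pos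
    (by linarith [hl i])) hd) hJ1, (∏ i, e i) / d / J1, fun T hT => ?_⟩
  have hTb : 0 < (T ^ 2) ^ Φ.b j := by positivity
  have hfac : ∀ m : ℝ, (∏ i, (Real.pi / (m + (T ^ 2 - 1) * l i))) / d / J1 * (T ^ 2) ^ Φ.b j =
      (∏ i, (Real.pi / (m + (T ^ 2 - 1) * l i)) * if l i ≠ 0 then T ^ 2 else 1) / d / J1 := by
    intro m
    rw [Finset.prod_mul_distrib, ← hT2]
    ring
  have hT1 : 1 ≤ T ^ 2 := by nlinarith
  constructor
  · refine le_trans ?_ (mul_le_mul_of_nonneg_right (hK T hT).1 hTb.le)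
    rw [hfac]
    gcongr with i
    · exact fun i _ => div_nonneg Real.pi_pos.le (by linarith [hl i])
    · have h1 := mul_nonneg (sub_nonneg.2 hT1) (hl i)
      by_cases h0 : l i = 0
      · simp [ha, h0]
      · rw [if_pos h0, ha, div_mul_eq_mul_div, div_le_div_iff₀ (by linarith [hl i]) (by linarith)]
        have h2 := mul_nonneg (sub_nonneg.2 hT1) hM.le
        nlinarith [Real.pi_pos, mul_nonneg Real.pi_pos.le h2, hl i,
          mul_nonneg Real.pi_pos.le (hl i)]
  · refine le_trans (mul_le_mul_of_nonneg_right (hK T hT).2 hTb.le) ?_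
    rw [hfac]
    gcongr with i
    · intro i _
      have h1 := mul_nonneg (sub_nonneg.2 hT1) (hl i)
      refine mul_nonneg (div_nonneg Real.pi_pos.le (by linarith)) ?_
      split_ifs <;> positivity
    · by_cases h0 : l i = 0
      · simp [he, h0]
      · have h1 := mul_nonneg (sub_nonneg.2 hT1) (hl i)
        have hli : 0 < l i := lt_of_le_of_ne (hl i) (Ne.symm h0)
        rw [if_pos h0, he]
        simp only [if_pos h0]
        have e1 : Real.pi / (c + (T ^ 2 - 1) * l i) * T ^ 2 =
          Real.pi / (c + (T ^ 2 - 1) * l i) +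
          Real.pi / (c + (T ^ 2 - 1) * l i) * (T ^ 2 - 1) := by ring
        have e2 : Real.pi / (c + (T ^ 2 - 1) * l i) ≤ Real.pi / c :=
          div_le_div_of_nonneg_left Real.pi_pos.le hc (by linarith)
        have e3 : Real.pi / (c + (T ^ 2 - 1) * l i) * (T ^ 2 - 1) ≤ Real.pi / l i := by
          rw [div_mul_eq_mul_div, div_le_div_iff₀ (by linarith) hli]
          nlinarith [mul_pos Real.pi_pos hc]
        have e4 : 0 < Real.pi / c := div_pos Real.pi_pos hc
        rw [e1]
        linarith

/-- The left side is multiplicative in `T` and bounded above and below, and a number whose powers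
stay within positive bounds is `1`. -/
theorem K_mulSingle_of_one_le (j : Fin r) {T : ℝ} (hT : 1 ≤ T) :
    Φ.K (C.diag (Pi.mulSingle j T)) * (T ^ 2) ^ Φ.b j = 1 := by
  obtain ⟨A, hA, B, hAB⟩ := Φ.K_bounds j
  have hT0 : 0 < T := by linarith
  refine eq_one_of_pow_bounded hA (B := B) fun n => ?_
  have h1 : Φ.K (C.diag (Pi.mulSingle j (T ^ n))) = Φ.K (C.diag (Pi.mulSingle j T)) ^ n := by
    induction n with
    | zero => simp [C.diag_one, K_one]
    | succ n ih =>
      rw [pow_succ, Pi.mulSingle_mul, ← C.diag_mul_diag,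
        Φ.K_mul (C.diag_mem_H (mulSingle_pos (pow_pos hT0 n))) (C.diag_mem_H (mulSingle_pos hT0)), ih,
        pow_succ]
  have h2 := hAB (T ^ n) (one_le_pow₀ hT)
  rw [h1] at h2
  have h3 : Φ.K (C.diag (Pi.mulSingle j T)) ^ n * ((T ^ n) ^ 2) ^ Φ.b j =
    (Φ.K (C.diag (Pi.mulSingle j T)) * (T ^ 2) ^ Φ.b j) ^ n := by ring
  rwa [h3] at h2

theorem K_mulSingle (j : Fin r) {T : ℝ} (hT : 0 < T) :
    Φ.K (C.diag (Pi.mulSingle j T)) * (T ^ 2) ^ Φ.b j = 1 := by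
  rcases le_total 1 T with h | h
  · exact Φ.K_mulSingle_of_one_le j h
  · have h1 := Φ.K_mulSingle_of_one_le j (one_le_inv₀ hT |>.2 h)
    have h2 := Φ.K_mul (C.diag_mem_H (mulSingle_pos (j := j) hT))
      (C.diag_mem_H (mulSingle_pos (j := j) (inv_pos.2 hT)))
    rw [C.diag_mul_diag, ← Pi.mulSingle_mul, mul_inv_cancel₀ hT.ne', Pi.mulSingle_one, C.diag_one,
      K_one] at h2
    calc _ = Φ.K (C.diag (Pi.mulSingle j T)) * (T ^ 2) ^ Φ.b j *
        (Φ.K (C.diag (Pi.mulSingle j T⁻¹)) * (T⁻¹ ^ 2) ^ Φ.b j) := by rw [h1, mul_one]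
      _ = (Φ.K (C.diag (Pi.mulSingle j T)) * Φ.K (C.diag (Pi.mulSingle j T⁻¹))) *
        ((T * T⁻¹) ^ 2) ^ Φ.b j := by ring
      _ = 1 := by rw [← h2, mul_inv_cancel₀ hT.ne']; simp

/-- The ranks of the diagonal entries, as an exponent of the generalized powers. -/
def bv (j : Fin r) : ℝ := Φ.b j

theorem K_eq {t : W} (ht : t ∈ C.H) : Φ.K t = C.χ (-Φ.bv) t := by
  rw [Φ.K_eq_dpart ht, ConeData.dpart, Φ.K_diag_eq_prod ht, ConeData.χ]
  refine Finset.prod_congr rfl fun j _ => ?_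
  have h := Φ.K_mulSingle j (ht j)
  have h1 : 0 < C.ρ j t ^ 2 := pow_pos (ht j) 2
  rw [Pi.neg_apply, bv, Real.rpow_neg h1.le, Real.rpow_natCast]
  exact eq_inv_of_mul_eq_one_left h

/-- The Gaussian integral of the form is a generalized power on the dual cone, the exponents of
which are the ranks of the diagonal entries. -/
theorem exists_J_eq : ∃ c > 0, ∀ ξ ∈ C.Ωd, Φ.J ξ = ENNReal.ofReal (c * C.Qdp (-Φ.bv) ξ) := by
  have h0 := ENNReal.toReal_pos Φ.J_one.1.ne' Φ.J_one.2.ne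
  refine ⟨(Φ.J (C.dsq 1)).toReal, h0, ?_⟩
  rintro _ ⟨t, ht, rfl⟩
  rw [ConeData.Qdp_dsq ht, ← Φ.K_eq ht, K, mul_div_cancel₀ _ h0.ne', ENNReal.ofReal_toReal]
  exact (Φ.J_pos_lt_top ⟨t, ht, rfl⟩).2.ne

end FormData

/-! ### Holomorphic powers on the tube -/

theorem norm_cexpPairing {ι : Type*} [Fintype ι] (z : ι → ℂ) (ξ : ι → ℝ) :
    ‖cexpPairing z ξ‖ = Real.exp (-(((2 * Real.pi) • fun i => (z i).im) ⬝ᵥ ξ)) := by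
  rw [cexpPairing, Complex.norm_exp]
  congr 1
  have h : 2 * (Real.pi : ℂ) * Complex.I * ∑ i, z i * (ξ i : ℂ) =
      Complex.I * ((2 * Real.pi : ℝ) : ℂ) * ∑ i, z i * (ξ i : ℂ) := by push_cast; ring
  rw [h, mul_assoc, Complex.I_mul_re, Complex.im_ofReal_mul, Complex.im_sum]
  simp only [Complex.im_mul_ofReal, smul_eq_mul, dotProduct, Pi.smul_apply, Finset.mul_sum,
    mul_assoc]

theorem cexpPairing_add {ι : Type*} [Fintype ι] (z w : ι → ℂ) (ξ : ι → ℝ) :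
    cexpPairing (z + w) ξ = cexpPairing z ξ * cexpPairing w ξ := by
  simp only [cexpPairing, ← Complex.exp_add, Pi.add_apply, add_mul, Finset.sum_add_distrib, mul_add]

theorem continuous_cexpPairing {ι : Type*} [Fintype ι] :
    Continuous fun p : (ι → ℂ) × (ι → ℝ) => cexpPairing p.1 p.2 := by
  unfold cexpPairing
  fun_prop

theorem differentiable_cexpPairing {ι : Type*} [Fintype ι] (ξ : ι → ℝ) :
    Differentiable ℂ fun z : ι → ℂ => cexpPairing z ξ := by
  unfold cexpPairing
  fun_prop

theorem cexpPairing_I_smul {ι : Type*} [Fintype ι] (y ξ : ι → ℝ) :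
    cexpPairing (fun i => (y i : ℂ) * Complex.I) ξ = Real.exp (-(((2 * Real.pi) • y) ⬝ᵥ ξ)) := by
  rw [cexpPairing, Complex.ofReal_exp]
  congr 1
  simp only [dotProduct, smul_eq_mul, Pi.smul_apply]
  push_cast
  rw [Finset.mul_sum, ← Finset.sum_neg_distrib]
  refine Finset.sum_congr rfl fun i _ => ?_
  linear_combination (2 * (Real.pi : ℂ) * (y i : ℂ) * (ξ i : ℂ)) * Complex.I_mul_I

theorem continuous_im {ι : Type*} : Continuous fun z : ι → ℂ => fun i => (z i).im := by fun_prop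

/-- The exponential `e^{-⟨y, ξ⟩}`. -/
def expd {ι : Type*} [Fintype ι] (y ξ : ι → ℝ) : ℝ≥0∞ := ENNReal.ofReal (Real.exp (-(y ⬝ᵥ ξ)))

theorem measurable_expd_comp {ι X : Type*} [Fintype ι] [MeasurableSpace X] {f g : X → ι → ℝ}
    (hf : Measurable f) (hg : Measurable g) : Measurable fun x => expd (f x) (g x) := by
  unfold expd dotProduct
  fun_prop

theorem expd_add {ι : Type*} [Fintype ι] (y z ξ : ι → ℝ) : expd (y + z) ξ = expd y ξ * expd z ξ := by
  rw [expd, expd, expd, ← ENNReal.ofReal_mul (Real.exp_pos _).le, ← Real.exp_add, add_dotProduct,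
    neg_add]

namespace ConeData

variable {r : ℕ} {ι W : Type*} [Fintype ι] [Ring W] [Algebra ℝ W] {C : ConeData r ι W}

variable (C) in
/-- The generalized power `Q^α` on the cone, extended by zero. -/
def qp (α : Fin r → ℝ) : (ι → ℝ) → ℝ≥0∞ := C.Ω.indicator fun y => ENNReal.ofReal (C.Qp α y)

variable (C) in
/-- The generalized power `(Q⋆)^α` on the dual cone, extended by zero. -/
def qd (α : Fin r → ℝ) : (ι → ℝ) → ℝ≥0∞ := C.Ωd.indicator fun y => ENNReal.ofReal (C.Qdp α y)

theorem qp_of_mem {y : ι → ℝ} (hy : y ∈ C.Ω) (α : Fin r → ℝ) :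
    C.qp α y = ENNReal.ofReal (C.Qp α y) := Set.indicator_of_mem hy _

theorem qp_of_notMem {y : ι → ℝ} (hy : y ∉ C.Ω) (α : Fin r → ℝ) :
    C.qp α y = 0 := Set.indicator_of_notMem hy _

theorem qd_of_mem {y : ι → ℝ} (hy : y ∈ C.Ωd) (α : Fin r → ℝ) :
    C.qd α y = ENNReal.ofReal (C.Qdp α y) := Set.indicator_of_mem hy _

theorem qd_of_notMem {y : ι → ℝ} (hy : y ∉ C.Ωd) (α : Fin r → ℝ) :
    C.qd α y = 0 := Set.indicator_of_notMem hy _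

theorem qp_lt_top (α : Fin r → ℝ) (y : ι → ℝ) : C.qp α y < ∞ := by
  by_cases hy : y ∈ C.Ω
  · rw [qp_of_mem hy]; exact ENNReal.ofReal_lt_top
  · rw [qp_of_notMem hy]; exact ENNReal.zero_lt_top

theorem qp_pos {y : ι → ℝ} (hy : y ∈ C.Ω) (α : Fin r → ℝ) : 0 < C.qp α y := by
  rw [qp_of_mem hy]; exact ENNReal.ofReal_pos.2 (Qp_pos hy α)

theorem qp_add (α β : Fin r → ℝ) (y : ι → ℝ) : C.qp (α + β) y = C.qp α y * C.qp β y := by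
  by_cases hy : y ∈ C.Ω
  · rw [qp_of_mem hy, qp_of_mem hy, qp_of_mem hy, Qp_add hy, ENNReal.ofReal_mul (Qp_pos hy _).le]
  · simp [qp_of_notMem hy]

theorem qd_add (α β : Fin r → ℝ) (y : ι → ℝ) : C.qd (α + β) y = C.qd α y * C.qd β y := by
  by_cases hy : y ∈ C.Ωd
  · rw [qd_of_mem hy, qd_of_mem hy, qd_of_mem hy, Qdp_add hy, ENNReal.ofReal_mul (Qdp_pos hy _).le]
  · simp [qd_of_notMem hy]

theorem measurable_indicator_of_continuousOn {X Y : Type*} [TopologicalSpace X] [MeasurableSpace X]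
    [BorelSpace X] [TopologicalSpace Y] [MeasurableSpace Y] [BorelSpace Y] [Zero Y] {s : Set X}
    (hs : MeasurableSet s) {f : X → Y} (hf : ContinuousOn f s) : Measurable (s.indicator f) := by
  classical
  have := hf.measurable_piecewise (g := fun _ => (0 : Y)) continuousOn_const hs
  rwa [show s.piecewise f (fun _ => (0 : Y)) = s.indicator f from
    (Set.piecewise_eq_indicator (s := s) (f := f))] at this

theorem measurable_qp (α : Fin r → ℝ) : Measurable (C.qp α) :=
  measurable_indicator_of_continuousOn C.isOpen_Ω.measurableSet
    (ENNReal.continuous_ofReal.comp_continuousOn (continuousOn_Qp α))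

theorem measurable_qd (α : Fin r → ℝ) : Measurable (C.qd α) :=
  measurable_indicator_of_continuousOn C.isOpen_Ωd.measurableSet
    (ENNReal.continuous_ofReal.comp_continuousOn (continuousOn_Qdp α))

theorem measurable_Qdp_indicator (α : Fin r → ℝ) :
    Measurable (C.Ωd.indicator fun ξ => (C.Qdp α ξ : ℂ)) :=
  measurable_indicator_of_continuousOn C.isOpen_Ωd.measurableSet
    (Complex.continuous_ofReal.comp_continuousOn (continuousOn_Qdp α))

theorem lintegral_qp {α : Fin r → ℝ} (hα : ∀ i, (C.m i : ℝ) / 2 < α i) :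
    ∃ Γ > 0, ∀ ξ ∈ C.Ωd, ∫⁻ y, expd y ξ * C.qp (α - C.τ) y =
      ENNReal.ofReal Γ * C.qd (-α) ξ := by
  obtain ⟨Γ, hΓ, h⟩ := lintegral_gamma hα
  refine ⟨Γ, hΓ, fun ξ hξ => ?_⟩
  rw [qd_of_mem hξ, ← ENNReal.ofReal_mul hΓ.le, ← h ξ hξ,
    ← lintegral_indicator C.isOpen_Ω.measurableSet]
  refine lintegral_congr fun y => ?_
  by_cases hy : y ∈ C.Ω
  · rw [qp_of_mem hy, Set.indicator_of_mem hy, ENNReal.ofReal_mul (Real.exp_pos _).le, expd]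
  · rw [qp_of_notMem hy, Set.indicator_of_notMem hy, mul_zero]

theorem lintegral_qd {α : Fin r → ℝ} (hα : ∀ i, (C.n i : ℝ) / 2 < α i) :
    ∃ Γ > 0, ∀ y ∈ C.Ω, ∫⁻ ξ, expd y ξ * C.qd (α - C.τ) ξ =
      ENNReal.ofReal Γ * C.qp (-α) y := by
  obtain ⟨Γ, hΓ, h⟩ := lintegral_gammad hα
  refine ⟨Γ, hΓ, fun y hy => ?_⟩
  rw [qp_of_mem hy, ← ENNReal.ofReal_mul hΓ.le, ← h y hy,
    ← lintegral_indicator C.isOpen_Ωd.measurableSet]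
  refine lintegral_congr fun ξ => ?_
  by_cases hξ : ξ ∈ C.Ωd
  · rw [qd_of_mem hξ, Set.indicator_of_mem hξ, ENNReal.ofReal_mul (Real.exp_pos _).le, expd]
  · rw [qd_of_notMem hξ, Set.indicator_of_notMem hξ, mul_zero]

theorem qp_smul (α : Fin r → ℝ) {a : ℝ} (ha : 0 < a) (y : ι → ℝ) :
    C.qp α (a • y) = ENNReal.ofReal (a ^ (∑ j, α j)) * C.qp α y := by
  by_cases hy : y ∈ C.Ω
  · rw [qp_of_mem hy, qp_of_mem (C.smul_mem_Ω hy ha), Qp_smul hy ha,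
      ENNReal.ofReal_mul (Real.rpow_nonneg ha.le _)]
  · rw [qp_of_notMem hy, mul_zero, qp_of_notMem]
    intro h
    have := C.smul_mem_Ω h (inv_pos.2 ha)
    rw [smul_smul, inv_mul_cancel₀ ha.ne', one_smul] at this
    exact hy this

variable (C) in
/-- The tube over the cone. -/
def tube : Set (ι → ℂ) := {z | (fun i => (z i).im) ∈ C.Ω}

theorem isOpen_tube : IsOpen C.tube := C.isOpen_Ω.preimage continuous_im

variable (C) in
/-- The Laplace transform of a generalized power on the dual cone; up to a constant it is the
holomorphic power `Q^{-(β + τ)}(z / i)`. -/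
def L (β : Fin r → ℝ) (z : ι → ℂ) : ℂ :=
  ∫ ξ, cexpPairing z ξ * C.Ωd.indicator (fun ξ => (C.Qdp β ξ : ℂ)) ξ

theorem enorm_L_integrand (β : Fin r → ℝ) (z : ι → ℂ) (ξ : ι → ℝ) :
    ‖cexpPairing z ξ * C.Ωd.indicator (fun ξ => (C.Qdp β ξ : ℂ)) ξ‖ₑ =
      expd ((2 * Real.pi) • fun i => (z i).im) ξ * C.qd β ξ := by
  rw [enorm_mul, ← ofReal_norm, norm_cexpPairing, expd]
  congr 1
  by_cases hξ : ξ ∈ C.Ωd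
  · rw [Set.indicator_of_mem hξ, qd_of_mem hξ, ← ofReal_norm, Complex.norm_real,
      Real.norm_of_nonneg (Qdp_pos hξ _).le]
  · rw [Set.indicator_of_notMem hξ, qd_of_notMem hξ, enorm_zero]

theorem measurable_L_integrand (β : Fin r → ℝ) : Measurable fun p : (ι → ℂ) × (ι → ℝ) =>
    cexpPairing p.1 p.2 * C.Ωd.indicator (fun ξ => (C.Qdp β ξ : ℂ)) p.2 :=
  continuous_cexpPairing.measurable.mul ((measurable_Qdp_indicator β).comp measurable_snd)

theorem two_pi_smul_mem {y : ι → ℝ} (hy : y ∈ C.Ω) : (2 * Real.pi) • y ∈ C.Ω :=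
  C.smul_mem_Ω hy (by positivity)

theorem lintegral_L_integrand {β : Fin r → ℝ} (hβ : ∀ i, (C.n i : ℝ) / 2 < β i + C.τ i) :
    ∃ Γ > 0, ∀ z ∈ C.tube,
      ∫⁻ ξ, ‖cexpPairing z ξ * C.Ωd.indicator (fun ξ => (C.Qdp β ξ : ℂ)) ξ‖ₑ =
      ENNReal.ofReal Γ * C.qp (-(β + C.τ)) fun i => (z i).im := by
  obtain ⟨Γ, hΓ, h⟩ := lintegral_qd (α := β + C.τ) hβ
  have hp : 0 < (2 * Real.pi) ^ (∑ j, (-(β + C.τ)) j) := Real.rpow_pos_of_pos (by positivity) _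
  refine ⟨Γ * (2 * Real.pi) ^ (∑ j, (-(β + C.τ)) j), mul_pos hΓ hp, fun z hz => ?_⟩
  simp_rw [enorm_L_integrand]
  rw [ENNReal.ofReal_mul hΓ.le, mul_assoc, ← qp_smul _ (by positivity), ← h _ (two_pi_smul_mem hz),
    add_sub_cancel_right]

theorem integrable_L_integrand {β : Fin r → ℝ} (hβ : ∀ i, (C.n i : ℝ) / 2 < β i + C.τ i)
    {z : ι → ℂ} (hz : z ∈ C.tube) :
    Integrable fun ξ => cexpPairing z ξ * C.Ωd.indicator (fun ξ => (C.Qdp β ξ : ℂ)) ξ := by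
  obtain ⟨Γ, hΓ, h⟩ := lintegral_L_integrand hβ
  refine ⟨((measurable_L_integrand β).comp
    (measurable_const.prodMk measurable_id)).aestronglyMeasurable, ?_⟩
  rw [hasFiniteIntegral_iff_enorm, h z hz]
  exact ENNReal.mul_lt_top ENNReal.ofReal_lt_top (qp_lt_top _ _)

theorem differentiableOn_L {β : Fin r → ℝ} (hβ : ∀ i, (C.n i : ℝ) / 2 < β i + C.τ i) :
    DifferentiableOn ℂ (C.L β) C.tube := by
  obtain ⟨Γ, hΓ, h⟩ := lintegral_L_integrand hβ
  refine (differentiableOn_integral_of_locally (volume : Measure (ι → ℂ)) (volume : Measure (ι → ℝ))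
    isOpen_tube (f := fun z ξ => cexpPairing z ξ * C.Ωd.indicator (fun ξ => (C.Qdp β ξ : ℂ)) ξ)
    (fun z hz => (integrable_L_integrand hβ hz).1)
    (measurable_L_integrand β).enorm.aemeasurable
    (Filter.Eventually.of_forall fun ξ =>
      ((differentiable_cexpPairing ξ).mul_const _).differentiableOn) ?_).2
  intro z₀ hz₀
  obtain ⟨R, hR, hRb⟩ := Metric.isOpen_iff.1 isOpen_tube z₀ hz₀
  have hsub : Metric.closedBall z₀ (R / 2) ⊆ C.tube :=
    (Metric.closedBall_subset_ball (by linarith)).trans hRb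
  refine ⟨R / 2, by linarith, Metric.ball_subset_closedBall.trans hsub, ?_⟩
  have hcont : ContinuousOn (fun z : ι → ℂ => C.Qp (-(β + C.τ)) fun i => (z i).im)
      (Metric.closedBall z₀ (R / 2)) :=
    (continuousOn_Qp _).comp continuous_im.continuousOn fun z hz => hsub hz
  obtain ⟨M, hM⟩ := (isCompact_closedBall z₀ (R / 2)).bddAbove_image hcont
  calc ∫⁻ z in Metric.ball z₀ (R / 2), ∫⁻ ξ,
        ‖cexpPairing z ξ * C.Ωd.indicator (fun ξ => (C.Qdp β ξ : ℂ)) ξ‖ₑ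
      ≤ ∫⁻ z in Metric.ball z₀ (R / 2), ENNReal.ofReal Γ * ENNReal.ofReal M := by
        refine setLIntegral_mono_ae' measurableSet_ball (Filter.Eventually.of_forall fun z hz => ?_)
        have hz' := hsub (Metric.ball_subset_closedBall hz)
        rw [h z hz', qp_of_mem (show (fun i => (z i).im) ∈ C.Ω from hz')]
        gcongr
        exact hM ⟨z, Metric.ball_subset_closedBall hz, rfl⟩
    _ < ∞ := by
        rw [setLIntegral_const]
        exact ENNReal.mul_lt_top (ENNReal.mul_lt_top ENNReal.ofReal_lt_top ENNReal.ofReal_lt_top)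
          measure_ball_lt_top

/-- On the imaginary axis `L_β` is given by the gamma integral of the dual cone. -/
theorem L_imaginary {β : Fin r → ℝ} (hβ : ∀ i, (C.n i : ℝ) / 2 < β i + C.τ i) :
    ∃ Γ > 0, ∀ y ∈ C.Ω, C.L β (fun i => (y i : ℂ) * Complex.I) =
      ((Γ * C.Qp (-(β + C.τ)) y : ℝ) : ℂ) := by
  obtain ⟨Γ, hΓ, h⟩ := lintegral_L_integrand hβ
  refine ⟨Γ, hΓ, fun y hy => ?_⟩
  have him : (fun i => ((y i : ℂ) * Complex.I).im) = y := by ext i; simp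
  have hz : (fun i => (y i : ℂ) * Complex.I) ∈ C.tube := by
    rw [tube, Set.mem_ofPred_eq, him]; exact hy
  have h1 := h _ hz
  rw [him, qp_of_mem hy, ← ENNReal.ofReal_mul hΓ.le] at h1
  have h2 : ∀ ξ, cexpPairing (fun i => (y i : ℂ) * Complex.I) ξ *
      C.Ωd.indicator (fun ξ => (C.Qdp β ξ : ℂ)) ξ =
      ((‖cexpPairing (fun i => (y i : ℂ) * Complex.I) ξ *
      C.Ωd.indicator (fun ξ => (C.Qdp β ξ : ℂ)) ξ‖ : ℝ) : ℂ) := by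
    intro ξ
    rw [norm_mul, cexpPairing_I_smul, Complex.norm_real, Real.norm_of_nonneg (Real.exp_pos _).le,
      Complex.ofReal_mul]
    congr 1
    by_cases hξ : ξ ∈ C.Ωd
    · rw [Set.indicator_of_mem hξ, Complex.norm_real, Real.norm_of_nonneg (Qdp_pos hξ _).le]
    · rw [Set.indicator_of_notMem hξ]; simp
  rw [L, integral_congr_ae (Filter.Eventually.of_forall h2), integral_complex_ofReal]
  congr 1
  rw [integral_norm_eq_lintegral_enorm (integrable_L_integrand hβ hz).1, h1, ENNReal.toReal_ofReal
    (mul_pos hΓ (Qp_pos hy _)).le]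

theorem norm_L_le {β : Fin r → ℝ} (hβ : ∀ i, (C.n i : ℝ) / 2 < β i + C.τ i) :
    ∃ Γ > 0, ∀ z ∈ C.tube, ‖C.L β z‖ₑ ≤ ENNReal.ofReal Γ * C.qp (-(β + C.τ)) fun i => (z i).im := by
  obtain ⟨Γ, hΓ, h⟩ := lintegral_L_integrand hβ
  refine ⟨Γ, hΓ, fun z hz => ?_⟩
  rw [← h z hz]
  exact enorm_integral_le_lintegral_enorm _

theorem L_conj (β : Fin r → ℝ) (z : ι → ℂ) : C.L β (-star z) = star (C.L β z) := by
  have hs : ∀ a : ℂ, star a = (starRingEnd ℂ) a := fun _ => rfl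
  rw [L, L, hs (∫ _, _), ← integral_conj]
  refine integral_congr_ae (Filter.Eventually.of_forall fun ξ => ?_)
  simp only [map_mul]
  congr 1
  · rw [cexpPairing, cexpPairing, ← Complex.exp_conj]
    congr 1
    simp only [map_mul, map_sum, Complex.conj_I, Complex.conj_ofReal, map_ofNat, Pi.neg_apply,
      Pi.star_apply, neg_mul, Finset.sum_neg_distrib, hs]
    ring
  · by_cases hξ : ξ ∈ C.Ωd
    · rw [Set.indicator_of_mem hξ, Complex.conj_ofReal]
    · rw [Set.indicator_of_notMem hξ, map_zero]

end ConeData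

/-! ### Slice norms of the holomorphic powers and the beta integral -/

theorem im_ofReal_add_mul_I {ι : Type*} (x y : ι → ℝ) :
    (fun i => ((x i : ℂ) + (y i : ℂ) * Complex.I).im) = y := by ext i; simp

theorem im_mul_I {ι : Type*} (y : ι → ℝ) : (fun i => ((y i : ℂ) * Complex.I).im) = y := by ext i; simp

namespace ConeData

variable {r : ℕ} {ι W : Type*} [Fintype ι] [Ring W] [Algebra ℝ W] {C : ConeData r ι W}

theorem mem_tube {x y : ι → ℝ} (hy : y ∈ C.Ω) :
    (fun i => (x i : ℂ) + (y i : ℂ) * Complex.I) ∈ C.tube := by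
  rw [tube, Set.mem_ofPred_eq, im_ofReal_add_mul_I]
  exact hy

/-- The holomorphic powers are multiplicative: both sides agree for imaginary arguments, hence
everywhere by the identity theorem along complex lines. -/
theorem exists_L_eq_sq {β β' : Fin r → ℝ} (hβ' : ∀ i, (C.n i : ℝ) / 2 < β' i + C.τ i)
    (hβ : ∀ i, (C.n i : ℝ) / 2 < β i + C.τ i) (h : ∀ i, 2 * (β' i + C.τ i) = β i + C.τ i) :
    ∃ c > 0, ∀ x : ι → ℝ, ∀ y ∈ C.Ω, C.L β (fun i => (x i : ℂ) + (y i : ℂ) * Complex.I) =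
      (c : ℝ) * C.L β' (fun i => (x i : ℂ) + (y i : ℂ) * Complex.I) ^ 2 := by
  obtain ⟨Γ, hΓ, h1⟩ := L_imaginary hβ
  obtain ⟨Γ', hΓ', h1'⟩ := L_imaginary hβ'
  refine ⟨Γ / Γ' ^ 2, by positivity, fun x y hy => ?_⟩
  -- The line `p` passes through `iy` at `0` and through `x + iy` at `1`. For imaginary `l` the
  -- point `p l` lies on the imaginary axis of the tube, where both sides are powers of `Q`.
  set p : ℂ → ι → ℂ := fun l i => l * (x i : ℂ) + (y i : ℂ) * Complex.I with hp
  have hpd : Differentiable ℂ p := by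
    rw [hp]; fun_prop
  have him : ∀ l, (fun i => (p l i).im) = y + l.im • x := fun l => by
    ext i; simp [hp]; ring
  set S : Set ℂ := {l | y + l.im • x ∈ C.Ω} with hS
  have hSt : ∀ l, l ∈ S → p l ∈ C.tube := fun l hl => by
    rw [tube, Set.mem_ofPred_eq, him]; exact hl
  have hSo : IsOpen S := C.isOpen_Ω.preimage (by fun_prop)
  have hSc : Convex ℝ S := by
    intro a ha b hb s t hs ht hst
    rw [hS, Set.mem_ofPred_eq]
    have : y + (s • a + t • b).im • x = s • (y + a.im • x) + t • (y + b.im • x) := by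
      ext i
      simp only [Complex.add_im, Complex.real_smul, Complex.im_ofReal_mul, Pi.add_apply,
        Pi.smul_apply, smul_eq_mul]
      linear_combination (-(y i)) * hst
    rw [this]
    exact C.convex_Ω ha hb hs ht hst
  have hd1 : DifferentiableOn ℂ (fun l => C.L β (p l)) S :=
    (differentiableOn_L hβ).comp hpd.differentiableOn hSt
  have hd2 : DifferentiableOn ℂ (fun l => ((Γ / Γ' ^ 2 : ℝ) : ℂ) * C.L β' (p l) ^ 2) S :=
    (((differentiableOn_L hβ').comp hpd.differentiableOn hSt).pow 2).const_mul _
  have h0 : (0 : ℂ) ∈ S := by rw [hS, Set.mem_ofPred_eq]; simpa using hy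
  have himag : ∀ s : ℝ, ((s : ℂ) * Complex.I) ∈ S →
      C.L β (p (s * Complex.I)) = ((Γ / Γ' ^ 2 : ℝ) : ℂ) * C.L β' (p (s * Complex.I)) ^ 2 := by
    intro s hs
    have e : p (s * Complex.I) = fun i => ((y + s • x) i : ℂ) * Complex.I := by
      ext i; simp [hp]; ring
    have hs' : y + s • x ∈ C.Ω := by
      have := hs
      rw [hS, Set.mem_ofPred_eq] at this
      simpa using this
    have e2 : C.Qp (-(β + C.τ)) (y + s • x) = C.Qp (-(β' + C.τ)) (y + s • x) ^ 2 := by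
      rw [_root_.sq, ← Qp_add hs']
      congr 1
      ext i
      have := h i
      simp only [Pi.neg_apply, Pi.add_apply]
      linarith
    rw [e, h1 _ hs', h1' _ hs', e2, ← Complex.ofReal_pow, ← Complex.ofReal_mul]
    congr 1
    field_simp
  have hfreq : ∃ᶠ l in nhdsWithin (0 : ℂ) {0}ᶜ,
      C.L β (p l) = ((Γ / Γ' ^ 2 : ℝ) : ℂ) * C.L β' (p l) ^ 2 := by
    have ht : Filter.Tendsto (fun s : ℝ => (s : ℂ) * Complex.I) (nhdsWithin 0 {0}ᶜ)
        (nhdsWithin 0 {0}ᶜ) := by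
      refine tendsto_nhdsWithin_iff.2 ⟨?_, ?_⟩
      · have : Continuous fun s : ℝ => (s : ℂ) * Complex.I := by fun_prop
        have h3 := this.tendsto 0
        rw [Complex.ofReal_zero, zero_mul] at h3
        exact h3.mono_left nhdsWithin_le_nhds
      · filter_upwards [self_mem_nhdsWithin] with s hs
        simpa using hs
    refine ht.frequently (Filter.Eventually.frequently ?_)
    have hev : ∀ᶠ l in nhdsWithin (0 : ℂ) {0}ᶜ, l ∈ S :=
      nhdsWithin_le_nhds (hSo.mem_nhds h0)
    filter_upwards [ht.eventually hev] with s hs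
    exact himag s hs
  have hS1 : (1 : ℂ) ∈ S := by rw [hS, Set.mem_ofPred_eq]; simpa using hy
  have hE := AnalyticOnNhd.eqOn_of_preconnected_of_frequently_eq (hd1.analyticOnNhd hSo)
    (hd2.analyticOnNhd hSo) hSc.isPreconnected h0 hfreq hS1
  simpa [hp] using hE

theorem L_eq_fourier (β : Fin r → ℝ) (x y : ι → ℝ) :
    C.L β (fun i => (x i : ℂ) + (y i : ℂ) * Complex.I) =
    ∫ ξ, cexpPairing (fun i => (x i : ℂ)) ξ * (cexpPairing (fun i => (y i : ℂ) * Complex.I) ξ *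
      C.Ωd.indicator (fun ξ => (C.Qdp β ξ : ℂ)) ξ) := by
  rw [L]
  refine integral_congr_ae (Filter.Eventually.of_forall fun ξ => ?_)
  have := cexpPairing_add (fun i => (x i : ℂ)) (fun i => (y i : ℂ) * Complex.I) ξ
  simp only
  rw [← mul_assoc, ← this]
  rfl

theorem mul_I_mem_tube {y : ι → ℝ} (hy : y ∈ C.Ω) : (fun i => (y i : ℂ) * Complex.I) ∈ C.tube := by
  rw [tube, Set.mem_ofPred_eq, im_mul_I]
  exact hy

/-- The `L²`-norms of the holomorphic powers over the horizontal slices of the tube. -/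
theorem lintegral_L_sq {β : Fin r → ℝ} (hβ : ∀ i, (C.n i : ℝ) / 2 < β i + C.τ i)
    (hβ2 : ∀ i, (C.n i : ℝ) / 2 < 2 * β i + C.τ i) : ∃ c > 0, ∀ y ∈ C.Ω,
    ∫⁻ x : ι → ℝ, ‖C.L β (fun i => (x i : ℂ) + (y i : ℂ) * Complex.I)‖ₑ ^ 2 =
      ENNReal.ofReal c * C.qp (-(β + β + C.τ)) y := by
  obtain ⟨Γ, hΓ, h⟩ := lintegral_L_integrand (C := C) (β := β + β) (fun i => by
    have := hβ2 i; simp only [Pi.add_apply]; linarith)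
  have h2 : (0 : ℝ) < 2 ^ (∑ j, (-(β + β + C.τ)) j) := by positivity
  refine ⟨Γ * 2 ^ (∑ j, (-(β + β + C.τ)) j), by positivity, fun y hy => ?_⟩
  have hsq : ∀ ξ, ‖cexpPairing (fun i => (y i : ℂ) * Complex.I) ξ *
      C.Ωd.indicator (fun ξ => (C.Qdp β ξ : ℂ)) ξ‖ₑ ^ 2 =
      ‖cexpPairing (fun i => (((2 : ℝ) • y) i : ℂ) * Complex.I) ξ *
      C.Ωd.indicator (fun ξ => (C.Qdp (β + β) ξ : ℂ)) ξ‖ₑ := by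
    intro ξ
    rw [enorm_L_integrand, enorm_L_integrand, im_mul_I, im_mul_I, qd_add, two_smul, smul_add,
      expd_add]
    ring
  have h2y : (2 : ℝ) • y ∈ C.Ω := C.smul_mem_Ω hy (by norm_num)
  have hval := h _ (mul_I_mem_tube h2y)
  rw [im_mul_I] at hval
  have hI := integrable_L_integrand hβ (mul_I_mem_tube hy)
  have hM : MemLp (fun ξ => cexpPairing (fun i => (y i : ℂ) * Complex.I) ξ *
      C.Ωd.indicator (fun ξ => (C.Qdp β ξ : ℂ)) ξ) 2 := by
    refine ⟨hI.1, ?_⟩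
    rw [eLpNorm_lt_top_iff_lintegral_rpow_enorm_lt_top (by norm_num) (by norm_num)]
    simp only [ENNReal.toReal_ofNat, ENNReal.rpow_ofNat]
    rw [lintegral_congr hsq, hval]
    exact ENNReal.mul_lt_top ENNReal.ofReal_lt_top (qp_lt_top _ _)
  simp_rw [L_eq_fourier]
  rw [lintegral_fourier_pi_sq hI hM, lintegral_congr hsq, hval, qp_smul _ (by norm_num),
    ENNReal.ofReal_mul hΓ.le, mul_assoc]

/-- The `L¹`-norms of the holomorphic powers over the horizontal slices of the tube. -/
theorem lintegral_L {β : Fin r → ℝ} (hβ : ∀ i, (C.n i : ℝ) / 2 < β i) : ∃ c > 0, ∀ y ∈ C.Ω,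
    ∫⁻ x : ι → ℝ, ‖C.L β (fun i => (x i : ℂ) + (y i : ℂ) * Complex.I)‖ₑ =
      ENNReal.ofReal c * C.qp (-β) y := by
  -- `2 (β' + τ) = β + τ`, so that `L_β` is a multiple of the square of `L_β'`
  set β' : Fin r → ℝ := fun i => (β i - C.τ i) / 2 with hβ'
  have hτ : ∀ i, C.τ i = 1 + ((C.m i : ℝ) + C.n i) / 2 := fun i => rfl
  have hm : ∀ i, (0 : ℝ) ≤ C.m i := fun i => Nat.cast_nonneg _
  have hn : ∀ i, (0 : ℝ) ≤ C.n i := fun i => Nat.cast_nonneg _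
  have h1 : ∀ i, (C.n i : ℝ) / 2 < β' i + C.τ i := fun i => by
    simp only [hβ']; linarith [hβ i, hτ i, hm i, hn i]
  have h2 : ∀ i, (C.n i : ℝ) / 2 < 2 * β' i + C.τ i := fun i => by
    simp only [hβ']; linarith [hβ i, hτ i, hm i, hn i]
  have h3 : ∀ i, (C.n i : ℝ) / 2 < β i + C.τ i := fun i => by linarith [hβ i, hτ i, hm i, hn i]
  obtain ⟨c, hc, hsq⟩ := exists_L_eq_sq h1 h3 (fun i => by simp only [hβ']; ring)
  obtain ⟨c', hc', hL2⟩ := lintegral_L_sq h1 h2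
  refine ⟨c * c', mul_pos hc hc', fun y hy => ?_⟩
  have e : ∀ x : ι → ℝ, ‖C.L β (fun i => (x i : ℂ) + (y i : ℂ) * Complex.I)‖ₑ =
      ENNReal.ofReal c * ‖C.L β' (fun i => (x i : ℂ) + (y i : ℂ) * Complex.I)‖ₑ ^ 2 := fun x => by
    rw [hsq x y hy, enorm_mul, enorm_pow, ← ofReal_norm, Complex.norm_real,
      Real.norm_of_nonneg hc.le]
  rw [lintegral_congr e, lintegral_const_mul' _ _ ENNReal.ofReal_ne_top, hL2 y hy,
    ENNReal.ofReal_mul hc.le, mul_assoc]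
  congr 3
  ext i
  simp [hβ']

end ConeData

namespace FormData

variable {r : ℕ} {ι W : Type*} [Fintype ι] [Ring W] [Algebra ℝ W] {C : ConeData r ι W}
  {k : ℕ} (Φ : FormData C k)

theorem exists_lintegral_expd_fd : ∃ c > 0, ∀ ξ ∈ C.Ωd,
    ∫⁻ u, expd (Φ.fd u) ξ = ENNReal.ofReal c * C.qd (-Φ.bv) ξ := by
  obtain ⟨c, hc, h⟩ := Φ.exists_J_eq
  refine ⟨c, hc, fun ξ hξ => ?_⟩
  rw [ConeData.qd_of_mem hξ, ← ENNReal.ofReal_mul hc.le, ← h ξ hξ]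
  rfl

/-- The beta integral of the cone and the form. -/
theorem lintegral_beta {β γ : Fin r → ℝ} (hβ : ∀ i, (C.n i : ℝ) / 2 < β i)
    (hγ : ∀ i, (C.m i : ℝ) / 2 < γ i) (hδ : ∀ i, (C.n i : ℝ) / 2 < β i - Φ.bv i - γ i) :
    ∃ c > 0, ∀ y ∈ C.Ω, ∫⁻ u : Fin k → ℂ, ∫⁻ t, C.qp (-β) (y + t + Φ.fd u) * C.qp (γ - C.τ) t =
      ENNReal.ofReal c * C.qp (-(β - Φ.bv - γ)) y := by
  obtain ⟨Γ₁, hΓ₁, h₁⟩ := ConeData.lintegral_qd hβ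
  obtain ⟨Γ₂, hΓ₂, h₂⟩ := ConeData.lintegral_qp hγ
  obtain ⟨Γ₃, hΓ₃, h₃⟩ := ConeData.lintegral_qd (α := β - Φ.bv - γ) hδ
  obtain ⟨c, hc, hJ⟩ := Φ.exists_lintegral_expd_fd
  refine ⟨Γ₁⁻¹ * (Γ₂ * c * Γ₃), by positivity, fun y hy => ?_⟩
  have hfm : Measurable Φ.fd := Φ.continuous_fd.measurable
  have hΓ₁' : ENNReal.ofReal Γ₁⁻¹ * ENNReal.ofReal Γ₁ = 1 := by
    rw [← ENNReal.ofReal_mul (by positivity), inv_mul_cancel₀ hΓ₁.ne', ENNReal.ofReal_one]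
  -- Write `Q^{-β}` as a Laplace transform and integrate first over `t` (gamma), then over `u`
  -- (Gauss), and finally over `ξ` (gamma).
  have e1 : ∀ u t, C.qp (-β) (y + t + Φ.fd u) * C.qp (γ - C.τ) t = ENNReal.ofReal Γ₁⁻¹ *
      ∫⁻ ξ, expd y ξ * expd t ξ * expd (Φ.fd u) ξ * C.qd (β - C.τ) ξ * C.qp (γ - C.τ) t := by
    intro u t
    by_cases ht : t ∈ C.Ω
    · have hmem : y + t + Φ.fd u ∈ C.Ω :=
        C.add_mem_Ω (C.add_mem_Ω hy (subset_closure ht)) (Φ.mem_closure u)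
      have h4 := h₁ _ hmem
      simp only [expd_add] at h4
      rw [lintegral_mul_const' _ _ (ConeData.qp_lt_top _ _).ne, h4, ← mul_assoc, ← mul_assoc, hΓ₁',
        one_mul]
    · simp [ConeData.qp_of_notMem ht]
  have hmeas : ∀ u, Measurable fun p : (ι → ℝ) × (ι → ℝ) =>
      expd y p.2 * expd p.1 p.2 * expd (Φ.fd u) p.2 * C.qd (β - C.τ) p.2 * C.qp (γ - C.τ) p.1 :=
    fun u => ((((measurable_expd_comp measurable_const measurable_snd).mul
      (measurable_expd_comp measurable_fst measurable_snd)).mul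
      (measurable_expd_comp measurable_const measurable_snd)).mul
      ((ConeData.measurable_qd _).comp measurable_snd)).mul
      ((ConeData.measurable_qp _).comp measurable_fst)
  have hm1 : ∀ ξ : ι → ℝ, Measurable fun t : ι → ℝ => expd t ξ * C.qp (γ - C.τ) t := fun ξ =>
    (measurable_expd_comp measurable_id measurable_const).mul (ConeData.measurable_qp _)
  simp_rw [e1]
  have e2 : ∀ u, ∫⁻ t, ENNReal.ofReal Γ₁⁻¹ *
      ∫⁻ ξ, expd y ξ * expd t ξ * expd (Φ.fd u) ξ * C.qd (β - C.τ) ξ * C.qp (γ - C.τ) t =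
      ENNReal.ofReal Γ₁⁻¹ * ∫⁻ ξ, ENNReal.ofReal Γ₂ *
        (expd y ξ * C.qd (β - C.τ - γ) ξ * expd (Φ.fd u) ξ) := by
    intro u
    rw [lintegral_const_mul' _ _ ENNReal.ofReal_ne_top]
    congr 1
    rw [lintegral_lintegral_swap]
    · refine lintegral_congr fun ξ => ?_
      by_cases hξ : ξ ∈ C.Ωd
      · have e3 : ∀ t, expd y ξ * expd t ξ * expd (Φ.fd u) ξ * C.qd (β - C.τ) ξ * C.qp (γ - C.τ) t =
            (expd y ξ * expd (Φ.fd u) ξ * C.qd (β - C.τ) ξ) * (expd t ξ * C.qp (γ - C.τ) t) :=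
          fun t => by ring
        rw [lintegral_congr e3, lintegral_const_mul _ (hm1 ξ), h₂ ξ hξ,
          sub_eq_add_neg (β - C.τ) γ, ConeData.qd_add]
        ring
      · simp [ConeData.qd_of_notMem hξ]
    · exact (hmeas u).aemeasurable
  have hm2 : Measurable fun p : (Fin k → ℂ) × (ι → ℝ) =>
      ENNReal.ofReal Γ₂ * (expd y p.2 * C.qd (β - C.τ - γ) p.2 * expd (Φ.fd p.1) p.2) :=
    (((measurable_expd_comp measurable_const measurable_snd).mul
      ((ConeData.measurable_qd _).comp measurable_snd)).mul
      (measurable_expd_comp (hfm.comp measurable_fst) measurable_snd)).const_mul _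
  rw [lintegral_congr e2, lintegral_const_mul' _ _ ENNReal.ofReal_ne_top,
    lintegral_lintegral_swap hm2.aemeasurable]
  have e4 : ∀ ξ, ∫⁻ u, ENNReal.ofReal Γ₂ * (expd y ξ * C.qd (β - C.τ - γ) ξ * expd (Φ.fd u) ξ) =
      ENNReal.ofReal (Γ₂ * c) * (expd y ξ * C.qd (β - Φ.bv - γ - C.τ) ξ) := by
    intro ξ
    by_cases hξ : ξ ∈ C.Ωd
    · have e5 : ∀ u, ENNReal.ofReal Γ₂ * (expd y ξ * C.qd (β - C.τ - γ) ξ * expd (Φ.fd u) ξ) =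
          (ENNReal.ofReal Γ₂ * (expd y ξ * C.qd (β - C.τ - γ) ξ)) * expd (Φ.fd u) ξ :=
        fun u => by ring
      have e6 : β - Φ.bv - γ - C.τ = β - C.τ - γ + -Φ.bv := by abel
      rw [lintegral_congr e5, lintegral_const_mul _ (measurable_expd_comp hfm measurable_const),
        hJ ξ hξ, e6, ConeData.qd_add, ENNReal.ofReal_mul hΓ₂.le]
      ring
    · simp [ConeData.qd_of_notMem hξ]
  rw [lintegral_congr e4, lintegral_const_mul' _ _ ENNReal.ofReal_ne_top, h₃ y hy,
    ENNReal.ofReal_mul (inv_nonneg.2 hΓ₁.le), ENNReal.ofReal_mul (mul_pos hΓ₂ hc).le]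
  ring

end FormData

/-! ### Coordinates and measures on the Siegel domain -/

/-- Lebesgue measure on `ℂ^ι` is the product of the Lebesgue measures in the real and the imaginary
parts. -/
theorem lintegral_complex_pi {ι : Type*} [Fintype ι] {f : (ι → ℂ) → ℝ≥0∞} (hf : Measurable f) :
    ∫⁻ z, f z = ∫⁻ y : ι → ℝ, ∫⁻ x : ι → ℝ, f (fun i => (x i : ℂ) + (y i : ℂ) * Complex.I) := by
  have h1 : MeasurePreserving (fun (z : ι → ℂ) i => Complex.measurableEquivRealProd (z i)) :=
    volume_preserving_pi fun _ => Complex.volume_preserving_equiv_real_prod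
  have h2 := (volume_measurePreserving_arrowProdEquivProdArrow ℝ ℝ ι).comp h1
  have h3 : Measurable fun p : (ι → ℝ) × (ι → ℝ) =>
      f (fun i => (p.1 i : ℂ) + (p.2 i : ℂ) * Complex.I) := hf.comp (by fun_prop)
  have h4 := h2.lintegral_comp h3
  rw [Measure.volume_eq_prod, lintegral_prod_symm' _ h3] at h4
  rw [← h4]
  refine lintegral_congr fun z => ?_
  congr 1
  ext i
  exact (Complex.re_add_im (z i)).symm

namespace FormData

variable {r : ℕ} {ι W : Type*} [Fintype ι] [Ring W] [Algebra ℝ W] {C : ConeData r ι W}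
  {k : ℕ} (Φ : FormData C k)

/-- The Siegel domain. -/
def D : Set ((ι → ℂ) × (Fin k → ℂ)) := {w | (fun i => (w.1 i).im) - Φ.fd w.2 ∈ C.Ω}

/-- The point `(x + i(t + F(u,u)), u)`, where `a = (u, t)`. -/
def pt (x : ι → ℝ) (a : (Fin k → ℂ) × (ι → ℝ)) : (ι → ℂ) × (Fin k → ℂ) :=
  (fun i => (x i : ℂ) + ((a.2 i + Φ.fd a.1 i : ℝ) : ℂ) * Complex.I, a.1)

/-- The height `Im z - F(u,u)` of a point `(z, u)` over the Shilov boundary. -/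
def ht (w : (ι → ℂ) × (Fin k → ℂ)) : ι → ℝ := (fun i => (w.1 i).im) - Φ.fd w.2

theorem continuous_ht : Continuous Φ.ht := by
  have h := Φ.continuous_fd
  unfold ht
  fun_prop

theorem continuous_pt : Continuous fun p : (ι → ℝ) × (Fin k → ℂ) × (ι → ℝ) => Φ.pt p.1 p.2 := by
  have h := Φ.continuous_fd
  unfold pt
  fun_prop

theorem ht_pt (x : ι → ℝ) (a : (Fin k → ℂ) × (ι → ℝ)) : Φ.ht (Φ.pt x a) = a.2 := by
  ext i; simp [ht, pt]

theorem pt_ht (w : (ι → ℂ) × (Fin k → ℂ)) : Φ.pt (fun i => (w.1 i).re) (w.2, Φ.ht w) = w := by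
  refine Prod.ext ?_ rfl
  ext i
  simp [pt, ht]

theorem isOpen_D : IsOpen Φ.D := C.isOpen_Ω.preimage Φ.continuous_ht

theorem pt_mem_D {x : ι → ℝ} {a : (Fin k → ℂ) × (ι → ℝ)} : Φ.pt x a ∈ Φ.D ↔ a.2 ∈ C.Ω := by
  change Φ.ht (Φ.pt x a) ∈ C.Ω ↔ _
  rw [ht_pt]

/-- The coordinates `(x, u, t)` on `ℂ^ι × ℂ^k`. -/
def ptEquiv : ((ι → ℝ) × (Fin k → ℂ) × (ι → ℝ)) ≃ᵐ ((ι → ℂ) × (Fin k → ℂ)) where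
  toFun p := Φ.pt p.1 p.2
  invFun w := (fun i => (w.1 i).re, w.2, Φ.ht w)
  left_inv p := by
    refine Prod.ext ?_ (Prod.ext rfl (Φ.ht_pt _ _))
    ext i; simp [pt]
  right_inv w := Φ.pt_ht w
  measurable_toFun := Φ.continuous_pt.measurable
  measurable_invFun := by
    have h := Φ.continuous_ht
    have h2 : Continuous fun w : (ι → ℂ) × (Fin k → ℂ) =>
        ((fun i => (w.1 i).re, w.2, Φ.ht w) : (ι → ℝ) × (Fin k → ℂ) × (ι → ℝ)) := by fun_prop
    exact h2.measurable

/-- The exponent of the weight with parameter `ν`. -/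
def wt (ν : Fin r → ℝ) : Fin r → ℝ := ν - (2⁻¹ : ℝ) • Φ.bv - C.τ

/-- The weighted measure on the Siegel domain. -/
def Vm (ν : Fin r → ℝ) : Measure ((ι → ℂ) × (Fin k → ℂ)) :=
  volume.withDensity fun w => C.qp (Φ.wt ν) (Φ.ht w)

/-- The weighted measure in the variables `(u, t)`. -/
def mY (ν : Fin r → ℝ) : Measure ((Fin k → ℂ) × (ι → ℝ)) :=
  (volume : Measure (Fin k → ℂ)).prod ((volume : Measure (ι → ℝ)).withDensity (C.qp (Φ.wt ν)))

theorem sFinite_density (ν : Fin r → ℝ) :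
    SFinite ((volume : Measure (ι → ℝ)).withDensity (C.qp (Φ.wt ν))) := inferInstance

instance (ν : Fin r → ℝ) : SFinite (Φ.mY ν) := by unfold mY; infer_instance

instance (ν : Fin r → ℝ) : SFinite (Φ.Vm ν) := by unfold Vm; infer_instance

theorem lintegral_mY (ν : Fin r → ℝ) {f : (Fin k → ℂ) × (ι → ℝ) → ℝ≥0∞} (hf : Measurable f) :
    ∫⁻ a, f a ∂(Φ.mY ν) = ∫⁻ u, ∫⁻ t, C.qp (Φ.wt ν) t * f (u, t) := by
  rw [mY, lintegral_prod _ hf.aemeasurable]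
  refine lintegral_congr fun u => ?_
  have hfu : Measurable fun t => f (u, t) := hf.comp measurable_prodMk_left
  rw [lintegral_withDensity_eq_lintegral_mul _ (ConeData.measurable_qp _) hfu]
  rfl

theorem lintegral_volume_pt {f : (ι → ℂ) × (Fin k → ℂ) → ℝ≥0∞} (hf : Measurable f) :
    ∫⁻ w, f w = ∫⁻ u : Fin k → ℂ, ∫⁻ t : ι → ℝ, ∫⁻ x : ι → ℝ, f (Φ.pt x (u, t)) := by
  rw [Measure.volume_eq_prod, lintegral_prod_symm' _ hf]
  refine lintegral_congr fun u => ?_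
  have hfu : Measurable fun z : ι → ℂ => f (z, u) := hf.comp measurable_prodMk_right
  rw [lintegral_complex_pi hfu,
    ← lintegral_add_right_eq_self _ (Φ.fd u)]
  rfl

theorem lintegral_Vm (ν : Fin r → ℝ) {f : (ι → ℂ) × (Fin k → ℂ) → ℝ≥0∞} (hf : Measurable f) :
    ∫⁻ w, f w ∂(Φ.Vm ν) = ∫⁻ a, (∫⁻ x : ι → ℝ, f (Φ.pt x a)) ∂(Φ.mY ν) := by
  have hm : Measurable fun w => C.qp (Φ.wt ν) (Φ.ht w) :=
    (ConeData.measurable_qp _).comp Φ.continuous_ht.measurable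
  have hm2 : Measurable fun a => ∫⁻ x : ι → ℝ, f (Φ.pt x a) := by
    have : Measurable fun p : ((Fin k → ℂ) × (ι → ℝ)) × (ι → ℝ) => f (Φ.pt p.2 p.1) :=
      hf.comp (Φ.continuous_pt.comp continuous_swap).measurable
    exact this.lintegral_prod_right'
  rw [Vm, lintegral_withDensity_eq_lintegral_mul _ hm hf, Φ.lintegral_volume_pt (hm.mul hf),
    Φ.lintegral_mY ν hm2]
  refine lintegral_congr fun u => lintegral_congr fun t => ?_
  simp only [Pi.mul_apply, ht_pt]
  exact lintegral_const_mul' _ _ (ConeData.qp_lt_top _ _).ne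

theorem measurePreserving_ptEquiv (ν : Fin r → ℝ) :
    MeasurePreserving Φ.ptEquiv ((volume : Measure (ι → ℝ)).prod (Φ.mY ν)) (Φ.Vm ν) := by
  refine ⟨Φ.ptEquiv.measurable, ?_⟩
  refine Measure.ext_of_lintegral _ fun f hf => ?_
  have hfm : Measurable fun p => f (Φ.ptEquiv p) := hf.comp Φ.ptEquiv.measurable
  rw [lintegral_map hf Φ.ptEquiv.measurable, Φ.lintegral_Vm ν hf, lintegral_prod_symm' _ hfm]
  rfl

theorem ae_mY (ν : Fin r → ℝ) : ∀ᵐ a ∂(Φ.mY ν), a.2 ∈ C.Ω := by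
  have h1 : ∀ᵐ t ∂((volume : Measure (ι → ℝ)).withDensity (C.qp (Φ.wt ν))), t ∈ C.Ω := by
    rw [ae_withDensity_iff (ConeData.measurable_qp _)]
    refine Filter.Eventually.of_forall fun t ht => ?_
    by_contra h
    exact ht (ConeData.qp_of_notMem h _)
  exact Measure.quasiMeasurePreserving_snd.ae h1

theorem ae_Vm_iff (ν : Fin r → ℝ) {p : (ι → ℂ) × (Fin k → ℂ) → Prop} :
    (∀ᵐ w ∂(Φ.Vm ν), p w) ↔ ∀ᵐ w ∂(volume.restrict Φ.D), p w := by
  have hm : Measurable fun w => C.qp (Φ.wt ν) (Φ.ht w) :=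
    (ConeData.measurable_qp _).comp Φ.continuous_ht.measurable
  rw [Vm, ae_withDensity_iff hm, ae_restrict_iff' Φ.isOpen_D.measurableSet]
  refine Filter.eventually_congr (Filter.Eventually.of_forall fun w => ?_)
  have : C.qp (Φ.wt ν) (Φ.ht w) ≠ 0 ↔ w ∈ Φ.D := by
    constructor
    · intro h
      by_contra h2
      exact h (ConeData.qp_of_notMem h2 _)
    · intro h
      exact (ConeData.qp_pos h _).ne'
  rw [this]

theorem aestronglyMeasurable_Vm_iff (ν : Fin r → ℝ) {f : (ι → ℂ) × (Fin k → ℂ) → ℂ} :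
    AEStronglyMeasurable f (Φ.Vm ν) ↔ AEStronglyMeasurable f (volume.restrict Φ.D) := by
  constructor
  · rintro ⟨g, hg, h⟩
    exact ⟨g, hg, (Φ.ae_Vm_iff ν).1 h⟩
  · rintro ⟨g, hg, h⟩
    exact ⟨g, hg, (Φ.ae_Vm_iff ν).2 h⟩

/-- Twice the imaginary part of the form. -/
def imF (u v : Fin k → ℂ) : ι → ℝ := fun i => 2 * (Φ.F u v i).im

theorem fd_sub (u v : Fin k → ℂ) (i : ι) :
    Φ.fd (u - v) i = Φ.fd u i + Φ.fd v i - 2 * (Φ.F u v i).re := by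
  have h : (Φ.F v u i).re = (Φ.F u v i).re := by
    rw [Φ.hermitian u v]; simp
  simp only [fd, map_sub, LinearMap.sub_apply, Pi.sub_apply, Complex.sub_re, h]
  ring

/-- The argument of the kernel depends on `x` and `x'` only through a translation of `x - x'`, and
its imaginary part is the argument of the base kernel. -/
theorem kernel_arg (x x' : ι → ℝ) (a b : (Fin k → ℂ) × (ι → ℝ)) :
    (Φ.pt x a).1 - star (Φ.pt x' b).1 - (2 * Complex.I) • Φ.F (Φ.pt x a).2 (Φ.pt x' b).2 =
      fun i => ((x - x' + Φ.imF a.1 b.1) i : ℂ) +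
        ((a.2 + b.2 + Φ.fd (a.1 - b.1)) i : ℂ) * Complex.I := by
  ext i
  simp only [pt, Pi.sub_apply, Pi.star_apply, Pi.smul_apply, Pi.add_apply, fd_sub, imF, smul_eq_mul]
  rw [← Complex.re_add_im (Φ.F a.1 b.1 i)]
  simp only [star_add, star_mul', Complex.star_def, Complex.conj_ofReal, Complex.conj_I]
  push_cast
  simp only [Complex.add_re, Complex.add_im, Complex.ofReal_re, Complex.ofReal_im, Complex.mul_re,
    Complex.mul_im, Complex.I_re, Complex.I_im]
  push_cast
  linear_combination (2 * ((Φ.F a.1 b.1 i).im : ℂ)) * (-Complex.I_mul_I)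

end FormData

/-! ### The positive operator on the base -/

namespace FormData

variable {r : ℕ} {ι W : Type*} [Fintype ι] [Ring W] [Algebra ℝ W] {C : ConeData r ι W}
  {k : ℕ} (Φ : FormData C k)

/-- The conditions on the parameters under which the operators with the kernel of parameter `μ`
are bounded on the mixed norm spaces with weight `ν` and outer exponent `q`. -/
structure Admissible (μ ν : Fin r → ℝ) (q : ℝ) : Prop where
  hμ : ∀ j, ((C.m j : ℝ) + C.n j + Φ.bv j) / 2 < μ j
  hν : ∀ j, ((C.m j : ℝ) + Φ.bv j) / 2 < ν j
  hq : 1 ≤ q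
  lower : ∀ j, ν j - ((C.m j : ℝ) + Φ.bv j) / 2 + (C.n j : ℝ) / 2 <
    q * (μ j - ((C.m j : ℝ) + Φ.bv j) / 2)
  upper : ∀ j, (q - 1) * ((C.n j : ℝ) / 2) < ν j - ((C.m j : ℝ) + Φ.bv j) / 2

/-- The exponent of the kernel with parameter `μ`. -/
def ex (μ : Fin r → ℝ) : Fin r → ℝ := μ + (2⁻¹ : ℝ) • Φ.bv

variable {Φ}

theorem bv_nonneg (j : Fin r) : 0 ≤ Φ.bv j := Nat.cast_nonneg _

theorem ex_apply (μ : Fin r → ℝ) (j : Fin r) : Φ.ex μ j = μ j + Φ.bv j / 2 := by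
  simp only [ex, Pi.add_apply, Pi.smul_apply, smul_eq_mul]; ring

theorem Admissible.n_lt_ex {μ ν : Fin r → ℝ} {q : ℝ} (h : Φ.Admissible μ ν q) (j : Fin r) :
    (C.n j : ℝ) / 2 < Φ.ex μ j := by
  have h1 := h.hμ j
  have h2 := Φ.bv_nonneg j
  have h3 : (0 : ℝ) ≤ C.m j := Nat.cast_nonneg _
  rw [ex_apply]
  linarith

theorem fd_neg (u : Fin k → ℂ) : Φ.fd (-u) = Φ.fd u := by
  ext i; simp [fd]

theorem fd_sub_comm (u v : Fin k → ℂ) : Φ.fd (u - v) = Φ.fd (v - u) := by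
  rw [← fd_neg, neg_sub]

variable (Φ) in
/-- The kernel of the positive operator on the base of the Siegel domain. -/
def baseKernel (μ : Fin r → ℝ) (a b : (Fin k → ℂ) × (ι → ℝ)) : ℝ≥0∞ :=
  C.qp (-Φ.ex μ) (a.2 + b.2 + Φ.fd (a.1 - b.1))

theorem baseKernel_comm (μ : Fin r → ℝ) (a b : (Fin k → ℂ) × (ι → ℝ)) :
    Φ.baseKernel μ a b = Φ.baseKernel μ b a := by
  rw [baseKernel, baseKernel, add_comm a.2, fd_sub_comm]

theorem measurable_baseKernel (μ : Fin r → ℝ) :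
    Measurable (Function.uncurry (Φ.baseKernel μ)) := by
  have h := Φ.continuous_fd
  have h2 : Continuous fun p : ((Fin k → ℂ) × (ι → ℝ)) × ((Fin k → ℂ) × (ι → ℝ)) =>
      p.1.2 + p.2.2 + Φ.fd (p.1.1 - p.2.1) := by fun_prop
  exact (ConeData.measurable_qp _).comp h2.measurable

/-- The integral of the base kernel against a generalized power. -/
theorem lintegral_baseKernel {μ ν δ : Fin r → ℝ} (h1 : ∀ j, (C.n j : ℝ) / 2 < Φ.ex μ j)
    (h2 : ∀ j, (C.m j : ℝ) / 2 < δ j + ν j - Φ.bv j / 2)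
    (h3 : ∀ j, (C.n j : ℝ) / 2 < μ j - ν j - δ j) :
    ∃ c > 0, ∀ a : (Fin k → ℂ) × (ι → ℝ), a.2 ∈ C.Ω →
      ∫⁻ b, Φ.baseKernel μ a b * C.qp δ b.2 ∂(Φ.mY ν) =
        ENNReal.ofReal c * C.qp (-(μ - ν - δ)) a.2 := by
  obtain ⟨c, hc, h⟩ := Φ.lintegral_beta (β := Φ.ex μ) (γ := δ + ν - (2⁻¹ : ℝ) • Φ.bv) h1
    (fun j => by
      simp only [Pi.add_apply, Pi.sub_apply, Pi.smul_apply, smul_eq_mul]; linarith [h2 j])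
    (fun j => by
      have := h3 j
      rw [ex_apply]
      simp only [Pi.add_apply, Pi.sub_apply, Pi.smul_apply, smul_eq_mul]
      linarith)
  refine ⟨c, hc, fun a ha => ?_⟩
  have hm : Measurable fun b : (Fin k → ℂ) × (ι → ℝ) => Φ.baseKernel μ a b * C.qp δ b.2 :=
    ((measurable_baseKernel μ).comp measurable_prodMk_left).mul
      ((ConeData.measurable_qp _).comp measurable_snd)
  rw [Φ.lintegral_mY ν hm, ← lintegral_sub_left_eq_self _ a.1]
  have e : Φ.ex μ - Φ.bv - (δ + ν - (2⁻¹ : ℝ) • Φ.bv) = μ - ν - δ := by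
    ext j
    simp only [ex, Pi.add_apply, Pi.sub_apply, Pi.smul_apply, smul_eq_mul]
    ring
  rw [← e, ← h _ ha]
  refine lintegral_congr fun u => lintegral_congr fun t => ?_
  have e2 : δ + ν - (2⁻¹ : ℝ) • Φ.bv - C.τ = Φ.wt ν + δ := by
    rw [wt]; abel
  rw [e2, ConeData.qp_add, baseKernel]
  simp only [sub_sub_cancel]
  ring

theorem lintegral_mY_change (μ ν : Fin r → ℝ) {f : (Fin k → ℂ) × (ι → ℝ) → ℝ≥0∞}
    (hf : Measurable f) :
    ∫⁻ b, f b ∂(Φ.mY μ) = ∫⁻ b, C.qp (μ - ν) b.2 * f b ∂(Φ.mY ν) := by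
  have hm : Measurable fun b : (Fin k → ℂ) × (ι → ℝ) => C.qp (μ - ν) b.2 * f b :=
    ((ConeData.measurable_qp _).comp measurable_snd).mul hf
  rw [Φ.lintegral_mY μ hf, Φ.lintegral_mY ν hm]
  refine lintegral_congr fun u => lintegral_congr fun t => ?_
  have e : Φ.wt μ = Φ.wt ν + (μ - ν) := by rw [wt, wt]; abel
  rw [e, ConeData.qp_add, mul_assoc]

/-- Exponents for Schur's test. -/
theorem Admissible.exists_exponent {μ ν : Fin r → ℝ} {q q' : ℝ} (h : Φ.Admissible μ ν q)
    (hqq : q.HolderConjugate q') : ∃ σ : Fin r → ℝ, ∀ j,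
      (C.n j : ℝ) / 2 < q' * σ j ∧ q' * σ j < μ j - ((C.m j : ℝ) + Φ.bv j) / 2 ∧
      ν j - μ j + (C.n j : ℝ) / 2 < q * σ j ∧ q * σ j < ν j - ((C.m j : ℝ) + Φ.bv j) / 2 := by
  have hq := hqq.pos
  have hq' := hqq.symm.pos
  have hsum : q + q' = q * q' := hqq.mul_eq_add.symm
  have key : ∀ j, ∃ s : ℝ, (C.n j : ℝ) / 2 < q' * s ∧ q' * s < μ j - ((C.m j : ℝ) + Φ.bv j) / 2 ∧
      ν j - μ j + (C.n j : ℝ) / 2 < q * s ∧ q * s < ν j - ((C.m j : ℝ) + Φ.bv j) / 2 := by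
    intro j
    have h1 := h.hμ j
    have h2 := h.hν j
    have h3 := h.lower j
    have h4 := h.upper j
    set N : ℝ := (C.n j : ℝ) / 2 with hN
    set A : ℝ := μ j - ((C.m j : ℝ) + Φ.bv j) / 2 with hA
    set B : ℝ := ν j - ((C.m j : ℝ) + Φ.bv j) / 2 with hB
    have hNA : N < A := by rw [hN, hA]; linarith
    have hBA : ν j - μ j = B - A := by rw [hB, hA]; ring
    have e : q / q' = q - 1 := by
      rw [div_eq_iff hq'.ne']; linarith
    -- Of the four inequalities between the two lower and the two upper bounds of `σ_j`, two
    -- follow from the condition on `μ` and the others are those on `q`.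
    have hlt : max (N / q') ((B - A + N) / q) < min (A / q') (B / q) := by
      rw [max_lt_iff, lt_min_iff, lt_min_iff]
      refine ⟨⟨by gcongr, ?_⟩, ⟨?_, ?_⟩⟩
      · rw [div_lt_div_iff₀ hq' hq]
        have : N * q = (q - 1) * N * q' := by rw [← e]; field_simp
        rw [this]
        gcongr
      · rw [div_lt_div_iff₀ hq hq']
        have : A * q = (q - 1) * A * q' := by rw [← e]; field_simp
        rw [this]
        gcongr
        linarith
      · gcongr
        linarith
    obtain ⟨s, hs1, hs2⟩ := exists_between hlt
    rw [max_lt_iff] at hs1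
    rw [lt_min_iff] at hs2
    refine ⟨s, ?_, ?_, ?_, ?_⟩
    · have := (div_lt_iff₀ hq').1 hs1.1; linarith
    · have := (lt_div_iff₀ hq').1 hs2.1; linarith
    · have := (div_lt_iff₀ hq).1 hs1.2; rw [hBA]; linarith
    · have := (lt_div_iff₀ hq).1 hs2.2; linarith
  choose σ hσ using key
  exact ⟨σ, hσ⟩

theorem qp_rpow (α : Fin r → ℝ) {y : ι → ℝ} (hy : y ∈ C.Ω) {s : ℝ} :
    C.qp α y ^ s = C.qp (s • α) y := by
  have h0 : ∀ j, 0 ≤ C.Q j y := fun j => (ConeData.Q_pos hy j).le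
  rw [ConeData.qp_of_mem hy, ConeData.qp_of_mem hy,
    ENNReal.ofReal_rpow_of_pos (ConeData.Qp_pos hy α)]
  congr 1
  rw [ConeData.Qp, ConeData.Qp, ← Real.finsetProd_rpow _ _ fun j _ => Real.rpow_nonneg (h0 j) _]
  refine Finset.prod_congr rfl fun j _ => ?_
  rw [← Real.rpow_mul (h0 j), Pi.smul_apply, smul_eq_mul, mul_comm]

/-- The operator with the base kernel is bounded. -/
theorem Admissible.exists_schur {μ ν : Fin r → ℝ} {q : ℝ} (h : Φ.Admissible μ ν q) :
    ∃ K : ℝ≥0∞, K ≠ ∞ ∧ ∀ N : (Fin k → ℂ) × (ι → ℝ) → ℝ≥0∞, Measurable N →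
      ∫⁻ a, (∫⁻ b, Φ.baseKernel μ a b * N b ∂(Φ.mY μ)) ^ q ∂(Φ.mY ν) ≤
        K * ∫⁻ a, N a ^ q ∂(Φ.mY ν) := by
  have hKm := measurable_baseKernel (Φ := Φ) μ
  have hKs : ∀ a, Measurable (Φ.baseKernel μ a) := fun a => hKm.comp measurable_prodMk_left
  have hqm : ∀ α, Measurable fun b : (Fin k → ℂ) × (ι → ℝ) => C.qp α b.2 := fun α =>
    (ConeData.measurable_qp α).comp measurable_snd
  rcases eq_or_lt_of_le h.hq with hq1 | hq1
  · -- for `q = 1` Tonelli's theorem suffices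
    subst hq1
    obtain ⟨c, hc, hI⟩ := lintegral_baseKernel (Φ := Φ) (μ := μ) (ν := ν) (δ := 0) h.n_lt_ex
      (fun j => by have := h.hν j; simp only [Pi.zero_apply]; linarith)
      (fun j => by have := h.lower j; simp only [Pi.zero_apply]; linarith)
    refine ⟨ENNReal.ofReal c, ENNReal.ofReal_ne_top, fun N hN => ?_⟩
    simp only [ENNReal.rpow_one]
    have hm : Measurable (Function.uncurry fun a b => Φ.baseKernel μ a b * N b) :=
      hKm.mul (hN.comp measurable_snd)
    rw [lintegral_lintegral_swap hm.aemeasurable]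
    have hm2 : Measurable fun b => ∫⁻ a, Φ.baseKernel μ a b * N b ∂(Φ.mY ν) :=
      hm.lintegral_prod_left'
    rw [lintegral_mY_change μ ν hm2, ← lintegral_const_mul' _ _ ENNReal.ofReal_ne_top]
    refine lintegral_mono_ae ?_
    filter_upwards [Φ.ae_mY ν] with b hb
    have h0 := hI b hb
    have e0 : C.qp 0 = fun y => C.Ω.indicator (fun _ => 1) y := by
      ext y
      rw [ConeData.qp]
      congr 1
      ext z
      simp [ConeData.Qp_zero]
    have h1 : ∫⁻ a, Φ.baseKernel μ a b * N b ∂(Φ.mY ν) =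
        ENNReal.ofReal c * C.qp (-(μ - ν)) b.2 * N b := by
      have hKb : Measurable fun a => Φ.baseKernel μ a b := hKm.comp measurable_prodMk_right
      rw [lintegral_mul_const _ hKb]
      congr 1
      rw [sub_zero] at h0
      rw [← h0]
      refine lintegral_congr_ae ?_
      filter_upwards [Φ.ae_mY ν] with a ha
      rw [baseKernel_comm, e0]
      simp [Set.indicator_of_mem ha]
    rw [h1]
    have h2 : C.qp (μ - ν) b.2 * C.qp (-(μ - ν)) b.2 = 1 := by
      rw [← ConeData.qp_add, add_neg_cancel, e0]
      simp [Set.indicator_of_mem hb]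
    calc C.qp (μ - ν) b.2 * (ENNReal.ofReal c * C.qp (-(μ - ν)) b.2 * N b)
        = ENNReal.ofReal c * ((C.qp (μ - ν) b.2 * C.qp (-(μ - ν)) b.2) * N b) := by ring
      _ ≤ _ := by rw [h2, one_mul]
  · have hqq := Real.HolderConjugate.conjExponent hq1
    set q' := Real.conjExponent q
    obtain ⟨σ, hσ⟩ := h.exists_exponent hqq
    obtain ⟨c₁, hc₁, hI₁⟩ := lintegral_baseKernel (Φ := Φ) (μ := μ) (ν := ν)
      (δ := μ - ν - q' • σ) h.n_lt_ex
      (fun j => by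
        have := (hσ j).2.1
        simp only [Pi.sub_apply, Pi.smul_apply, smul_eq_mul]; linarith)
      (fun j => by
        have := (hσ j).1
        simp only [Pi.sub_apply, Pi.smul_apply, smul_eq_mul]; linarith)
    obtain ⟨c₂, hc₂, hI₂⟩ := lintegral_baseKernel (Φ := Φ) (μ := μ) (ν := ν)
      (δ := -(q • σ)) h.n_lt_ex
      (fun j => by
        have := (hσ j).2.2.2
        simp only [Pi.neg_apply, Pi.smul_apply, smul_eq_mul]; linarith)
      (fun j => by
        have := (hσ j).2.2.1
        simp only [Pi.neg_apply, Pi.smul_apply, smul_eq_mul]; linarith)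
    refine ⟨ENNReal.ofReal c₁ ^ (q / q') * ENNReal.ofReal c₂,
      ENNReal.mul_ne_top (ENNReal.rpow_ne_top_of_nonneg
        (div_nonneg hqq.nonneg hqq.symm.nonneg) ENNReal.ofReal_ne_top)
        ENNReal.ofReal_ne_top, fun N hN => ?_⟩
    have hchange : ∀ a, ∫⁻ b, Φ.baseKernel μ a b * N b ∂(Φ.mY μ) =
        ∫⁻ b, (Φ.baseKernel μ a b * C.qp (μ - ν) b.2) * N b ∂(Φ.mY ν) := fun a => by
      have hKN : Measurable fun b => Φ.baseKernel μ a b * N b := (hKs a).mul hN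
      rw [lintegral_mY_change μ ν hKN]
      exact lintegral_congr fun b => by ring
    simp_rw [hchange]
    -- both test functions are `Q^{-σ}`; the kernel is taken with respect to the measure of weight
    -- `ν`
    refine schur_test (Φ.mY ν) (Φ.mY ν) hqq (K := fun a b => Φ.baseKernel μ a b * C.qp (μ - ν) b.2)
      (φ := fun a => C.qp (-σ) a.2) (ψ := fun a => C.qp (-σ) a.2) ?_ (hqm _) (hqm _) ?_ ?_ ?_ ?_
      hN.aemeasurable
    · exact hKm.mul ((hqm _).comp measurable_snd)
    · filter_upwards [Φ.ae_mY ν] with a ha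
      exact (ConeData.qp_pos ha _).ne'
    · exact Filter.Eventually.of_forall fun a => (ConeData.qp_lt_top _ _).ne
    · filter_upwards [Φ.ae_mY ν] with a ha
      have e : -(μ - ν - (μ - ν - q' • σ)) = q' • -σ := by rw [smul_neg]; abel
      rw [qp_rpow _ ha, ← e, ← hI₁ a ha]
      refine le_of_eq (lintegral_congr_ae ?_)
      filter_upwards [Φ.ae_mY ν] with b hb
      rw [qp_rpow _ hb, mul_assoc, ← ConeData.qp_add, smul_neg, sub_eq_add_neg _ (q' • σ)]
    · filter_upwards [Φ.ae_mY ν] with b hb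
      have e : μ - ν + -(μ - ν - -(q • σ)) = q • -σ := by rw [smul_neg]; abel
      rw [qp_rpow _ hb, ← e, ConeData.qp_add]
      have h0 := hI₂ b hb
      calc ∫⁻ a, Φ.baseKernel μ a b * C.qp (μ - ν) b.2 * C.qp (-σ) a.2 ^ q ∂(Φ.mY ν)
          = ∫⁻ a, C.qp (μ - ν) b.2 * (Φ.baseKernel μ b a * C.qp (-(q • σ)) a.2) ∂(Φ.mY ν) := by
            refine lintegral_congr_ae ?_
            filter_upwards [Φ.ae_mY ν] with a ha
            rw [qp_rpow _ ha, smul_neg, baseKernel_comm]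
            ring
        _ = C.qp (μ - ν) b.2 * (ENNReal.ofReal c₂ * C.qp (-(μ - ν - -(q • σ))) b.2) := by
            rw [lintegral_const_mul' _ _ (ConeData.qp_lt_top _ _).ne, h0]
        _ ≤ _ := le_of_eq (by ring)

end FormData

/-! ### The kernel and the mixed norms -/

namespace FormData

variable {r : ℕ} {ι W : Type*} [Fintype ι] [Ring W] [Algebra ℝ W] {C : ConeData r ι W}
  {k : ℕ} (Φ : FormData C k)

/-- The holomorphic power on the tube, extended by zero. -/
def Lt (C : ConeData r ι W) (β : Fin r → ℝ) : (ι → ℂ) → ℂ := C.tube.indicator (C.L β)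

theorem Lt_of_mem {z : ι → ℂ} (hz : z ∈ C.tube) (β : Fin r → ℝ) : Lt C β z = C.L β z :=
  Set.indicator_of_mem hz _

theorem measurable_Lt {β : Fin r → ℝ} (hβ : ∀ i, (C.n i : ℝ) / 2 < β i + C.τ i) :
    Measurable (Lt C β) :=
  ConeData.measurable_indicator_of_continuousOn ConeData.isOpen_tube.measurableSet
    (ConeData.differentiableOn_L hβ).continuousOn

theorem Lt_conj (β : Fin r → ℝ) (z : ι → ℂ) : Lt C β (-star z) = star (Lt C β z) := by
  have h : -star z ∈ C.tube ↔ z ∈ C.tube := by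
    simp only [ConeData.tube, Set.mem_ofPred_eq]
    have : (fun i => ((-star z) i).im) = fun i => (z i).im := by ext i; simp
    rw [this]
  by_cases hz : z ∈ C.tube
  · rw [Lt_of_mem hz, Lt_of_mem (h.2 hz), ConeData.L_conj]
  · rw [Lt, Set.indicator_of_notMem hz, Set.indicator_of_notMem fun h2 => hz (h.1 h2), star_zero]

/-- The argument of the holomorphic power in the kernel. -/
def arg (ζ w : (ι → ℂ) × (Fin k → ℂ)) : ι → ℂ :=
  ζ.1 - star w.1 - (2 * Complex.I) • Φ.F ζ.2 w.2

/-- The Bergman kernel, up to a constant: `L_β(z - w̄ - 2iF(u,v))`. -/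
def ker (β : Fin r → ℝ) (ζ w : (ι → ℂ) × (Fin k → ℂ)) : ℂ := Lt C β (Φ.arg ζ w)

theorem continuous_arg : Continuous fun p : ((ι → ℂ) × (Fin k → ℂ)) × ((ι → ℂ) × (Fin k → ℂ)) =>
    Φ.arg p.1 p.2 := by
  have h : Continuous fun p : ((ι → ℂ) × (Fin k → ℂ)) × ((ι → ℂ) × (Fin k → ℂ)) =>
      Φ.F p.1.2 p.2.2 := Φ.continuous_F.comp
    ((continuous_snd.comp continuous_fst).prodMk (continuous_snd.comp continuous_snd))
  unfold arg
  fun_prop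

theorem measurable_ker {β : Fin r → ℝ} (hβ : ∀ i, (C.n i : ℝ) / 2 < β i + C.τ i) :
    Measurable (Function.uncurry (Φ.ker β)) :=
  (measurable_Lt hβ).comp Φ.continuous_arg.measurable

theorem arg_swap (ζ w : (ι → ℂ) × (Fin k → ℂ)) : Φ.arg w ζ = -star (Φ.arg ζ w) := by
  rw [arg, arg, Φ.hermitian ζ.2 w.2]
  ext i
  simp only [Pi.sub_apply, Pi.neg_apply, Pi.star_apply, Pi.smul_apply, smul_eq_mul, star_sub,
    star_star, star_mul']
  have h1 : star (2 : ℂ) = 2 := map_ofNat (starRingEnd ℂ) 2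
  have h2 : star Complex.I = -Complex.I := Complex.conj_I
  rw [h1, h2]
  ring

theorem ker_swap (β : Fin r → ℝ) (ζ w : (ι → ℂ) × (Fin k → ℂ)) :
    Φ.ker β w ζ = star (Φ.ker β ζ w) := by
  rw [ker, ker, arg_swap, Lt_conj]

theorem add_mem {a b : (Fin k → ℂ) × (ι → ℝ)} (ha : a.2 ∈ C.Ω) (hb : b.2 ∈ C.Ω) :
    a.2 + b.2 + Φ.fd (a.1 - b.1) ∈ C.Ω :=
  C.add_mem_Ω (C.add_mem_Ω ha (subset_closure hb)) (Φ.mem_closure _)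

theorem arg_mem_tube {ζ w : (ι → ℂ) × (Fin k → ℂ)} (hζ : ζ ∈ Φ.D) (hw : w ∈ Φ.D) :
    Φ.arg ζ w ∈ C.tube := by
  rw [← Φ.pt_ht ζ, ← Φ.pt_ht w, arg, kernel_arg]
  exact ConeData.mem_tube (Φ.add_mem (a := (ζ.2, Φ.ht ζ)) (b := (w.2, Φ.ht w)) hζ hw)

/-- The `L^p`-norm over the horizontal slice of height `t` over `u`, where `a = (u, t)`. -/
def N (p : ℝ≥0∞) (f : (ι → ℂ) × (Fin k → ℂ) → ℂ) (a : (Fin k → ℂ) × (ι → ℝ)) : ℝ≥0∞ :=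
  eLpNorm (fun x => f (Φ.pt x a)) p volume

theorem measurable_N (p : ℝ≥0∞) {f : (ι → ℂ) × (Fin k → ℂ) → ℂ} (hf : Measurable f) :
    Measurable (Φ.N p f) := by
  have h : Measurable (Function.uncurry fun (a : (Fin k → ℂ) × (ι → ℝ)) (x : ι → ℝ) =>
      f (Φ.pt x a)) := hf.comp (Φ.continuous_pt.comp continuous_swap).measurable
  exact measurable_eLpNorm_param volume h p

theorem N_congr (p : ℝ≥0∞) (ν : Fin r → ℝ) {f g : (ι → ℂ) × (Fin k → ℂ) → ℂ}
    (h : f =ᵐ[Φ.Vm ν] g) : Φ.N p f =ᵐ[Φ.mY ν] Φ.N p g := by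
  have h1 : ∀ᵐ q ∂((volume : Measure (ι → ℝ)).prod (Φ.mY ν)), f (Φ.ptEquiv q) = g (Φ.ptEquiv q) :=
    (Φ.measurePreserving_ptEquiv ν).quasiMeasurePreserving.ae h
  have h2 := Measure.ae_ae_of_ae_prod
    ((Measure.measurePreserving_swap (μ := Φ.mY ν) (ν := (volume : Measure (ι → ℝ)))
      ).quasiMeasurePreserving.ae h1)
  filter_upwards [h2] with a ha
  exact eLpNorm_congr_ae ha

/-- Minkowski's inequality for the positive operator. -/
theorem exists_N_le {μ : Fin r → ℝ} (hμ : ∀ j, (C.n j : ℝ) / 2 < Φ.ex μ j) : ∃ c : ℝ, 0 < c ∧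
    ∀ p : ℝ≥0∞, 1 ≤ p → ∀ f : (ι → ℂ) × (Fin k → ℂ) → ℂ, Measurable f →
    ∀ a : (Fin k → ℂ) × (ι → ℝ), a.2 ∈ C.Ω → ∀ g : (ι → ℝ) → ℂ,
    (∀ x, ‖g x‖ₑ ≤ ∫⁻ w, ‖Φ.ker (Φ.ex μ) (Φ.pt x a) w‖ₑ * ‖f w‖ₑ ∂(Φ.Vm μ)) →
    eLpNorm g p volume ≤ ENNReal.ofReal c * ∫⁻ b, Φ.baseKernel μ a b * Φ.N p f b ∂(Φ.mY μ) := by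
  obtain ⟨c, hc, hL⟩ := ConeData.lintegral_L (C := C) hμ
  have hμ' : ∀ i, (C.n i : ℝ) / 2 < Φ.ex μ i + C.τ i := fun i => by
    linarith [hμ i, C.n_lt_τ i, (C.n i).cast_nonneg (α := ℝ)]
  refine ⟨c, hc, fun p hp f hf a ha g hg => ?_⟩
  set Y : (Fin k → ℂ) × (ι → ℝ) → ι → ℝ := fun b => a.2 + b.2 + Φ.fd (a.1 - b.1) with hY
  have hYc : Continuous Y := by
    have := Φ.continuous_fd
    rw [hY]; fun_prop
  have hImc : Continuous fun b : (Fin k → ℂ) × (ι → ℝ) => Φ.imF a.1 b.1 := by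
    have : Continuous fun b : (Fin k → ℂ) × (ι → ℝ) => Φ.F a.1 b.1 :=
      Φ.continuous_F.comp (continuous_const.prodMk continuous_fst)
    unfold imF
    fun_prop
  set κ : ((Fin k → ℂ) × (ι → ℝ)) × (ι → ℝ) → ℝ≥0∞ := fun q =>
    ‖Lt C (Φ.ex μ) (fun i => (q.2 i : ℂ) + (Y q.1 i : ℂ) * Complex.I)‖ₑ with hκ
  set h : (ι → ℝ) → ((Fin k → ℂ) × (ι → ℝ)) × (ι → ℝ) → ℂ := fun x q =>
    f (Φ.pt (x + Φ.imF a.1 q.1.1 - q.2) q.1) with hh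
  have hκm : Measurable κ := by
    refine ((measurable_Lt hμ').comp (Continuous.measurable ?_)).enorm
    fun_prop
  have hhm : Measurable (Function.uncurry h) := by
    refine hf.comp ((Φ.continuous_pt.comp (f := fun q : (ι → ℝ) × (((Fin k → ℂ) × (ι → ℝ)) × (ι → ℝ))
      => (q.1 + Φ.imF a.1 q.2.1.1 - q.2.2, q.2.1)) ?_).measurable)
    have h1 : Continuous fun q : (ι → ℝ) × (((Fin k → ℂ) × (ι → ℝ)) × (ι → ℝ)) =>
      Φ.imF a.1 q.2.1.1 := hImc.comp (by fun_prop)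
    fun_prop
  have hhx : ∀ x, Measurable (h x) := fun x => hhm.comp measurable_prodMk_left
  have hfx : ∀ x, Measurable fun w => ‖Φ.ker (Φ.ex μ) (Φ.pt x a) w‖ₑ * ‖f w‖ₑ := fun x =>
    ((Φ.measurable_ker hμ').comp measurable_prodMk_left).enorm.mul hf.enorm
  -- the substitution `x' ↦ x + 2 Im F(u,v) - x'` turns the slice integral into a convolution
  have hle : ∀ x, ‖g x‖ₑ ≤ ∫⁻ q, κ q * ‖h x q‖ₑ ∂((Φ.mY μ).prod volume) := by
    intro x
    refine (hg x).trans (le_of_eq ?_)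
    have hm : Measurable fun q => κ q * ‖h x q‖ₑ := hκm.mul (hhx x).enorm
    rw [Φ.lintegral_Vm μ (hfx x), lintegral_prod _ hm.aemeasurable]
    refine lintegral_congr fun b => ?_
    rw [← lintegral_sub_left_eq_self _ (x + Φ.imF a.1 b.1)]
    refine lintegral_congr fun x' => ?_
    rw [ker, arg, kernel_arg]
    have e : x - (x + Φ.imF a.1 b.1 - x') + Φ.imF a.1 b.1 = x' := by abel
    rw [e]
  have hmain := eLpNorm_le_lintegral_of_le volume ((Φ.mY μ).prod (volume : Measure (ι → ℝ))) hp hκm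
    hhm (Filter.Eventually.of_forall hle)
  have htrans : ∀ q, eLpNorm (fun x => h x q) p volume = Φ.N p f q.1 := by
    intro q
    have hfm : Measurable fun x => f (Φ.pt x q.1) :=
      hf.comp (Φ.continuous_pt.comp (by fun_prop : Continuous fun x : ι → ℝ => (x, q.1))).measurable
    rw [N, ← eLpNorm_comp_measurePreserving hfm.aestronglyMeasurable
      (measurePreserving_add_right volume (Φ.imF a.1 q.1.1 - q.2))]
    congr 1
    ext x
    simp only [hh, Function.comp_apply, add_sub_assoc]
  simp_rw [htrans] at hmain
  have hm2 : Measurable fun q : ((Fin k → ℂ) × (ι → ℝ)) × (ι → ℝ) => κ q * Φ.N p f q.1 :=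
    hκm.mul ((Φ.measurable_N p hf).comp measurable_fst)
  rw [lintegral_prod _ hm2.aemeasurable] at hmain
  refine hmain.trans (le_of_eq ?_)
  rw [← lintegral_const_mul' _ _ ENNReal.ofReal_ne_top]
  refine lintegral_congr_ae ?_
  filter_upwards [Φ.ae_mY μ] with b hb
  have hκb : Measurable fun x => κ (b, x) := hκm.comp measurable_prodMk_left
  have hYb := Φ.add_mem ha hb
  rw [lintegral_mul_const _ hκb, baseKernel, ← mul_assoc, ← hL _ hYb]
  congr 1
  refine lintegral_congr fun x => ?_
  rw [hκ]
  simp only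
  rw [Lt_of_mem (ConeData.mem_tube hYb)]

variable {Φ} in
/-- The positive operator with the Bergman kernel is bounded in the mixed norms. -/
theorem Admissible.exists_bound {μ ν : Fin r → ℝ} {q : ℝ} (h : Φ.Admissible μ ν q) :
    ∃ K : ℝ≥0∞, K ≠ ∞ ∧ ∀ p : ℝ≥0∞, 1 ≤ p → ∀ f : (ι → ℂ) × (Fin k → ℂ) → ℂ, Measurable f →
    ∀ g : (ι → ℂ) × (Fin k → ℂ) → ℂ,
    (∀ ζ ∈ Φ.D, ‖g ζ‖ₑ ≤ ∫⁻ w, ‖Φ.ker (Φ.ex μ) ζ w‖ₑ * ‖f w‖ₑ ∂(Φ.Vm μ)) →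
    ∫⁻ a, Φ.N p g a ^ q ∂(Φ.mY ν) ≤ K * ∫⁻ a, Φ.N p f a ^ q ∂(Φ.mY ν) := by
  obtain ⟨K, hK, hS⟩ := h.exists_schur
  obtain ⟨c, hc, hN⟩ := Φ.exists_N_le h.n_lt_ex
  have hq0 : 0 ≤ q := zero_le_one.trans h.hq
  refine ⟨ENNReal.ofReal c ^ q * K, ENNReal.mul_ne_top
    (ENNReal.rpow_ne_top_of_nonneg hq0 ENNReal.ofReal_ne_top) hK, fun p hp f hf g hg => ?_⟩
  calc ∫⁻ a, Φ.N p g a ^ q ∂(Φ.mY ν)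
      ≤ ∫⁻ a, ENNReal.ofReal c ^ q *
          (∫⁻ b, Φ.baseKernel μ a b * Φ.N p f b ∂(Φ.mY μ)) ^ q ∂(Φ.mY ν) := by
        refine lintegral_mono_ae ?_
        filter_upwards [Φ.ae_mY ν] with a ha
        rw [← ENNReal.mul_rpow_of_nonneg _ _ hq0]
        refine ENNReal.rpow_le_rpow ?_ hq0
        exact hN p hp f hf a ha _ fun x => hg _ (Φ.pt_mem_D.2 ha)
    _ ≤ _ := by
        rw [lintegral_const_mul' _ _ (ENNReal.rpow_ne_top_of_nonneg hq0 ENNReal.ofReal_ne_top),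
          mul_assoc]
        gcongr
        exact hS _ (Φ.measurable_N p hf)

end FormData

/-! ### Convergence and holomorphy of the integrals -/

namespace FormData

variable {r : ℕ} {ι W : Type*} [Fintype ι] [Ring W] [Algebra ℝ W] {C : ConeData r ι W}
  {k : ℕ} (Φ : FormData C k)

theorem le_one_add_rpow {q : ℝ} (hq : 1 ≤ q) (x : ℝ≥0∞) : x ≤ 1 + x ^ q := by
  rcases le_total x 1 with h | h
  · exact h.trans le_self_add
  · calc x = x ^ (1 : ℝ) := (ENNReal.rpow_one x).symm
      _ ≤ x ^ q := ENNReal.rpow_le_rpow_of_exponent_le h hq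
      _ ≤ 1 + x ^ q := le_add_self

/-- The mixed norm spaces embed locally into `L¹`. -/
theorem exists_lintegral_ball_le (ν : Fin r → ℝ) {p : ℝ≥0∞} (hp : 1 ≤ p) {q : ℝ} (hq : 1 ≤ q)
    {ζ₀ : (ι → ℂ) × (Fin k → ℂ)} (hζ₀ : ζ₀ ∈ Φ.D) : ∃ R > 0, Metric.ball ζ₀ R ⊆ Φ.D ∧
    ∃ K : ℝ≥0∞, K ≠ ∞ ∧ ∀ h : (ι → ℂ) × (Fin k → ℂ) → ℂ, Measurable h →
      ∫⁻ ζ in Metric.ball ζ₀ R, ‖h ζ‖ₑ ≤ K * (1 + ∫⁻ a, Φ.N p h a ^ q ∂(Φ.mY ν)) := by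
  obtain ⟨R₀, hR₀, hsub₀⟩ := Metric.isOpen_iff.1 Φ.isOpen_D ζ₀ hζ₀
  set R := R₀ / 2 with hR
  have hR0 : 0 < R := by positivity
  have hsub : Metric.closedBall ζ₀ R ⊆ Φ.D :=
    (Metric.closedBall_subset_ball (by rw [hR]; linarith)).trans hsub₀
  refine ⟨R, hR0, Metric.ball_subset_closedBall.trans hsub, ?_⟩
  -- the compact sets over which the variables range
  have hcpt := isCompact_closedBall ζ₀ R
  set S : Set ((Fin k → ℂ) × (ι → ℝ)) := (fun w => (w.2, Φ.ht w)) '' Metric.closedBall ζ₀ R with hS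
  have hSc : IsCompact S := hcpt.image (continuous_snd.prodMk Φ.continuous_ht)
  set X : Set (ι → ℝ) := (fun w : (ι → ℂ) × (Fin k → ℂ) => fun i => (w.1 i).re) ''
    Metric.closedBall ζ₀ R with hX
  have hXc : IsCompact X := hcpt.image (by fun_prop)
  have hSΩ : ∀ a ∈ S, a.2 ∈ C.Ω := by
    rintro _ ⟨w, hw, rfl⟩
    exact hsub hw
  -- the weight is bounded above and below
  have hcont : ContinuousOn (fun a : (Fin k → ℂ) × (ι → ℝ) => C.Qp (Φ.wt ν) a.2) S :=
    (ConeData.continuousOn_Qp _).comp continuous_snd.continuousOn hSΩ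
  have hcont' : ContinuousOn (fun a : (Fin k → ℂ) × (ι → ℝ) => C.Qp (-Φ.wt ν) a.2) S :=
    (ConeData.continuousOn_Qp _).comp continuous_snd.continuousOn hSΩ
  obtain ⟨M₁, hM₁⟩ := hSc.bddAbove_image hcont
  obtain ⟨M₂, hM₂⟩ := hSc.bddAbove_image hcont'
  have hSfin : Φ.mY ν S ≠ ∞ := by
    rw [← lintegral_indicator_one hSc.measurableSet,
      Φ.lintegral_mY ν (measurable_one.indicator hSc.measurableSet)]
    have h1 : ∀ u t, C.qp (Φ.wt ν) t * S.indicator (1 : (Fin k → ℂ) × (ι → ℝ) → ℝ≥0∞) (u, t) ≤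
        ENNReal.ofReal M₁ * S.indicator (1 : (Fin k → ℂ) × (ι → ℝ) → ℝ≥0∞) (u, t) := by
      intro u t
      by_cases h : (u, t) ∈ S
      · rw [ConeData.qp_of_mem (hSΩ _ h)]
        gcongr
        exact hM₁ ⟨_, h, rfl⟩
      · simp [Set.indicator_of_notMem h]
    refine ne_top_of_le_ne_top ?_ (lintegral_mono fun u => lintegral_mono fun t => h1 u t)
    rw [← lintegral_prod _ ((measurable_one.indicator hSc.measurableSet).const_mul _).aemeasurable,
      lintegral_const_mul' _ _ ENNReal.ofReal_ne_top, lintegral_indicator_one hSc.measurableSet]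
    exact ENNReal.mul_ne_top ENNReal.ofReal_ne_top hSc.measure_lt_top.ne
  set cX : ℝ≥0∞ := volume X ^ (1 / (1 : ℝ≥0∞).toReal - 1 / p.toReal) with hcX
  have hcXt : cX ≠ ∞ := by
    refine ENNReal.rpow_ne_top_of_nonneg ?_ hXc.measure_lt_top.ne
    rcases eq_or_ne p ∞ with rfl | hpt
    · simp
    · have : 1 ≤ p.toReal := by
        rw [← ENNReal.toReal_one]; exact ENNReal.toReal_mono hpt hp
      have h2 : 1 / p.toReal ≤ 1 := by
        rw [div_le_one (by linarith)]; exact this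
      simp only [ENNReal.toReal_one, div_one] at h2 ⊢
      linarith
  refine ⟨ENNReal.ofReal M₂ * (cX * (Φ.mY ν S + 1)), ENNReal.mul_ne_top ENNReal.ofReal_ne_top
    (ENNReal.mul_ne_top hcXt (ENNReal.add_ne_top.2 ⟨hSfin, ENNReal.one_ne_top⟩)), fun h hh => ?_⟩
  set g : (ι → ℂ) × (Fin k → ℂ) → ℝ≥0∞ := (Metric.ball ζ₀ R).indicator fun ζ => ‖h ζ‖ₑ with hg
  have hgm : Measurable g := hh.enorm.indicator measurableSet_ball
  have h1 : ∫⁻ ζ in Metric.ball ζ₀ R, ‖h ζ‖ₑ ≤ ENNReal.ofReal M₂ * ∫⁻ ζ, g ζ ∂(Φ.Vm ν) := by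
    have hm : Measurable fun w => C.qp (Φ.wt ν) (Φ.ht w) :=
      (ConeData.measurable_qp _).comp Φ.continuous_ht.measurable
    rw [← lintegral_indicator measurableSet_ball, Vm, lintegral_withDensity_eq_lintegral_mul _ hm hgm,
      ← lintegral_const_mul' _ _ ENNReal.ofReal_ne_top]
    refine lintegral_mono fun ζ => ?_
    by_cases hζ : ζ ∈ Metric.ball ζ₀ R
    · have hζ' := Metric.ball_subset_closedBall hζ
      have hΩ : Φ.ht ζ ∈ C.Ω := hsub hζ'
      have h3 : ENNReal.ofReal (C.Qp (-Φ.wt ν) (Φ.ht ζ)) ≤ ENNReal.ofReal M₂ :=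
        ENNReal.ofReal_le_ofReal (hM₂ ⟨(ζ.2, Φ.ht ζ), ⟨ζ, hζ', rfl⟩, rfl⟩)
      rw [Pi.mul_apply, hg]
      simp only [Set.indicator_of_mem hζ]
      have h4 : C.qp (-Φ.wt ν) (Φ.ht ζ) * C.qp (Φ.wt ν) (Φ.ht ζ) = 1 := by
        rw [← ConeData.qp_add, neg_add_cancel, ConeData.qp_of_mem hΩ, ConeData.Qp_zero,
          ENNReal.ofReal_one]
      rw [← ConeData.qp_of_mem hΩ] at h3
      calc ‖h ζ‖ₑ = C.qp (-Φ.wt ν) (Φ.ht ζ) * C.qp (Φ.wt ν) (Φ.ht ζ) * ‖h ζ‖ₑ := by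
            rw [h4, one_mul]
        _ ≤ ENNReal.ofReal M₂ * C.qp (Φ.wt ν) (Φ.ht ζ) * ‖h ζ‖ₑ := by gcongr
        _ = _ := by rw [mul_assoc]
    · simp [Set.indicator_of_notMem hζ]
  refine h1.trans ?_
  rw [mul_assoc]
  gcongr
  rw [Φ.lintegral_Vm ν hgm]
  have h2 : ∀ a, ∫⁻ x : ι → ℝ, g (Φ.pt x a) ≤ S.indicator (fun a => cX * Φ.N p h a) a := by
    intro a
    by_cases ha : a ∈ S
    · rw [Set.indicator_of_mem ha]
      have hfm : Measurable fun x => h (Φ.pt x a) :=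
        hh.comp (Φ.continuous_pt.comp (by fun_prop : Continuous fun x : ι → ℝ => (x, a))).measurable
      calc ∫⁻ x : ι → ℝ, g (Φ.pt x a) ≤ ∫⁻ x in X, ‖h (Φ.pt x a)‖ₑ := by
            rw [← lintegral_indicator hXc.measurableSet]
            refine lintegral_mono fun x => ?_
            by_cases hx : Φ.pt x a ∈ Metric.ball ζ₀ R
            · have hxX : x ∈ X := ⟨_, Metric.ball_subset_closedBall hx, by ext i; simp [pt]⟩
              rw [hg, Set.indicator_of_mem hx, Set.indicator_of_mem hxX]
            · rw [hg, Set.indicator_of_notMem hx]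
              exact bot_le
        _ = eLpNorm (fun x => h (Φ.pt x a)) 1 (volume.restrict X) :=
            eLpNorm_one_eq_lintegral_enorm.symm
        _ ≤ eLpNorm (fun x => h (Φ.pt x a)) p (volume.restrict X) *
            (volume.restrict X) Set.univ ^ (1 / (1 : ℝ≥0∞).toReal - 1 / p.toReal) :=
            eLpNorm_le_eLpNorm_mul_rpow_measure_univ hp hfm.aestronglyMeasurable
        _ ≤ Φ.N p h a * cX := by
            rw [Measure.restrict_apply_univ]
            gcongr
            exact eLpNorm_mono_measure _ Measure.restrict_le_self
        _ = _ := mul_comm _ _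
    · rw [Set.indicator_of_notMem ha]
      refine le_of_eq ?_
      have h3 : ∀ x, g (Φ.pt x a) = 0 := by
        intro x
        refine Set.indicator_of_notMem (fun hx => ha ?_) _
        exact ⟨_, Metric.ball_subset_closedBall hx, Prod.ext rfl (Φ.ht_pt _ _)⟩
      simp [h3]
  calc ∫⁻ a, (∫⁻ x : ι → ℝ, g (Φ.pt x a)) ∂(Φ.mY ν)
      ≤ ∫⁻ a in S, cX * Φ.N p h a ∂(Φ.mY ν) := by
        rw [← lintegral_indicator hSc.measurableSet]
        exact lintegral_mono h2
    _ ≤ cX * ∫⁻ a in S, 1 + Φ.N p h a ^ q ∂(Φ.mY ν) := by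
        rw [lintegral_const_mul' _ _ hcXt]
        gcongr with a
        exact le_one_add_rpow hq _
    _ ≤ cX * (Φ.mY ν S + ∫⁻ a, Φ.N p h a ^ q ∂(Φ.mY ν)) := by
        gcongr
        rw [lintegral_add_left measurable_const, setLIntegral_one]
        gcongr
        exact Measure.restrict_le_self
    _ ≤ cX * ((Φ.mY ν S + 1) * (1 + ∫⁻ a, Φ.N p h a ^ q ∂(Φ.mY ν))) := by
        gcongr
        rw [add_mul, one_mul, mul_add, mul_one]
        gcongr
        · exact le_self_add
        · exact le_add_self
    _ = _ := by ring

theorem differentiable_arg (w : (ι → ℂ) × (Fin k → ℂ)) : Differentiable ℂ fun ζ => Φ.arg ζ w := by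
  have h : (fun ζ : (ι → ℂ) × (Fin k → ℂ) => Φ.F ζ.2 w.2) =
      fun ζ => ∑ a, ∑ b, (ζ.2 a * star (w.2 b)) • Φ.F (Pi.single a 1) (Pi.single b 1) := by
    funext ζ
    exact Φ.F_eq_sum _ _
  have h2 : Differentiable ℂ fun ζ : (ι → ℂ) × (Fin k → ℂ) => Φ.F ζ.2 w.2 := by
    rw [h]
    fun_prop
  unfold arg
  fun_prop

theorem differentiableOn_ker {β : Fin r → ℝ} (hβ : ∀ i, (C.n i : ℝ) / 2 < β i + C.τ i)
    {w : (ι → ℂ) × (Fin k → ℂ)} (hw : w ∈ Φ.D) : DifferentiableOn ℂ (fun ζ => Φ.ker β ζ w) Φ.D := by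
  refine ((ConeData.differentiableOn_L hβ).comp (Φ.differentiable_arg w).differentiableOn
    fun ζ hζ => Φ.arg_mem_tube hζ hw).congr fun ζ hζ => ?_
  exact Lt_of_mem (Φ.arg_mem_tube hζ hw) β

theorem ae_mem_D (ν : Fin r → ℝ) : ∀ᵐ w ∂(Φ.Vm ν), w ∈ Φ.D :=
  (Φ.ae_Vm_iff ν).2 (ae_restrict_mem Φ.isOpen_D.measurableSet)

variable {Φ} in
theorem Admissible.n_lt_ex_add {μ ν : Fin r → ℝ} {q : ℝ} (h : Φ.Admissible μ ν q) (j : Fin r) :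
    (C.n j : ℝ) / 2 < Φ.ex μ j + C.τ j := by
  have h1 : (0 : ℝ) ≤ C.m j := Nat.cast_nonneg _
  have h2 : (0 : ℝ) ≤ C.n j := Nat.cast_nonneg _
  have h3 : C.τ j = 1 + ((C.m j : ℝ) + C.n j) / 2 := rfl
  linarith [h.n_lt_ex j]

variable {Φ} in
/-- The integrals against the kernel converge absolutely at every point of the domain and define
holomorphic functions. -/
theorem Admissible.integrable_and_holomorphic {μ ν : Fin r → ℝ} {q : ℝ} (h : Φ.Admissible μ ν q)
    {p : ℝ≥0∞} (hp : 1 ≤ p) {f : (ι → ℂ) × (Fin k → ℂ) → ℂ} (hf : Measurable f)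
    (hfin : ∫⁻ a, Φ.N p f a ^ q ∂(Φ.mY ν) < ∞) :
    (∀ ζ ∈ Φ.D, Integrable (fun w => Φ.ker (Φ.ex μ) ζ w * f w) (Φ.Vm μ)) ∧
    DifferentiableOn ℂ (fun ζ => ∫ w, Φ.ker (Φ.ex μ) ζ w * f w ∂(Φ.Vm μ)) Φ.D := by
  have hkm := Φ.measurable_ker h.n_lt_ex_add
  have hjm : Measurable fun z : ((ι → ℂ) × (Fin k → ℂ)) × ((ι → ℂ) × (Fin k → ℂ)) =>
      Φ.ker (Φ.ex μ) z.1 z.2 * f z.2 := hkm.mul (hf.comp measurable_snd)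
  have : (volume : Measure ((ι → ℂ) × (Fin k → ℂ))).IsAddHaarMeasure :=
    Measure.prod.instIsAddHaarMeasure _ _
  refine differentiableOn_integral_of_locally volume (Φ.Vm μ) Φ.isOpen_D
    (f := fun ζ w => Φ.ker (Φ.ex μ) ζ w * f w) (fun ζ _ => ?_) hjm.enorm.aemeasurable ?_ ?_
  · have : Measurable fun w => Φ.ker (Φ.ex μ) ζ w * f w :=
      (hkm.comp measurable_prodMk_left).mul hf
    exact this.aestronglyMeasurable
  · filter_upwards [Φ.ae_mem_D μ] with w hw
    exact (Φ.differentiableOn_ker h.n_lt_ex_add hw).mul_const _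
  · intro ζ₀ hζ₀
    obtain ⟨R, hR, hsub, K, hK, hloc⟩ := Φ.exists_lintegral_ball_le ν hp h.hq hζ₀
    obtain ⟨K', hK', hbd⟩ := h.exists_bound
    refine ⟨R, hR, hsub, ?_⟩
    set G : (ι → ℂ) × (Fin k → ℂ) → ℝ≥0∞ := fun ζ => ∫⁻ w, ‖Φ.ker (Φ.ex μ) ζ w * f w‖ₑ ∂(Φ.Vm μ)
      with hG
    have hGm : Measurable G := hjm.enorm.lintegral_prod_right'
    have hGeq : ∀ ζ, G ζ = ∫⁻ w, ‖Φ.ker (Φ.ex μ) ζ w‖ₑ * ‖f w‖ₑ ∂(Φ.Vm μ) := fun ζ => by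
      simp only [hG, enorm_mul]
    -- The mixed norm is only defined for functions with finite values, and `G` could be infinite
    -- so far, hence the truncation.
    have htrunc : ∀ n : ℕ, ∫⁻ ζ in Metric.ball ζ₀ R, min (G ζ) n ≤
        K * (1 + K' * ∫⁻ a, Φ.N p f a ^ q ∂(Φ.mY ν)) := by
      intro n
      set g : (ι → ℂ) × (Fin k → ℂ) → ℂ := fun ζ => ((min (G ζ) n).toReal : ℂ) with hg
      have hgm : Measurable g :=
        Complex.measurable_ofReal.comp (hGm.min measurable_const).ennreal_toReal
      have hge : ∀ ζ, ‖g ζ‖ₑ = min (G ζ) n := fun ζ => by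
        rw [hg, ← ofReal_norm, Complex.norm_real, Real.norm_of_nonneg ENNReal.toReal_nonneg,
          ENNReal.ofReal_toReal]
        exact ne_top_of_le_ne_top (ENNReal.natCast_ne_top n) (min_le_right _ _)
      have h1 := hloc g hgm
      simp_rw [hge] at h1
      refine h1.trans ?_
      gcongr
      refine hbd p hp f hf g fun ζ _ => ?_
      rw [hge, ← hGeq]
      exact min_le_left _ _
    have hsup : ∀ ζ, G ζ = ⨆ n : ℕ, min (G ζ) n := by
      intro ζ
      rw [← inf_iSup_eq, ENNReal.iSup_natCast, inf_top_eq]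
    have : ∫⁻ ζ in Metric.ball ζ₀ R, G ζ ≤ K * (1 + K' * ∫⁻ a, Φ.N p f a ^ q ∂(Φ.mY ν)) := by
      rw [lintegral_congr hsup, lintegral_iSup (fun n => hGm.min measurable_const)]
      · exact iSup_le htrunc
      · intro m n hmn ζ
        exact min_le_min le_rfl (Nat.cast_le.2 hmn)
    refine this.trans_lt ?_
    exact ENNReal.mul_lt_top hK.lt_top (ENNReal.add_lt_top.2 ⟨ENNReal.one_lt_top,
      ENNReal.mul_lt_top hK'.lt_top hfin⟩)

end FormData

/-! ### The partial Fourier transform -/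

namespace FormData

variable {r : ℕ} {ι W : Type*} [Fintype ι] [Ring W] [Algebra ℝ W] {C : ConeData r ι W}
  {k : ℕ} (Φ : FormData C k)

/-- Horizontal translation. -/
def sh (x : ι → ℝ) (ζ : (ι → ℂ) × (Fin k → ℂ)) : (ι → ℂ) × (Fin k → ℂ) :=
  (ζ.1 + fun i => (x i : ℂ), ζ.2)

theorem continuous_sh : Continuous fun p : ((ι → ℂ) × (Fin k → ℂ)) × (ι → ℝ) => sh p.2 p.1 := by
  unfold sh
  fun_prop

theorem sh_eq_pt (x : ι → ℝ) (ζ : (ι → ℂ) × (Fin k → ℂ)) :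
    sh x ζ = Φ.pt ((fun i => (ζ.1 i).re) + x) (ζ.2, Φ.ht ζ) := by
  conv_lhs => rw [← Φ.pt_ht ζ]
  refine Prod.ext ?_ rfl
  ext i
  simp only [sh, pt, Pi.add_apply]
  push_cast
  ring

theorem sh_mem_D {x : ι → ℝ} {ζ : (ι → ℂ) × (Fin k → ℂ)} (hζ : ζ ∈ Φ.D) : sh x ζ ∈ Φ.D := by
  rw [Φ.sh_eq_pt, Φ.pt_mem_D]
  exact hζ

theorem lintegral_sh (f : (ι → ℂ) × (Fin k → ℂ) → ℂ) (ζ : (ι → ℂ) × (Fin k → ℂ)) :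
    ∫⁻ x, ‖f (sh x ζ)‖ₑ = Φ.N 1 f (ζ.2, Φ.ht ζ) := by
  rw [N, eLpNorm_one_eq_lintegral_enorm,
    ← lintegral_add_left_eq_self (fun x => ‖f (Φ.pt x (ζ.2, Φ.ht ζ))‖ₑ) (fun i => (ζ.1 i).re)]
  simp_rw [Φ.sh_eq_pt]

/-- The Fourier integral `∫ f(z + x, u) e^{-2πi⟨z + x, ξ⟩} dx`. -/
def T (f : (ι → ℂ) × (Fin k → ℂ) → ℂ) (ξ : ι → ℝ) (ζ : (ι → ℂ) × (Fin k → ℂ)) : ℂ :=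
  ∫ x : ι → ℝ, cexpPairing (-(sh x ζ).1) ξ * f (sh x ζ)

theorem enorm_T_integrand (f : (ι → ℂ) × (Fin k → ℂ) → ℂ) (ξ : ι → ℝ)
    (ζ : (ι → ℂ) × (Fin k → ℂ)) (x : ι → ℝ) :
    ‖cexpPairing (-(sh x ζ).1) ξ * f (sh x ζ)‖ₑ =
      expd (-((2 * Real.pi) • fun i => (ζ.1 i).im)) ξ * ‖f (sh x ζ)‖ₑ := by
  rw [enorm_mul, ← ofReal_norm, norm_cexpPairing, expd]
  congr 5
  ext i
  simp [sh]

theorem lintegral_T_integrand (f : (ι → ℂ) × (Fin k → ℂ) → ℂ) (ξ : ι → ℝ)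
    (ζ : (ι → ℂ) × (Fin k → ℂ)) :
    ∫⁻ x, ‖cexpPairing (-(sh x ζ).1) ξ * f (sh x ζ)‖ₑ =
      expd (-((2 * Real.pi) • fun i => (ζ.1 i).im)) ξ * Φ.N 1 f (ζ.2, Φ.ht ζ) := by
  simp_rw [enorm_T_integrand]
  rw [lintegral_const_mul' _ _ (by rw [expd]; exact ENNReal.ofReal_ne_top), Φ.lintegral_sh]

theorem measurable_T_integrand {f : (ι → ℂ) × (Fin k → ℂ) → ℂ} (hf : Measurable f) :
    Measurable fun p : ((ι → ℝ) × ((ι → ℂ) × (Fin k → ℂ))) × (ι → ℝ) =>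
      cexpPairing (-(sh p.2 p.1.2).1) p.1.1 * f (sh p.2 p.1.2) := by
  have h1 : Continuous fun p : ((ι → ℝ) × ((ι → ℂ) × (Fin k → ℂ))) × (ι → ℝ) =>
      sh p.2 p.1.2 := continuous_sh.comp (by fun_prop :
        Continuous fun p : ((ι → ℝ) × ((ι → ℂ) × (Fin k → ℂ))) × (ι → ℝ) => (p.1.2, p.2))
  have h2 : Continuous fun p : ((ι → ℝ) × ((ι → ℂ) × (Fin k → ℂ))) × (ι → ℝ) =>
      cexpPairing (-(sh p.2 p.1.2).1) p.1.1 :=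
    continuous_cexpPairing.comp (f := fun p : ((ι → ℝ) × ((ι → ℂ) × (Fin k → ℂ))) × (ι → ℝ) =>
      (-(sh p.2 p.1.2).1, p.1.1)) (by fun_prop)
  exact h2.measurable.mul (hf.comp h1.measurable)

/-- Slice norms are locally integrable as functions on the domain. -/
theorem exists_lintegral_ball_slice (ν : Fin r → ℝ) {q : ℝ} (hq : 1 ≤ q)
    {f : (ι → ℂ) × (Fin k → ℂ) → ℂ} (hf : Measurable f)
    (hfin : ∫⁻ a, Φ.N 1 f a ^ q ∂(Φ.mY ν) < ∞) {ζ₀ : (ι → ℂ) × (Fin k → ℂ)} (hζ₀ : ζ₀ ∈ Φ.D) :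
    ∃ R > 0, Metric.ball ζ₀ R ⊆ Φ.D ∧
      ∫⁻ ζ in Metric.ball ζ₀ R, Φ.N 1 f (ζ.2, Φ.ht ζ) < ∞ := by
  obtain ⟨R, hR, hsub, K, hK, hloc⟩ := Φ.exists_lintegral_ball_le ν (p := ∞) le_top hq hζ₀
  refine ⟨R, hR, hsub, ?_⟩
  set G : (ι → ℂ) × (Fin k → ℂ) → ℝ≥0∞ := fun ζ => Φ.N 1 f (ζ.2, Φ.ht ζ) with hG
  have hGm : Measurable G := (Φ.measurable_N 1 hf).comp
    (continuous_snd.prodMk Φ.continuous_ht).measurable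
  have htrunc : ∀ n : ℕ, ∫⁻ ζ in Metric.ball ζ₀ R, min (G ζ) n ≤
      K * (1 + ∫⁻ a, Φ.N 1 f a ^ q ∂(Φ.mY ν)) := by
    intro n
    set g : (ι → ℂ) × (Fin k → ℂ) → ℂ := fun ζ => ((min (G ζ) n).toReal : ℂ) with hg
    have hgm : Measurable g :=
      Complex.measurable_ofReal.comp (hGm.min measurable_const).ennreal_toReal
    have hge : ∀ ζ, ‖g ζ‖ₑ = min (G ζ) n := fun ζ => by
      rw [hg, ← ofReal_norm, Complex.norm_real, Real.norm_of_nonneg ENNReal.toReal_nonneg,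
        ENNReal.ofReal_toReal]
      exact ne_top_of_le_ne_top (ENNReal.natCast_ne_top n) (min_le_right _ _)
    have h1 := hloc g hgm
    simp_rw [hge] at h1
    refine h1.trans ?_
    gcongr with a
    rw [N, eLpNorm_exponent_top]
    refine eLpNormEssSup_le_of_ae_enorm_bound (Filter.Eventually.of_forall fun x => ?_)
    rw [hge]
    refine (min_le_left _ _).trans (le_of_eq ?_)
    simp only [hG, Φ.ht_pt]
    rfl
  have hsup : ∀ ζ, G ζ = ⨆ n : ℕ, min (G ζ) n := by
    intro ζ
    rw [← inf_iSup_eq, ENNReal.iSup_natCast, inf_top_eq]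
  have : ∫⁻ ζ in Metric.ball ζ₀ R, G ζ ≤ K * (1 + ∫⁻ a, Φ.N 1 f a ^ q ∂(Φ.mY ν)) := by
    rw [lintegral_congr hsup, lintegral_iSup (fun n => hGm.min measurable_const)]
    · exact iSup_le htrunc
    · intro m n hmn ζ
      exact min_le_min le_rfl (Nat.cast_le.2 hmn)
  refine this.trans_lt ?_
  exact ENNReal.mul_lt_top hK.lt_top (ENNReal.add_lt_top.2 ⟨ENNReal.one_lt_top, hfin⟩)

/-- The Fourier integrals of holomorphic functions with integrable slices are holomorphic. -/
theorem T_holomorphic (ν : Fin r → ℝ) {q : ℝ} (hq : 1 ≤ q)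
    {f : (ι → ℂ) × (Fin k → ℂ) → ℂ} (hf : Measurable f) (hd : DifferentiableOn ℂ f Φ.D)
    (hfin : ∫⁻ a, Φ.N 1 f a ^ q ∂(Φ.mY ν) < ∞) (ξ : ι → ℝ) :
    (∀ ζ ∈ Φ.D, Integrable fun x : ι → ℝ => cexpPairing (-(sh x ζ).1) ξ * f (sh x ζ)) ∧
    DifferentiableOn ℂ (T f ξ) Φ.D := by
  have : (volume : Measure ((ι → ℂ) × (Fin k → ℂ))).IsAddHaarMeasure :=
    Measure.prod.instIsAddHaarMeasure _ _
  have hm : Measurable fun p : ((ι → ℂ) × (Fin k → ℂ)) × (ι → ℝ) =>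
      cexpPairing (-(sh p.2 p.1).1) ξ * f (sh p.2 p.1) := by
    have hpair : Measurable fun p : ((ι → ℂ) × (Fin k → ℂ)) × (ι → ℝ) =>
        (((ξ, p.1), p.2) : ((ι → ℝ) × ((ι → ℂ) × (Fin k → ℂ))) × (ι → ℝ)) := by fun_prop
    have h := (measurable_T_integrand hf).comp hpair
    exact h
  have hm2 : ∀ ζ : (ι → ℂ) × (Fin k → ℂ), Measurable fun x : ι → ℝ =>
      cexpPairing (-(sh x ζ).1) ξ * f (sh x ζ) := fun ζ => by
    have hpair : Measurable fun x : ι → ℝ => (ζ, x) := measurable_prodMk_left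
    have h := hm.comp hpair
    exact h
  refine differentiableOn_integral_of_locally volume (volume : Measure (ι → ℝ)) Φ.isOpen_D
    (f := fun ζ x => cexpPairing (-(sh x ζ).1) ξ * f (sh x ζ))
    (fun ζ _ => (hm2 ζ).aestronglyMeasurable) hm.enorm.aemeasurable
    (Filter.Eventually.of_forall fun x => ?_) ?_
  · have h1 : Differentiable ℂ fun ζ : (ι → ℂ) × (Fin k → ℂ) => sh x ζ := by
      unfold sh
      fun_prop
    have h2 : Differentiable ℂ fun ζ : (ι → ℂ) × (Fin k → ℂ) => cexpPairing (-(sh x ζ).1) ξ :=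
      (differentiable_cexpPairing ξ).comp (g := fun z => cexpPairing z ξ)
        (f := fun ζ : (ι → ℂ) × (Fin k → ℂ) => -(sh x ζ).1) (by fun_prop)
    exact h2.differentiableOn.mul (hd.comp h1.differentiableOn fun ζ hζ => Φ.sh_mem_D hζ)
  · intro ζ₀ hζ₀
    obtain ⟨R, hR, hsub, hlt⟩ := Φ.exists_lintegral_ball_slice ν hq hf hfin hζ₀
    refine ⟨R, hR, hsub, ?_⟩
    have hec : Continuous fun ζ : (ι → ℂ) × (Fin k → ℂ) =>
        Real.exp (-(-((2 * Real.pi) • fun i => (ζ.1 i).im) ⬝ᵥ ξ)) := by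
      unfold dotProduct
      fun_prop
    obtain ⟨M, hM⟩ := (isCompact_closedBall ζ₀ R).bddAbove_image hec.continuousOn
    calc ∫⁻ ζ in Metric.ball ζ₀ R, ∫⁻ x, ‖cexpPairing (-(sh x ζ).1) ξ * f (sh x ζ)‖ₑ
        ≤ ∫⁻ ζ in Metric.ball ζ₀ R, ENNReal.ofReal M * Φ.N 1 f (ζ.2, Φ.ht ζ) := by
          refine setLIntegral_mono' measurableSet_ball fun ζ hζ => ?_
          rw [Φ.lintegral_T_integrand]
          gcongr
          exact ENNReal.ofReal_le_ofReal (hM ⟨ζ, Metric.ball_subset_closedBall hζ, rfl⟩)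
      _ = ENNReal.ofReal M * ∫⁻ ζ in Metric.ball ζ₀ R, Φ.N 1 f (ζ.2, Φ.ht ζ) :=
          lintegral_const_mul' _ _ ENNReal.ofReal_ne_top
      _ < ∞ := ENNReal.mul_lt_top ENNReal.ofReal_lt_top hlt

theorem T_sh (f : (ι → ℂ) × (Fin k → ℂ) → ℂ) (ξ x : ι → ℝ) (ζ : (ι → ℂ) × (Fin k → ℂ)) :
    T f ξ (sh x ζ) = T f ξ ζ := by
  have h : ∀ x', sh x' (sh x ζ) = sh (x + x') ζ := fun x' => by
    refine Prod.ext ?_ rfl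
    ext i
    simp [sh, add_assoc]
  rw [T, T]
  simp_rw [h]
  exact integral_add_left_eq_self (fun x' => cexpPairing (-(sh x' ζ).1) ξ * f (sh x' ζ)) x

/-- The base point of the cone. -/
def base (C : ConeData r ι W) : ι → ℝ := C.sq 1

theorem base_mem : base C ∈ C.Ω := ⟨1, C.one_mem_H, rfl⟩

/-- The partial Fourier transform, normalized to be independent of the slice. -/
def ft (f : (ι → ℂ) × (Fin k → ℂ) → ℂ) (ξ : ι → ℝ) (u : Fin k → ℂ) : ℂ :=
  T f ξ (Φ.pt 0 (u, base C))

/-- Holomorphy in `z` and invariance under real translations make the Fourier integral independent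
of `z`. -/
theorem T_eq_ft (ν : Fin r → ℝ) {q : ℝ} (hq : 1 ≤ q)
    {f : (ι → ℂ) × (Fin k → ℂ) → ℂ} (hf : Measurable f) (hd : DifferentiableOn ℂ f Φ.D)
    (hfin : ∫⁻ a, Φ.N 1 f a ^ q ∂(Φ.mY ν) < ∞) (ξ : ι → ℝ) {ζ : (ι → ℂ) × (Fin k → ℂ)}
    (hζ : ζ ∈ Φ.D) : T f ξ ζ = Φ.ft f ξ ζ.2 := by
  obtain ⟨-, hT⟩ := Φ.T_holomorphic ν hq hf hd hfin ξ
  set u := ζ.2 with hu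
  set S : Set (ι → ℂ) := {z | (z, u) ∈ Φ.D} with hS
  have hSo : IsOpen S := Φ.isOpen_D.preimage (by fun_prop)
  have hSc : Convex ℝ S := by
    intro z hz w hw a b ha hb hab
    have h := C.convex_Ω hz hw ha hb hab
    rw [hS, Set.mem_ofPred_eq, D, Set.mem_ofPred_eq]
    convert h using 1
    ext i
    simp only [Pi.sub_apply, Pi.add_apply, Pi.smul_apply, smul_eq_mul, Complex.add_im,
      Complex.real_smul, Complex.im_ofReal_mul]
    linear_combination (Φ.fd u i) * hab
  set φ : (ι → ℂ) → ℂ := fun z => T f ξ (z, u) with hφ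
  have hφd : DifferentiableOn ℂ φ S := hT.comp (by fun_prop) fun z hz => hz
  have hder : ∀ z ∈ S, fderivWithin ℂ φ S z = 0 := by
    intro z hz
    rw [fderivWithin_of_isOpen hSo hz]
    have hdz : HasFDerivAt φ (fderiv ℂ φ z) z := (hφd.differentiableAt (hSo.mem_nhds hz)).hasFDerivAt
    -- the derivative vanishes in real directions, hence in all directions
    have hreal : ∀ x : ι → ℝ, fderiv ℂ φ z (fun i => (x i : ℂ)) = 0 := by
      intro x
      have h2 : HasDerivAt (fun s : ℂ => z + s • (fun i => (x i : ℂ))) (fun i => (x i : ℂ)) 0 := by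
        simpa using ((hasDerivAt_id (0 : ℂ)).smul_const (fun i => (x i : ℂ))).const_add z
      have h3 : HasDerivAt (fun s : ℂ => φ (z + s • (fun i => (x i : ℂ))))
          (fderiv ℂ φ z (fun i => (x i : ℂ))) 0 := by
        refine HasFDerivAt.comp_hasDerivAt (0 : ℂ) (l := φ) ?_ h2
        rw [zero_smul, add_zero]
        exact hdz
      have h4 : HasDerivAt (fun s : ℝ => φ (z + (s : ℂ) • (fun i => (x i : ℂ))))
          (fderiv ℂ φ z (fun i => (x i : ℂ))) 0 := by
        have := h3.comp_ofReal (z := (0 : ℝ))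
        exact this
      have h5 : (fun s : ℝ => φ (z + (s : ℂ) • (fun i => (x i : ℂ)))) = fun _ => φ z := by
        funext s
        have := T_sh f ξ (s • x) (z, u)
        rw [hφ]
        simp only
        rw [← this, sh]
        congr 2
        ext i
        simp
      rw [h5] at h4
      exact h4.unique (hasDerivAt_const _ _)
    ext v
    have hv : v = (fun i => ((v i).re : ℂ)) + Complex.I • fun i => ((v i).im : ℂ) := by
      ext i
      simp [mul_comm Complex.I]
    rw [hv, map_add, map_smul, hreal, hreal, smul_zero, add_zero]
    rfl
  have h0 : (Φ.pt 0 (u, base C)).1 ∈ S := by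
    have : Φ.pt 0 (u, base C) ∈ Φ.D := Φ.pt_mem_D.2 base_mem
    exact this
  have hz : ζ.1 ∈ S := hζ
  exact (hSc.is_const_of_fderivWithin_eq_zero hφd hder hz h0 :)

end FormData

/-! ### Support of the partial Fourier transform and inversion -/

theorem cexpPairing_zero {ι : Type*} [Fintype ι] (ξ : ι → ℝ) : cexpPairing 0 ξ = 1 := by
  simp [cexpPairing]

theorem expd_rpow {ι : Type*} [Fintype ι] (y ξ : ι → ℝ) (q : ℝ) :
    expd y ξ ^ q = expd y (q • ξ) := by
  rw [expd, expd, ENNReal.ofReal_rpow_of_pos (Real.exp_pos _), ← Real.exp_mul, dotProduct_smul,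
    smul_eq_mul]
  congr 2
  ring

theorem expd_ne_zero {ι : Type*} [Fintype ι] (y ξ : ι → ℝ) : expd y ξ ≠ 0 :=
  (ENNReal.ofReal_pos.2 (Real.exp_pos _)).ne'

theorem expd_ne_top {ι : Type*} [Fintype ι] (y ξ : ι → ℝ) : expd y ξ ≠ ∞ := ENNReal.ofReal_ne_top

theorem expd_smul_left {ι : Type*} [Fintype ι] (c : ℝ) (y ξ : ι → ℝ) :
    expd (c • y) ξ = expd y (c • ξ) := by
  simp [expd]

namespace ConeData

variable {r : ℕ} {ι W : Type*} [Fintype ι] [Ring W] [Algebra ℝ W] {C : ConeData r ι W}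

/-- Outside of the closed dual cone the Laplace integral of a generalized power diverges. -/
theorem lintegral_expd_qp_eq_top {ξ y₀ : ι → ℝ} (hy₀ : y₀ ∈ C.Ω) (h : y₀ ⬝ᵥ ξ < 0)
    (α : Fin r → ℝ) : ∫⁻ t, expd t ξ * C.qp α t = ∞ := by
  set S : Set (ι → ℝ) := {t | t ⬝ᵥ ξ < y₀ ⬝ᵥ ξ / 2} ∩ C.Ω with hS
  have hcd : Continuous fun t : ι → ℝ => t ⬝ᵥ ξ := continuous_id.dotProduct continuous_const
  have hSo : IsOpen S := (isOpen_lt hcd continuous_const).inter C.isOpen_Ω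
  set m := ∫⁻ t in S, C.qp α t with hm
  have hm0 : m ≠ 0 := by
    refine ((lintegral_pos_iff_support (measurable_qp α)).2 ?_).ne'
    rw [Measure.restrict_apply (measurableSet_support (measurable_qp α))]
    have hsub : S ⊆ Function.support (C.qp α) ∩ S := fun t ht => ⟨(qp_pos ht.2 α).ne', ht⟩
    refine lt_of_lt_of_le ?_ (measure_mono hsub)
    exact hSo.measure_pos volume ⟨y₀, by rw [Set.mem_ofPred_eq]; linarith, hy₀⟩
  set g : (ι → ℝ) → ℝ≥0∞ := fun t => expd t ξ * C.qp α t with hg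
  have hgm : Measurable g :=
    (measurable_expd_comp measurable_id measurable_const).mul (measurable_qp α)
  set δ := -(y₀ ⬝ᵥ ξ / 2) with hδ
  have hδ0 : 0 < δ := by rw [hδ]; linarith
  -- the dilation by `a` multiplies the integral by a power and gains an exponential factor
  have hle : ∀ a : ℝ, 1 ≤ a → ENNReal.ofReal (Real.exp (δ * a) / a ^ (-∑ j, α j)) * m ≤
      ∫⁻ t, g t := by
    intro a ha
    have ha0 : 0 < a := by linarith
    have h1 : ∫⁻ t, g (a • t) ≤ ∫⁻ t, g t := by
      rw [← lintegral_map hgm (measurable_const_smul a), Measure.map_addHaar_smul volume ha0.ne',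
        lintegral_smul_measure, smul_eq_mul]
      refine mul_le_of_le_one_left bot_le ?_
      rw [ENNReal.ofReal_le_one, abs_of_pos (by positivity)]
      exact inv_le_one_of_one_le₀ (one_le_pow₀ ha)
    refine le_trans ?_ h1
    rw [hm, ← lintegral_const_mul' _ _ ENNReal.ofReal_ne_top, ← lintegral_indicator hSo.measurableSet]
    refine lintegral_mono fun t => ?_
    by_cases ht : t ∈ S
    · rw [Set.indicator_of_mem ht, hg]
      simp only
      rw [qp_smul _ ha0, ← mul_assoc, expd, ← ENNReal.ofReal_mul (Real.exp_pos _).le]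
      gcongr
      rw [Real.rpow_neg ha0.le, div_inv_eq_mul]
      gcongr
      have h2 : t ⬝ᵥ ξ < y₀ ⬝ᵥ ξ / 2 := ht.1
      rw [smul_dotProduct, smul_eq_mul, hδ]
      nlinarith
    · rw [Set.indicator_of_notMem ht]
      exact bot_le
  have htend := tendsto_exp_mul_div_rpow_atTop (-∑ j, α j) δ hδ0
  have h3 : Filter.Tendsto (fun a : ℝ => ENNReal.ofReal (Real.exp (δ * a) / a ^ (-∑ j, α j)) * m)
      Filter.atTop (nhds (∞ * m)) :=
    ENNReal.Tendsto.mul_const (ENNReal.tendsto_ofReal_atTop.comp htend) (Or.inl ENNReal.top_ne_zero)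
  rw [ENNReal.top_mul hm0] at h3
  exact top_le_iff.1 (le_of_tendsto h3 (Filter.eventually_atTop.2 ⟨1, hle⟩))

end ConeData

namespace FormData

variable {r : ℕ} {ι W : Type*} [Fintype ι] [Ring W] [Algebra ℝ W] {C : ConeData r ι W}
  {k : ℕ} (Φ : FormData C k)

theorem pt_fst (x : ι → ℝ) (a : (Fin k → ℂ) × (ι → ℝ)) :
    (Φ.pt x a).1 = (fun i => (x i : ℂ)) + fun i => ((a.2 + Φ.fd a.1) i : ℂ) * Complex.I := by
  ext i
  simp [pt]

theorem sh_pt (x : ι → ℝ) (a : (Fin k → ℂ) × (ι → ℝ)) : sh x (Φ.pt 0 a) = Φ.pt x a := by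
  refine Prod.ext ?_ rfl
  ext i
  simp [pt, sh, add_comm]

theorem stronglyMeasurable_ft {f : (ι → ℂ) × (Fin k → ℂ) → ℂ} (hf : Measurable f) :
    StronglyMeasurable fun p : (ι → ℝ) × (Fin k → ℂ) => Φ.ft f p.1 p.2 := by
  have h1 : StronglyMeasurable fun p : (ι → ℝ) × ((ι → ℂ) × (Fin k → ℂ)) => T f p.1 p.2 := by
    have h := (measurable_T_integrand hf).stronglyMeasurable.integral_prod_right'
      (ν := (volume : Measure (ι → ℝ)))
    exact h
  have h2 : Measurable fun p : (ι → ℝ) × (Fin k → ℂ) => (p.1, Φ.pt 0 (p.2, base C)) :=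
    measurable_fst.prodMk (Φ.continuous_pt.comp (by fun_prop :
      Continuous fun p : (ι → ℝ) × (Fin k → ℂ) => ((0 : ι → ℝ), (p.2, base C)))).measurable
  have h := h1.comp_measurable h2
  exact h

/-- A holomorphic function all of whose slices are integrable, in the mean of order `q`. -/
structure Slices (ν : Fin r → ℝ) (q : ℝ) (f : (ι → ℂ) × (Fin k → ℂ) → ℂ) : Prop where
  hq : 1 ≤ q
  measurable : Measurable f
  holo : DifferentiableOn ℂ f Φ.D
  fin : ∫⁻ a, Φ.N 1 f a ^ q ∂(Φ.mY ν) < ∞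

variable {Φ} {ν : Fin r → ℝ} {q : ℝ} {f : (ι → ℂ) × (Fin k → ℂ) → ℂ}

namespace Slices

theorem T_eq (h : Φ.Slices ν q f) (ξ : ι → ℝ) {ζ : (ι → ℂ) × (Fin k → ℂ)}
    (hζ : ζ ∈ Φ.D) : T f ξ ζ = Φ.ft f ξ ζ.2 :=
  Φ.T_eq_ft ν h.hq h.measurable h.holo h.fin ξ hζ

theorem N_lt_top (h : Φ.Slices ν q f) {a : (Fin k → ℂ) × (ι → ℝ)} (ha : a.2 ∈ C.Ω) :
    Φ.N 1 f a < ∞ := by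
  have h1 := ((Φ.T_holomorphic ν h.hq h.measurable h.holo h.fin 0).1 _
    ((Φ.pt_mem_D (x := 0)).2 ha)).2
  rw [hasFiniteIntegral_iff_enorm, Φ.lintegral_T_integrand, Φ.ht_pt] at h1
  exact ENNReal.lt_top_of_mul_ne_top_right h1.ne (expd_ne_zero _ _)

theorem integrable_slice (h : Φ.Slices ν q f) {a : (Fin k → ℂ) × (ι → ℝ)} (ha : a.2 ∈ C.Ω) :
    Integrable fun x => f (Φ.pt x a) := by
  have hfm : Measurable fun x => f (Φ.pt x a) := h.measurable.comp
    (Φ.continuous_pt.comp (by fun_prop : Continuous fun x : ι → ℝ => (x, a))).measurable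
  refine ⟨hfm.aestronglyMeasurable, ?_⟩
  rw [hasFiniteIntegral_iff_enorm, ← eLpNorm_one_eq_lintegral_enorm]
  exact h.N_lt_top ha

theorem continuous_slice (h : Φ.Slices ν q f) {a : (Fin k → ℂ) × (ι → ℝ)} (ha : a.2 ∈ C.Ω) :
    Continuous fun x => f (Φ.pt x a) :=
  h.holo.continuousOn.comp_continuous (Φ.continuous_pt.comp (by fun_prop :
    Continuous fun x : ι → ℝ => (x, a))) fun _ => Φ.pt_mem_D.2 ha

/-- The Fourier integral of a slice, by independence of the height. -/
theorem fourier_slice (h : Φ.Slices ν q f) {a : (Fin k → ℂ) × (ι → ℝ)} (ha : a.2 ∈ C.Ω)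
    (ξ : ι → ℝ) : ∫ x : ι → ℝ, cexpPairing (fun i => -(x i : ℂ)) ξ * f (Φ.pt x a) =
      cexpPairing (fun i => ((a.2 + Φ.fd a.1) i : ℂ) * Complex.I) ξ * Φ.ft f ξ a.1 := by
  have h1 := h.T_eq ξ ((Φ.pt_mem_D (x := 0)).2 ha)
  rw [T] at h1
  rw [show a.1 = (Φ.pt 0 a).2 from rfl, ← h1, ← integral_const_mul]
  refine integral_congr_ae (Filter.Eventually.of_forall fun x => ?_)
  simp only [Φ.sh_pt]
  rw [← mul_assoc, ← cexpPairing_add, Φ.pt_fst]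
  congr 2
  ext i
  simp only [Pi.add_apply, Pi.neg_apply, pt]
  ring

/-- The bound of the Fourier integral by the `L¹`-norm, for every height `t`; letting `t` vary
gives both the support and the decay of the partial Fourier transform. -/
theorem expd_mul_ft_le (h : Φ.Slices ν q f) (u : Fin k → ℂ) {t : ι → ℝ} (ht : t ∈ C.Ω)
    (ξ : ι → ℝ) : expd ((2 * Real.pi) • (t + Φ.fd u)) ξ * ‖Φ.ft f ξ u‖ₑ ≤ Φ.N 1 f (u, t) := by
  have h1 := h.fourier_slice (a := (u, t)) ht ξ
  have h2 : ‖cexpPairing (fun i => ((t + Φ.fd u) i : ℂ) * Complex.I) ξ‖ₑ =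
      expd ((2 * Real.pi) • (t + Φ.fd u)) ξ := by
    rw [← ofReal_norm, norm_cexpPairing, im_mul_I, expd]
  rw [← h2, ← enorm_mul, ← h1, N, eLpNorm_one_eq_lintegral_enorm]
  refine (enorm_integral_le_lintegral_enorm _).trans (lintegral_mono fun x => ?_)
  rw [enorm_mul]
  refine mul_le_of_le_one_left bot_le ?_
  rw [← ofReal_norm, norm_cexpPairing, ENNReal.ofReal_le_one]
  have h3 : (fun i => (-(x i : ℂ)).im) = 0 := by ext i; simp
  simp only [h3, smul_zero, zero_dotProduct, neg_zero, Real.exp_zero, le_refl]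

theorem differentiable_ft (h : Φ.Slices ν q f) (ξ : ι → ℝ) : Differentiable ℂ (Φ.ft f ξ) := by
  intro u₀
  obtain ⟨-, hT⟩ := Φ.T_holomorphic ν h.hq h.measurable h.holo h.fin ξ
  set z₀ := (Φ.pt 0 (u₀, base C)).1 with hz₀
  have h0 : (z₀, u₀) ∈ Φ.D := (Φ.pt_mem_D (x := 0) (a := (u₀, base C))).2 base_mem
  have hev : ∀ᶠ u in nhds u₀, Φ.ft f ξ u = T f ξ (z₀, u) := by
    have hcont : Continuous fun u : Fin k → ℂ => (z₀, u) := by fun_prop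
    filter_upwards [hcont.continuousAt.preimage_mem_nhds (Φ.isOpen_D.mem_nhds h0)] with u hu
    exact (h.T_eq ξ hu).symm
  have h1 : DifferentiableAt ℂ (fun u => T f ξ (z₀, u)) u₀ :=
    (hT.differentiableAt (Φ.isOpen_D.mem_nhds h0)).comp u₀ (by fun_prop)
  exact h1.congr_of_eventuallyEq hev

/-- The partial Fourier transform vanishes outside of the closed dual cone. -/
theorem ft_eq_zero (h : Φ.Slices ν q f) {ξ y₀ : ι → ℝ} (hy₀ : y₀ ∈ C.Ω) (hlt : y₀ ⬝ᵥ ξ < 0)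
    (u : Fin k → ℂ) : Φ.ft f ξ u = 0 := by
  have hq0 : 0 < q := zero_lt_one.trans_le h.hq
  have hNm : Measurable fun a => Φ.N 1 f a ^ q := (Φ.measurable_N 1 h.measurable).pow_const q
  have hfin := h.fin
  rw [Φ.lintegral_mY ν hNm] at hfin
  have hm : Measurable fun p : (Fin k → ℂ) × (ι → ℝ) => C.qp (Φ.wt ν) p.2 * Φ.N 1 f (p.1, p.2) ^ q :=
    ((ConeData.measurable_qp _).comp measurable_snd).mul hNm
  have hae : ∀ᵐ u : Fin k → ℂ, ∫⁻ t, C.qp (Φ.wt ν) t * Φ.N 1 f (u, t) ^ q < ∞ :=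
    ae_lt_top hm.lintegral_prod_right' hfin.ne
  have hzero : ∀ᵐ u : Fin k → ℂ, Φ.ft f ξ u = 0 := by
    filter_upwards [hae] with u hu
    set A : ℝ≥0∞ := expd ((2 * Real.pi) • Φ.fd u) (q • ξ) * ‖Φ.ft f ξ u‖ₑ ^ q with hA
    have hAtop : A ≠ ∞ := ENNReal.mul_ne_top (expd_ne_top _ _)
      (ENNReal.rpow_ne_top_of_nonneg hq0.le enorm_ne_top)
    have h1 : A * ∫⁻ t, expd t ((2 * Real.pi) • q • ξ) * C.qp (Φ.wt ν) t ≤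
        ∫⁻ t, C.qp (Φ.wt ν) t * Φ.N 1 f (u, t) ^ q := by
      rw [← lintegral_const_mul' _ _ hAtop]
      refine lintegral_mono fun t => ?_
      by_cases ht : t ∈ C.Ω
      · have h2 := ENNReal.rpow_le_rpow (h.expd_mul_ft_le u ht ξ) hq0.le
        rw [ENNReal.mul_rpow_of_nonneg _ _ hq0.le, expd_rpow, smul_add, expd_add,
          expd_smul_left _ t] at h2
        calc A * (expd t ((2 * Real.pi) • q • ξ) * C.qp (Φ.wt ν) t) = C.qp (Φ.wt ν) t *
              (expd t ((2 * Real.pi) • q • ξ) * expd ((2 * Real.pi) • Φ.fd u) (q • ξ) *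
                ‖Φ.ft f ξ u‖ₑ ^ q) := by rw [hA]; ring
          _ ≤ _ := by gcongr
      · simp [ConeData.qp_of_notMem ht]
    have hneg : y₀ ⬝ᵥ ((2 * Real.pi) • q • ξ) < 0 := by
      rw [dotProduct_smul, dotProduct_smul, smul_eq_mul, smul_eq_mul]
      have : 0 < 2 * Real.pi := by positivity
      exact mul_neg_of_pos_of_neg this (mul_neg_of_pos_of_neg hq0 hlt)
    -- Off the closed dual cone the integral on the left diverges, whereas the right side is
    -- finite.
    rw [ConeData.lintegral_expd_qp_eq_top hy₀ hneg] at h1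
    have hA0 : A = 0 := by
      by_contra hne
      rw [ENNReal.mul_top hne] at h1
      exact hu.ne (top_le_iff.1 h1)
    rcases mul_eq_zero.1 hA0 with h2 | h2
    · exact absurd h2 (expd_ne_zero _ _)
    · rwa [ENNReal.rpow_eq_zero_iff_of_pos hq0, enorm_eq_zero] at h2
  have hc : Continuous (Φ.ft f ξ) := (h.differentiable_ft ξ).continuous
  have := (hc.ae_eq_iff_eq volume (continuous_const (y := (0 : ℂ)))).1 hzero
  exact congrFun this u

theorem ae_ft (h : Φ.Slices ν q f) : ∀ᵐ ξ : ι → ℝ, ξ ∉ C.Ωd → ∀ u, Φ.ft f ξ u = 0 := by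
  filter_upwards [ConeData.ae_mem_Ωd (C := C)] with ξ hξ hn u
  have h1 : ¬ ∀ y ∈ C.Ω, 0 ≤ y ⬝ᵥ ξ := fun h2 => hn (hξ h2)
  push Not at h1
  obtain ⟨y, hy, hlt⟩ := h1
  exact h.ft_eq_zero hy hlt u

/-- Fourier inversion: the function is the Laplace transform of its partial Fourier transform. -/
theorem inversion (h : Φ.Slices ν q f) (x : ι → ℝ) {a : (Fin k → ℂ) × (ι → ℝ)} (ha : a.2 ∈ C.Ω) :
    ∫ ξ, cexpPairing (Φ.pt x a).1 ξ * Φ.ft f ξ a.1 = f (Φ.pt x a) := by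
  obtain ⟨u, t⟩ := a
  have hinv := fourier_inversion_pi (h.continuous_slice ha) (h.integrable_slice ha) ?_ x
  · rw [← hinv]
    refine integral_congr_ae (Filter.Eventually.of_forall fun ξ => ?_)
    simp only [h.fourier_slice ha, Φ.pt_fst, cexpPairing_add, mul_assoc]
  · simp_rw [h.fourier_slice ha]
    -- The bound at height `t/2` leaves a factor that is integrable over the dual cone.
    have ht2 : (2⁻¹ : ℝ) • t ∈ C.Ω := C.smul_mem_Ω ha (by norm_num)
    have hms : StronglyMeasurable fun ξ : ι → ℝ =>
        cexpPairing (fun i => ((t + Φ.fd u) i : ℂ) * Complex.I) ξ * Φ.ft f ξ u := by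
      have hp : Measurable fun ξ : ι → ℝ => (ξ, u) := measurable_prodMk_right
      have h1 := (Φ.stronglyMeasurable_ft h.measurable).comp_measurable hp
      refine StronglyMeasurable.mul ?_ h1
      exact (continuous_cexpPairing.comp (by fun_prop : Continuous fun ξ : ι → ℝ =>
        ((fun i => ((t + Φ.fd u) i : ℂ) * Complex.I), ξ))).stronglyMeasurable
    refine ⟨hms.aestronglyMeasurable, ?_⟩
    rw [hasFiniteIntegral_iff_enorm]
    obtain ⟨Γ, hΓ, hL⟩ := ConeData.lintegral_qd C.n_lt_τ
    have hz : (2 * Real.pi) • (2⁻¹ : ℝ) • t ∈ C.Ω := ConeData.two_pi_smul_mem ht2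
    calc ∫⁻ ξ, ‖cexpPairing (fun i => ((t + Φ.fd u) i : ℂ) * Complex.I) ξ * Φ.ft f ξ u‖ₑ
        ≤ ∫⁻ ξ, Φ.N 1 f (u, (2⁻¹ : ℝ) • t) *
            (expd ((2 * Real.pi) • (2⁻¹ : ℝ) • t) ξ * C.qd (C.τ - C.τ) ξ) := by
          refine lintegral_mono_ae ?_
          filter_upwards [h.ae_ft] with ξ hξ
          by_cases hmem : ξ ∈ C.Ωd
          · have h1 := h.expd_mul_ft_le u ht2 ξ
            have h2 : C.qd (C.τ - C.τ) ξ = 1 := by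
              rw [sub_self, ConeData.qd_of_mem hmem, ConeData.Qdp_zero, ENNReal.ofReal_one]
            have h3 : t = (2⁻¹ : ℝ) • t + (2⁻¹ : ℝ) • t := by
              rw [← add_smul]; norm_num
            rw [h2, mul_one, enorm_mul, ← ofReal_norm, norm_cexpPairing, im_mul_I, ← expd]
            conv_lhs => rw [h3, add_assoc, smul_add, expd_add, mul_assoc, mul_comm]
            gcongr
          · simp [hξ hmem]
      _ < ∞ := by
          rw [lintegral_const_mul' _ _ (h.N_lt_top (a := (u, (2⁻¹ : ℝ) • t)) ht2).ne, hL _ hz]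
          exact ENNReal.mul_lt_top (h.N_lt_top (a := (u, (2⁻¹ : ℝ) • t)) ht2)
            (ENNReal.mul_lt_top ENNReal.ofReal_lt_top (ConeData.qp_lt_top _ _))

end Slices

end FormData

/-! ### The reproducing integral on the Fourier side -/

theorem integral_cexpPairing_mul_I {X ι : Type*} [Fintype ι] [MeasurableSpace X] (m : Measure X)
    {y : X → ι → ℝ} (hy : Measurable y) (ξ : ι → ℝ) :
    ∫ x, cexpPairing (fun i => (((2 : ℝ) • y x) i : ℂ) * Complex.I) ξ ∂m =
      ((∫⁻ x, expd (y x) ((4 * Real.pi) • ξ) ∂m).toReal : ℂ) := by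
  have h1 : ∀ x, cexpPairing (fun i => (((2 : ℝ) • y x) i : ℂ) * Complex.I) ξ =
      ((Real.exp (-(y x ⬝ᵥ ((4 * Real.pi) • ξ))) : ℝ) : ℂ) := fun x => by
    rw [cexpPairing_I_smul]
    congr 3
    rw [smul_smul, smul_dotProduct, dotProduct_smul]
    congr 1
    ring
  simp_rw [h1]
  have hm : Measurable fun x => Real.exp (-(y x ⬝ᵥ ((4 * Real.pi) • ξ))) := by
    unfold dotProduct
    fun_prop
  rw [integral_complex_ofReal, integral_eq_lintegral_of_nonneg_ae
    (Filter.Eventually.of_forall fun x => (Real.exp_pos _).le) hm.aestronglyMeasurable]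
  rfl

namespace FormData

variable {r : ℕ} {ι W : Type*} [Fintype ι] [Ring W] [Algebra ℝ W] {C : ConeData r ι W}
  {k : ℕ} (Φ : FormData C k)

/-- The measure `Q^{wt μ}(s) ds` on the cone. -/
def mS (μ : Fin r → ℝ) : Measure (ι → ℝ) :=
  (volume : Measure (ι → ℝ)).withDensity (C.qp (Φ.wt μ))

instance (μ : Fin r → ℝ) : SFinite (Φ.mS μ) := Φ.sFinite_density μ

theorem mS_ne_zero (μ : Fin r → ℝ) : Φ.mS μ ≠ 0 := by
  intro h
  have h1 : ∀ᵐ t : ι → ℝ, C.qp (Φ.wt μ) t = 0 :=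
    (withDensity_eq_zero_iff (ConeData.measurable_qp _).aemeasurable).1 h
  have h2 : volume C.Ω = 0 := by
    refine measure_mono_null (fun t ht => ?_) (ae_iff.1 h1)
    exact (ConeData.qp_pos ht _).ne'
  exact (C.isOpen_Ω.measure_pos volume ⟨_, base_mem⟩).ne' h2

/-- The constant of the reproducing formula: the Gamma and Gauss integrals cancel against the
density of the kernel. -/
theorem exists_kernel_const {μ : Fin r → ℝ} (hμ : ∀ j, (C.m j : ℝ) / 2 < μ j - Φ.bv j / 2) :
    ∃ c : ℝ, 0 < c ∧ ∀ ξ ∈ C.Ωd, C.Qdp (Φ.ex μ) ξ *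
      ((∫⁻ w, expd (Φ.fd w) ((4 * Real.pi) • ξ)).toReal *
        (∫⁻ s, expd s ((4 * Real.pi) • ξ) ∂(Φ.mS μ)).toReal) = c := by
  set α : Fin r → ℝ := μ - (2⁻¹ : ℝ) • Φ.bv with hα
  obtain ⟨Γ, hΓ, h1⟩ := ConeData.lintegral_qp (C := C) (α := α) fun j => by
    have := hμ j
    simp only [hα, Pi.sub_apply, Pi.smul_apply, smul_eq_mul]
    linarith
  obtain ⟨d, hd, h2⟩ := Φ.exists_lintegral_expd_fd
  refine ⟨Γ * d * (4 * Real.pi) ^ ∑ j, (-Φ.ex μ) j, by positivity, fun ξ hξ => ?_⟩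
  have h4 : 0 < 4 * Real.pi := by positivity
  have hξ4 := C.smul_mem_Ωd hξ h4
  have hm : Measurable fun s : ι → ℝ => expd s ((4 * Real.pi) • ξ) :=
    measurable_expd_comp measurable_id measurable_const
  have h3 : ∫⁻ s, expd s ((4 * Real.pi) • ξ) ∂(Φ.mS μ) =
      ENNReal.ofReal Γ * C.qd (-α) ((4 * Real.pi) • ξ) := by
    rw [← h1 _ hξ4, mS, lintegral_withDensity_eq_lintegral_mul _ (ConeData.measurable_qp _) hm]
    exact lintegral_congr fun s => mul_comm _ _
  rw [h3, h2 _ hξ4, ConeData.qd_of_mem hξ4, ConeData.qd_of_mem hξ4, ENNReal.toReal_mul,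
    ENNReal.toReal_mul, ENNReal.toReal_ofReal hΓ.le, ENNReal.toReal_ofReal hd.le,
    ENNReal.toReal_ofReal (ConeData.Qdp_pos hξ4 _).le,
    ENNReal.toReal_ofReal (ConeData.Qdp_pos hξ4 _).le]
  have h5 : C.Qdp (-Φ.bv) ((4 * Real.pi) • ξ) * C.Qdp (-α) ((4 * Real.pi) • ξ) =
      (4 * Real.pi) ^ (∑ j, (-Φ.ex μ) j) * C.Qdp (-Φ.ex μ) ξ := by
    rw [← ConeData.Qdp_add hξ4, ← ConeData.Qdp_smul hξ h4]
    congr 1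
    ext j
    simp only [hα, ex, Pi.add_apply, Pi.neg_apply, Pi.sub_apply, Pi.smul_apply, smul_eq_mul]
    ring
  have h6 : C.Qdp (Φ.ex μ) ξ * C.Qdp (-Φ.ex μ) ξ = 1 := by
    rw [← ConeData.Qdp_add hξ, add_neg_cancel, ConeData.Qdp_zero]
  calc _ = Γ * d * (C.Qdp (Φ.ex μ) ξ * (C.Qdp (-Φ.bv) ((4 * Real.pi) • ξ) *
        C.Qdp (-α) ((4 * Real.pi) • ξ))) := by ring
    _ = Γ * d * (4 * Real.pi) ^ (∑ j, (-Φ.ex μ) j) *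
        (C.Qdp (Φ.ex μ) ξ * C.Qdp (-Φ.ex μ) ξ) := by rw [h5]; ring
    _ = _ := by rw [h6, mul_one]

/-- The argument of the factor that depends on the second variable of the kernel. -/
def psiArg (u v : Fin k → ℂ) : ι → ℂ :=
  (fun i => (((2 : ℝ) • Φ.fd v) i : ℂ) * Complex.I) - (2 * Complex.I) • Φ.F u v

theorem psiArg_add (u w : Fin k → ℂ) : Φ.psiArg u (u + w) =
    (2 * Complex.I) • Φ.F w u + fun i => (((2 : ℝ) • Φ.fd w) i : ℂ) * Complex.I := by
  have h1 : ∀ v i, ((Φ.fd v i : ℝ) : ℂ) = Φ.F v v i := fun v i => by rw [Φ.F_self]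
  ext i
  simp only [psiArg, Pi.sub_apply, Pi.add_apply, Pi.smul_apply, smul_eq_mul, map_add]
  push_cast
  rw [h1, h1]
  simp only [map_add, LinearMap.add_apply, Pi.add_apply]
  ring

theorem arg_pt (x : ι → ℝ) (a b : (Fin k → ℂ) × (ι → ℝ)) (x' : ι → ℝ) :
    Φ.arg (Φ.pt x a) (Φ.pt x' b) = Φ.arg (Φ.pt x a) (Φ.pt 0 b) + fun i => -(x' i : ℂ) := by
  ext i
  simp only [arg, Pi.sub_apply, Pi.add_apply, pt, Pi.star_apply, Pi.smul_apply, star_add, star_mul']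
  have : star ((x' i : ℝ) : ℂ) = x' i := Complex.conj_ofReal _
  rw [this]
  simp
  ring

theorem arg_pt_zero (x : ι → ℝ) (a b : (Fin k → ℂ) × (ι → ℝ)) :
    Φ.arg (Φ.pt x a) (Φ.pt 0 b) + (fun i => ((b.2 + Φ.fd b.1) i : ℂ) * Complex.I) =
      (Φ.pt x a).1 + (Φ.psiArg a.1 b.1 + fun i => (((2 : ℝ) • b.2) i : ℂ) * Complex.I) := by
  ext i
  have h : star (((b.2 i + Φ.fd b.1 i : ℝ) : ℂ) * Complex.I) =
      -(((b.2 i + Φ.fd b.1 i : ℝ) : ℂ) * Complex.I) := by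
    rw [star_mul']
    have h1 : star Complex.I = -Complex.I := Complex.conj_I
    have h2 : star ((b.2 i + Φ.fd b.1 i : ℝ) : ℂ) = ((b.2 i + Φ.fd b.1 i : ℝ) : ℂ) :=
      Complex.conj_ofReal _
    rw [h1, h2]
    ring
  have h0 : (Φ.pt 0 b).1 i = ((b.2 i + Φ.fd b.1 i : ℝ) : ℂ) * Complex.I := by simp [pt]
  simp only [arg, psiArg, Pi.sub_apply, Pi.add_apply, Pi.star_apply, Pi.smul_apply, smul_eq_mul]
  rw [h0, h]
  simp only [pt]
  push_cast
  ring

theorem im_arg_pt (x x' : ι → ℝ) (a b : (Fin k → ℂ) × (ι → ℝ)) :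
    (fun i => (Φ.arg (Φ.pt x a) (Φ.pt x' b) i).im) = a.2 + b.2 + Φ.fd (a.1 - b.1) := by
  rw [arg, kernel_arg]
  exact im_ofReal_add_mul_I _ _

/-- The integrand of the reproducing integral after Fourier transform. -/
def E (β : Fin r → ℝ) (f : (ι → ℂ) × (Fin k → ℂ) → ℂ) (x : ι → ℝ) (a b : (Fin k → ℂ) × (ι → ℝ))
    (ξ : ι → ℝ) : ℂ :=
  (cexpPairing (Φ.arg (Φ.pt x a) (Φ.pt 0 b)) ξ * C.Ωd.indicator (fun ξ => (C.Qdp β ξ : ℂ)) ξ) *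
    (cexpPairing (fun i => ((b.2 + Φ.fd b.1) i : ℂ) * Complex.I) ξ * Φ.ft f ξ b.1)

theorem E_eq (β : Fin r → ℝ) (f : (ι → ℂ) × (Fin k → ℂ) → ℂ) (x : ι → ℝ)
    (a b : (Fin k → ℂ) × (ι → ℝ)) (ξ : ι → ℝ) : Φ.E β f x a b ξ =
      cexpPairing (Φ.pt x a).1 ξ * C.Ωd.indicator (fun ξ => (C.Qdp β ξ : ℂ)) ξ *
        ((cexpPairing (Φ.psiArg a.1 b.1) ξ * Φ.ft f ξ b.1) *
          cexpPairing (fun i => (((2 : ℝ) • b.2) i : ℂ) * Complex.I) ξ) := by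
  have h := congrArg (fun z => cexpPairing z ξ) (Φ.arg_pt_zero x a b)
  simp only [cexpPairing_add] at h
  rw [E]
  linear_combination (C.Ωd.indicator (fun ξ => (C.Qdp β ξ : ℂ)) ξ * Φ.ft f ξ b.1) * h

theorem stronglyMeasurable_E (β : Fin r → ℝ) {f : (ι → ℂ) × (Fin k → ℂ) → ℂ} (hf : Measurable f)
    (x : ι → ℝ) (a : (Fin k → ℂ) × (ι → ℝ)) :
    StronglyMeasurable fun p : ((Fin k → ℂ) × (ι → ℝ)) × (ι → ℝ) => Φ.E β f x a p.1 p.2 := by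
  have hfd := Φ.continuous_fd
  have hc1 : Continuous fun b : (Fin k → ℂ) × (ι → ℝ) => Φ.arg (Φ.pt x a) (Φ.pt 0 b) :=
    Φ.continuous_arg.comp (continuous_const.prodMk (Φ.continuous_pt.comp
      (continuous_const.prodMk continuous_id)))
  have hc2 : Continuous fun p : ((Fin k → ℂ) × (ι → ℝ)) × (ι → ℝ) =>
      cexpPairing (Φ.arg (Φ.pt x a) (Φ.pt 0 p.1)) p.2 :=
    continuous_cexpPairing.comp (f := fun p : ((Fin k → ℂ) × (ι → ℝ)) × (ι → ℝ) =>
      (Φ.arg (Φ.pt x a) (Φ.pt 0 p.1), p.2)) ((hc1.comp continuous_fst).prodMk continuous_snd)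
  have hc3 : Continuous fun p : ((Fin k → ℂ) × (ι → ℝ)) × (ι → ℝ) =>
      cexpPairing (fun i => ((p.1.2 + Φ.fd p.1.1) i : ℂ) * Complex.I) p.2 :=
    continuous_cexpPairing.comp (f := fun p : ((Fin k → ℂ) × (ι → ℝ)) × (ι → ℝ) =>
      (fun i => ((p.1.2 + Φ.fd p.1.1) i : ℂ) * Complex.I, p.2)) (by fun_prop)
  have hp : Measurable fun p : ((Fin k → ℂ) × (ι → ℝ)) × (ι → ℝ) => (p.2, p.1.1) := by fun_prop
  have h1 := (Φ.stronglyMeasurable_ft hf).comp_measurable hp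
  have hsnd : Measurable fun p : ((Fin k → ℂ) × (ι → ℝ)) × (ι → ℝ) => p.2 := measurable_snd
  have h2 := (ConeData.measurable_Qdp_indicator (C := C) β).comp hsnd
  exact (hc2.stronglyMeasurable.mul h2.stronglyMeasurable).mul (hc3.stronglyMeasurable.mul h1)

variable {Φ} {μ ν : Fin r → ℝ} {q : ℝ} {f : (ι → ℂ) × (Fin k → ℂ) → ℂ}

namespace Slices

/-- The integral of the kernel over a horizontal slice, by Fubini's theorem. -/
theorem integral_E (h : Φ.Slices ν q f) {β : Fin r → ℝ}
    (hβ : ∀ i, (C.n i : ℝ) / 2 < β i + C.τ i) (x : ι → ℝ) {a b : (Fin k → ℂ) × (ι → ℝ)}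
    (ha : a.2 ∈ C.Ω) (hb : b.2 ∈ C.Ω) :
    ∫ ξ, Φ.E β f x a b ξ = ∫ x' : ι → ℝ, Φ.ker β (Φ.pt x a) (Φ.pt x' b) * f (Φ.pt x' b) := by
  have hmem : ∀ x', Φ.arg (Φ.pt x a) (Φ.pt x' b) ∈ C.tube := fun x' =>
    Φ.arg_mem_tube (Φ.pt_mem_D.2 ha) (Φ.pt_mem_D.2 hb)
  set g : (ι → ℝ) → ℂ := fun ξ => cexpPairing (Φ.arg (Φ.pt x a) (Φ.pt 0 b)) ξ *
    C.Ωd.indicator (fun ξ => (C.Qdp β ξ : ℂ)) ξ with hg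
  have hgi : Integrable g := ConeData.integrable_L_integrand hβ (hmem 0)
  have hprod : Integrable (fun p : (ι → ℝ) × (ι → ℝ) => f (Φ.pt p.1 b) * g p.2)
      ((volume : Measure (ι → ℝ)).prod volume) := (h.integrable_slice hb).mul_prod hgi
  have hint : Integrable (fun p : (ι → ℝ) × (ι → ℝ) => cexpPairing (fun i => -(p.1 i : ℂ)) p.2 *
      (f (Φ.pt p.1 b) * g p.2)) ((volume : Measure (ι → ℝ)).prod volume) := by
    refine hprod.mono (Continuous.aestronglyMeasurable ?_ |>.mul hprod.1) ?_
    · exact continuous_cexpPairing.comp (f := fun p : (ι → ℝ) × (ι → ℝ) =>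
        ((fun i => -(p.1 i : ℂ)), p.2)) (by fun_prop)
    · refine Filter.Eventually.of_forall fun p => le_of_eq ?_
      have h3 : (fun i => (-(p.1 i : ℂ)).im) = 0 := by ext i; simp
      rw [norm_mul, norm_cexpPairing, h3]
      simp
  have hswap := integral_integral_swap (f := fun x' ξ => cexpPairing (fun i => -((x' : ι → ℝ) i : ℂ)) ξ *
    (f (Φ.pt x' b) * g ξ)) hint
  calc ∫ ξ, Φ.E β f x a b ξ
      = ∫ ξ, ∫ x' : ι → ℝ, cexpPairing (fun i => -(x' i : ℂ)) ξ * (f (Φ.pt x' b) * g ξ) := by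
        refine integral_congr_ae (Filter.Eventually.of_forall fun ξ => ?_)
        simp only
        simp_rw [← mul_assoc]
        rw [integral_mul_const, h.fourier_slice hb, E, mul_comm]
    _ = ∫ x' : ι → ℝ, ∫ ξ, cexpPairing (fun i => -(x' i : ℂ)) ξ * (f (Φ.pt x' b) * g ξ) := hswap.symm
    _ = _ := by
        refine integral_congr_ae (Filter.Eventually.of_forall fun x' => ?_)
        simp only
        rw [ker, Lt_of_mem (hmem x'), ConeData.L, ← integral_mul_const]
        refine integral_congr_ae (Filter.Eventually.of_forall fun ξ => ?_)
        simp only [hg]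
        rw [Φ.arg_pt x a b x', cexpPairing_add]
        ring

/-- Absolute convergence, where one factor `Q^{-τ}` of the Laplace integral is estimated by its
value at the height of the first point. -/
theorem integrable_E (h : Φ.Slices ν q f) (hβ : ∀ i, (C.n i : ℝ) / 2 < Φ.ex μ i + C.τ i)
    (x : ι → ℝ) {a : (Fin k → ℂ) × (ι → ℝ)} (ha : a.2 ∈ C.Ω)
    (hfin : ∫⁻ b, Φ.baseKernel μ a b * Φ.N 1 f b ∂(Φ.mY μ) < ∞) :
    Integrable (fun p : ((Fin k → ℂ) × (ι → ℝ)) × (ι → ℝ) => Φ.E (Φ.ex μ) f x a p.1 p.2)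
      ((Φ.mY μ).prod volume) := by
  have hm := Φ.stronglyMeasurable_E (Φ.ex μ) h.measurable x a
  refine ⟨hm.aestronglyMeasurable, ?_⟩
  rw [hasFiniteIntegral_iff_enorm, lintegral_prod _ hm.enorm.aemeasurable]
  obtain ⟨Γ, hΓ, hL⟩ := ConeData.lintegral_L_integrand (C := C) hβ
  calc ∫⁻ b, (∫⁻ ξ, ‖Φ.E (Φ.ex μ) f x a b ξ‖ₑ) ∂(Φ.mY μ)
      ≤ ∫⁻ b, ENNReal.ofReal Γ * C.qp (-C.τ) a.2 * (Φ.baseKernel μ a b * Φ.N 1 f b) ∂(Φ.mY μ) := by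
        refine lintegral_mono_ae ?_
        filter_upwards [Φ.ae_mY μ] with b hb
        have hY := Φ.add_mem ha hb
        have hmem : Φ.arg (Φ.pt x a) (Φ.pt 0 b) ∈ C.tube :=
          Φ.arg_mem_tube (Φ.pt_mem_D.2 ha) (Φ.pt_mem_D.2 hb)
        have hN := (h.N_lt_top hb).ne
        calc ∫⁻ ξ, ‖Φ.E (Φ.ex μ) f x a b ξ‖ₑ
            ≤ ∫⁻ ξ, ‖cexpPairing (Φ.arg (Φ.pt x a) (Φ.pt 0 b)) ξ *
                C.Ωd.indicator (fun ξ => (C.Qdp (Φ.ex μ) ξ : ℂ)) ξ‖ₑ * Φ.N 1 f b := by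
              refine lintegral_mono fun ξ => ?_
              rw [E, enorm_mul]
              gcongr
              refine le_trans (le_of_eq ?_) (h.expd_mul_ft_le b.1 hb ξ)
              rw [enorm_mul, ← ofReal_norm, norm_cexpPairing, im_mul_I, ← expd]
          _ = ENNReal.ofReal Γ * C.qp (-(Φ.ex μ + C.τ)) (a.2 + b.2 + Φ.fd (a.1 - b.1)) *
                Φ.N 1 f b := by
              rw [lintegral_mul_const' _ _ hN, hL _ hmem, Φ.im_arg_pt]
          _ ≤ _ := by
              rw [neg_add, ConeData.qp_add, baseKernel]
              have hle : C.qp (-C.τ) (a.2 + b.2 + Φ.fd (a.1 - b.1)) ≤ C.qp (-C.τ) a.2 := by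
                rw [ConeData.qp_of_mem hY, ConeData.qp_of_mem ha, add_assoc]
                refine ENNReal.ofReal_le_ofReal (ConeData.Qp_add_le C.n_lt_τ ha ?_)
                exact subset_closure (C.add_mem_Ω hb (Φ.mem_closure _))
              calc _ ≤ ENNReal.ofReal Γ * (C.qp (-Φ.ex μ) (a.2 + b.2 + Φ.fd (a.1 - b.1)) *
                    C.qp (-C.τ) a.2) * Φ.N 1 f b := by gcongr
                _ = _ := by ring
    _ < ∞ := by
        rw [lintegral_const_mul' _ _ (ENNReal.mul_ne_top ENNReal.ofReal_ne_top
          (ConeData.qp_lt_top _ _).ne)]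
        exact ENNReal.mul_lt_top (ENNReal.mul_lt_top ENNReal.ofReal_lt_top
          (ConeData.qp_lt_top _ _)) hfin

/-- The Gaussian mean value property in the variable `u`. -/
theorem integral_psi (h : Φ.Slices ν q f) (u : Fin k → ℂ) (ξ : ι → ℝ)
    (hint : Integrable fun v => cexpPairing (Φ.psiArg u v) ξ * Φ.ft f ξ v) :
    ∫ v, cexpPairing (Φ.psiArg u v) ξ * Φ.ft f ξ v =
      Φ.ft f ξ u * ((∫⁻ w, expd (Φ.fd w) ((4 * Real.pi) • ξ)).toReal : ℂ) := by
  set g : (Fin k → ℂ) → ℂ := fun v => cexpPairing ((2 * Complex.I) • Φ.F (v - u) u) ξ * Φ.ft f ξ v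
    with hg
  set wgt : (Fin k → ℂ) → ℂ := fun w =>
    cexpPairing (fun i => (((2 : ℝ) • Φ.fd w) i : ℂ) * Complex.I) ξ with hwgt
  have heq : ∀ w, cexpPairing (Φ.psiArg u (u + w)) ξ * Φ.ft f ξ (u + w) = g (u + w) * wgt w := by
    intro w
    simp only [hg, hwgt]
    rw [Φ.psiArg_add, cexpPairing_add, add_sub_cancel_left]
    ring
  have hgd : Differentiable ℂ g := by
    have h1 : Differentiable ℂ fun v : Fin k → ℂ => Φ.F (v - u) u := by
      have h2 : (fun v : Fin k → ℂ => Φ.F (v - u) u) = fun v =>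
          ∑ a, ∑ b, ((v - u) a * star (u b)) • Φ.F (Pi.single a 1) (Pi.single b 1) :=
        funext fun v => Φ.F_eq_sum _ _
      rw [h2]
      fun_prop
    have h3 : Differentiable ℂ fun v => cexpPairing ((2 * Complex.I) • Φ.F (v - u) u) ξ :=
      (differentiable_cexpPairing ξ).comp (g := fun z => cexpPairing z ξ) (h1.fun_const_smul _)
    exact h3.mul (h.differentiable_ft ξ)
  -- the weight is invariant under `w ↦ e^{iθ} w`, and `g` is entire with the value of the partial
  -- Fourier transform at `u`
  have hmain := integral_mul_circular (volume : Measure (Fin k → ℂ)) (f := g) (w := wgt) (c := u)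
    (fun a x ha => by simp only [hwgt, Φ.fd_smul, ha, one_pow, one_smul])
    (fun x _ a _ => hgd _) (by
      have := hint.comp_add_left u
      simp_rw [heq] at this
      exact this)
  rw [← integral_add_left_eq_self (fun v => cexpPairing (Φ.psiArg u v) ξ * Φ.ft f ξ v) u]
  simp_rw [heq]
  rw [hmain, hwgt, integral_cexpPairing_mul_I volume Φ.continuous_fd.measurable]
  congr 1
  simp only [hg]
  rw [sub_self, map_zero, LinearMap.zero_apply, smul_zero, cexpPairing_zero, one_mul]

end Slices

end FormData

/-! ### The reproducing formula -/

/-- Hölder's inequality against a bounded integrable weight. -/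
theorem exists_lintegral_mul_le {X : Type*} [MeasurableSpace X] (m : Measure X) {p M K : ℝ≥0∞}
    (hp : 1 ≤ p) (hM : M ≠ ∞) (hK : K ≠ ∞) : ∃ K' : ℝ≥0∞, K' ≠ ∞ ∧ ∀ (g : X → ℂ) (w : X → ℝ≥0∞),
    Measurable g → Measurable w → (∀ x, w x ≤ M) → ∫⁻ x, w x ∂m ≤ K →
    ∫⁻ x, ‖g x‖ₑ * w x ∂m ≤ K' * eLpNorm g p m := by
  have he : 0 ≤ 1 / (1 : ℝ≥0∞).toReal - 1 / p.toReal := by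
    rcases eq_or_ne p ∞ with rfl | hpt
    · simp
    · have : 1 ≤ p.toReal := by
        rw [← ENNReal.toReal_one]; exact ENNReal.toReal_mono hpt hp
      have h2 : 1 / p.toReal ≤ 1 := by
        rw [div_le_one (by linarith)]; exact this
      simp only [ENNReal.toReal_one, div_one] at h2 ⊢
      linarith
  refine ⟨(M + 1) ^ (1 / p).toReal * K ^ (1 / (1 : ℝ≥0∞).toReal - 1 / p.toReal),
    ENNReal.mul_ne_top (ENNReal.rpow_ne_top_of_nonneg ENNReal.toReal_nonneg
      (ENNReal.add_ne_top.2 ⟨hM, ENNReal.one_ne_top⟩)) (ENNReal.rpow_ne_top_of_nonneg he hK),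
    fun g w hg hw hwM hwK => ?_⟩
  have h1 : m.withDensity w ≤ (M + 1) • m := by
    rw [← withDensity_const]
    exact withDensity_mono (Filter.Eventually.of_forall fun x => (hwM x).trans le_self_add)
  have huniv : (m.withDensity w) Set.univ ≤ K := by
    rw [withDensity_apply _ MeasurableSet.univ, Measure.restrict_univ]
    exact hwK
  calc ∫⁻ x, ‖g x‖ₑ * w x ∂m = ∫⁻ x, ‖g x‖ₑ ∂(m.withDensity w) := by
        rw [lintegral_withDensity_eq_lintegral_mul _ hw hg.enorm]
        exact lintegral_congr fun x => mul_comm _ _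
    _ = eLpNorm g 1 (m.withDensity w) := eLpNorm_one_eq_lintegral_enorm.symm
    _ ≤ eLpNorm g p (m.withDensity w) *
          (m.withDensity w) Set.univ ^ (1 / (1 : ℝ≥0∞).toReal - 1 / p.toReal) :=
        eLpNorm_le_eLpNorm_mul_rpow_measure_univ hp hg.aestronglyMeasurable
    _ ≤ eLpNorm g p ((M + 1) • m) * K ^ (1 / (1 : ℝ≥0∞).toReal - 1 / p.toReal) := by
        gcongr
    _ = _ := by
        rw [eLpNorm_smul_measure_of_ne_zero (by simp), smul_eq_mul]
        ring

namespace FormData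

variable {r : ℕ} {ι W : Type*} [Fintype ι] [Ring W] [Algebra ℝ W] {C : ConeData r ι W}
  {k : ℕ} {Φ : FormData C k} {μ ν : Fin r → ℝ} {q : ℝ} {f : (ι → ℂ) × (Fin k → ℂ) → ℂ}

/-- The reproducing formula at a point where the positive operator converges: after the Fourier
transform in `x`, Fubini's theorem allows to integrate first over `(u, t)`, which gives the
Gaussian mean value in `u` and the gamma integral in `t`. -/
theorem Slices.reproducing_pt (h : Φ.Slices ν q f) (hA : Φ.Admissible μ ν q) {c : ℝ}
    (hc : ∀ ξ ∈ C.Ωd, C.Qdp (Φ.ex μ) ξ *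
      ((∫⁻ w, expd (Φ.fd w) ((4 * Real.pi) • ξ)).toReal *
        (∫⁻ s, expd s ((4 * Real.pi) • ξ) ∂(Φ.mS μ)).toReal) = c)
    {a : (Fin k → ℂ) × (ι → ℝ)} (ha : a.2 ∈ C.Ω)
    (hfin : ∫⁻ b, Φ.baseKernel μ a b * Φ.N 1 f b ∂(Φ.mY μ) < ∞) (x : ι → ℝ) :
    ∫ w, Φ.ker (Φ.ex μ) (Φ.pt x a) w * f w ∂(Φ.Vm μ) = c * f (Φ.pt x a) := by
  have hint := (hA.integrable_and_holomorphic le_rfl h.measurable h.fin).1 (Φ.pt x a)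
    (Φ.pt_mem_D.2 ha)
  have hmp := Φ.measurePreserving_ptEquiv μ
  have hE := h.integrable_E hA.n_lt_ex_add x ha hfin
  have hint' := (hmp.integrable_comp_emb Φ.ptEquiv.measurableEmbedding).2 hint
  have hinner : ∀ᵐ ξ : ι → ℝ, ∫ b, Φ.E (Φ.ex μ) f x a b ξ ∂(Φ.mY μ) =
      c * (cexpPairing (Φ.pt x a).1 ξ * Φ.ft f ξ a.1) := by
    filter_upwards [h.ae_ft, hE.prod_left_ae] with ξ hξ0 hξi
    simp_rw [E_eq] at hξi ⊢
    by_cases hξ : ξ ∈ C.Ωd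
    · rw [Set.indicator_of_mem hξ] at hξi ⊢
      set A : ℂ := cexpPairing (Φ.pt x a).1 ξ * (C.Qdp (Φ.ex μ) ξ : ℂ) with hAdef
      have hA0 : A ≠ 0 := mul_ne_zero (Complex.exp_ne_zero _)
        (Complex.ofReal_ne_zero.2 (ConeData.Qdp_pos hξ _).ne')
      set ψ : (Fin k → ℂ) → ℂ := fun v => cexpPairing (Φ.psiArg a.1 v) ξ * Φ.ft f ξ v with hψ
      set φ : (ι → ℝ) → ℂ := fun s =>
        cexpPairing (fun i => (((2 : ℝ) • s) i : ℂ) * Complex.I) ξ with hφ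
      have h1 : Integrable (fun b : (Fin k → ℂ) × (ι → ℝ) => ψ b.1 * φ b.2)
          ((volume : Measure (Fin k → ℂ)).prod (Φ.mS μ)) := by
        have h2 := hξi.const_mul A⁻¹
        simp_rw [inv_mul_cancel_left₀ hA0] at h2
        exact h2
      have : NeZero (Φ.mS μ) := ⟨Φ.mS_ne_zero μ⟩
      obtain ⟨s, hs⟩ := h1.prod_left_ae.exists
      have hψi : Integrable ψ := by
        have h2 := hs.mul_const (φ s)⁻¹
        have hφ0 : φ s ≠ 0 := Complex.exp_ne_zero _
        simp_rw [mul_inv_cancel_right₀ hφ0] at h2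
        exact h2
      have h3 : ∫ b : (Fin k → ℂ) × (ι → ℝ), ψ b.1 * φ b.2 ∂(Φ.mY μ) =
          (∫ v, ψ v) * ∫ s, φ s ∂(Φ.mS μ) := integral_prod_mul ψ φ
      have h4 := integral_cexpPairing_mul_I (Φ.mS μ) (y := fun s : ι → ℝ => s) measurable_id ξ
      rw [integral_const_mul, h3, hψ, h.integral_psi a.1 ξ hψi, hφ, h4, ← hc ξ hξ, hAdef]
      push_cast
      ring
    · simp [Set.indicator_of_notMem hξ, hξ0 hξ]
  calc ∫ w, Φ.ker (Φ.ex μ) (Φ.pt x a) w * f w ∂(Φ.Vm μ)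
      = ∫ b, (∫ x' : ι → ℝ, Φ.ker (Φ.ex μ) (Φ.pt x a) (Φ.pt x' b) * f (Φ.pt x' b)) ∂(Φ.mY μ) := by
        rw [← hmp.integral_comp']
        exact integral_prod_symm _ hint'
    _ = ∫ b, (∫ ξ, Φ.E (Φ.ex μ) f x a b ξ) ∂(Φ.mY μ) := by
        refine integral_congr_ae ?_
        filter_upwards [Φ.ae_mY μ] with b hb
        exact (h.integral_E hA.n_lt_ex_add x ha hb).symm
    _ = ∫ ξ, (∫ b, Φ.E (Φ.ex μ) f x a b ξ ∂(Φ.mY μ)) :=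
        integral_integral_swap (f := fun b ξ => Φ.E (Φ.ex μ) f x a b ξ) hE
    _ = ∫ ξ, c * (cexpPairing (Φ.pt x a).1 ξ * Φ.ft f ξ a.1) := integral_congr_ae hinner
    _ = _ := by rw [integral_const_mul, h.inversion x ha]

/-- The reproducing formula for functions with integrable slices. -/
theorem Slices.reproducing (h : Φ.Slices ν q f) (hA : Φ.Admissible μ ν q) {c : ℝ}
    (hc : ∀ ξ ∈ C.Ωd, C.Qdp (Φ.ex μ) ξ *
      ((∫⁻ w, expd (Φ.fd w) ((4 * Real.pi) • ξ)).toReal *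
        (∫⁻ s, expd s ((4 * Real.pi) • ξ) ∂(Φ.mS μ)).toReal) = c)
    {ζ : (ι → ℂ) × (Fin k → ℂ)} (hζ : ζ ∈ Φ.D) :
    ∫ w, Φ.ker (Φ.ex μ) ζ w * f w ∂(Φ.Vm μ) = c * f ζ := by
  have hq0 : 0 < q := zero_lt_one.trans_le h.hq
  obtain ⟨K, hK, hS⟩ := hA.exists_schur
  have hNm := Φ.measurable_N 1 h.measurable
  have hfin : ∀ᵐ a ∂(Φ.mY ν), ∫⁻ b, Φ.baseKernel μ a b * Φ.N 1 f b ∂(Φ.mY μ) < ∞ := by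
    have h1 := (hS _ hNm).trans_lt (ENNReal.mul_lt_top hK.lt_top h.fin)
    have hm : Measurable fun a => ∫⁻ b, Φ.baseKernel μ a b * Φ.N 1 f b ∂(Φ.mY μ) := by
      have h2 : Measurable fun z : ((Fin k → ℂ) × (ι → ℝ)) × ((Fin k → ℂ) × (ι → ℝ)) =>
          Φ.baseKernel μ z.1 z.2 * Φ.N 1 f z.2 :=
        (measurable_baseKernel μ).mul (hNm.comp measurable_snd)
      exact h2.lintegral_prod_right'
    filter_upwards [ae_lt_top (hm.pow_const q) h1.ne] with a ha
    exact (ENNReal.rpow_lt_top_iff_of_pos hq0).1 ha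
  -- almost everywhere first, then everywhere by continuity of both sides
  have hae : ∀ᵐ ζ ∂(Φ.Vm ν), ∫ w, Φ.ker (Φ.ex μ) ζ w * f w ∂(Φ.Vm μ) = c * f ζ := by
    rw [← (Φ.measurePreserving_ptEquiv ν).map_eq, Φ.ptEquiv.measurableEmbedding.ae_map_iff]
    have h1 := (Measure.quasiMeasurePreserving_snd (μ := (volume : Measure (ι → ℝ)))
      (ν := Φ.mY ν)).ae (hfin.and (Φ.ae_mY ν))
    filter_upwards [h1] with p hp
    exact h.reproducing_pt hA hc hp.2 hp.1 p.1
  have hae' := (Φ.ae_Vm_iff ν).1 hae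
  have hhol := (hA.integrable_and_holomorphic le_rfl h.measurable h.fin).2
  have : (volume : Measure ((ι → ℂ) × (Fin k → ℂ))).IsAddHaarMeasure :=
    Measure.prod.instIsAddHaarMeasure _ _
  exact Measure.eqOn_open_of_ae_eq hae' Φ.isOpen_D hhol.continuousOn
    (continuousOn_const.mul h.holo.continuousOn) hζ

variable (C) in
/-- Holomorphic functions that are uniformly bounded, converge to `1`, and are integrable over
horizontal slices. -/
theorem exists_regularizers : ∃ G : ℕ → (ι → ℂ) → ℂ, (∀ n, Measurable (G n)) ∧
    (∀ n, DifferentiableOn ℂ (G n) C.tube) ∧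
    (∃ M : ℝ≥0∞, M ≠ ∞ ∧ ∀ n z, ‖G n z‖ₑ ≤ M) ∧
    (∀ z ∈ C.tube, Filter.Tendsto (fun n => G n z) Filter.atTop (nhds 1)) ∧
    ∀ n, ∃ K : ℝ≥0∞, K ≠ ∞ ∧ ∀ y ∈ C.Ω,
      ∫⁻ x : ι → ℝ, ‖G n (fun i => (x i : ℂ) + (y i : ℂ) * Complex.I)‖ₑ ≤ K := by
  set β : Fin r → ℝ := fun i => C.n i + 1 with hβdef
  have hn : ∀ i, (0 : ℝ) ≤ C.n i := fun i => Nat.cast_nonneg _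
  have hβ1 : ∀ i, (C.n i : ℝ) / 2 < β i := fun i => by simp only [hβdef]; linarith [hn i]
  have hβ : ∀ i, (C.n i : ℝ) / 2 < β i + C.τ i := fun i => by linarith [hβ1 i, C.n_lt_τ i, hn i]
  set e := base C with he
  have hee : e ∈ C.Ω := base_mem
  set z₁ : ι → ℂ := fun i => (e i : ℂ) * Complex.I with hz₁
  have hz₁t : z₁ ∈ C.tube := ConeData.mul_I_mem_tube hee
  obtain ⟨Γ, hΓ, hI⟩ := ConeData.L_imaginary (C := C) hβ
  have hL0 : C.L β z₁ ≠ 0 := by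
    rw [hz₁, hI e hee]
    exact Complex.ofReal_ne_zero.2 (mul_pos hΓ (ConeData.Qp_pos hee _)).ne'
  obtain ⟨Γ', hΓ', hb⟩ := ConeData.norm_L_le (C := C) hβ
  obtain ⟨d, hd, hLi⟩ := ConeData.lintegral_L (C := C) hβ1
  set ε : ℕ → ℝ := fun n => 1 / ((n : ℝ) + 1) with hε
  have hε0 : ∀ n, 0 < ε n := fun n => by positivity
  have him : ∀ n (z : ι → ℂ), (fun i => (((ε n : ℂ) • z + z₁) i).im) =
      e + ε n • fun i => (z i).im := by
    intro n z
    ext i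
    simp only [hz₁, Pi.add_apply, Pi.smul_apply, smul_eq_mul, Complex.add_im, Complex.ofReal_im,
      Complex.I_im, Complex.mul_im, Complex.ofReal_re, Complex.I_re]
    ring
  have hmem : ∀ n, ∀ z ∈ C.tube, (ε n : ℂ) • z + z₁ ∈ C.tube := by
    intro n z hz
    rw [ConeData.tube, Set.mem_ofPred_eq, him]
    exact C.add_mem_Ω hee (subset_closure (C.smul_mem_Ω hz (hε0 n)))
  have hqp : ∀ {α : Fin r → ℝ}, (∀ i, (C.n i : ℝ) / 2 < α i) → ∀ n, ∀ y ∈ C.Ω,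
      C.qp (-α) (e + ε n • y) ≤ C.qp (-α) e := by
    intro α hα n y hy
    have hcl := subset_closure (C.smul_mem_Ω hy (hε0 n))
    rw [ConeData.qp_of_mem hee, ConeData.qp_of_mem (C.add_mem_Ω hee hcl)]
    exact ENNReal.ofReal_le_ofReal (ConeData.Qp_add_le hα hee hcl)
  -- `G_n(z) = L_β(ε_n z + ie) / L_β(ie)` with `ε_n → 0`
  set G : ℕ → (ι → ℂ) → ℂ := fun n => C.tube.indicator fun z =>
    (C.L β z₁)⁻¹ * C.L β ((ε n : ℂ) • z + z₁) with hG
  have hGd : ∀ n, DifferentiableOn ℂ (fun z => (C.L β z₁)⁻¹ * C.L β ((ε n : ℂ) • z + z₁)) C.tube :=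
    fun n => ((ConeData.differentiableOn_L hβ).comp (f := fun z : ι → ℂ => (ε n : ℂ) • z + z₁)
      (by fun_prop) (hmem n)).const_mul _
  refine ⟨G, fun n => ConeData.measurable_indicator_of_continuousOn
    ConeData.isOpen_tube.measurableSet (hGd n).continuousOn, fun n => (hGd n).congr fun z hz =>
      Set.indicator_of_mem hz _, ⟨‖(C.L β z₁)⁻¹‖ₑ * (ENNReal.ofReal Γ' * C.qp (-(β + C.τ)) e),
      ENNReal.mul_ne_top enorm_ne_top (ENNReal.mul_ne_top ENNReal.ofReal_ne_top
        (ConeData.qp_lt_top _ _).ne), fun n z => ?_⟩, fun z hz => ?_, fun n => ?_⟩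
  · by_cases hz : z ∈ C.tube
    · simp only [hG, Set.indicator_of_mem hz, enorm_mul]
      gcongr
      refine (hb _ (hmem n z hz)).trans ?_
      gcongr
      rw [him]
      exact hqp (α := β + C.τ) hβ n _ hz
    · simp [hG, Set.indicator_of_notMem hz]
  · have hGz : ∀ n, G n z = (C.L β z₁)⁻¹ * C.L β ((ε n : ℂ) • z + z₁) := fun n =>
      Set.indicator_of_mem hz _
    simp_rw [hGz]
    rw [← inv_mul_cancel₀ hL0]
    refine Filter.Tendsto.const_mul _ ?_
    have hc : ContinuousAt (C.L β) z₁ := (ConeData.differentiableOn_L hβ).continuousOn.continuousAt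
      (ConeData.isOpen_tube.mem_nhds hz₁t)
    refine hc.tendsto.comp ?_
    have h1 : Filter.Tendsto (fun n => (ε n : ℂ)) Filter.atTop (nhds 0) := by
      have h := (Complex.continuous_ofReal.tendsto 0).comp (tendsto_one_div_add_atTop_nhds_zero_nat
        (𝕜 := ℝ))
      rwa [Complex.ofReal_zero] at h
    have h2 := (h1.smul_const z).add_const z₁
    rwa [zero_smul, zero_add] at h2
  · refine ⟨‖(C.L β z₁)⁻¹‖ₑ * (ENNReal.ofReal |(ε n ^ Module.finrank ℝ (ι → ℝ))⁻¹| *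
      (ENNReal.ofReal d * C.qp (-β) e)), ENNReal.mul_ne_top enorm_ne_top
      (ENNReal.mul_ne_top ENNReal.ofReal_ne_top (ENNReal.mul_ne_top ENNReal.ofReal_ne_top
        (ConeData.qp_lt_top _ _).ne)), fun y hy => ?_⟩
    have hy' : e + ε n • y ∈ C.Ω := C.add_mem_Ω hee (subset_closure (C.smul_mem_Ω hy (hε0 n)))
    set g : (ι → ℝ) → ℝ≥0∞ := fun x =>
      ‖Lt C β (fun i => (x i : ℂ) + ((e + ε n • y) i : ℂ) * Complex.I)‖ₑ with hg
    have hgm : Measurable g := by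
      refine ((measurable_Lt hβ).comp (Continuous.measurable ?_)).enorm
      fun_prop
    have h1 : ∀ x : ι → ℝ, ‖G n (fun i => (x i : ℂ) + (y i : ℂ) * Complex.I)‖ₑ =
        ‖(C.L β z₁)⁻¹‖ₑ * g (ε n • x) := by
      intro x
      have hz : (fun i => (x i : ℂ) + (y i : ℂ) * Complex.I) ∈ C.tube := ConeData.mem_tube hy
      simp only [hG, Set.indicator_of_mem hz, enorm_mul, hg]
      rw [Lt_of_mem (ConeData.mem_tube hy')]
      congr 3
      ext i
      simp only [hz₁, Pi.add_apply, Pi.smul_apply, smul_eq_mul]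
      push_cast
      ring
    simp_rw [h1]
    rw [lintegral_const_mul' _ _ enorm_ne_top]
    gcongr
    rw [← lintegral_map hgm (measurable_const_smul (ε n)),
      Measure.map_addHaar_smul volume (hε0 n).ne', lintegral_smul_measure, smul_eq_mul]
    gcongr
    calc ∫⁻ x, g x = ENNReal.ofReal d * C.qp (-β) (e + ε n • y) := by
          rw [← hLi _ hy']
          refine lintegral_congr fun x => ?_
          rw [hg]
          simp only
          rw [Lt_of_mem (ConeData.mem_tube hy')]
      _ ≤ _ := by
          gcongr
          exact hqp hβ1 n y hy

theorem fst_mem_tube {ζ : (ι → ℂ) × (Fin k → ℂ)} (hζ : ζ ∈ Φ.D) : ζ.1 ∈ C.tube := by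
  have h := C.add_mem_Ω (y := Φ.ht ζ) hζ (Φ.mem_closure ζ.2)
  rw [ConeData.tube, Set.mem_ofPred_eq]
  convert h using 1
  ext i
  simp [ht, fd]

/-- The reproducing formula in the mixed norm spaces. -/
theorem Admissible.reproducing (hA : Φ.Admissible μ ν q) {c : ℝ}
    (hc : ∀ ξ ∈ C.Ωd, C.Qdp (Φ.ex μ) ξ *
      ((∫⁻ w, expd (Φ.fd w) ((4 * Real.pi) • ξ)).toReal *
        (∫⁻ s, expd s ((4 * Real.pi) • ξ) ∂(Φ.mS μ)).toReal) = c)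
    {p : ℝ≥0∞} (hp : 1 ≤ p) (hf : Measurable f) (hd : DifferentiableOn ℂ f Φ.D)
    (hfin : ∫⁻ a, Φ.N p f a ^ q ∂(Φ.mY ν) < ∞) {ζ : (ι → ℂ) × (Fin k → ℂ)} (hζ : ζ ∈ Φ.D) :
    ∫ w, Φ.ker (Φ.ex μ) ζ w * f w ∂(Φ.Vm μ) = c * f ζ := by
  have hq0 : 0 < q := zero_lt_one.trans_le hA.hq
  obtain ⟨G, hGm, hGd, ⟨M, hM, hGM⟩, hG1, hGK⟩ := exists_regularizers C
  have hint := (hA.integrable_and_holomorphic hp hf hfin).1 ζ hζ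
  -- regularized functions have integrable slices; pass to the limit by dominated convergence
  set g : ℕ → (ι → ℂ) × (Fin k → ℂ) → ℂ := fun n w => f w * G n w.1 with hg
  have hslices : ∀ n, Φ.Slices ν q (g n) := by
    intro n
    obtain ⟨K, hK, hGK⟩ := hGK n
    obtain ⟨K', hK', hH⟩ := exists_lintegral_mul_le (volume : Measure (ι → ℝ)) hp hM hK
    refine ⟨hA.hq, hf.mul ((hGm n).comp measurable_fst), hd.mul ((hGd n).comp (by fun_prop)
      fun w hw => fst_mem_tube hw), ?_⟩
    calc ∫⁻ a, Φ.N 1 (g n) a ^ q ∂(Φ.mY ν)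
        ≤ ∫⁻ a, K' ^ q * Φ.N p f a ^ q ∂(Φ.mY ν) := by
          refine lintegral_mono_ae ?_
          filter_upwards [Φ.ae_mY ν] with a ha
          rw [← ENNReal.mul_rpow_of_nonneg _ _ hq0.le]
          refine ENNReal.rpow_le_rpow ?_ hq0.le
          have hpt : Continuous fun x : ι → ℝ => Φ.pt x a :=
            Φ.continuous_pt.comp (by fun_prop : Continuous fun x : ι → ℝ => (x, a))
          have hy : a.2 + Φ.fd a.1 ∈ C.Ω := C.add_mem_Ω ha (Φ.mem_closure _)
          have h1 := hH (fun x => f (Φ.pt x a)) (fun x => ‖G n (Φ.pt x a).1‖ₑ)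
            (hf.comp hpt.measurable)
            (((hGm n).comp (measurable_fst.comp hpt.measurable)).enorm) (fun x => hGM n _)
            (hGK _ hy)
          rw [N, eLpNorm_one_eq_lintegral_enorm]
          simp only [hg, enorm_mul]
          exact h1
      _ < ∞ := by
          rw [lintegral_const_mul' _ _ (ENNReal.rpow_ne_top_of_nonneg hq0.le hK')]
          exact ENNReal.mul_lt_top (ENNReal.rpow_lt_top_of_nonneg hq0.le hK') hfin
  have heq : ∀ n, ∫ w, Φ.ker (Φ.ex μ) ζ w * g n w ∂(Φ.Vm μ) = c * g n ζ := fun n =>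
    (hslices n).reproducing hA hc hζ
  have hkm := Φ.measurable_ker hA.n_lt_ex_add
  have hkζ : Measurable fun w => Φ.ker (Φ.ex μ) ζ w := hkm.comp measurable_prodMk_left
  have hlim1 : Filter.Tendsto (fun n => ∫ w, Φ.ker (Φ.ex μ) ζ w * g n w ∂(Φ.Vm μ)) Filter.atTop
      (nhds (∫ w, Φ.ker (Φ.ex μ) ζ w * f w ∂(Φ.Vm μ))) := by
    refine tendsto_integral_of_dominated_convergence
      (fun w => ‖Φ.ker (Φ.ex μ) ζ w * f w‖ * M.toReal) (fun n => ?_) (hint.norm.mul_const _)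
      (fun n => ?_) ?_
    · exact (hkζ.mul (hslices n).measurable).aestronglyMeasurable
    · refine Filter.Eventually.of_forall fun w => ?_
      rw [hg]
      simp only
      rw [← mul_assoc, norm_mul]
      gcongr
      have h1 := ENNReal.toReal_mono hM (hGM n w.1)
      rwa [toReal_enorm] at h1
    · filter_upwards [Φ.ae_mem_D μ] with w hw
      have h1 := ((hG1 w.1 (fst_mem_tube hw)).const_mul (f w)).const_mul (Φ.ker (Φ.ex μ) ζ w)
      rwa [mul_one] at h1
  have hlim2 : Filter.Tendsto (fun n => (c : ℂ) * g n ζ) Filter.atTop (nhds (c * f ζ)) := by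
    have h1 := ((hG1 ζ.1 (fst_mem_tube hζ)).const_mul (f ζ)).const_mul (c : ℂ)
    rwa [mul_one] at h1
  simp_rw [heq] at hlim1
  exact tendsto_nhds_unique hlim1 hlim2

end FormData

/-! ### The integral operators and the Bergman kernel -/

namespace FormData

variable {r : ℕ} {ι W : Type*} [Fintype ι] [Ring W] [Algebra ℝ W] {C : ConeData r ι W}
  {k : ℕ} (Φ : FormData C k)

/-- The mixed norm. -/
def mix (ν : Fin r → ℝ) (p : ℝ≥0∞) (q : ℝ) (f : (ι → ℂ) × (Fin k → ℂ) → ℂ) : ℝ≥0∞ :=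
  (∫⁻ u : Fin k → ℂ, ∫⁻ t : ι → ℝ, C.qp (Φ.wt ν) t * Φ.N p f (u, t) ^ q) ^ (1 / q)

theorem mix_eq (ν : Fin r → ℝ) (p : ℝ≥0∞) (q : ℝ) {f : (ι → ℂ) × (Fin k → ℂ) → ℂ}
    (hf : Measurable f) : Φ.mix ν p q f = (∫⁻ a, Φ.N p f a ^ q ∂(Φ.mY ν)) ^ (1 / q) := by
  rw [mix, Φ.lintegral_mY ν ((Φ.measurable_N p hf).pow_const q)]

theorem mix_congr (ν : Fin r → ℝ) (p : ℝ≥0∞) (q : ℝ) {f g : (ι → ℂ) × (Fin k → ℂ) → ℂ}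
    (h : f =ᵐ[volume.restrict Φ.D] g) : Φ.mix ν p q f = Φ.mix ν p q g := by
  have h1 := Φ.N_congr p ν ((Φ.ae_Vm_iff ν).2 h)
  have h2 := Measure.ae_ae_of_ae_prod h1
  rw [mix, mix]
  congr 1
  refine lintegral_congr_ae ?_
  filter_upwards [h2] with u hu
  have h3 := (ae_withDensity_iff (ConeData.measurable_qp _)).1 hu
  refine lintegral_congr_ae ?_
  filter_upwards [h3] with t ht
  by_cases h0 : C.qp (Φ.wt ν) t = 0
  · simp [h0]
  · rw [ht h0]

theorem mix_lt_top_iff {ν : Fin r → ℝ} {p : ℝ≥0∞} {q : ℝ} (hq : 1 ≤ q)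
    {f : (ι → ℂ) × (Fin k → ℂ) → ℂ} (hf : Measurable f) :
    Φ.mix ν p q f < ∞ ↔ ∫⁻ a, Φ.N p f a ^ q ∂(Φ.mY ν) < ∞ := by
  rw [Φ.mix_eq ν p q hf, ENNReal.rpow_lt_top_iff_of_pos (by positivity)]

theorem lintegral_N_two (ν : Fin r → ℝ) {f : (ι → ℂ) × (Fin k → ℂ) → ℂ} (hf : Measurable f) :
    ∫⁻ a, Φ.N 2 f a ^ (2 : ℝ) ∂(Φ.mY ν) = ∫⁻ w, ‖f w‖ₑ ^ (2 : ℝ) ∂(Φ.Vm ν) := by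
  rw [Φ.lintegral_Vm ν (hf.enorm.pow_const _)]
  refine lintegral_congr fun a => ?_
  rw [N, eLpNorm_eq_lintegral_rpow_enorm_toReal (by norm_num) (by norm_num), ← ENNReal.rpow_mul]
  norm_num

theorem mix_two_lt_top {ν : Fin r → ℝ} {f : (ι → ℂ) × (Fin k → ℂ) → ℂ}
    (hf : MemLp f 2 (Φ.Vm ν)) : Φ.mix ν 2 2 f < ∞ := by
  set g := hf.1.mk f
  have hfg : f =ᵐ[Φ.Vm ν] g := hf.1.ae_eq_mk
  have hg : Measurable g := hf.1.stronglyMeasurable_mk.measurable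
  rw [Φ.mix_congr ν 2 2 ((Φ.ae_Vm_iff ν).1 hfg), Φ.mix_lt_top_iff one_le_two hg,
    Φ.lintegral_N_two ν hg]
  have h1 := (memLp_congr_ae hfg).1 hf
  have h2 := lintegral_rpow_enorm_lt_top_of_eLpNorm_lt_top (by norm_num) (by norm_num) h1.2
  simpa using h2

variable {Φ}

theorem admissible_two {μ : Fin r → ℝ} (hμ : ∀ j, ((C.m j : ℝ) + C.n j + Φ.bv j) / 2 < μ j) :
    Φ.Admissible μ μ 2 where
  hμ := hμ
  hν j := by
    have h1 : (0 : ℝ) ≤ C.n j := Nat.cast_nonneg _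
    linarith [hμ j]
  hq := one_le_two
  lower j := by linarith [hμ j]
  upper j := by linarith [hμ j]

variable {μ ν : Fin r → ℝ} {q : ℝ}

/-- Integral operators dominated by the kernel are bounded in the mixed norms. -/
theorem Admissible.bounded (hA : Φ.Admissible μ ν q)
    {κ : (ι → ℂ) × (Fin k → ℂ) → (ι → ℂ) × (Fin k → ℂ) → ℂ} (hκ : Measurable (Function.uncurry κ))
    {M : ℝ≥0} (hM : ∀ ζ w, ‖κ ζ w‖₊ ≤ M * ‖Φ.ker (Φ.ex μ) ζ w‖₊) :
    ∃ K : ℝ≥0, ∀ p : ℝ≥0∞, 1 ≤ p → ∀ f, AEStronglyMeasurable f (volume.restrict Φ.D) →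
      Φ.mix ν p q f < ∞ → (∀ ζ ∈ Φ.D, Integrable (fun w => κ ζ w * f w) (Φ.Vm μ)) ∧
      StronglyMeasurable (fun ζ => ∫ w, κ ζ w * f w ∂(Φ.Vm μ)) ∧
      Φ.mix ν p q (fun ζ => ∫ w, κ ζ w * f w ∂(Φ.Vm μ)) ≤ K * Φ.mix ν p q f := by
  have hq0 : 0 < q := zero_lt_one.trans_le hA.hq
  obtain ⟨K, hK, hbd⟩ := hA.exists_bound
  have hKq : K ^ (1 / q) * M ≠ ∞ :=
    ENNReal.mul_ne_top (ENNReal.rpow_ne_top_of_nonneg (by positivity) hK) ENNReal.coe_ne_top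
  refine ⟨(K ^ (1 / q) * M).toNNReal, fun p hp f hf hfin => ?_⟩
  set g := hf.mk f with hgdef
  have hfg : f =ᵐ[volume.restrict Φ.D] g := hf.ae_eq_mk
  have hg : Measurable g := hf.stronglyMeasurable_mk.measurable
  have hfgμ : f =ᵐ[Φ.Vm μ] g := (Φ.ae_Vm_iff μ).2 hfg
  have hcongr : ∀ ζ, (fun w => κ ζ w * f w) =ᵐ[Φ.Vm μ] fun w => κ ζ w * g w := fun ζ => by
    filter_upwards [hfgμ] with w hw
    rw [hw]
  rw [Φ.mix_congr ν p q hfg] at hfin ⊢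
  have hfin' := (Φ.mix_lt_top_iff hA.hq hg).1 hfin
  have hint := (hA.integrable_and_holomorphic hp hg hfin').1
  have hκζ : ∀ ζ, Measurable (κ ζ) := fun ζ => hκ.comp measurable_prodMk_left
  have hle : ∀ ζ w, ‖κ ζ w * g w‖ ≤ (M : ℝ) * ‖Φ.ker (Φ.ex μ) ζ w * g w‖ := fun ζ w => by
    rw [norm_mul, norm_mul, ← mul_assoc]
    gcongr
    exact_mod_cast hM ζ w
  have hint' : ∀ ζ ∈ Φ.D, Integrable (fun w => κ ζ w * g w) (Φ.Vm μ) := fun ζ hζ =>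
    ((hint ζ hζ).norm.const_mul (M : ℝ)).mono' ((hκζ ζ).mul hg).aestronglyMeasurable
      (Filter.Eventually.of_forall (hle ζ))
  have hPeq : (fun ζ => ∫ w, κ ζ w * f w ∂(Φ.Vm μ)) = fun ζ => ∫ w, κ ζ w * g w ∂(Φ.Vm μ) :=
    funext fun ζ => integral_congr_ae (hcongr ζ)
  have hjm : Measurable fun z : ((ι → ℂ) × (Fin k → ℂ)) × ((ι → ℂ) × (Fin k → ℂ)) =>
      κ z.1 z.2 * g z.2 := hκ.mul (hg.comp measurable_snd)
  have hsm : StronglyMeasurable fun ζ => ∫ w, κ ζ w * g w ∂(Φ.Vm μ) := by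
    have h := hjm.stronglyMeasurable.integral_prod_right' (ν := Φ.Vm μ)
    exact h
  refine ⟨fun ζ hζ => (hint' ζ hζ).congr (hcongr ζ).symm, by rw [hPeq]; exact hsm, ?_⟩
  rw [hPeq, Φ.mix_eq ν p q hsm.measurable, Φ.mix_eq ν p q hg, ENNReal.coe_toNNReal hKq]
  have hgM : Measurable fun w => ((M : ℝ) : ℂ) • g w := hg.const_mul _
  have hMe : ‖((M : ℝ) : ℂ)‖ₑ = (M : ℝ≥0∞) := by
    rw [enorm_eq_nnnorm]
    congr 1
    ext
    simp
  have h1 := hbd p hp (fun w => ((M : ℝ) : ℂ) • g w) hgM (fun ζ => ∫ w, κ ζ w * g w ∂(Φ.Vm μ))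
    fun ζ hζ => by
      refine (enorm_integral_le_lintegral_enorm _).trans (lintegral_mono fun w => ?_)
      rw [enorm_mul, enorm_smul, ← mul_assoc, mul_comm ‖Φ.ker (Φ.ex μ) ζ w‖ₑ]
      gcongr
      rw [hMe, enorm_eq_nnnorm, enorm_eq_nnnorm, ← ENNReal.coe_mul]
      exact ENNReal.coe_le_coe.2 (hM ζ w)
  have h4 : ∀ a, Φ.N p (fun w => ((M : ℝ) : ℂ) • g w) a = M * Φ.N p g a := fun a => by
    rw [N, N]
    have := eLpNorm_const_smul ((M : ℝ) : ℂ) (fun x => g (Φ.pt x a)) p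
      (volume : Measure (ι → ℝ))
    rw [hMe] at this
    exact this
  simp_rw [h4, ENNReal.mul_rpow_of_nonneg _ _ hq0.le] at h1
  rw [lintegral_const_mul' _ _ (ENNReal.rpow_ne_top_of_nonneg hq0.le ENNReal.coe_ne_top)] at h1
  have h5 := ENNReal.rpow_le_rpow h1 (by positivity : 0 ≤ 1 / q)
  refine h5.trans (le_of_eq ?_)
  rw [ENNReal.mul_rpow_of_nonneg _ _ (by positivity), ENNReal.mul_rpow_of_nonneg _ _ (by positivity),
    ← ENNReal.rpow_mul, mul_one_div_cancel hq0.ne', ENNReal.rpow_one, mul_assoc]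

variable (Φ) in
/-- The normalizing constant of the Bergman kernel: the product of the density `(Q⋆)^β` with the
Gauss and the gamma integral, which does not depend on `ξ`. -/
structure IsNormalization (μ : Fin r → ℝ) (c : ℝ) : Prop where
  pos : 0 < c
  eq : ∀ ξ ∈ C.Ωd, C.Qdp (Φ.ex μ) ξ *
    ((∫⁻ w, expd (Φ.fd w) ((4 * Real.pi) • ξ)).toReal *
      (∫⁻ s, expd s ((4 * Real.pi) • ξ) ∂(Φ.mS μ)).toReal) = c

variable (Φ) in
/-- The Bergman kernel. -/
def bk (μ : Fin r → ℝ) (c : ℝ) (ζ w : (ι → ℂ) × (Fin k → ℂ)) : ℂ :=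
  (c : ℂ)⁻¹ * Φ.ker (Φ.ex μ) ζ w

theorem bk_swap (μ : Fin r → ℝ) (c : ℝ) (ζ w : (ι → ℂ) × (Fin k → ℂ)) :
    Φ.bk μ c w ζ = star (Φ.bk μ c ζ w) := by
  rw [bk, bk, Φ.ker_swap, star_mul', star_inv₀]
  congr 2
  exact (Complex.conj_ofReal c).symm

theorem Admissible.measurable_bk (hA : Φ.Admissible μ ν q) (c : ℝ) :
    Measurable (Function.uncurry (Φ.bk μ c)) :=
  (Φ.measurable_ker hA.n_lt_ex_add).const_mul _

theorem nnnorm_bk_le {c : ℝ} (ζ w : (ι → ℂ) × (Fin k → ℂ)) :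
    ‖Φ.bk μ c ζ w‖₊ ≤ ‖(c : ℂ)⁻¹‖₊ * ‖Φ.ker (Φ.ex μ) ζ w‖₊ := by
  rw [bk, nnnorm_mul]

theorem Admissible.holomorphic (hA : Φ.Admissible μ ν q) (c : ℝ) {p : ℝ≥0∞} (hp : 1 ≤ p)
    {f : (ι → ℂ) × (Fin k → ℂ) → ℂ} (hf : AEStronglyMeasurable f (volume.restrict Φ.D))
    (hfin : Φ.mix ν p q f < ∞) :
    DifferentiableOn ℂ (fun ζ => ∫ w, Φ.bk μ c ζ w * f w ∂(Φ.Vm μ)) Φ.D := by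
  set g := hf.mk f with hgdef
  have hfg : f =ᵐ[volume.restrict Φ.D] g := hf.ae_eq_mk
  have hg : Measurable g := hf.stronglyMeasurable_mk.measurable
  rw [Φ.mix_congr ν p q hfg, Φ.mix_lt_top_iff hA.hq hg] at hfin
  refine ((hA.integrable_and_holomorphic hp hg hfin).2.const_mul (c : ℂ)⁻¹).congr fun ζ _ => ?_
  rw [← integral_const_mul]
  refine integral_congr_ae ?_
  filter_upwards [(Φ.ae_Vm_iff μ).2 hfg] with w hw
  rw [hw, bk, mul_assoc]

/-- The reproducing property of the Bergman kernel in the mixed norm spaces. -/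
theorem Admissible.integral_bk (hA : Φ.Admissible μ ν q) {c : ℝ} (hc : Φ.IsNormalization μ c)
    {p : ℝ≥0∞} (hp : 1 ≤ p) {f : (ι → ℂ) × (Fin k → ℂ) → ℂ} (hd : DifferentiableOn ℂ f Φ.D)
    (hfin : Φ.mix ν p q f < ∞) {ζ : (ι → ℂ) × (Fin k → ℂ)} (hζ : ζ ∈ Φ.D) :
    ∫ w, Φ.bk μ c ζ w * f w ∂(Φ.Vm μ) = f ζ := by
  have hDm := Φ.isOpen_D.measurableSet
  set g : (ι → ℂ) × (Fin k → ℂ) → ℂ := Φ.D.indicator f with hgdef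
  have hg : Measurable g := ConeData.measurable_indicator_of_continuousOn hDm hd.continuousOn
  have hgd : DifferentiableOn ℂ g Φ.D := hd.congr fun w hw => Set.indicator_of_mem hw _
  have hfg : f =ᵐ[volume.restrict Φ.D] g := by
    filter_upwards [ae_restrict_mem hDm] with w hw
    exact (Set.indicator_of_mem hw _).symm
  rw [Φ.mix_congr ν p q hfg, Φ.mix_lt_top_iff hA.hq hg] at hfin
  have h1 := hA.reproducing hc.eq hp hg hgd hfin hζ
  have h2 : ∫ w, Φ.bk μ c ζ w * f w ∂(Φ.Vm μ) =
      (c : ℂ)⁻¹ * ∫ w, Φ.ker (Φ.ex μ) ζ w * g w ∂(Φ.Vm μ) := by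
    rw [← integral_const_mul]
    refine integral_congr_ae ?_
    filter_upwards [(Φ.ae_Vm_iff μ).2 hfg] with w hw
    rw [hw, bk, mul_assoc]
  rw [h2, h1, inv_mul_cancel_left₀ (Complex.ofReal_ne_zero.2 hc.pos.ne'), hgdef,
    Set.indicator_of_mem hζ]

/-- The kernel functions belong to the weighted Bergman space. -/
theorem memLp_bk (hμ : ∀ j, ((C.m j : ℝ) + C.n j + Φ.bv j) / 2 < μ j) (c : ℝ)
    {ζ : (ι → ℂ) × (Fin k → ℂ)} (hζ : ζ ∈ Φ.D) :
    DifferentiableOn ℂ (fun w => Φ.bk μ c w ζ) Φ.D ∧ MemLp (fun w => Φ.bk μ c w ζ) 2 (Φ.Vm μ) := by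
  have hA := admissible_two hμ
  have hkm := Φ.measurable_ker hA.n_lt_ex_add
  have hkζ : Measurable fun w => Φ.ker (Φ.ex μ) w ζ := hkm.comp measurable_prodMk_right
  refine ⟨(Φ.differentiableOn_ker hA.n_lt_ex_add hζ).const_mul _, MemLp.const_mul ?_ _⟩
  refine ⟨hkζ.aestronglyMeasurable, ?_⟩
  refine (eLpNorm_lt_top_iff_lintegral_rpow_enorm_lt_top (by norm_num) (by norm_num)).2 ?_
  have hn : ∀ i, (0 : ℝ) ≤ C.n i := fun i => Nat.cast_nonneg _
  have hm : ∀ i, (0 : ℝ) ≤ C.m i := fun i => Nat.cast_nonneg _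
  have hb := Φ.bv_nonneg
  have hτ : ∀ i, C.τ i = 1 + ((C.m i : ℝ) + C.n i) / 2 := fun i => rfl
  have hex := hA.n_lt_ex
  obtain ⟨d, hd, hsq⟩ := ConeData.lintegral_L_sq (C := C) (β := Φ.ex μ) hA.n_lt_ex_add
    (fun i => by linarith [hex i, hn i, hm i, hτ i])
  set γ : Fin r → ℝ := μ - (2⁻¹ : ℝ) • Φ.bv with hγ
  have hγj : ∀ j, γ j = μ j - Φ.bv j / 2 := fun j => by
    simp only [hγ, Pi.sub_apply, Pi.smul_apply, smul_eq_mul]; ring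
  have hsum : ∀ j, (Φ.ex μ + Φ.ex μ + C.τ) j = 2 * μ j + Φ.bv j + C.τ j := fun j => by
    simp only [Pi.add_apply, ex_apply]; ring
  -- the slice norms are `Q^{-(2β+τ)}`, which the beta integral integrates
  obtain ⟨d', hd', hbeta⟩ := Φ.lintegral_beta (β := Φ.ex μ + Φ.ex μ + C.τ) (γ := γ)
    (fun j => by rw [hsum]; linarith [hμ j, hn j, hm j, hb j, hτ j])
    (fun j => by rw [hγj]; linarith [hμ j, hn j, hm j, hb j, hτ j])
    (fun j => by rw [hsum, hγj]; linarith [hμ j, hn j, hm j, hb j, hτ j])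
  set a : (Fin k → ℂ) × (ι → ℝ) := (ζ.2, Φ.ht ζ) with ha
  have haΩ : a.2 ∈ C.Ω := hζ
  set x : ι → ℝ := fun i => (ζ.1 i).re with hx
  have hζpt : Φ.pt x a = ζ := Φ.pt_ht ζ
  have hslice : ∀ b : (Fin k → ℂ) × (ι → ℝ), b.2 ∈ C.Ω →
      ∫⁻ x' : ι → ℝ, ‖Φ.ker (Φ.ex μ) (Φ.pt x' b) ζ‖ₑ ^ (2 : ℝ) =
      ENNReal.ofReal d * C.qp (-(Φ.ex μ + Φ.ex μ + C.τ)) (a.2 + b.2 + Φ.fd (b.1 - a.1)) := by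
    intro b hb
    have hY : b.2 + a.2 + Φ.fd (b.1 - a.1) ∈ C.Ω := Φ.add_mem hb haΩ
    rw [add_comm a.2 b.2, ← hsq _ hY,
      ← lintegral_add_right_eq_self _ (x - Φ.imF b.1 a.1)]
    refine lintegral_congr fun x' => ?_
    rw [ker, Lt_of_mem (Φ.arg_mem_tube (Φ.pt_mem_D.2 hb) hζ), arg, ← hζpt, kernel_arg,
      ← ENNReal.rpow_natCast]
    congr 4
    ext i
    congr 3
    simp only [Pi.add_apply, Pi.sub_apply]
    ring
  have hslm : Measurable fun w => ‖Φ.ker (Φ.ex μ) w ζ‖ₑ ^ (2 : ℝ) := hkζ.enorm.pow_const _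
  have hbm : Measurable fun b : (Fin k → ℂ) × (ι → ℝ) => ENNReal.ofReal d *
      C.qp (-(Φ.ex μ + Φ.ex μ + C.τ)) (a.2 + b.2 + Φ.fd (b.1 - a.1)) := by
    have h := Φ.continuous_fd
    have h2 : Continuous fun b : (Fin k → ℂ) × (ι → ℝ) => a.2 + b.2 + Φ.fd (b.1 - a.1) := by fun_prop
    exact ((ConeData.measurable_qp _).comp h2.measurable).const_mul _
  have hwt : Φ.wt μ = γ - C.τ := rfl
  calc ∫⁻ w, ‖Φ.ker (Φ.ex μ) w ζ‖ₑ ^ (2 : ℝ≥0∞).toReal ∂(Φ.Vm μ)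
      = ∫⁻ b, (∫⁻ x' : ι → ℝ, ‖Φ.ker (Φ.ex μ) (Φ.pt x' b) ζ‖ₑ ^ (2 : ℝ)) ∂(Φ.mY μ) := by
        rw [← Φ.lintegral_Vm μ hslm, ENNReal.toReal_ofNat]
    _ = ∫⁻ b, ENNReal.ofReal d *
          C.qp (-(Φ.ex μ + Φ.ex μ + C.τ)) (a.2 + b.2 + Φ.fd (b.1 - a.1)) ∂(Φ.mY μ) := by
        refine lintegral_congr_ae ?_
        filter_upwards [Φ.ae_mY μ] with b hb
        exact hslice b hb
    _ = ENNReal.ofReal d * ∫⁻ u : Fin k → ℂ, ∫⁻ t, C.qp (-(Φ.ex μ + Φ.ex μ + C.τ))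
          (a.2 + t + Φ.fd u) * C.qp (γ - C.τ) t := by
        rw [Φ.lintegral_mY μ hbm, ← lintegral_const_mul' _ _ ENNReal.ofReal_ne_top,
          ← lintegral_sub_right_eq_self (fun u => ENNReal.ofReal d * ∫⁻ t,
            C.qp (-(Φ.ex μ + Φ.ex μ + C.τ)) (a.2 + t + Φ.fd u) * C.qp (γ - C.τ) t) a.1]
        refine lintegral_congr fun u => ?_
        rw [← lintegral_const_mul' _ _ ENNReal.ofReal_ne_top, hwt]
        refine lintegral_congr fun t => ?_
        ring
    _ < ∞ := by
        rw [hbeta _ haΩ]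
        exact ENNReal.mul_lt_top ENNReal.ofReal_lt_top (ENNReal.mul_lt_top ENNReal.ofReal_lt_top
          (ConeData.qp_lt_top _ _))

end FormData

/-! ### Reduction of `T`-algebras to cone data -/

namespace TAlgebra

section Upper

variable {r : ℕ} {𝒰 : Type*} [NonUnitalNonAssocRing 𝒰] [Module ℝ 𝒰]
  [IsScalarTower ℝ 𝒰 𝒰] [SMulCommClass ℝ 𝒰 𝒰] [StarRing 𝒰] [StarModule ℝ 𝒰]
  (T : TAlgebra r 𝒰)

theorem upper_eq_iSup : T.upper =
    ⨆ p : {p : Fin r × Fin r // p.1 ≤ p.2}, T.comp p.1.1 p.1.2 := by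
  rw [upper, iSup_subtype, iSup_prod]

theorem comp_le_upper {i j : Fin r} (hij : i ≤ j) : T.comp i j ≤ T.upper := by
  rw [upper_eq_iSup]
  exact le_iSup (fun p : {p : Fin r × Fin r // p.1 ≤ p.2} => T.comp p.1.1 p.1.2) ⟨(i, j), hij⟩

theorem upper_induction {P : 𝒰 → Prop} (hc : ∀ i j a, i ≤ j → a ∈ T.comp i j → P a)
    (hadd : ∀ a b, P a → P b → P (a + b)) (h0 : P 0) {a : 𝒰} (ha : a ∈ T.upper) : P a := by
  rw [upper_eq_iSup] at ha
  exact Submodule.iSup_induction (motive := P) _ ha (fun p a ha => hc _ _ a p.2 ha) h0 hadd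

theorem induction {P : 𝒰 → Prop} (hc : ∀ i j a, a ∈ T.comp i j → P a)
    (hadd : ∀ a b, P a → P b → P (a + b)) (h0 : P 0) (a : 𝒰) : P a := by
  have ha : a ∈ ⨆ p : Fin r × Fin r, T.comp p.1 p.2 := by
    rw [T.isInternal.submodule_iSup_eq_top]; exact Submodule.mem_top
  exact Submodule.iSup_induction (motive := P) _ ha (fun p a ha => hc _ _ a ha) h0 hadd

theorem mul_mem_upper {a b : 𝒰} (ha : a ∈ T.upper) (hb : b ∈ T.upper) : a * b ∈ T.upper := by
  refine T.upper_induction (P := fun a => a * b ∈ T.upper) (fun i j a hij ha => ?_)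
    (fun x y hx hy => by rw [add_mul]; exact add_mem hx hy) (by rw [zero_mul]; exact zero_mem _) ha
  refine T.upper_induction (P := fun b => a * b ∈ T.upper) (fun l k b hlk hb => ?_)
    (fun x y hx hy => by rw [mul_add]; exact add_mem hx hy) (by rw [mul_zero]; exact zero_mem _) hb
  by_cases h : j = l
  · subst h
    exact T.comp_le_upper (hij.trans hlk) (T.mul_mem ha hb)
  · rw [T.mul_eq_zero h ha hb]
    exact zero_mem _

theorem c_mem_comp (i : Fin r) : T.c i ∈ T.comp i i := by
  rw [T.comp_diag]
  exact Submodule.mem_span_singleton_self _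

theorem c_mul_eq {i j : Fin r} {a : 𝒰} (ha : a ∈ T.comp i j) (k : Fin r) :
    T.c k * a = if k = i then a else 0 := by
  split_ifs with h
  · subst h
    exact T.c_mul ha
  · exact T.mul_eq_zero h (T.c_mem_comp k) ha

theorem mul_c_eq {i j : Fin r} {a : 𝒰} (ha : a ∈ T.comp i j) (k : Fin r) :
    a * T.c k = if k = j then a else 0 := by
  split_ifs with h
  · subst h
    exact T.mul_c ha
  · exact T.mul_eq_zero (Ne.symm h) ha (T.c_mem_comp k)

theorem sum_c_mul (a : 𝒰) : (∑ i, T.c i) * a = a := by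
  refine T.induction (P := fun a => (∑ i, T.c i) * a = a) (fun i j a ha => ?_)
    (fun x y hx hy => by rw [mul_add, hx, hy]) (mul_zero _) a
  rw [Finset.sum_mul]
  simp [T.c_mul_eq ha]

theorem mul_sum_c (a : 𝒰) : a * (∑ i, T.c i) = a := by
  refine T.induction (P := fun a => a * (∑ i, T.c i) = a) (fun i j a ha => ?_)
    (fun x y hx hy => by rw [add_mul, hx, hy]) (zero_mul _) a
  rw [Finset.mul_sum]
  simp [T.mul_c_eq ha]

theorem sum_c_mem : ∑ i, T.c i ∈ T.upper :=
  sum_mem fun i _ => T.comp_le_upper le_rfl (T.c_mem_comp i)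

instance upperRing : Ring T.upper :=
  { (inferInstance : AddCommGroup T.upper) with
    mul := fun a b => ⟨(a : 𝒰) * b, T.mul_mem_upper a.2 b.2⟩
    one := ⟨∑ i, T.c i, T.sum_c_mem⟩
    left_distrib := fun a b d => Subtype.ext (mul_add _ _ _)
    right_distrib := fun a b d => Subtype.ext (add_mul _ _ _)
    zero_mul := fun a => Subtype.ext (zero_mul _)
    mul_zero := fun a => Subtype.ext (mul_zero _)
    mul_assoc := fun a b d => Subtype.ext (T.upper_assoc a.2 b.2 d.2).symm
    one_mul := fun a => Subtype.ext (T.sum_c_mul _)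
    mul_one := fun a => Subtype.ext (T.mul_sum_c _) }

theorem coe_mul (a b : T.upper) : ((a * b : T.upper) : 𝒰) = a * b := rfl

theorem coe_one : ((1 : T.upper) : 𝒰) = ∑ i, T.c i := rfl

instance upperAlgebra : Algebra ℝ T.upper :=
  Algebra.ofModule (fun x a b => Subtype.ext (smul_mul_assoc x (a : 𝒰) b))
    (fun x a b => Subtype.ext (mul_smul_comm x (a : 𝒰) b))

theorem eq_smul_c {i : Fin r} {a : 𝒰} (ha : a ∈ T.comp i i) : a = T.ρ i a • T.c i := by
  rw [T.comp_diag, Submodule.mem_span_singleton] at ha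
  obtain ⟨x, rfl⟩ := ha
  rw [map_smul, T.ρ_c, smul_eq_mul, mul_one]

/-- The diagonal entries of a product of triangular elements multiply. -/
theorem ρ_mul {a b : 𝒰} (ha : a ∈ T.upper) (hb : b ∈ T.upper) (i : Fin r) :
    T.ρ i (a * b) = T.ρ i a * T.ρ i b := by
  refine T.upper_induction (P := fun a => T.ρ i (a * b) = T.ρ i a * T.ρ i b)
    (fun i' j a hij ha => ?_)
    (fun x y hx hy => by rw [add_mul, map_add, hx, hy, map_add, add_mul]) (by simp) ha
  refine T.upper_induction (P := fun b => T.ρ i (a * b) = T.ρ i a * T.ρ i b)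
    (fun l k b hlk hb => ?_)
    (fun x y hx hy => by rw [mul_add, map_add, hx, hy, map_add, mul_add]) (by simp) hb
  by_cases h1 : (i', j) = (i, i)
  · obtain ⟨hi, hj⟩ := Prod.mk.inj h1
    subst hi hj
    by_cases h2 : (l, k) = (j, j)
    · obtain ⟨hl, hk⟩ := Prod.mk.inj h2
      subst hl hk
      rw [T.eq_smul_c ha, T.eq_smul_c hb, smul_mul_smul_comm, T.c_mul_c, map_smul, map_smul,
        map_smul, T.ρ_c]
      simp
    · rw [T.ρ_comp h2 hb, mul_zero]
      by_cases h3 : j = l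
      · subst h3
        exact T.ρ_comp h2 (T.mul_mem ha hb)
      · rw [T.mul_eq_zero h3 ha hb, map_zero]
  · rw [T.ρ_comp h1 ha, zero_mul]
    by_cases h3 : j = l
    · subst h3
      refine T.ρ_comp (fun h => h1 ?_) (T.mul_mem ha hb)
      obtain ⟨rfl, rfl⟩ := Prod.mk.inj h
      rw [le_antisymm hlk hij]
    · rw [T.mul_eq_zero h3 ha hb, map_zero]

theorem star_c (i : Fin r) : star (T.c i) = T.c i := by
  have h1 := T.eq_smul_c (T.star_mem (T.c_mem_comp i))
  have h2 : star (T.c i) * star (T.c i) = star (T.c i) := by rw [← star_mul, T.c_mul_c]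
  rw [h1, smul_mul_smul_comm, T.c_mul_c] at h2
  have h3 := congrArg (T.ρ i) h2
  rw [map_smul, map_smul, T.ρ_c, smul_eq_mul, smul_eq_mul, mul_one, mul_one] at h3
  have h4 : T.ρ i (star (T.c i)) ≠ 0 := fun h => by
    rw [h, zero_smul, star_eq_zero] at h1
    have := T.ρ_c i
    rw [h1, map_zero] at this
    exact zero_ne_one this
  rw [h1, mul_left_cancel₀ h4 (h3.trans (mul_one _).symm), one_smul]

theorem ρ_star (i : Fin r) (a : 𝒰) : T.ρ i (star a) = T.ρ i a := by
  refine T.induction (P := fun a => T.ρ i (star a) = T.ρ i a) (fun j k a ha => ?_)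
    (fun x y hx hy => by rw [star_add, map_add, hx, hy, map_add]) (by simp) a
  by_cases h : (j, k) = (i, i)
  · obtain ⟨rfl, rfl⟩ := Prod.mk.inj h
    rw [T.eq_smul_c ha, star_smul, T.star_c]
    simp
  · rw [T.ρ_comp h ha]
    refine T.ρ_comp (fun h2 => h ?_) (T.star_mem ha)
    obtain ⟨rfl, rfl⟩ := Prod.mk.inj h2
    rfl

theorem ρ_c_eq (i j : Fin r) : T.ρ i (T.c j) = if i = j then 1 else 0 := by
  split_ifs with h
  · subst h
    exact T.ρ_c i
  · exact T.ρ_comp (fun h2 => h (Prod.mk.inj h2).1.symm) (T.c_mem_comp j)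

/-- The trace. -/
def trace : 𝒰 →ₗ[ℝ] ℝ := ∑ i, T.ρ i

theorem trace_apply (a : 𝒰) : T.trace a = ∑ i, T.ρ i a := by simp [trace]

/-- The diagonal entries as characters of the algebra of upper triangular elements. -/
def ρhom (i : Fin r) : T.upper →ₐ[ℝ] ℝ :=
  AlgHom.ofLinearMap ((T.ρ i).comp T.upper.subtype)
    (by
      change T.ρ i (∑ j, T.c j) = 1
      simp [T.ρ_c_eq])
    fun a b => T.ρ_mul a.2 b.2 i

theorem ρhom_apply (i : Fin r) (a : T.upper) : T.ρhom i a = T.ρ i (a : 𝒰) := rfl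

theorem isInternal_upper : DirectSum.IsInternal fun p : {p : Fin r × Fin r // p.1 ≤ p.2} =>
    (T.comp p.1.1 p.1.2).comap T.upper.subtype := by
  rw [DirectSum.isInternal_submodule_iff_iSupIndep_and_iSup_eq_top]
  have hmap : ∀ p : {p : Fin r × Fin r // p.1 ≤ p.2},
      ((T.comp p.1.1 p.1.2).comap T.upper.subtype).map T.upper.subtype = T.comp p.1.1 p.1.2 := by
    intro p
    rw [Submodule.map_comap_subtype, inf_eq_right]
    exact T.comp_le_upper p.2
  constructor
  · intro p
    rw [Submodule.disjoint_def]
    intro x hx hx2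
    have hind := (T.isInternal.submodule_iSupIndep).comp
      (Subtype.val_injective (p := fun p : Fin r × Fin r => p.1 ≤ p.2))
    have h1 := (Submodule.disjoint_def.1 (hind p)) (x : 𝒰) hx ?_
    · exact Subtype.ext h1
    · have h2 := Submodule.mem_map_of_mem (f := T.upper.subtype) hx2
      simp_rw [Submodule.map_iSup, hmap] at h2
      exact h2
  · refine Submodule.map_injective_of_injective T.upper.injective_subtype ?_
    rw [Submodule.map_iSup, Submodule.map_top, Submodule.range_subtype]
    exact (iSup_congr fun p => hmap p).trans T.upper_eq_iSup.symm

theorem finrank_comap {i j : Fin r} (hij : i ≤ j) :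
    Module.finrank ℝ ((T.comp i j).comap T.upper.subtype) = Module.finrank ℝ (T.comp i j) :=
  (Submodule.comapSubtypeEquivOfLe (T.comp_le_upper hij)).finrank_eq

end Upper

section Coordinates

variable {r : ℕ} {𝒰 : Type*} [NonUnitalNonAssocRing 𝒰] [Module ℝ 𝒰]
  [IsScalarTower ℝ 𝒰 𝒰] [SMulCommClass ℝ 𝒰 𝒰] [StarRing 𝒰] [StarModule ℝ 𝒰]
  (T : TAlgebra r 𝒰) {ι : Type*} [Fintype ι] (e : Module.Basis ι ℝ (selfAdjoint.submodule ℝ 𝒰))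

/-- The Hermitian element with given coordinates, as a linear map. -/
def ofC : (ι → ℝ) →ₗ[ℝ] 𝒰 :=
  (selfAdjoint.submodule ℝ 𝒰).subtype ∘ₗ e.equivFun.symm.toLinearMap

theorem ofC_apply (y : ι → ℝ) : ofC e y = ofCoords e y := rfl

theorem ofC_injective : Function.Injective (ofC e) :=
  (Submodule.injective_subtype _).comp e.equivFun.symm.injective

/-- The coordinates of `a + a⋆`. -/
def symC : 𝒰 →ₗ[ℝ] (ι → ℝ) where
  toFun a := e.equivFun ⟨a + star a, by
    change star (a + star a) = a + star a
    rw [star_add, star_star, add_comm]⟩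
  map_add' a b := by
    rw [← map_add]
    congr 1
    refine Subtype.ext ?_
    simp only [star_add, Submodule.coe_add]
    abel
  map_smul' x a := by
    rw [RingHom.id_apply, ← map_smul]
    congr 1
    refine Subtype.ext ?_
    simp [star_smul, smul_add]

theorem ofC_symC (a : 𝒰) : ofC e (symC e a) = a + star a := by
  simp [ofC, symC]

theorem star_ofC (y : ι → ℝ) : star (ofC e y) = ofC e y :=
  (e.equivFun.symm y).2

/-- `s ↦ s + s⋆` on the upper triangular elements. -/
def symU : T.upper ≃ₗ[ℝ] (ι → ℝ) :=
  LinearEquiv.ofBijective ((symC e).comp T.upper.subtype) (by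
    constructor
    · refine (injective_iff_map_eq_zero _).2 fun s hs => ?_
      have h1 : (s : 𝒰) + star (s : 𝒰) = 0 := by
        rw [← ofC_symC e]
        have h2 : symC e (s : 𝒰) = 0 := hs
        rw [h2, map_zero]
      by_contra hne
      have h3 := T.tr_mul_star_pos (s : 𝒰) fun h => hne (Subtype.ext h)
      rw [eq_neg_of_add_eq_zero_right h1] at h3
      have h4 : ∑ i, T.ρ i ((s : 𝒰) * -(s : 𝒰)) = -∑ i, T.ρ i (s : 𝒰) ^ 2 := by
        rw [← Finset.sum_neg_distrib]
        refine Finset.sum_congr rfl fun i _ => ?_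
        rw [mul_neg, map_neg, T.ρ_mul s.2 s.2, sq]
      rw [h4] at h3
      have h5 : 0 ≤ ∑ i, T.ρ i (s : 𝒰) ^ 2 := Finset.sum_nonneg fun i _ => sq_nonneg _
      linarith
    · intro y
      have h : ∀ a : 𝒰, ∃ s : T.upper, symC e (s : 𝒰) = symC e a := by
        refine T.induction (fun i j a ha => ?_) ?_ ⟨0, by simp⟩
        · rcases le_total i j with hij | hij
          · exact ⟨⟨a, T.comp_le_upper hij ha⟩, rfl⟩
          · refine ⟨⟨star a, T.comp_le_upper hij (T.star_mem ha)⟩, ofC_injective e ?_⟩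
            rw [ofC_symC, ofC_symC, star_star, add_comm]
        · rintro a b ⟨s, hs⟩ ⟨t, ht⟩
          exact ⟨s + t, by rw [Submodule.coe_add, map_add, hs, ht, map_add]⟩
      obtain ⟨s, hs⟩ := h ((2⁻¹ : ℝ) • ofC e y)
      refine ⟨s, ofC_injective e ?_⟩
      change ofC e (symC e (s : 𝒰)) = _
      rw [hs, ofC_symC, star_smul, star_ofC, star_trivial, ← add_smul]
      norm_num)

theorem ofC_symU (s : T.upper) : ofC e (T.symU e s) = (s : 𝒰) + star (s : 𝒰) := ofC_symC e _

/-- The coordinates of `s t⋆ + t s⋆`. -/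
def Bform : T.upper →ₗ[ℝ] T.upper →ₗ[ℝ] (ι → ℝ) :=
  LinearMap.mk₂ ℝ (fun s t => symC e ((s : 𝒰) * star (t : 𝒰)))
    (fun s s' t => by rw [Submodule.coe_add, add_mul, map_add])
    (fun x s t => by rw [Submodule.coe_smul, smul_mul_assoc, map_smul])
    (fun s t t' => by rw [Submodule.coe_add, star_add, mul_add, map_add])
    (fun x s t => by
      rw [Submodule.coe_smul, star_smul, star_trivial, mul_smul_comm, map_smul])

theorem ofC_Bform (s t : T.upper) :
    ofC e (T.Bform e s t) = (s : 𝒰) * star (t : 𝒰) + t * star (s : 𝒰) := by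
  change ofC e (symC e ((s : 𝒰) * star (t : 𝒰))) = _
  rw [ofC_symC, star_mul, star_star]

variable {T e}

/-- The linear action is determined on all of `V` by polarization. -/
theorem IsAction.Bform {t : T.upper} {g : (ι → ℝ) →ₗ[ℝ] (ι → ℝ)} (hg : T.IsAction e (t : 𝒰) g)
    (s s' : T.upper) : T.Bform e (t * s) (t * s') = g (T.Bform e s s') := by
  set b : T.upper →ₗ[ℝ] T.upper →ₗ[ℝ] (ι → ℝ) := (T.Bform e).compr₂ g -
    (T.Bform e).compl₁₂ (LinearMap.mulLeft ℝ t) (LinearMap.mulLeft ℝ t) with hb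
  have hbapp : ∀ s s', b s s' = g (T.Bform e s s') - T.Bform e (t * s) (t * s') := fun _ _ => rfl
  have hBsymm : ∀ s s', T.Bform e s s' = T.Bform e s' s := fun s s' => by
    refine ofC_injective e ?_
    rw [ofC_Bform, ofC_Bform, add_comm]
  have hsymm : ∀ s s', b s s' = b s' s := fun s s' => by
    rw [hbapp, hbapp, hBsymm s, hBsymm (t * s)]
  -- The defect `b` vanishes on the diagonal over `H`, hence at `s + x · 1` for all large `x`,
  -- hence at all `s`.
  have hH : ∀ s : T.upper, (∀ i, 0 < T.ρ i (s : 𝒰)) → b s s = 0 := by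
    intro s hs
    have h1 : ofCoords e ((2⁻¹ : ℝ) • T.Bform e s s) = (s : 𝒰) * star (s : 𝒰) := by
      rw [← ofC_apply, map_smul, ofC_Bform, ← two_smul ℝ, smul_smul]
      norm_num
    have h2 := hg (s : 𝒰) ⟨s.2, hs⟩ _ h1
    rw [← ofC_apply, map_smul, map_smul] at h2
    have h3 : ofC e (g (T.Bform e s s)) = ofC e (T.Bform e (t * s) (t * s)) := by
      have h4 := congrArg (fun z => (2 : ℝ) • z) h2
      simp only [smul_smul] at h4
      rw [mul_inv_cancel₀ two_ne_zero, one_smul] at h4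
      rw [h4, ofC_Bform, T.coe_mul, star_mul, two_smul]
    rw [hbapp, ofC_injective e h3, sub_self]
  have hquad : ∀ s, b s s = 0 := by
    intro s
    obtain ⟨M, hM⟩ := (Set.finite_range fun i => |T.ρ i (s : 𝒰)|).bddAbove
    have hM' : ∀ i, |T.ρ i (s : 𝒰)| ≤ M := fun i => hM ⟨i, rfl⟩
    set l : ℝ := |M| + 1 with hl
    have hl0 : 0 < l := by positivity
    have h1 : ∀ x : ℝ, l ≤ x → b s s + (2 * x) • b s 1 = 0 := by
      intro x hx
      have hx0 : 0 < x := by linarith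
      have h2 := hH (s + x • 1) fun i => by
        rw [Submodule.coe_add, Submodule.coe_smul, T.coe_one, map_add, map_smul, map_sum]
        simp only [T.ρ_c_eq, Finset.sum_ite_eq, Finset.mem_univ, if_true, smul_eq_mul, mul_one]
        have := neg_abs_le (T.ρ i (s : 𝒰))
        have := hM' i
        have := le_abs_self M
        linarith
      have h3 := hH (1 : T.upper) fun i => by
        rw [T.coe_one, map_sum]
        simp [T.ρ_c_eq]
      simp only [map_add, LinearMap.add_apply, map_smul, LinearMap.smul_apply, h3, smul_zero,
        add_zero, hsymm 1 s] at h2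
      rw [two_mul, add_smul, ← add_assoc]
      exact h2
    have h2 := h1 l le_rfl
    have h3 := h1 (2 * l) (by linarith)
    have h4 : (2 * l) • b s 1 = 0 := by
      have h5 : (2 * (2 * l)) • b s 1 = (2 * l) • b s 1 + (2 * l) • b s 1 := by
        rw [← add_smul]; ring_nf
      rw [h5, ← add_assoc, h2, zero_add] at h3
      exact h3
    rwa [h4, add_zero] at h2
  have hfin : b s s' = 0 := by
    have h1 := hquad (s + s')
    simp only [map_add, LinearMap.add_apply, hquad s, hquad s', hsymm s' s, zero_add, add_zero] at h1
    rw [← two_smul ℝ] at h1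
    exact (smul_eq_zero.1 h1).resolve_left two_ne_zero
  rw [hbapp] at hfin
  exact (sub_eq_zero.1 hfin).symm

variable {k : ℕ} (Φ : HermForm T e k)

/-- The cone data of a `T`-algebra; the linear action of the group is supplied by the homogeneous
form. -/
def coneData : ConeData r ι T.upper where
  N i j := (T.comp i j).comap T.upper.subtype
  isInternal := T.isInternal_upper
  c i := ⟨T.c i, T.comp_le_upper le_rfl (T.c_mem_comp i)⟩
  sum_c := Subtype.ext (by simp [T.coe_one])
  c_mem i := T.c_mem_comp i
  c_mul {i j a} _ ha l := Subtype.ext (by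
    refine (T.c_mul_eq (a := (a : 𝒰)) ha l).trans ?_
    split_ifs <;> rfl)
  mul_c {i j a} _ ha l := Subtype.ext (by
    refine (T.mul_c_eq (a := (a : 𝒰)) ha l).trans ?_
    split_ifs <;> rfl)
  ρ := T.ρhom
  ρ_c i j := T.ρ_c_eq i j
  ρ_N {i j a} hij ha l := T.ρ_comp (fun h => hij.ne ((Prod.mk.inj h).1.trans
    (Prod.mk.inj h).2.symm)) ha
  eq_smul_c {i a} ha := Subtype.ext (T.eq_smul_c ha)
  sym := T.symU e
  B := T.Bform e
  B_symm s t := by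
    refine ofC_injective e ?_
    rw [ofC_Bform, ofC_Bform, add_comm]
  B_c a i := by
    refine ofC_injective e ?_
    rw [ofC_Bform, ofC_symU, T.coe_mul, star_mul, T.star_c]
  act t ht := by
    obtain ⟨g, hg, -⟩ := Φ.homogeneous (t : 𝒰) ⟨t.2, ht⟩
    exact ⟨g, hg.Bform⟩
  tr := T.trace ∘ₗ ofC e
  tr_sym s := by
    rw [LinearMap.comp_apply, ofC_symU, T.trace_apply, Finset.mul_sum]
    refine Finset.sum_congr rfl fun i _ => ?_
    rw [map_add, T.ρ_star, T.ρhom_apply]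
    ring
  tr_pos s hs := by
    rw [LinearMap.comp_apply, ofC_Bform, map_add, T.trace_apply]
    have := T.tr_mul_star_pos (s : 𝒰) fun h => hs (Subtype.ext h)
    linarith

theorem coneData_mem_H {t : T.upper} : t ∈ (coneData Φ).H ↔ (t : 𝒰) ∈ T.H :=
  ⟨fun h => ⟨t.2, h⟩, fun h => h.2⟩

theorem ofCoords_sq (t : T.upper) : ofCoords e ((coneData Φ).sq t) = (t : 𝒰) * star (t : 𝒰) := by
  rw [← ofC_apply, ConeData.sq, map_smul]
  change (2⁻¹ : ℝ) • ofC e (T.Bform e t t) = _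
  rw [ofC_Bform, ← two_smul ℝ, smul_smul]
  norm_num

theorem eq_sq {y : ι → ℝ} {t : 𝒰} (ht : t ∈ T.H) (h : ofCoords e y = t * star t) :
    (⟨t, ht.1⟩ : T.upper) ∈ (coneData Φ).H ∧ y = (coneData Φ).sq ⟨t, ht.1⟩ := by
  refine ⟨ht.2, ofC_injective e ?_⟩
  rw [ofC_apply, ofC_apply, ofCoords_sq, h]

theorem coneData_Ω : (coneData Φ).Ω = T.cone e := by
  ext y
  constructor
  · rintro ⟨t, ht, rfl⟩
    exact ⟨t, (coneData_mem_H Φ).1 ht, ofCoords_sq Φ t⟩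
  · rintro ⟨t, ht, h⟩
    obtain ⟨h1, h2⟩ := eq_sq Φ ht h
    exact ⟨_, h1, h2.symm⟩

theorem coneData_Q {y : ι → ℝ} (hy : y ∈ T.cone e) (j : Fin r) :
    (coneData Φ).Q j y = T.Q e j y := by
  have h : ∃ t ∈ T.H, ofCoords e y = t * star t := hy
  rw [Q, dif_pos h]
  obtain ⟨h1, h2⟩ := eq_sq Φ h.choose_spec.1 h.choose_spec.2
  conv_lhs => rw [h2]
  rw [ConeData.Q_sq h1]
  rfl

theorem coneData_Qp {y : ι → ℝ} (hy : y ∈ T.cone e) (α : Fin r → ℝ) :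
    (coneData Φ).Qp α y = T.Qpow e α y := by
  rw [ConeData.Qp, Qpow]
  refine Finset.prod_congr rfl fun j _ => ?_
  rw [coneData_Q Φ hy]

theorem coneData_n (j : Fin r) : (coneData Φ).n j = T.n j :=
  Finset.sum_congr rfl fun _ hi => T.finrank_comap (Finset.mem_Iio.1 hi).le

theorem coneData_m (j : Fin r) : (coneData Φ).m j = T.m j :=
  Finset.sum_congr rfl fun _ hi => T.finrank_comap (Finset.mem_Ioi.1 hi).le

theorem coneData_τ : (coneData Φ).τ = T.τ := by
  ext j
  rw [ConeData.τ, τ, coneData_n, coneData_m]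

theorem coneData_entry (j : Fin r) (y : ι → ℝ) : (coneData Φ).entry j y = T.ρ j (ofCoords e y) := by
  obtain ⟨s, rfl⟩ := (coneData Φ).sym.surjective y
  rw [ConeData.entry_apply, LinearEquiv.symm_apply_apply, ← ofC_apply]
  change 2 * T.ρ j (s : 𝒰) = T.ρ j (ofC e (T.symU e s))
  rw [ofC_symU, map_add, T.ρ_star]
  ring

/-- The Hermitian form, over the cone data. -/
def formData : FormData (coneData Φ) k where
  F := Φ.F
  hermitian := Φ.hermitian
  mem_closure u := by
    rw [coneData_Ω]
    exact Φ.mem_closure u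
  eq_zero := Φ.eq_zero
  homogeneous t ht := by
    obtain ⟨g, hg, t', ht'⟩ := Φ.homogeneous (t : 𝒰) ((coneData_mem_H Φ).1 ht)
    refine ⟨t', fun u => ?_⟩
    rw [← ht']
    have h : (coneData Φ).π t = g := by
      refine LinearMap.ext fun y => ?_
      obtain ⟨s, rfl⟩ := (coneData Φ).sym.surjective y
      rw [← ConeData.B_one, (coneData Φ).π_B ht]
      exact hg.Bform s 1
    rw [h]

theorem formData_b (j : Fin r) : (formData Φ).b j = Φ.b j := by
  rw [FormData.b, HermForm.b]
  congr 1
  ext a b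
  rw [FormData.mat, HermForm.matrix, Matrix.of_apply, Matrix.of_apply]
  classical
  refine Finset.sum_congr rfl fun i _ => ?_
  rw [coneData_entry]
  congr 4
  rw [ofCoords]
  congr 1
  simp [Module.Basis.equivFun_symm_apply, Pi.single_apply]

end Coordinates

end TAlgebra

/-! ### Domain, measures and norms in terms of the cone data -/

namespace TAlgebra

variable {r : ℕ} {𝒰 : Type*} [NonUnitalNonAssocRing 𝒰] [Module ℝ 𝒰]
  [IsScalarTower ℝ 𝒰 𝒰] [SMulCommClass ℝ 𝒰 𝒰] [StarRing 𝒰] [StarModule ℝ 𝒰]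
  {T : TAlgebra r 𝒰} {ι : Type*} [Fintype ι] {e : Module.Basis ι ℝ (selfAdjoint.submodule ℝ 𝒰)}
  {k : ℕ} (Φ : HermForm T e k)

theorem formData_D : (formData Φ).D = Φ.domain := by
  ext w
  change _ ∈ (coneData Φ).Ω ↔ _ ∈ T.cone e
  rw [coneData_Ω]
  exact Iff.rfl

theorem formData_wt (ν : Fin r → ℝ) :
    (formData Φ).wt ν = fun j => ν j - (Φ.b j : ℝ) / 2 - T.τ j := by
  ext j
  have h : (formData Φ).bv j = Φ.b j := by rw [FormData.bv, formData_b]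
  rw [FormData.wt, coneData_τ]
  simp only [Pi.sub_apply, Pi.smul_apply, smul_eq_mul, h]
  ring

/-- The weight on the cone, extended by zero. -/
theorem formData_qp (ν : Fin r → ℝ) (y : ι → ℝ) :
    (coneData Φ).qp ((formData Φ).wt ν) y =
      (T.cone e).indicator (fun y => ENNReal.ofReal (Φ.weight ν y)) y := by
  rw [ConeData.qp, coneData_Ω]
  by_cases hy : y ∈ T.cone e
  · rw [Set.indicator_of_mem hy, Set.indicator_of_mem hy, coneData_Qp Φ hy, formData_wt]
    rfl
  · rw [Set.indicator_of_notMem hy, Set.indicator_of_notMem hy]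

/-- The weighted measures agree: outside of the domain the extended weight vanishes. -/
theorem formData_Vm (ν : Fin r → ℝ) : (formData Φ).Vm ν = Φ.measure ν := by
  have hD : MeasurableSet Φ.domain := by
    rw [← formData_D]
    exact (formData Φ).isOpen_D.measurableSet
  rw [HermForm.measure, FormData.Vm, ← withDensity_indicator hD]
  congr 1
  ext w
  rw [formData_qp]
  rfl

theorem formData_mix (ν : Fin r → ℝ) (p : ℝ≥0∞) (q : ℝ)
    (f : (ι → ℂ) × (Fin k → ℂ) → ℂ) : (formData Φ).mix ν p q f = Φ.mixedNorm ν p q f := by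
  rw [FormData.mix, HermForm.mixedNorm]
  congr 1
  refine lintegral_congr fun u => ?_
  have hΩ : MeasurableSet {y : ι → ℝ | y - Φ.diag u ∈ T.cone e} := by
    rw [← coneData_Ω Φ]
    exact (((coneData Φ).isOpen_Ω).preimage (continuous_id.sub continuous_const)).measurableSet
  rw [← lintegral_indicator hΩ]
  refine Eq.trans ?_ (lintegral_add_right_eq_self _ (Φ.diag u))
  refine lintegral_congr fun t => ?_
  rw [formData_qp]
  have hN : (formData Φ).N p f (u, t) = eLpNorm (fun x : ι → ℝ =>
      f (fun i => (x i : ℂ) + ((t + Φ.diag u) i : ℂ) * Complex.I, u)) p volume := rfl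
  by_cases ht : t ∈ T.cone e
  · have ht' : t + Φ.diag u ∈ {y : ι → ℝ | y - Φ.diag u ∈ T.cone e} := by
      rw [Set.mem_ofPred_eq, add_sub_cancel_right]; exact ht
    rw [Set.indicator_of_mem ht, Set.indicator_of_mem ht', hN, add_sub_cancel_right, mul_comm]
  · have ht' : t + Φ.diag u ∉ {y : ι → ℝ | y - Φ.diag u ∈ T.cone e} := by
      rw [Set.mem_ofPred_eq, add_sub_cancel_right]; exact ht
    rw [Set.indicator_of_notMem ht, Set.indicator_of_notMem ht', zero_mul]

theorem memL_iff (ν : Fin r → ℝ) (p : ℝ≥0∞) (q : ℝ) (f : (ι → ℂ) × (Fin k → ℂ) → ℂ) :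
    Φ.MemL ν p q f ↔ AEStronglyMeasurable f (volume.restrict (formData Φ).D) ∧
      (formData Φ).mix ν p q f < ∞ := by
  rw [HermForm.MemL, formData_D, formData_mix]

end TAlgebra

/-! ### Self-adjointness on `L²` -/

namespace FormData

variable {r : ℕ} {ι W : Type*} [Fintype ι] [Ring W] [Algebra ℝ W] {C : ConeData r ι W}
  {k : ℕ} {Φ : FormData C k}

theorem memLp_two_of_mix_lt_top {ν : Fin r → ℝ} {f : (ι → ℂ) × (Fin k → ℂ) → ℂ}
    (hf : StronglyMeasurable f) (h : Φ.mix ν 2 2 f < ∞) : MemLp f 2 (Φ.Vm ν) := by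
  rw [Φ.mix_lt_top_iff one_le_two hf.measurable, Φ.lintegral_N_two ν hf.measurable] at h
  refine ⟨hf.aestronglyMeasurable, ?_⟩
  refine (eLpNorm_lt_top_iff_lintegral_rpow_enorm_lt_top (by norm_num) (by norm_num)).2 ?_
  simpa using h

variable {μ : Fin r → ℝ}

/-- The integral operator of the Bergman kernel on `L²`. -/
theorem memLp_integral_bk (hμ : ∀ j, ((C.m j : ℝ) + C.n j + Φ.bv j) / 2 < μ j) (c : ℝ)
    {f : (ι → ℂ) × (Fin k → ℂ) → ℂ} (hf : MemLp f 2 (Φ.Vm μ)) :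
    MemLp (fun ζ => ∫ w, Φ.bk μ c ζ w * f w ∂(Φ.Vm μ)) 2 (Φ.Vm μ) := by
  have hA := admissible_two hμ
  obtain ⟨K, hK⟩ := hA.bounded (hA.measurable_bk c) (fun ζ w => nnnorm_bk_le ζ w)
  have hfin := Φ.mix_two_lt_top hf
  obtain ⟨-, h1, h2⟩ := hK 2 one_le_two f ((Φ.aestronglyMeasurable_Vm_iff μ).1 hf.1) hfin
  exact memLp_two_of_mix_lt_top h1 (h2.trans_lt (ENNReal.mul_lt_top ENNReal.coe_lt_top hfin))

/-- The absolute convergence behind the self-adjointness of the operator on `L²`: the positive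
operator is bounded on `L²`. -/
theorem integrable_star_mul_bk_mul
    (hμ : ∀ j, ((C.m j : ℝ) + C.n j + Φ.bv j) / 2 < μ j) (c : ℝ)
    {f h : (ι → ℂ) × (Fin k → ℂ) → ℂ} (hf : MemLp f 2 (Φ.Vm μ)) (hh : MemLp h 2 (Φ.Vm μ)) :
    Integrable (fun z : ((ι → ℂ) × (Fin k → ℂ)) × ((ι → ℂ) × (Fin k → ℂ)) =>
      star (h z.1) * (Φ.bk μ c z.1 z.2 * f z.2)) ((Φ.Vm μ).prod (Φ.Vm μ)) := by
  have hA := admissible_two hμ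
  have hbm := hA.measurable_bk c
  have hnm : Measurable (Function.uncurry fun ζ w => ((‖Φ.bk μ c ζ w‖ : ℝ) : ℂ)) :=
    Complex.measurable_ofReal.comp hbm.norm
  obtain ⟨K, hK⟩ := hA.bounded hnm (M := ‖(c : ℂ)⁻¹‖₊) (fun ζ w => by
    rw [Complex.nnnorm_real, nnnorm_norm]
    exact nnnorm_bk_le ζ w)
  have hfn : MemLp (fun w => ((‖f w‖ : ℝ) : ℂ)) 2 (Φ.Vm μ) := hf.norm.ofReal
  have hfin := Φ.mix_two_lt_top hfn
  obtain ⟨h1, h2, h3⟩ := hK 2 one_le_two _ ((Φ.aestronglyMeasurable_Vm_iff μ).1 hfn.1) hfin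
  have hG := memLp_two_of_mix_lt_top h2
    (h3.trans_lt (ENNReal.mul_lt_top ENNReal.coe_lt_top hfin))
  have e1 := hh.1.star.comp_fst (ν := Φ.Vm μ)
  have e2 := hf.1.comp_snd (μ := Φ.Vm μ)
  have e3 := hbm.aestronglyMeasurable (μ := (Φ.Vm μ).prod (Φ.Vm μ))
  have hjoint := e1.mul (e3.mul e2)
  refine (integrable_prod_iff hjoint).2 ⟨?_, ?_⟩
  · filter_upwards [Φ.ae_mem_D μ] with ζ hζ
    have h4 := h1 ζ hζ
    have hbζ : AEStronglyMeasurable (Φ.bk μ c ζ) (Φ.Vm μ) :=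
      (hbm.of_uncurry_left (x := ζ)).aestronglyMeasurable
    have h5 : Integrable (fun w => Φ.bk μ c ζ w * f w) (Φ.Vm μ) := by
      refine h4.norm.mono' (hbζ.mul hf.1) (Filter.Eventually.of_forall fun w => ?_)
      rw [norm_mul, norm_mul, Complex.norm_real, Complex.norm_real, norm_norm, norm_norm]
    exact h5.const_mul (star (h ζ))
  · have h5 : Integrable (fun ζ => ‖h ζ‖ * ‖∫ w, ((‖Φ.bk μ c ζ w‖ : ℝ) : ℂ) * ((‖f w‖ : ℝ) : ℂ)
        ∂(Φ.Vm μ)‖) (Φ.Vm μ) := hh.norm.integrable_mul hG.norm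
    refine h5.congr (Filter.Eventually.of_forall fun ζ => ?_)
    have h6 : (fun w => ((‖Φ.bk μ c ζ w‖ : ℝ) : ℂ) * ((‖f w‖ : ℝ) : ℂ)) =
        fun w => ((‖Φ.bk μ c ζ w‖ * ‖f w‖ : ℝ) : ℂ) := funext fun w => (Complex.ofReal_mul _ _).symm
    have h7 : 0 ≤ ∫ w, ‖Φ.bk μ c ζ w‖ * ‖f w‖ ∂(Φ.Vm μ) := integral_nonneg fun w => by positivity
    have h8 : (fun w => ‖star (h ζ) * (Φ.bk μ c ζ w * f w)‖) =
        fun w => ‖h ζ‖ * (‖Φ.bk μ c ζ w‖ * ‖f w‖) := funext fun w => by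
      rw [norm_mul, norm_mul, norm_star]
    change ‖h ζ‖ * ‖∫ w, ((‖Φ.bk μ c ζ w‖ : ℝ) : ℂ) * ((‖f w‖ : ℝ) : ℂ) ∂(Φ.Vm μ)‖ =
      ∫ w, ‖star (h ζ) * (Φ.bk μ c ζ w * f w)‖ ∂(Φ.Vm μ)
    rw [h6, h8, integral_complex_ofReal, Complex.norm_real, Real.norm_of_nonneg h7,
      integral_const_mul]

/-- The integral operator of the Bergman kernel is self-adjoint on `L²` and fixes the holomorphic
functions; this is the half of it that characterizes the orthogonal projector. -/
theorem integral_star_mul_integral_bk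
    (hμ : ∀ j, ((C.m j : ℝ) + C.n j + Φ.bv j) / 2 < μ j) {c : ℝ} (hc : Φ.IsNormalization μ c)
    {f h : (ι → ℂ) × (Fin k → ℂ) → ℂ} (hf : MemLp f 2 (Φ.Vm μ)) (hh : MemLp h 2 (Φ.Vm μ))
    (hd : DifferentiableOn ℂ h Φ.D) :
    ∫ ζ, star (h ζ) * ∫ w, Φ.bk μ c ζ w * f w ∂(Φ.Vm μ) ∂(Φ.Vm μ) =
      ∫ w, star (h w) * f w ∂(Φ.Vm μ) := by
  calc ∫ ζ, star (h ζ) * ∫ w, Φ.bk μ c ζ w * f w ∂(Φ.Vm μ) ∂(Φ.Vm μ)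
      = ∫ ζ, ∫ w, star (h ζ) * (Φ.bk μ c ζ w * f w) ∂(Φ.Vm μ) ∂(Φ.Vm μ) := by
        refine integral_congr_ae (Filter.Eventually.of_forall fun ζ => ?_)
        exact (integral_const_mul _ _).symm
    _ = ∫ w, ∫ ζ, star (h ζ) * (Φ.bk μ c ζ w * f w) ∂(Φ.Vm μ) ∂(Φ.Vm μ) :=
        integral_integral_swap (f := fun ζ w => star (h ζ) * (Φ.bk μ c ζ w * f w))
          (integrable_star_mul_bk_mul hμ c hf hh)
    _ = ∫ w, star (h w) * f w ∂(Φ.Vm μ) := by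
        refine integral_congr_ae ?_
        filter_upwards [Φ.ae_mem_D μ] with w hw
        have h6 := (admissible_two hμ).integral_bk hc one_le_two hd (Φ.mix_two_lt_top hh) hw
        have h7 : ∀ ζ, star (h ζ) * (Φ.bk μ c ζ w * f w) = star (Φ.bk μ c w ζ * h ζ) * f w :=
          fun ζ => by
            rw [bk_swap μ c w ζ, star_mul']
            ring
        simp_rw [h7]
        rw [integral_mul_const]
        congr 1
        rw [← h6]
        exact integral_conj

end FormData

/-! ### The Bergman kernel and projector of the Siegel domain -/

namespace TAlgebra

variable {r : ℕ} {𝒰 : Type*} [NonUnitalNonAssocRing 𝒰] [Module ℝ 𝒰]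
  [IsScalarTower ℝ 𝒰 𝒰] [SMulCommClass ℝ 𝒰 𝒰] [StarRing 𝒰] [StarModule ℝ 𝒰]
  {T : TAlgebra r 𝒰} {ι : Type*} [Fintype ι] {e : Module.Basis ι ℝ (selfAdjoint.submodule ℝ 𝒰)}
  {k : ℕ} {Φ : HermForm T e k} {μ ν : Fin r → ℝ} {q : ℝ}

theorem formData_bv (j : Fin r) : (formData Φ).bv j = Φ.b j := by rw [FormData.bv, formData_b]

theorem formData_hμ (hμ : ∀ j, ((T.m j : ℝ) + T.n j + Φ.b j) / 2 < μ j) (j : Fin r) :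
    (((coneData Φ).m j : ℝ) + (coneData Φ).n j + (formData Φ).bv j) / 2 < μ j := by
  rw [coneData_m, coneData_n, formData_bv]
  exact hμ j

theorem formData_admissible (hμ : ∀ j, ((T.m j : ℝ) + T.n j + Φ.b j) / 2 < μ j)
    (hν : ∀ j, ((T.m j : ℝ) + Φ.b j) / 2 < ν j) (hq : 1 ≤ q)
    (hlower : ∀ j, (ν j - ((T.m j : ℝ) + Φ.b j) / 2 + (T.n j : ℝ) / 2) /
      (μ j - ((T.m j : ℝ) + Φ.b j) / 2) < q)
    (hupper : ∀ j, T.n j ≠ 0 →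
      q < 1 + (ν j - ((T.m j : ℝ) + Φ.b j) / 2) / ((T.n j : ℝ) / 2)) :
    (formData Φ).Admissible μ ν q where
  hμ := formData_hμ hμ
  hν j := by
    rw [coneData_m, formData_bv]
    exact hν j
  hq := hq
  lower j := by
    rw [coneData_m, coneData_n, formData_bv]
    have hn : (0 : ℝ) ≤ T.n j := Nat.cast_nonneg _
    have := hlower j
    rwa [div_lt_iff₀ (by linarith [hμ j])] at this
  upper j := by
    rw [coneData_m, coneData_n, formData_bv]
    rcases Nat.eq_zero_or_pos (T.n j) with h0 | h0
    · rw [h0]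
      simpa using hν j
    · have hn : (0 : ℝ) < T.n j := Nat.cast_pos.2 h0
      have := hupper j h0.ne'
      rw [← sub_lt_iff_lt_add', lt_div_iff₀ (by positivity)] at this
      exact this

theorem exists_isNormalization (hμ : ∀ j, ((T.m j : ℝ) + T.n j + Φ.b j) / 2 < μ j) :
    ∃ c, (formData Φ).IsNormalization μ c := by
  obtain ⟨c, hc, h⟩ := (formData Φ).exists_kernel_const (μ := μ) fun j => by
    have hn : (0 : ℝ) ≤ T.n j := Nat.cast_nonneg _
    rw [coneData_m, formData_bv]
    linarith [hμ j]
  exact ⟨c, hc, h⟩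

/-- The normalized kernel has the reproducing property in the weighted Bergman space. -/
theorem isBergmanKernel_bk (hμ : ∀ j, ((T.m j : ℝ) + T.n j + Φ.b j) / 2 < μ j) {c : ℝ}
    (hc : (formData Φ).IsNormalization μ c) : Φ.IsBergmanKernel μ ((formData Φ).bk μ c) := by
  intro ζ hζ
  rw [← formData_D, ← formData_Vm] at *
  refine ⟨FormData.memLp_bk (formData_hμ hμ) c hζ, fun f hd hf => ?_⟩
  rw [← (FormData.admissible_two (formData_hμ hμ)).integral_bk hc one_le_two hd
    ((formData Φ).mix_two_lt_top hf) hζ]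
  refine integral_congr_ae (Filter.Eventually.of_forall fun w => ?_)
  change _ = f w * star ((formData Φ).bk μ c w ζ)
  rw [FormData.bk_swap μ c ζ w, star_star, mul_comm]

/-- Two reproducing kernels are adjoint to each other, hence equal. -/
theorem HermForm.IsBergmanKernel.eq_star {B B' : (ι → ℂ) × (Fin k → ℂ) → (ι → ℂ) × (Fin k → ℂ) → ℂ}
    (hB : Φ.IsBergmanKernel μ B) (hB' : Φ.IsBergmanKernel μ B') {ζ w : (ι → ℂ) × (Fin k → ℂ)}
    (hζ : ζ ∈ Φ.domain) (hw : w ∈ Φ.domain) : B w ζ = star (B' ζ w) := by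
  have h1 := (hB' w hw).2 _ (hB ζ hζ).1.1 (hB ζ hζ).1.2
  have h2 := (hB ζ hζ).2 _ (hB' w hw).1.1 (hB' w hw).1.2
  rw [h1, h2]
  refine Eq.trans ?_ integral_conj
  refine integral_congr_ae (Filter.Eventually.of_forall fun x => ?_)
  change B x ζ * star (B' x w) = star (B' x w * star (B x ζ))
  rw [star_mul', star_star, mul_comm]

theorem HermForm.IsBergmanKernel.unique
    {B B' : (ι → ℂ) × (Fin k → ℂ) → (ι → ℂ) × (Fin k → ℂ) → ℂ}
    (hB : Φ.IsBergmanKernel μ B) (hB' : Φ.IsBergmanKernel μ B') {ζ w : (ι → ℂ) × (Fin k → ℂ)}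
    (hζ : ζ ∈ Φ.domain) (hw : w ∈ Φ.domain) : B ζ w = B' ζ w :=
  (hB.eq_star hB' hw hζ).trans (hB'.eq_star hB' hw hζ).symm

variable {p : ℝ≥0∞}

/-- Only the values of the kernel on `D × D` matter for the integral operator. -/
theorem integralOp_eq {κ K : (ι → ℂ) × (Fin k → ℂ) → (ι → ℂ) × (Fin k → ℂ) → ℂ}
    (h : ∀ ζ ∈ Φ.domain, ∀ w ∈ Φ.domain, K ζ w = κ ζ w) (f : (ι → ℂ) × (Fin k → ℂ) → ℂ)
    {ζ : (ι → ℂ) × (Fin k → ℂ)} (hζ : ζ ∈ Φ.domain) :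
    (fun w => κ ζ w * f w) =ᵐ[Φ.measure μ] (fun w => K ζ w * f w) ∧
      Φ.integralOp μ K f ζ = ∫ w, κ ζ w * f w ∂((formData Φ).Vm μ) := by
  have h1 : (fun w => κ ζ w * f w) =ᵐ[Φ.measure μ] (fun w => K ζ w * f w) := by
    have h2 := (formData Φ).ae_mem_D μ
    rw [formData_D, formData_Vm] at h2
    filter_upwards [h2] with w hw
    rw [h ζ hζ w hw]
  refine ⟨h1, ?_⟩
  rw [formData_Vm]
  exact (integral_congr_ae h1).symm

theorem integralOp_ae_eq {κ K : (ι → ℂ) × (Fin k → ℂ) → (ι → ℂ) × (Fin k → ℂ) → ℂ}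
    (h : ∀ ζ ∈ Φ.domain, ∀ w ∈ Φ.domain, K ζ w = κ ζ w) (f : (ι → ℂ) × (Fin k → ℂ) → ℂ) :
    Φ.integralOp μ K f =ᵐ[volume.restrict (formData Φ).D]
      fun ζ => ∫ w, κ ζ w * f w ∂((formData Φ).Vm μ) := by
  filter_upwards [ae_restrict_mem (formData Φ).isOpen_D.measurableSet] with ζ hζ
  rw [formData_D] at hζ
  exact (integralOp_eq h f hζ).2

theorem isBoundedOn_of_eqOn (hA : (formData Φ).Admissible μ ν q) (hp : 1 ≤ p)
    {κ K : (ι → ℂ) × (Fin k → ℂ) → (ι → ℂ) × (Fin k → ℂ) → ℂ}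
    (hκ : Measurable (Function.uncurry κ)) {M : ℝ≥0}
    (hM : ∀ ζ w, ‖κ ζ w‖₊ ≤ M * ‖(formData Φ).ker ((formData Φ).ex μ) ζ w‖₊)
    (h : ∀ ζ ∈ Φ.domain, ∀ w ∈ Φ.domain, K ζ w = κ ζ w) : Φ.IsBoundedOn μ K ν p q := by
  obtain ⟨R, hR⟩ := hA.bounded hκ hM
  refine ⟨R, fun f hf => ?_⟩
  have hf' := (memL_iff Φ ν p q f).1 hf
  obtain ⟨h1, h2, h3⟩ := hR p hp f hf'.1 hf'.2
  have hae := integralOp_ae_eq (μ := μ) h f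
  have hmix : Φ.mixedNorm ν p q (Φ.integralOp μ K f) ≤ R * Φ.mixedNorm ν p q f := by
    rw [← formData_mix, ← formData_mix, (formData Φ).mix_congr ν p q hae]
    exact h3
  refine ⟨?_, ⟨?_, hmix.trans_lt (ENNReal.mul_lt_top ENNReal.coe_lt_top hf.2)⟩, hmix⟩
  · rw [← formData_D]
    filter_upwards [ae_restrict_mem (formData Φ).isOpen_D.measurableSet] with ζ hζ
    have h4 := h1 ζ hζ
    rw [formData_D] at hζ
    rw [formData_Vm] at h4
    exact h4.congr (integralOp_eq h f hζ).1
  · rw [← formData_D]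
    exact ⟨_, h2, hae⟩

/-- The integral operator maps into the Bergman space, and `f - P f` is orthogonal to it by
self-adjointness. -/
theorem bergmanProjector_eq (hμ : ∀ j, ((T.m j : ℝ) + T.n j + Φ.b j) / 2 < μ j) {c : ℝ}
    (hc : (formData Φ).IsNormalization μ c) {f : (ι → ℂ) × (Fin k → ℂ) → ℂ}
    (hf : MemLp f 2 (Φ.measure μ)) :
    Φ.bergmanProjector μ (hf.toLp f) =ᵐ[Φ.measure μ]
      fun ζ => ∫ w, (formData Φ).bk μ c ζ w * f w ∂((formData Φ).Vm μ) := by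
  have hA := FormData.admissible_two (formData_hμ hμ)
  have hf' : MemLp f 2 ((formData Φ).Vm μ) := by rw [formData_Vm]; exact hf
  have hP := FormData.memLp_integral_bk (formData_hμ hμ) c hf'
  have hhol := hA.holomorphic c one_le_two (((formData Φ).aestronglyMeasurable_Vm_iff μ).1 hf'.1)
    ((formData Φ).mix_two_lt_top hf')
  have hsym : ∀ h : (ι → ℂ) × (Fin k → ℂ) → ℂ, MemLp h 2 (Φ.measure μ) →
      DifferentiableOn ℂ h Φ.domain →
      ∫ ζ, star (h ζ) * ∫ w, (formData Φ).bk μ c ζ w * f w ∂((formData Φ).Vm μ) ∂(Φ.measure μ) =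
        ∫ w, star (h w) * f w ∂(Φ.measure μ) := by
    intro h hh hd
    have h1 := FormData.integral_star_mul_integral_bk (Φ := formData Φ) (formData_hμ hμ) hc hf'
      (h := h) (by rw [formData_Vm]; exact hh) (by rw [formData_D]; exact hd)
    rw [← formData_Vm]
    exact h1
  set Pf : (ι → ℂ) × (Fin k → ℂ) → ℂ :=
    fun ζ => ∫ w, (formData Φ).bk μ c ζ w * f w ∂((formData Φ).Vm μ) with hPf
  rw [formData_Vm] at hP
  rw [formData_D] at hhol
  have hmem : hP.toLp Pf ∈ Φ.bergmanSpace μ := ⟨Pf, hhol, hP.coeFn_toLp⟩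
  have horth : hf.toLp f - hP.toLp Pf ∈ (Φ.bergmanSpace μ).topologicalClosureᗮ := by
    rw [Submodule.orthogonal_closure, Submodule.mem_orthogonal]
    rintro g ⟨h, hd, hgh⟩
    have hh : MemLp h 2 (Φ.measure μ) := (memLp_congr_ae hgh).1 (Lp.memLp g)
    rw [inner_sub_right, sub_eq_zero, L2.inner_def, L2.inner_def]
    have e1 : ∫ a, inner ℂ (g a) (hf.toLp f a) ∂(Φ.measure μ) =
        ∫ a, star (h a) * f a ∂(Φ.measure μ) := by
      refine integral_congr_ae ?_
      filter_upwards [hgh, hf.coeFn_toLp] with a h1 h2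
      rw [h1, h2, RCLike.inner_apply, mul_comm]
      rfl
    have e2 : ∫ a, inner ℂ (g a) (hP.toLp Pf a) ∂(Φ.measure μ) =
        ∫ a, star (h a) * Pf a ∂(Φ.measure μ) := by
      refine integral_congr_ae ?_
      filter_upwards [hgh, hP.coeFn_toLp] with a h1 h2
      rw [h1, h2, RCLike.inner_apply, mul_comm]
      rfl
    rw [e1, e2]
    exact (hsym h hh hd).symm
  have heq : Φ.bergmanProjector μ (hf.toLp f) = hP.toLp Pf :=
    Submodule.eq_starProjection_of_mem_orthogonal
      (Submodule.le_topologicalClosure _ hmem) horth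
  rw [heq]
  exact hP.coeFn_toLp

end TAlgebra

end

theorem corollary3p11 {r k : ℕ} {𝒰 ι : Type*} [Fintype ι] [NonUnitalNonAssocRing 𝒰] [Module ℝ 𝒰]
    [IsScalarTower ℝ 𝒰 𝒰] [SMulCommClass ℝ 𝒰 𝒰] [StarRing 𝒰] [StarModule ℝ 𝒰]
    (T : TAlgebra r 𝒰) (e : Module.Basis ι ℝ (selfAdjoint.submodule ℝ 𝒰))
    (Φ : TAlgebra.HermForm T e k)
    (μ ν : Fin r → ℝ)
    (hμ : ∀ j, ((T.m j : ℝ) + T.n j + Φ.b j) / 2 < μ j)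
    (hν : ∀ j, ((T.m j : ℝ) + Φ.b j) / 2 < ν j)
    (p : ℝ≥0∞) (hp : 1 ≤ p) (q : ℝ) (hq : 1 ≤ q)
    (hlower : ∀ j, (ν j - ((T.m j : ℝ) + Φ.b j) / 2 + (T.n j : ℝ) / 2) /
      (μ j - ((T.m j : ℝ) + Φ.b j) / 2) < q)
    -- for `n_j = 0` the upper bound is `+∞`
    (hupper : ∀ j, T.n j ≠ 0 →
      q < 1 + (ν j - ((T.m j : ℝ) + Φ.b j) / 2) / ((T.n j : ℝ) / 2)) :
    -- the reproducing kernel exists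
    Φ.IsBergmanKernel μ (Φ.bergmanKernel μ) ∧
    -- `P⁺_μ` is bounded on `L^{p,q}_ν(D)`
    Φ.IsBoundedOn μ (fun ζ w => (‖Φ.bergmanKernel μ ζ w‖ : ℂ)) ν p q ∧
    -- `P_μ` is bounded on `L^{p,q}_ν(D)`
    Φ.IsBoundedOn μ (Φ.bergmanKernel μ) ν p q ∧
    -- on `L²_μ(D) ∩ L^{p,q}_ν(D)` it is the orthogonal projector onto `A²_μ(D)`
    (∀ f, Φ.MemL ν p q f → ∀ hf : MemLp f 2 (Φ.measure μ),
      Φ.bergmanProjector μ (hf.toLp f) =ᵐ[Φ.measure μ] Φ.P μ f) ∧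
    -- it maps `L^{p,q}_ν(D)` into and onto `A^{p,q}_ν(D)`
    (∀ f, Φ.MemL ν p q f → ∃ g, Φ.MemA ν p q g ∧ Φ.P μ f =ᵐ[volume.restrict Φ.domain] g) ∧
    (∀ g, Φ.MemA ν p q g → ∃ f, Φ.MemL ν p q f ∧ Φ.P μ f =ᵐ[volume.restrict Φ.domain] g) := by
  have hA := TAlgebra.formData_admissible hμ hν hq hlower hupper
  obtain ⟨c, hc⟩ := TAlgebra.exists_isNormalization hμ
  have hbk := TAlgebra.isBergmanKernel_bk hμ hc
  have hB : Φ.IsBergmanKernel μ (Φ.bergmanKernel μ) := Classical.epsilon_spec ⟨_, hbk⟩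
  set κ := (TAlgebra.formData Φ).bk μ c with hκ
  have heq : ∀ ζ ∈ Φ.domain, ∀ w ∈ Φ.domain, Φ.bergmanKernel μ ζ w = κ ζ w :=
    fun ζ hζ w hw => hB.unique hbk hζ hw
  have hκm : Measurable (Function.uncurry κ) := hA.measurable_bk c
  have hnm : Measurable (Function.uncurry fun ζ w => ((‖κ ζ w‖ : ℝ) : ℂ)) :=
    Complex.measurable_ofReal.comp hκm.norm
  have hbd := TAlgebra.isBoundedOn_of_eqOn hA hp hκm (fun ζ w => FormData.nnnorm_bk_le ζ w) heq
  have hPeq := fun f => TAlgebra.integralOp_ae_eq (μ := μ) heq f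
  refine ⟨hB, ?_, hbd, fun f _ hf => ?_, fun f hf => ?_, fun g hg => ?_⟩
  · refine TAlgebra.isBoundedOn_of_eqOn hA hp hnm (M := ‖(c : ℂ)⁻¹‖₊) (fun ζ w => ?_)
      fun ζ hζ w hw => by rw [heq ζ hζ w hw]
    rw [Complex.nnnorm_real, nnnorm_norm]
    exact FormData.nnnorm_bk_le ζ w
  · refine (TAlgebra.bergmanProjector_eq hμ hc hf).trans (Filter.EventuallyEq.symm ?_)
    rw [← TAlgebra.formData_Vm]
    exact ((TAlgebra.formData Φ).ae_Vm_iff μ).2 (hPeq f)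
  · have hf' := (TAlgebra.memL_iff Φ ν p q f).1 hf
    have hP := hPeq f
    obtain ⟨C, hC⟩ := hbd
    have hPf := (TAlgebra.memL_iff Φ ν p q _).1 (hC f hf).2.1
    refine ⟨_, ⟨?_, (TAlgebra.memL_iff Φ ν p q _).2 ⟨hPf.1.congr hP, ?_⟩⟩, ?_⟩
    · rw [← TAlgebra.formData_D]
      exact hA.holomorphic c hp hf'.1 hf'.2
    · rw [← (TAlgebra.formData Φ).mix_congr ν p q hP]
      exact hPf.2
    · rw [← TAlgebra.formData_D]
      exact hP
  · refine ⟨g, hg.2, ?_⟩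
    have hg' := (TAlgebra.memL_iff Φ ν p q g).1 hg.2
    have hd : DifferentiableOn ℂ g (TAlgebra.formData Φ).D := by
      rw [TAlgebra.formData_D]
      exact hg.1
    rw [← TAlgebra.formData_D]
    filter_upwards [hPeq g, ae_restrict_mem (TAlgebra.formData Φ).isOpen_D.measurableSet]
      with ζ h1 h2
    exact h1.trans (hA.integral_bk hc hp hd hg'.2 h2)
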